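/- **Theorem 6 (Extended Borel–Pompeiu formula).** Let $n\ge 2$. For $z=x+iy\in\mathbb C^n$ put $z^2=\sum_k z_k^2$ and $\gamma(z)=\sqrt{z^2}$, with the branch $\operatorname{Re}\gamma\ge 0$; let $\omega_n=2\pi^{n/2}/\Gamma(n/2)$, and let $\varphi(z)=\dfrac{\gamma(z)^{2-n}}{\omega_n(2-n)}$ for $n\ge 3$, $\varphi(z)=\frac1{2\pi}\log\gamma(z)$ for $n=2$. Let $\mathcal C\ell_n$ be the complex Clifford algebra with generators $e_1,\dots,e_n$, $e_ke_l+e_le_k=2\delta_{kl}$, with $\mathbb C^n\subset\mathcal C\ell_n$ through $z=\sum_k z_ke_k$, and let $D=\sum_k e_k\,\partial/\partial x_k$ be the Dirac operator. For fixed $y$, let $\varphi_\varepsilon$ be the function of $x$ equal to $\varphi(x+iy)$ where $\operatorname{Re}\gamma(x+iy)>\varepsilon$ and to $0$ elsewhere. The extended source $\tilde\delta=\Delta\varphi$ and the complexified Cauchy kernel $C=D\varphi$ are the generalized functions of $x$ $$\tilde\delta(x+iy)=\lim_{\varepsilon\to0+}\Delta\varphi_\varepsilon,\qquad C(x+iy)=\lim_{\varepsilon\to0+}D\varphi_\varepsilon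 ,$$ all derivatives being those of generalized functions. Let $S_n\subset\mathbb C^n$ be the null cone $\{z^2=0\}$ if $n\ge4$ is even, and the set of all $x+iy$ with $|x|\le|y|$, $x\cdot y=0$ if $n=2$ or $n$ is odd. Off $S_n$ one has $\tilde\delta=0$, and $C$ is the function $C(z)=\dfrac{z}{\omega_n\gamma(z)^n}$. Let $M\subset\mathbb R^n$ be a bounded domain with piecewise $C^1$ boundary, with outgoing unit normal $n(x')$ and area measure $d\sigma$ on $\partial M$; let $f:\mathbb R^n\to\mathcal C\ell_n$ be of class $C^k$, $k=\max(1,\lfloor (n-1)/2\rfloor)$; and let $z\in\mathbb C^n$ be regular with respect to $\partial M$, that is, $z\notin\partial M+S_n$. Then the extension $$\tilde f_M(z)=\int_{\mathbb R^n}\tilde\delta(x'-z)\,\chi_M(x')f(x')\,dx'$$ of $\chi_M f$ and the integral of $C(x'-z)\,Df(x')$ over $M$ are defined, the boundary integral below converges absolutely, and $$\tilde f_M(z)=\int_{\partial M}C(x'-z)\,n(x')\,f(x')\,d\sigma(x')-\int_M C(x'-z)\,Df(x')\,dx' .$$ The integrals over $\mathbb R^n$ and over $M$ are actions of the generalized functions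 $\tilde\delta(\cdot-z)$ and $C(\cdot-z)$ on $\chi_Mf$ and $\chi_MDf$: with a smooth $\eta$ equal to $1$ near the set $\{x'\in\mathbb R^n: x'-z\in S_n\}$ and to $0$ near $\partial M$, the generalized function acts on $\eta\chi_Mf$ or $\eta\chi_MDf$ (through the limit of its values on smooth mollifications), and the remaining integral over $M$, with factor $1-\eta$, is an ordinary one. The result does not depend on $\eta$ or on the mollifier. -/

import Mathlib

open MeasureTheory Filter Topology
open scoped ContDiff

noncomputable section

namespace ComplexDistance

/-- Real Euclidean space of dimension `n`. -/
abbrev Rn (n : ℕ) : Type := EuclideanSpace ℝ (Fin n)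

/-- The quadratic form `z² = z₁² + ⋯ + zₙ²` on complex `n`-space. -/
abbrev sqForm (n : ℕ) : QuadraticForm ℂ (Fin n → ℂ) :=
  QuadraticMap.weightedSumSquares ℂ (fun _ : Fin n => (1 : ℂ))

/-! ### The complex Clifford algebra -/

/-- The complex Clifford algebra with generators `e₁, …, eₙ`, `eₖ eₗ + eₗ eₖ = 2 δₖₗ`. -/
def Cl (n : ℕ) : Type := CliffordAlgebra (sqForm n)

instance instRingCl (n : ℕ) : Ring (Cl n) :=
  inferInstanceAs (Ring (CliffordAlgebra (sqForm n)))

instance instAlgebraCl (n : ℕ) : Algebra ℂ (Cl n) :=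
  inferInstanceAs (Algebra ℂ (CliffordAlgebra (sqForm n)))

/-- A complex vector `z`, viewed as the element `∑ zₖ eₖ` of the Clifford algebra. -/
def vec (n : ℕ) : (Fin n → ℂ) →ₗ[ℂ] Cl n := CliffordAlgebra.ι (sqForm n)

/-- The generator `eₖ`. -/
def e {n : ℕ} (k : Fin n) : Cl n := vec n (Pi.single k 1)

/-- The basis `e_K` of the Clifford algebra, indexed by the `2ⁿ` subsets `K` of `{1, …, n}`. -/
def clBasis (n : ℕ) : Module.Basis (Finset (Fin n)) ℂ (Cl n) :=
  (Pi.basisFun ℂ (Fin n)).ExteriorAlgebra.map (CliffordAlgebra.equivExterior (sqForm n)).symm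

/-- The largest modulus of a coordinate, as a norm on the Clifford algebra. (The space has finite
dimension, so limits, derivatives and integrals do not depend on the choice of a norm.) -/
instance instNormedAddCommGroupCl (n : ℕ) : NormedAddCommGroup (Cl n) :=
  NormedAddCommGroup.induced (Cl n) (Finset (Fin n) → ℂ) (clBasis n).equivFun.toLinearMap
    (clBasis n).equivFun.injective

instance instNormedSpaceCl (n : ℕ) : NormedSpace ℂ (Cl n) :=
  NormedSpace.induced ℂ (Cl n) (Finset (Fin n) → ℂ) (clBasis n).equivFun.toLinearMap

/-- The Dirac operator `D h = ∑ₖ eₖ ∂h/∂xₖ`, acting from the left. -/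
def dirac {n : ℕ} (h : Rn n → Cl n) (x : Rn n) : Cl n :=
  ∑ k : Fin n, e k * fderiv ℝ h x (EuclideanSpace.single k 1)

/-! ### Complex length, potential and Cauchy kernel -/

/-- The complex vector `x - z`, for a real point `x` and a complex point `z`. -/
def shift {n : ℕ} (x : Rn n) (z : Fin n → ℂ) : Fin n → ℂ := fun i => (x i : ℂ) - z i

/-- The complex length `γ(w) = √(w²)`, with the branch `Re γ ≥ 0`. -/
def cLength {n : ℕ} (w : Fin n → ℂ) : ℂ := (∑ i, w i ^ 2) ^ (1 / 2 : ℂ)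

/-- The area `ωₙ = 2 π^(n/2) / Γ(n/2)` of the unit sphere of real `n`-space. -/
def sphereArea (n : ℕ) : ℝ := 2 * Real.pi ^ ((n : ℝ) / 2) / Real.Gamma ((n : ℝ) / 2)

/-- The holomorphic potential `φ = γ^(2-n) / (ωₙ (2-n))` for `n ≥ 3`, and
`φ = (2π)⁻¹ log γ` for `n = 2`. -/
def potential {n : ℕ} (w : Fin n → ℂ) : ℂ :=
  if n = 2 then Complex.log (cLength w) / (2 * Real.pi)
  else cLength w ^ (2 - n : ℤ) / (sphereArea n * (2 - n))

/-- The values `C(w) = w / (ωₙ γ(w)ⁿ)` of the Cauchy kernel off its singular set. -/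
def cauchyKernel {n : ℕ} (w : Fin n → ℂ) : Cl n :=
  ((sphereArea n : ℂ) * cLength w ^ n)⁻¹ • vec n w

/-- The singular set of the Cauchy kernel: the null cone for even `n ≥ 4`; for `n = 2` and for
odd `n` the points `x + i y` such that `x` lies in the disk `|x| ≤ |y|`, `x · y = 0`. -/
def singularSet (n : ℕ) : Set (Fin n → ℂ) :=
  {w | if Even n ∧ n ≠ 2 then ∑ i, w i ^ 2 = 0
    else ∑ i, (w i).re * (w i).im = 0 ∧ ∑ i, (w i).re ^ 2 ≤ ∑ i, (w i).im ^ 2}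

/-- The real points `x` for which `x - z` is singular. -/
def singularPoints {n : ℕ} (z : Fin n → ℂ) : Set (Rn n) := {x | shift x z ∈ singularSet n}

/-! ### Generalized functions -/

/-- The action `∫ φ_ε(x - z) h(x) dx` of the regularized potential `φ_ε = θ(Re γ - ε) φ`. -/
def regPotential {n : ℕ} (z : Fin n → ℂ) (ε : ℝ) (h : Rn n → Cl n) : Cl n :=
  ∫ x in {x : Rn n | ε < (cLength (shift x z)).re}, potential (shift x z) • h x

/-- The action on a smooth `h` of the regularized source `Δφ_ε`, translated by `z`. -/
def regSource {n : ℕ} (z : Fin n → ℂ) (ε : ℝ) (h : Rn n → Cl n) : Cl n :=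
  regPotential z ε (Laplacian.laplacian h)

/-- The action on a smooth `h`, by Clifford multiplication from the left, of the regularized
Cauchy kernel `Dφ_ε`, translated by `z`; all derivatives are those of generalized functions. -/
def regCauchy {n : ℕ} (z : Fin n → ℂ) (ε : ℝ) (h : Rn n → Cl n) : Cl n :=
  -regPotential z ε (dirac h)

/-- A smooth function of compact support and total integral one. -/
structure IsMollifier {n : ℕ} (ψ : Rn n → ℝ) : Prop where
  smooth : ContDiff ℝ ∞ ψ
  compact : HasCompactSupport ψ
  integral_one : ∫ x, ψ x = 1

/-- The convolution of `g` with `δ⁻ⁿ ψ(x/δ)`. -/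
def mollify {n : ℕ} (ψ : Rn n → ℝ) (δ : ℝ) (g : Rn n → Cl n) : Rn n → Cl n :=
  MeasureTheory.convolution (fun t : Rn n => (δ ^ n)⁻¹ * ψ (δ⁻¹ • t)) g
    (ContinuousLinearMap.lsmul ℝ ℝ) volume

/-- The generalized function `lim_{ε → 0+} T_ε` acts on `g`, a function of compact support that
need not be smooth, with the value `v`: it acts on every mollification of `g`, and the values tend
to `v`, whatever the mollifier. -/
def HasAction {n : ℕ} (T : ℝ → (Rn n → Cl n) → Cl n) (g : Rn n → Cl n) (v : Cl n) : Prop :=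
  ∀ ψ : Rn n → ℝ, IsMollifier ψ → ∃ w : ℝ → Cl n,
    (∀ δ : ℝ, 0 < δ → Tendsto (fun ε : ℝ => T ε (mollify ψ δ g)) (𝓝[>] 0) (𝓝 (w δ))) ∧
    Tendsto w (𝓝[>] 0) (𝓝 v)

/-- A smooth function equal to `1` near `S` and to `0` near `B`. -/
structure IsCutoff {n : ℕ} (S B : Set (Rn n)) (η : Rn n → ℝ) : Prop where
  smooth : ContDiff ℝ ∞ η
  eq_one : ∀ᶠ x in 𝓝ˢ S, η x = 1
  eq_zero : ∀ᶠ x in 𝓝ˢ B, η x = 0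

/-- The integral over real `n`-space of `T g` has the value `v`, where `T = lim_{ε → 0+} T_ε` is a
generalized function that is the ordinary function `K` off the closed set `S`, and `g` is a
function of bounded support with its discontinuities in the closed set `B`, disjoint from `S`.
Here `g` is split as `η g + (1 - η) g`: the generalized function acts on the first part, which
vanishes near `B`, and the second part, which vanishes near `S`, is integrated against `K` in the
ordinary sense; the result is the same for all cutoff functions `η`. -/
def HasIntegral {n : ℕ} (T : ℝ → (Rn n → Cl n) → Cl n) (K : Rn n → Cl n) (S B : Set (Rn n))
    (g : Rn n → Cl n) (v : Cl n) : Prop :=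
  (∃ η : Rn n → ℝ, IsCutoff S B η) ∧
  ∀ η : Rn n → ℝ, IsCutoff S B η →
    Integrable (fun x => K x * ((1 - η x) • g x)) ∧
    ∃ w : Cl n, HasAction T (fun x => η x • g x) w ∧
      v = w + ∫ x, K x * ((1 - η x) • g x)

/-- The extension of `χ_M f` has the value `v` at the complex point `z`, that is,
`v = ∫ δ(x' - z) χ_M(x') f(x') dx'` with the extended source `δ = Δφ`, which is supported in the
singular set. -/
def HasExtension {n : ℕ} (M : Set (Rn n)) (f : Rn n → Cl n) (z : Fin n → ℂ) (v : Cl n) : Prop :=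
  HasIntegral (regSource z) 0 (singularPoints z) (frontier M) (M.indicator f) v

/-- The integral `∫_M C(x' - z) g(x') dx'` of the Cauchy kernel `C = Dφ` has the value `v`. -/
def HasVolumeIntegral {n : ℕ} (M : Set (Rn n)) (g : Rn n → Cl n) (z : Fin n → ℂ) (v : Cl n) :
    Prop :=
  HasIntegral (regCauchy z) (fun x => cauchyKernel (shift x z)) (singularPoints z) (frontier M)
    (M.indicator g) v

/-! ### Domains with piecewise `C¹` boundary -/

/-- Near its boundary point `b` the set `M` is given by `μ > 0`, with `μ` of class `C¹` and
`∇μ(b) = -|∇μ(b)| ν ≠ 0`; so the boundary is a `C¹` hypersurface near `b`, the set `M` lies on one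
side of it, and `ν` is the outgoing unit normal. -/
def IsOutwardNormal {n : ℕ} (M : Set (Rn n)) (b ν : Rn n) : Prop :=
  ∃ μ : Rn n → ℝ, ContDiffAt ℝ 1 μ b ∧ μ b = 0 ∧ gradient μ b ≠ 0 ∧
    (∀ᶠ x in 𝓝 b, x ∈ M ↔ 0 < μ x) ∧ gradient μ b = -(‖gradient μ b‖ • ν)

open Classical in
/-- The outgoing unit normal (zero where there is none). -/
def outwardNormal {n : ℕ} (M : Set (Rn n)) (b : Rn n) : Rn n :=
  if h : ∃ ν, IsOutwardNormal M b ν then h.choose else 0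

/-- A bounded domain with piecewise `C¹` boundary: the boundary has finite area, and it is `C¹`
except for a set (edges, corners) of area zero. -/
structure IsPiecewiseC1Domain {n : ℕ} (M : Set (Rn n)) : Prop where
  isOpen : IsOpen M
  isConnected : IsConnected M
  isBounded : Bornology.IsBounded M
  area_lt_top : Measure.euclideanHausdorffMeasure (n - 1) (frontier M) < ⊤
  area_edges : Measure.euclideanHausdorffMeasure (n - 1)
    {b ∈ frontier M | ¬ ∃ ν, IsOutwardNormal M b ν} = 0

/-- The complex point `z` is regular with respect to the boundary of `M`: it is not of the form
`b + w` with `b` in the boundary and `w` in the singular set. -/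
def IsRegularFor {n : ℕ} (M : Set (Rn n)) (z : Fin n → ℂ) : Prop :=
  ¬ ∃ b ∈ frontier M, ∃ w ∈ singularSet n, z = (fun i => (b i : ℂ)) + w

/-- The integrand `C(x' - z) n(x') f(x')` of the boundary integral. -/
def boundaryIntegrand {n : ℕ} (M : Set (Rn n)) (f : Rn n → Cl n) (z : Fin n → ℂ) (x : Rn n) :
    Cl n :=
  cauchyKernel (shift x z) * vec n (fun i => (outwardNormal M x i : ℂ)) * f x

end ComplexDistance

end

noncomputable section

namespace ComplexDistance

/-! ### Cylindrical coordinates -/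

/-! The formula combines the divergence theorem away from the singular points with the weak identity
`⟨Δφ, F⟩ = -⟨Dφ, DF⟩` near them. Let `η` be a cutoff, `1` near the singular points and `0` near the
boundary. On the support of `(1 - η) f` the kernel `C` is smooth and is annihilated by `D` acting
from the right, so the divergence theorem for the fields `C eₖ (1 - η) f` gives the classical
formula without a source term (`setIntegral_cauchyKernel_mul_dirac`). The function `F = η χ_M f` has
compact support and the smoothness of `f`. Since `D² = Δ`, the identity `⟨Δφ_ε, h⟩ = -⟨Dφ_ε, Dh⟩` is
exact for each `ε` (`regSource_eq_neg_regCauchy`), and it passes to the limit through mollification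
(`hasAction_regCauchy`). The terms with `Dη` in `DF` and in `D((1 - η) f)` are opposite, and they
live where `C` is an ordinary smooth function; they cancel in the sum.

The analytic core is that the limits exist and that the source acts on functions of class `C^k`
only, that is, has order at most `k` (`exists_regSource_bound`). Let `β = |Im z| > 0`. In
cylindrical coordinates `(y, s)` about the axis through `Re z` along `Im z`, the quadratic form of
`x - z` is `ζ = u - 2iβs` with `u = |y|² + s² - β²`. Away from the axis, averaging over the spheres
`|y| = const` (`exists_sphericalMean`) leaves planar integrals against powers of `γ = √ζ` (or a
logarithm). Integration by parts in `u` replaces `γ^(-j-2)` by `γ^(-j)` at the price of one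
derivative, and the boundary terms on `Re γ = ε` tend to zero (`tendsto_flux`). So the
regularizations converge, and cutting off with an even weight `w(s/τ)` instead has the same limit
(`PlanarLimit`).

With that weight Green's formula leaves only terms containing `w'`, which is odd and therefore sees
only the jump of the slice integrals across `s = 0` (`norm_integral_odd_le`). The jump costs no
derivative for `γ⁻¹`, which is uniformly integrable on lines, nor for `γ⁻²`, where the difference of
the two sides is a Poisson kernel. Each further pair of powers costs one, so `γ^(-n)` costs
`⌊(n-1)/2⌋`; the potential costs one fewer for `n ≥ 3`, which pays for the derivative in `Dh`
(`jumpBound_kerOf`, `jumpBound_potOf`). When `Im z = 0`, an estimate on shrinking shells gives order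
one.

The divergence theorem is proved for boundaries measured by Hausdorff measure: first near a regular
point with an error relative to `∫ |ψ|`, then globally by a partition of unity, and finally across
the edges, where cutoffs with small gradient in `L¹` exist because the edges have area zero. -/

/-- Orthogonal coordinates `(y, t)` of real `(N+1)`-space, the last one along the unit vector `e`. -/
structure Cylinder {N : ℕ} (e : Rn (N + 1)) where
  map : (Rn N × ℝ) ≃L[ℝ] Rn (N + 1)
  measurePreserving : MeasurePreserving map volume volume
  inner_axis : ∀ p, inner ℝ (map p) e = p.2
  norm_sq : ∀ p, ‖map p‖ ^ 2 = ‖p.1‖ ^ 2 + p.2 ^ 2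

/-- The standard splitting of real `(N+1)`-space into the first coordinate and the others. -/
def consEquiv (N : ℕ) : (Rn N × ℝ) ≃ₗ[ℝ] Rn (N + 1) where
  toFun p := WithLp.toLp 2 (Fin.cons p.2 (fun i => p.1 i))
  invFun x := (WithLp.toLp 2 (fun i => x i.succ), x 0)
  map_add' p q := by
    ext i; refine Fin.cases ?_ (fun i => ?_) i <;> simp
  map_smul' c p := by
    ext i; refine Fin.cases ?_ (fun i => ?_) i <;> simp
  left_inv p := by
    ext <;> simp
  right_inv x := by
    ext i; refine Fin.cases ?_ (fun i => ?_) i <;> simp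

theorem measurePreserving_consEquiv (N : ℕ) :
    MeasurePreserving (consEquiv N) volume volume := by
  have h1 : MeasurePreserving (fun p : Rn N × ℝ => (p.2, (WithLp.ofLp p.1 : Fin N → ℝ)))
      volume volume := by
    have ha : MeasurePreserving (Prod.swap : Rn N × ℝ → ℝ × Rn N) volume volume :=
      Measure.measurePreserving_swap
    have hb : MeasurePreserving (Prod.map id (WithLp.ofLp : Rn N → Fin N → ℝ))
        (volume : Measure (ℝ × Rn N)) volume :=
      (MeasurePreserving.id _).prod (EuclideanSpace.volume_preserving_symm_measurableEquiv_toLp (Fin N))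
    exact hb.comp ha
  have h2 := (volume_preserving_piFinSuccAbove (fun _ : Fin (N + 1) => ℝ) 0).symm
  have h3 := (EuclideanSpace.volume_preserving_symm_measurableEquiv_toLp (Fin (N + 1))).symm
  have h := h3.comp (h2.comp h1)
  have he : ⇑(consEquiv N) = ⇑(MeasurableEquiv.toLp 2 (Fin (N + 1) → ℝ)).symm.symm ∘
      ⇑(MeasurableEquiv.piFinSuccAbove (fun _ => ℝ) 0).symm ∘ fun p => (p.2, p.1.ofLp) := by
    funext p
    ext i
    refine Fin.cases ?_ (fun i => ?_) i <;>
      simp [consEquiv, MeasurableEquiv.piFinSuccAbove, Fin.insertNthEquiv]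
  rw [he]
  exact h

theorem exists_cylinder {N : ℕ} (e : Rn (N + 1)) (he : ‖e‖ = 1) : Nonempty (Cylinder e) := by
  have hv : Orthonormal ℝ (({0} : Set (Fin (N + 1))).domRestrict (fun _ => e)) := by
    constructor
    · intro i; exact he
    · intro i j hij
      exact absurd (Subsingleton.elim i j) hij
  obtain ⟨b, hb⟩ := hv.exists_orthonormalBasis_extension_of_card_eq (by simp)
  have hb0 : b 0 = e := hb 0 rfl
  let L : Rn (N + 1) ≃ₗᵢ[ℝ] Rn (N + 1) := b.repr.symm
  have hL : L (EuclideanSpace.single 0 1) = e := by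
    rw [← hb0]; exact b.repr_symm_single 0
  refine ⟨⟨((consEquiv N).trans L.toLinearEquiv).toContinuousLinearEquiv, ?_, ?_, ?_⟩⟩
  · exact L.measurePreserving.comp (measurePreserving_consEquiv N)
  · intro p
    change inner ℝ (L (consEquiv N p)) e = p.2
    rw [← hL, L.inner_map_map, EuclideanSpace.inner_single_right]
    simp [consEquiv]
  · intro p
    change ‖L (consEquiv N p)‖ ^ 2 = _
    rw [L.norm_map, EuclideanSpace.norm_sq_eq, EuclideanSpace.norm_sq_eq, Fin.sum_univ_succ]
    simp [consEquiv, add_comm]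

namespace Cylinder

variable {N : ℕ} {e : Rn (N + 1)} (Ψ : Cylinder e)

theorem measurableEmbedding : MeasurableEmbedding Ψ.map :=
  Ψ.map.toHomeomorph.measurableEmbedding

theorem measurePreserving_add (b : Rn (N + 1)) :
    MeasurePreserving (fun p => b + Ψ.map p) volume volume :=
  (measurePreserving_add_left volume b).comp Ψ.measurePreserving

theorem measurableEmbedding_add (b : Rn (N + 1)) : MeasurableEmbedding (fun p => b + Ψ.map p) :=
  (measurableEmbedding_addLeft b).comp Ψ.measurableEmbedding

theorem integral_comp {F : Type*} [NormedAddCommGroup F] [NormedSpace ℝ F] (b : Rn (N + 1))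
    (f : Rn (N + 1) → F) : ∫ p, f (b + Ψ.map p) = ∫ x, f x :=
  (Ψ.measurePreserving_add b).integral_comp (Ψ.measurableEmbedding_add b) f

theorem integrable_comp_iff {F : Type*} [NormedAddCommGroup F] (b : Rn (N + 1))
    (f : Rn (N + 1) → F) : Integrable (fun p => f (b + Ψ.map p)) ↔ Integrable f :=
  (Ψ.measurePreserving_add b).integrable_comp_emb (Ψ.measurableEmbedding_add b)

theorem exists_eq (v : Rn (N + 1)) : ∃ w : Rn N, v = Ψ.map (w, inner ℝ v e) := by
  refine ⟨(Ψ.map.symm v).1, ?_⟩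
  have h := Ψ.inner_axis (Ψ.map.symm v)
  rw [ContinuousLinearEquiv.apply_symm_apply] at h
  rw [h]; simp

end Cylinder


/-! ### The divergence theorem below a graph -/

section

variable {F : Type*} [NormedAddCommGroup F] [NormedSpace ℝ F]

/-- Integration by parts against the constant function one. -/
theorem integral_fderiv_apply_eq_zero {E : Type*} [NormedAddCommGroup E] [NormedSpace ℝ E]
    [MeasurableSpace E] [BorelSpace E] [FiniteDimensional ℝ E] (μ : Measure E)
    [μ.IsAddHaarMeasure] {f : E → F} (hf : ContDiff ℝ 1 f)
    (hc : HasCompactSupport f) (v : E) : ∫ x, fderiv ℝ f x v ∂μ = 0 := by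
  have hd : Continuous (fun x => fderiv ℝ f x v) :=
    (hf.continuous_fderiv one_ne_zero).clm_apply continuous_const
  have hdc : HasCompactSupport (fun x => fderiv ℝ f x v) := hc.fderiv_apply ℝ v
  have h := integral_smul_fderiv_eq_neg_fderiv_smul_of_integrable (𝕜 := ℝ) (μ := μ)
    (f := fun _ : E => (1 : ℝ)) (g := f) (v := v) (by simp)
    (by simpa using hd.integrable_of_hasCompactSupport hdc)
    (by simpa using hf.continuous.integrable_of_hasCompactSupport hc)
    (fun x _ => differentiableAt_const _) (fun x _ => hf.differentiable one_ne_zero x)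
  simpa using h

variable {X : Type*} [NormedAddCommGroup X] [NormedSpace ℝ X]

theorem _root_.HasCompactSupport.slice_left {A B G : Type*} [TopologicalSpace A]
    [TopologicalSpace B] [R1Space B] [Zero G] {f : A × B → G} (hc : HasCompactSupport f) (a : A) :
    HasCompactSupport (fun b => f (a, b)) :=
  HasCompactSupport.intro (IsCompact.image hc continuous_snd) fun b hb =>
    image_eq_zero_of_notMem_tsupport fun h => hb ⟨_, h, rfl⟩

theorem _root_.HasCompactSupport.slice_right {A B G : Type*} [TopologicalSpace A]
    [R1Space A] [TopologicalSpace B] [Zero G] {f : A × B → G} (hc : HasCompactSupport f) (b : B) :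
    HasCompactSupport (fun a => f (a, b)) :=
  HasCompactSupport.intro (IsCompact.image hc continuous_fst) fun a ha =>
    image_eq_zero_of_notMem_tsupport fun h => ha ⟨_, h, rfl⟩

/-- Shearing a `C¹` function of compact support along a graph gives such a function. -/
theorem contDiff_shear {g : X → ℝ} {V : Set X} (hV : IsOpen V)
    (hg : ContDiffOn ℝ 1 g V) {ψ : X × ℝ → F} (hψ : ContDiff ℝ 1 ψ)
    (hc : HasCompactSupport ψ) (hs : ∀ p ∈ tsupport ψ, p.1 ∈ V) :
    ContDiff ℝ 1 (fun p : X × ℝ => ψ (p.1, g p.1 + p.2)) ∧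
      HasCompactSupport (fun p : X × ℝ => ψ (p.1, g p.1 + p.2)) := by
  have hK : IsCompact (Prod.fst '' tsupport ψ) := IsCompact.image hc continuous_fst
  have hKV : Prod.fst '' tsupport ψ ⊆ V := by rintro _ ⟨p, hp, rfl⟩; exact hs p hp
  constructor
  · rw [contDiff_iff_contDiffAt]
    intro p
    by_cases hp : p.1 ∈ V
    · have h1 : ContDiffAt ℝ 1 g p.1 := hg.contDiffAt (hV.mem_nhds hp)
      have h2 : ContDiffAt ℝ 1 (fun q : X × ℝ => g q.1) p := h1.comp p contDiffAt_fst
      exact hψ.contDiffAt.comp p (contDiffAt_fst.prodMk (h2.add contDiffAt_snd))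
    -- Off `V` nothing is known about `g`, but the projection of the support is a compact subset of
    -- `V`, so the sheared function vanishes on a whole neighbourhood.
    · have h0 : (fun q : X × ℝ => ψ (q.1, g q.1 + q.2)) =ᶠ[𝓝 p] fun _ => 0 := by
        have : ∀ᶠ q : X × ℝ in 𝓝 p, q.1 ∈ (Prod.fst '' tsupport ψ)ᶜ :=
          continuous_fst.continuousAt.eventually
            (hK.isClosed.isOpen_compl.mem_nhds fun h => hp (hKV h))
        filter_upwards [this] with q hq
        exact image_eq_zero_of_notMem_tsupport fun h => hq ⟨_, h, rfl⟩
      exact contDiffAt_const.congr_of_eventuallyEq h0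
  · have hcomp : IsCompact ((fun p : X × ℝ => (p.1, p.2 - g p.1)) '' tsupport ψ) := by
      refine IsCompact.image_of_continuousOn hc ?_
      refine continuousOn_fst.prodMk (continuousOn_snd.sub ?_)
      exact hg.continuousOn.comp continuousOn_fst hs
    refine HasCompactSupport.intro hcomp fun p hp => ?_
    refine image_eq_zero_of_notMem_tsupport fun h => hp ⟨_, h, ?_⟩
    simp

variable [CompleteSpace F]

theorem setIntegral_Iio_deriv {h : ℝ → F} {h' : ℝ → F} (hd : ∀ t, HasDerivAt h (h' t) t)
    (hc : HasCompactSupport h) (hi : Integrable h') (a : ℝ) :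
    ∫ t in Set.Iio a, h' t = h a := by
  rw [← integral_Iic_eq_integral_Iio]
  have := integral_Iic_of_hasDerivAt_of_tendsto' (a := a) (f := h) (f' := h') (m := 0)
    (fun x _ => hd x) hi.integrableOn ?_
  · simpa using this
  · have := hc.is_zero_at_infty
    exact this.mono_left atBot_le_cocompact

theorem setIntegral_Ioi_deriv {h : ℝ → F} {h' : ℝ → F} {a : ℝ}
    (hd : ∀ t ∈ Set.Ici a, HasDerivAt h (h' t) t)
    (hc : HasCompactSupport h) (hi : IntegrableOn h' (Set.Ioi a)) :
    ∫ t in Set.Ioi a, h' t = -h a := by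
  have := integral_Ioi_of_hasDerivAt_of_tendsto' (a := a) (f := h) (f' := h') (m := 0)
    hd hi ?_
  · simpa using this
  · have := hc.is_zero_at_infty
    exact this.mono_left atTop_le_cocompact

variable [FiniteDimensional ℝ X] [MeasureSpace X] [BorelSpace X]
  [(volume : Measure X).IsAddHaarMeasure]

theorem setIntegral_lt_eq {g : X → ℝ} (hg : Measurable g) {f : X × ℝ → F}
    (hf : Integrable f) :
    ∫ p in {p : X × ℝ | p.2 < g p.1}, f p = ∫ y, ∫ s in Set.Iio (0 : ℝ), f (y, g y + s) := by
  have hm : MeasurableSet {p : X × ℝ | p.2 < g p.1} :=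
    measurableSet_lt measurable_snd (hg.comp measurable_fst)
  rw [← integral_indicator hm, Measure.volume_eq_prod, integral_prod]
  · refine integral_congr_ae (Eventually.of_forall fun y => ?_)
    change ∫ t, _ = ∫ s in Set.Iio (0 : ℝ), f (y, g y + s)
    rw [← integral_indicator measurableSet_Iio,
      ← integral_add_left_eq_self (μ := volume) _ (g y)]
    refine integral_congr_ae (Eventually.of_forall fun s => ?_)
    simp only [Set.indicator_apply, Set.mem_ofPred_eq, Set.mem_Iio]
    congr 1
    simp
  · exact hf.indicator hm

/-- The shear `S(y, s) = ψ(y, g y + s)` straightens the region to the half-space `s < 0`. By the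
chain rule the derivative of `ψ` along `(w, α)` is the derivative of `S` along `(w, 0)` plus `(α -
Dg w) ∂S/∂s`. The first term integrates to zero over `y` for each `s`, the second gives the value of
`S` at `s = 0`. -/
theorem graph_divergence {g : X → ℝ} {V : Set X} (hV : IsOpen V) (hgm : Measurable g)
    (hg : ContDiffOn ℝ 1 g V) {ψ : X × ℝ → F} (hψ : ContDiff ℝ 1 ψ)
    (hc : HasCompactSupport ψ) (hs : ∀ p ∈ tsupport ψ, p.1 ∈ V) (w : X) (α : ℝ) :
    ∫ p in {p : X × ℝ | p.2 < g p.1}, fderiv ℝ ψ p (w, α) =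
      α • (∫ y, ψ (y, g y)) - ∫ y, fderiv ℝ g y w • ψ (y, g y) := by
  obtain ⟨hS, hSc⟩ := contDiff_shear hV hg hψ hc hs
  set S : X × ℝ → F := fun p => ψ (p.1, g p.1 + p.2) with hSdef
  have hint : Integrable (fun p => fderiv ℝ ψ p (w, α)) :=
    ((hψ.continuous_fderiv one_ne_zero).clm_apply continuous_const).integrable_of_hasCompactSupport
      (hc.fderiv_apply ℝ _)
  have hSi : ∀ v, Integrable (fun p => fderiv ℝ S p v) := fun v =>
    ((hS.continuous_fderiv one_ne_zero).clm_apply continuous_const).integrable_of_hasCompactSupport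
      (hSc.fderiv_apply ℝ _)
  have hSd : ∀ y ∈ V, ∀ s : ℝ, ∀ w' α', fderiv ℝ S (y, s) (w', α') =
      fderiv ℝ ψ (y, g y + s) (w', fderiv ℝ g y w' + α') := by
    intro y hy s w' α'
    have h1 : HasFDerivAt g (fderiv ℝ g y) y :=
      ((hg.contDiffAt (hV.mem_nhds hy)).differentiableAt one_ne_zero).hasFDerivAt
    have h2 : HasFDerivAt (fun p : X × ℝ => g p.1)
        ((fderiv ℝ g y).comp (ContinuousLinearMap.fst ℝ X ℝ)) (y, s) :=
      h1.comp (y, s) (f := fun p : X × ℝ => p.1) hasFDerivAt_fst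
    have h3 := (hψ.differentiable one_ne_zero (y, g y + s)).hasFDerivAt
    have h4 := h3.comp (y, s) (hasFDerivAt_fst.prodMk (h2.add hasFDerivAt_snd))
    have h5 : fderiv ℝ S (y, s) = _ := HasFDerivAt.fderiv h4
    rw [h5]; simp
  have hψ0 : ∀ y ∉ V, ∀ t, ψ (y, t) = 0 ∧ fderiv ℝ ψ (y, t) = 0 := by
    intro y hy t
    have : (y, t) ∉ tsupport ψ := fun h => hy (hs _ h)
    exact ⟨image_eq_zero_of_notMem_tsupport this,
      image_eq_zero_of_notMem_tsupport fun h => this (tsupport_fderiv_subset ℝ h)⟩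
  have hS0 : ∀ y ∉ V, ∀ s, fderiv ℝ S (y, s) = 0 := by
    intro y hy s
    have : (y, s) ∉ tsupport S := by
      intro h
      have hcl : IsClosed {p : X × ℝ | p.1 ∈ Prod.fst '' tsupport ψ} :=
        (IsCompact.image hc continuous_fst).isClosed.preimage continuous_fst
      have hsub : tsupport S ⊆ {p : X × ℝ | p.1 ∈ Prod.fst '' tsupport ψ} := by
        refine closure_minimal (fun p hp => ?_) hcl
        exact ⟨_, subset_tsupport ψ hp, rfl⟩
      obtain ⟨q, hq, hqy⟩ := hsub h
      have hqy' : q.1 = y := hqy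
      exact hy (hqy' ▸ hs q hq)
    exact image_eq_zero_of_notMem_tsupport fun h => this (tsupport_fderiv_subset ℝ h)
  have hkey : ∀ y s, fderiv ℝ ψ (y, g y + s) (w, α) =
      fderiv ℝ S (y, s) (w, 0) + (α - fderiv ℝ g y w) • fderiv ℝ S (y, s) (0, 1) := by
    intro y s
    by_cases hy : y ∈ V
    · rw [hSd y hy, hSd y hy, ← map_smul, ← map_add]
      congr 1
      simp
    · rw [(hψ0 y hy _).2, hS0 y hy]; simp
  have hS1 : ∀ y, ∫ s in Set.Iio (0 : ℝ), fderiv ℝ S (y, s) (0, 1) = ψ (y, g y) := by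
    intro y
    have hd : ∀ s, HasDerivAt (fun s => S (y, s)) (fderiv ℝ S (y, s) (0, 1)) s := by
      intro s
      have h1 := (hS.differentiable one_ne_zero (y, s)).hasFDerivAt
      exact h1.comp_hasDerivAt s ((hasDerivAt_const s y).prodMk (hasDerivAt_id s))
    have hcs : HasCompactSupport (fun s => S (y, s)) :=
      hSc.slice_left y
    rw [setIntegral_Iio_deriv hd hcs]
    · simp [hSdef]
    · refine Continuous.integrable_of_hasCompactSupport ?_ ?_
      · exact ((hS.continuous_fderiv one_ne_zero).clm_apply continuous_const).comp
          (by fun_prop : Continuous fun s : ℝ => (y, s))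
      · exact (hSc.fderiv_apply ℝ (0, 1)).slice_left y
  have hSw : ∀ s, ∫ y, fderiv ℝ S (y, s) (w, 0) = 0 := by
    intro s
    have h0 := integral_fderiv_apply_eq_zero (volume : Measure X) (f := fun y => S (y, s))
      (hS.comp (contDiff_id.prodMk contDiff_const))
      (hSc.slice_right s) w
    rw [← h0]
    refine integral_congr_ae (Eventually.of_forall fun y => ?_)
    have h1 := (hS.differentiable one_ne_zero (y, s)).hasFDerivAt
    have h2 := HasFDerivAt.comp (f := fun y => (y, s)) y h1
      ((hasFDerivAt_id y).prodMk (hasFDerivAt_const s y))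
    have h3 : fderiv ℝ (fun y => S (y, s)) y = _ := HasFDerivAt.fderiv h2
    simp only [h3]; simp
  rw [setIntegral_lt_eq hgm hint]
  simp_rw [hkey]
  have hi1 : ∀ y, IntegrableOn (fun s => fderiv ℝ S (y, s) (w, 0)) (Set.Iio 0) := by
    intro y
    refine (Continuous.integrable_of_hasCompactSupport ?_ ?_).integrableOn
    · exact ((hS.continuous_fderiv one_ne_zero).clm_apply continuous_const).comp
          (by fun_prop : Continuous fun s : ℝ => (y, s))
    · exact (hSc.fderiv_apply ℝ (w, 0)).slice_left y
  have hi2 : ∀ y, IntegrableOn (fun s => fderiv ℝ S (y, s) (0, 1)) (Set.Iio 0) := by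
    intro y
    refine (Continuous.integrable_of_hasCompactSupport ?_ ?_).integrableOn
    · exact ((hS.continuous_fderiv one_ne_zero).clm_apply continuous_const).comp
          (by fun_prop : Continuous fun s : ℝ => (y, s))
    · exact (hSc.fderiv_apply ℝ (0, 1)).slice_left y
  have hstep : ∀ y, ∫ s in Set.Iio (0 : ℝ), (fderiv ℝ S (y, s) (w, 0) +
      (α - fderiv ℝ g y w) • fderiv ℝ S (y, s) (0, 1)) =
      (∫ s in Set.Iio (0 : ℝ), fderiv ℝ S (y, s) (w, 0)) +
        (α • ψ (y, g y) - fderiv ℝ g y w • ψ (y, g y)) := by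
    intro y
    refine (integral_add (hi1 y) ((hi2 y).smul _)).trans ?_
    simp only [Pi.smul_apply]
    rw [integral_smul, hS1, sub_smul]
  simp_rw [hstep]
  have hψc : Continuous (fun y => S (y, 0)) := hS.continuous.comp (by fun_prop)
  have hSy : HasCompactSupport (fun y => S (y, 0)) :=
    hSc.slice_right 0
  have hψS : ∀ y, ψ (y, g y) = S (y, 0) := fun y => by simp [hSdef]
  have hI1 : Integrable (fun y => ψ (y, g y)) := by
    simp_rw [hψS]; exact hψc.integrable_of_hasCompactSupport hSy
  have hI2 : Integrable (fun y => fderiv ℝ g y w • ψ (y, g y)) := by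
    -- The derivative of `g` is continuous only on `V`; since `ψ` vanishes near the complement,
    -- extending the derivative by zero gives a continuous product.
    have : ∀ y, fderiv ℝ g y w • ψ (y, g y) =
        V.indicator (fun y => fderiv ℝ g y w) y • S (y, 0) := by
      intro y
      by_cases hy : y ∈ V
      · simp [hy, hψS]
      · simp [hy, (hψ0 y hy _).1]
    simp_rw [this]
    have hcont : Continuous (fun y => V.indicator (fun y => fderiv ℝ g y w) y • S (y, 0)) := by
      rw [continuous_iff_continuousAt]
      intro y
      by_cases hy : y ∈ V
      · have : (fun y => fderiv ℝ g y w • S (y, 0)) =ᶠ[𝓝 y]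
            (fun y => V.indicator (fun y => fderiv ℝ g y w) y • S (y, 0)) := by
          filter_upwards [hV.mem_nhds hy] with x hx
          simp [hx]
        refine ContinuousAt.congr ?_ this
        refine ContinuousAt.smul ?_ hψc.continuousAt
        exact (((hg.contDiffAt (hV.mem_nhds hy)).continuousAt_fderiv one_ne_zero)).clm_apply
          continuousAt_const
      · have hnt : y ∉ Prod.fst '' tsupport ψ := by
          rintro ⟨q, hq, rfl⟩; exact hy (hs q hq)
        have : (fun _ => (0 : F)) =ᶠ[𝓝 y]
            (fun y => V.indicator (fun y => fderiv ℝ g y w) y • S (y, 0)) := by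
          filter_upwards [(IsCompact.image hc continuous_fst).isClosed.isOpen_compl.mem_nhds hnt]
            with x hx
          have : ψ (x, g x + 0) = 0 := image_eq_zero_of_notMem_tsupport fun h => hx ⟨_, h, rfl⟩
          simp [hSdef] at this ⊢
          simp [this]
        exact continuousAt_const.congr this
    exact hcont.integrable_of_hasCompactSupport (hSy.smul_left)
  have hI3 : Integrable (fun y => ∫ s in Set.Iio (0 : ℝ), fderiv ℝ S (y, s) (w, 0)) := by
    have := (hSi (w, 0)).integrableOn (s := Set.univ ×ˢ Set.Iio (0 : ℝ))
    rw [IntegrableOn, Measure.volume_eq_prod, ← Measure.prod_restrict, Measure.restrict_univ]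
      at this
    exact this.integral_prod_left
  have hI4 : Integrable (fun y => α • ψ (y, g y)) := hI1.smul α
  refine (integral_add hI3 (hI4.sub hI2)).trans ?_
  simp only [Pi.sub_apply]
  rw [integral_sub hI4 hI2, integral_smul, integral_integral_swap]
  · simp [hSw]
  · have := (hSi (w, 0)).integrableOn (s := Set.univ ×ˢ Set.Iio (0 : ℝ))
    rw [IntegrableOn, Measure.volume_eq_prod, ← Measure.prod_restrict, Measure.restrict_univ]
      at this
    exact this

end


/-! ### Regular boundary points -/

theorem IsOutwardNormal.norm_eq_one {n : ℕ} {M : Set (Rn n)} {b ν : Rn n}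
    (h : IsOutwardNormal M b ν) : ‖ν‖ = 1 := by
  obtain ⟨μ, -, -, h0, -, h1⟩ := h
  have h2 := congrArg norm h1
  rw [norm_neg, norm_smul, norm_norm] at h2
  have h3 : ‖gradient μ b‖ ≠ 0 := norm_ne_zero_iff.2 h0
  field_simp at h2
  exact h2.symm

theorem mem_frontier_iff_of_isOpen {X : Type*} [TopologicalSpace X] {M : Set X} (hM : IsOpen M)
    {b : X} : b ∈ frontier M ↔ b ∈ closure M ∧ b ∉ M := by
  rw [hM.frontier_eq]; rfl

/-- Near a regular boundary point an open set lies below a graph with small slope. -/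
theorem IsOutwardNormal.exists_graph {N : ℕ} {M : Set (Rn (N + 1))} {b ν : Rn (N + 1)}
    (h : IsOutwardNormal M b ν) (Ψ : Cylinder ν) {K : NNReal} (hK : 0 < K) :
    ∃ (g : Rn N → ℝ) (V : Set (Rn N)) (r : ℝ), 0 < r ∧ IsOpen V ∧ (0 : Rn N) ∈ V ∧ Measurable g ∧
      ContDiffOn ℝ 1 g V ∧ LipschitzOnWith K g V ∧ (∀ y ∈ V, g y ∈ Set.Ioo (-r) r) ∧
      ∀ y ∈ V, ∀ t ∈ Set.Ioo (-r) r, (b + Ψ.map (y, t) ∈ M ↔ t < g y) := by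
  obtain ⟨μ, hμ, hb0, h0, hev, h1⟩ := h
  set c := ‖gradient μ b‖ with hc
  have hcpos : 0 < c := norm_pos_iff.2 h0
  set f : Rn N × ℝ → ℝ := fun p => μ (b + Ψ.map p) with hf
  have hf0 : f 0 = 0 := by simp [hf, hb0]
  have hcd : ContDiffAt ℝ 1 f 0 := by
    have h2 : ContDiffAt ℝ 1 (fun p : Rn N × ℝ => b + Ψ.map p) 0 :=
      (contDiff_const.add Ψ.map.contDiff).contDiffAt
    refine ContDiffAt.comp (f := fun p : Rn N × ℝ => b + Ψ.map p) (g := μ) 0 ?_ h2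
    simpa using hμ
  -- In cylinder coordinates the differential of the defining function at the origin is `-c dt`. It
  -- is invertible in `t`, so the implicit function theorem applies, and zero in `y`, so the graph
  -- has slope zero at the origin and is Lipschitz with any positive constant nearby.
  have hfd : HasFDerivAt f ((-c) • ContinuousLinearMap.snd ℝ (Rn N) ℝ) 0 := by
    have h2 : HasFDerivAt μ (fderiv ℝ μ b) (b + Ψ.map 0) := by
      simpa using (hμ.differentiableAt one_ne_zero).hasFDerivAt
    have h3 : HasFDerivAt (fun p : Rn N × ℝ => b + Ψ.map p)
        (Ψ.map : (Rn N × ℝ) →L[ℝ] Rn (N + 1)) 0 := (Ψ.map.hasFDerivAt).const_add b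
    have h4 := HasFDerivAt.comp (f := fun p : Rn N × ℝ => b + Ψ.map p) (g := μ) 0 h2 h3
    refine h4.congr_fderiv ?_
    refine ContinuousLinearMap.ext fun p => ?_
    have hgrad : ∀ v, fderiv ℝ μ b v = inner ℝ (gradient μ b) v := fun v => by
      simp [gradient]
    rw [ContinuousLinearMap.comp_apply, ContinuousLinearEquiv.coe_coe, hgrad, h1, inner_neg_left,
      inner_smul_left, real_inner_comm, Ψ.inner_axis]
    simp
  have hfe : fderiv ℝ f 0 = (-c) • ContinuousLinearMap.snd ℝ (Rn N) ℝ := hfd.fderiv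
  have hinr : (fderiv ℝ f 0 ∘L .inr ℝ (Rn N) ℝ) = (-c) • ContinuousLinearMap.id ℝ ℝ := by
    rw [hfe]; ext; simp
  have hinv : (fderiv ℝ f 0 ∘L .inr ℝ (Rn N) ℝ).IsInvertible := by
    rw [hinr]
    refine ⟨ContinuousLinearEquiv.smulLeft (Units.mk0 (-c) (by simpa using hcpos.ne')), ?_⟩
    ext; simp
  set g0 := hcd.implicitFunction one_ne_zero hinv with hg0
  have hg00 : g0 0 = 0 := hcd.implicitFunction_apply_self one_ne_zero hinv
  have hgs : HasStrictFDerivAt g0 (0 : Rn N →L[ℝ] ℝ) 0 := by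
    have := hcd.hasStrictFDerivAt_implicitFunction one_ne_zero hinv
    have hz : (fderiv ℝ f 0 ∘L .inl ℝ (Rn N) ℝ) = 0 := by
      rw [hfe]; ext; simp
    rw [hz, ContinuousLinearMap.comp_zero, neg_zero] at this
    exact this
  obtain ⟨s1, hs1, hlip⟩ := hgs.exists_lipschitzOnWith_of_nnnorm_lt K (by simpa using hK)
  have hgc : ContDiffAt ℝ 1 g0 0 := hcd.contDiffAt_implicitFunction one_ne_zero hinv
  obtain ⟨s2, hs2, hgc2⟩ := hgc.contDiffOn (m := 1) le_rfl (by simp)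
  have hev1 : ∀ᶠ y in 𝓝 (0 : Rn N), f (y, g0 y) = 0 := by
    have := hcd.eventually_apply_implicitFunction one_ne_zero hinv
    rwa [hf0] at this
  have hev2 : ∀ᶠ p in 𝓝 (0 : Rn N × ℝ), (b + Ψ.map p ∈ M ↔ 0 < f p) := by
    have : Tendsto (fun p : Rn N × ℝ => b + Ψ.map p) (𝓝 0) (𝓝 b) := by
      have : Continuous (fun p : Rn N × ℝ => b + Ψ.map p) := by fun_prop
      simpa using this.tendsto 0
    exact this.eventually hev
  -- Strict differentiability with error below `c/2` makes `f` strictly decreasing in `t` uniformly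
  -- near the origin, so that its sign decides on which side of the graph a point lies.
  have hev3 : ∀ᶠ pq in 𝓝 ((0, 0) : (Rn N × ℝ) × (Rn N × ℝ)),
      ‖f pq.1 - f pq.2 - fderiv ℝ f 0 (pq.1 - pq.2)‖ ≤ c / 2 * ‖pq.1 - pq.2‖ :=
    ((hcd.hasStrictFDerivAt one_ne_zero).isLittleO).def (by positivity)
  obtain ⟨r1, hr1, hB1⟩ := Metric.eventually_nhds_iff_ball.1 hev2
  obtain ⟨r2, hr2, hB2⟩ := Metric.eventually_nhds_iff_ball.1 hev3
  set r := min r1 r2 with hr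
  have hrpos : 0 < r := lt_min hr1 hr2
  have hgr : ∀ᶠ y in 𝓝 (0 : Rn N), g0 y ∈ Set.Ioo (-r) r := by
    have := hgs.continuousAt.tendsto
    rw [hg00] at this
    exact this.eventually (Ioo_mem_nhds (by linarith) hrpos)
  obtain ⟨r3, hr3, hB3⟩ := Metric.eventually_nhds_iff_ball.1
    (((hev1.and hgr).and (eventually_mem_set.2 hs1)).and (eventually_mem_set.2 hs2))
  set V := Metric.ball (0 : Rn N) (min r r3) with hV
  have hV3 : ∀ y ∈ V, y ∈ Metric.ball (0 : Rn N) r3 := fun y hy =>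
    Metric.ball_subset_ball (min_le_right _ _) hy
  have hcdV : ContDiffOn ℝ 1 g0 V := hgc2.mono fun y hy => (hB3 y (hV3 y hy)).2
  -- Extension by zero gives a function that is measurable everywhere, as Fubini below the graph
  -- requires.
  refine ⟨V.indicator g0, V, r, hrpos, Metric.isOpen_ball, ?_, ?_, ?_, ?_, ?_, ?_⟩
  · exact Metric.mem_ball_self (lt_min hrpos hr3)
  · classical
    rw [← Set.piecewise_eq_indicator]
    exact hcdV.continuousOn.measurable_piecewise continuousOn_const
      Metric.isOpen_ball.measurableSet
  · exact hcdV.congr fun y hy => Set.indicator_of_mem hy _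
  · have : LipschitzOnWith K g0 V := hlip.mono fun y hy => (hB3 y (hV3 y hy)).1.2
    intro x hx y hy
    rw [Set.indicator_of_mem hx, Set.indicator_of_mem hy]
    exact this hx hy
  · intro y hy
    rw [Set.indicator_of_mem hy]
    exact (hB3 y (hV3 y hy)).1.1.2
  · intro y hy t ht
    rw [Set.indicator_of_mem hy]
    have hyr : ‖y‖ < r := by
      have := Metric.ball_subset_ball (min_le_left r r3) hy
      simpa using this
    have hnorm : ∀ t' ∈ Set.Ioo (-r) r, ‖((y, t') : Rn N × ℝ)‖ < r := fun t' ht' => by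
      rw [Prod.norm_def]
      exact max_lt hyr (by rw [Real.norm_eq_abs]; exact abs_lt.2 ht')
    have hgy := (hB3 y (hV3 y hy)).1.1
    have hM := hB1 (y, t) (by simpa using (hnorm t ht).trans_le (min_le_left _ _))
    rw [hM]
    have h5 := hB2 ((y, t), (y, g0 y)) (by
      rw [Metric.mem_ball, Prod.dist_eq, dist_zero_right, dist_zero_right]
      exact max_lt ((hnorm t ht).trans_le (min_le_right _ _))
        ((hnorm _ hgy.2).trans_le (min_le_right _ _)))
    have h6 : ‖((y, t) : Rn N × ℝ) - (y, g0 y)‖ = |t - g0 y| := by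
      rw [Prod.mk_sub_mk, sub_self, Prod.norm_def]; simp
    have h7 : fderiv ℝ f 0 ((y, t) - (y, g0 y)) = -c * (t - g0 y) := by
      rw [hfe]; simp
    simp only [h6, h7, hgy.1, Real.norm_eq_abs] at h5
    have h8 := abs_le.1 h5
    constructor
    · intro hpos
      by_contra hle
      push Not at hle
      rw [abs_of_nonneg (by linarith)] at h8
      nlinarith [h8.2, mul_nonneg hcpos.le (sub_nonneg.2 hle)]
    · intro hlt
      rw [abs_of_neg (by linarith)] at h8
      nlinarith [h8.1, mul_pos hcpos (sub_pos.2 hlt)]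


/-! ### The divergence theorem near one regular boundary point, with relative error -/

section

variable {F : Type*} [NormedAddCommGroup F] [NormedSpace ℝ F]

/-- The difference is an integral over the positive measure `μ - ρ`, and `∫ |ψ| d(μ - ρ) ≤ (c - 1) ∫
|ψ| dρ`. -/
theorem norm_integral_sub_le_of_le_smul {X : Type*} [MeasurableSpace X] {ρ μ : Measure X}
    [IsFiniteMeasure μ] (h1 : ρ ≤ μ) {c : ℝ} (hc : 1 ≤ c) (h2 : μ ≤ ENNReal.ofReal c • ρ)
    {ψ : X → F} (hψ : Integrable ψ μ) :
    ‖(∫ x, ψ x ∂μ) - ∫ x, ψ x ∂ρ‖ ≤ (c - 1) * ∫ x, ‖ψ x‖ ∂μ := by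
  have : IsFiniteMeasure ρ := isFiniteMeasure_of_le μ h1
  have hρ : Integrable ψ ρ := hψ.mono_measure h1
  have hs : Integrable ψ (μ - ρ) := hψ.mono_measure Measure.sub_le
  have hdec : ∫ x, ψ x ∂μ = (∫ x, ψ x ∂(μ - ρ)) + ∫ x, ψ x ∂ρ := by
    rw [← integral_add_measure hs hρ, Measure.sub_add_cancel_of_le h1]
  have hdec' : ∫ x, ‖ψ x‖ ∂μ = (∫ x, ‖ψ x‖ ∂(μ - ρ)) + ∫ x, ‖ψ x‖ ∂ρ := by
    rw [← integral_add_measure hs.norm hρ.norm, Measure.sub_add_cancel_of_le h1]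
  have h3 : ∫ x, ‖ψ x‖ ∂μ ≤ c * ∫ x, ‖ψ x‖ ∂ρ := by
    have := integral_mono_measure h2 (Eventually.of_forall fun x => norm_nonneg (ψ x))
      (hρ.norm.smul_measure ENNReal.ofReal_ne_top)
    rwa [integral_smul_measure, ENNReal.toReal_ofReal (by linarith), smul_eq_mul] at this
  have h4 : ∫ x, ‖ψ x‖ ∂ρ ≤ ∫ x, ‖ψ x‖ ∂μ :=
    integral_mono_measure h1 (Eventually.of_forall fun x => norm_nonneg (ψ x)) hψ.norm
  rw [hdec, add_sub_cancel_right]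
  refine (norm_integral_le_integral_norm _).trans ?_
  nlinarith [mul_le_mul_of_nonneg_left h4 (sub_nonneg.2 hc)]

open Measure in
theorem euclideanHausdorffMeasure_image_le {X Y : Type*} [EMetricSpace X] [MeasurableSpace X]
    [BorelSpace X] [EMetricSpace Y] [MeasurableSpace Y] [BorelSpace Y] {K : NNReal} {f : X → Y}
    {s : Set X} (h : LipschitzOnWith K f s) (d : ℕ) :
    μHE[d] (f '' s) ≤ (K : ENNReal) ^ d * μHE[d] s := by
  rw [euclideanHausdorffMeasure_def, euclideanHausdorffMeasure_def]
  simp only [Measure.smul_apply, ENNReal.smul_def, smul_eq_mul]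
  have := h.hausdorffMeasure_image_le (d := d) (by positivity)
  rw [ENNReal.rpow_natCast] at this
  calc _ ≤ _ := mul_le_mul_right this _
    _ = _ := by ring

section

variable {N : ℕ} {ν : Rn (N + 1)} (Ψ : Cylinder ν) (b : Rn (N + 1)) {g : Rn N → ℝ} {K : NNReal}
  {A : Set (Rn N)}

theorem Cylinder.lipschitzOnWith_graph (hg : LipschitzOnWith K g A) :
    LipschitzOnWith (1 + K) (fun y => b + Ψ.map (y, g y)) A := by
  refine LipschitzOnWith.of_dist_le_mul fun x hx y hy => ?_
  rw [dist_add_left, dist_eq_norm, ← map_sub]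
  have h1 := hg.dist_le_mul x hx y hy
  rw [Real.dist_eq] at h1
  refine le_of_sq_le_sq ?_ (by positivity)
  rw [Ψ.norm_sq, ← sq_abs ((x, g x) - (y, g y)).2]
  have h2 : ‖((x, g x) - (y, g y)).1‖ = dist x y := by rw [dist_eq_norm]; rfl
  have h3 : |((x, g x) - (y, g y)).2| ≤ K * dist x y := h1
  have h4 : (0 : ℝ) ≤ K * dist x y := by positivity
  rw [h2]
  have h5 : |((x, g x) - (y, g y)).2| ^ 2 ≤ (K * dist x y) ^ 2 :=
    pow_le_pow_left₀ (abs_nonneg _) h3 2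
  push_cast
  nlinarith [dist_nonneg (x := x) (y := y), mul_nonneg (dist_nonneg (x := x) (y := y)) h4]

/-- The orthogonal projection to the `y` coordinates does not increase distances and undoes the
graph map. With the Lipschitz bound for the graph map itself this pins the area of the graph between
`volume A` and `(1 + K)^N * volume A`; as `K` can be chosen small, no area formula is needed. -/
theorem Cylinder.volume_le_image : volume A ≤
    Measure.euclideanHausdorffMeasure N ((fun y => b + Ψ.map (y, g y)) '' A) := by
  have hP : LipschitzWith 1 (fun x => (Ψ.map.symm (x - b)).1) := by
    refine LipschitzWith.of_dist_le_mul fun x y => ?_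
    have h1 : ‖x - y‖ ^ 2 = ‖(Ψ.map.symm (x - b) - Ψ.map.symm (y - b)).1‖ ^ 2 +
        (Ψ.map.symm (x - b) - Ψ.map.symm (y - b)).2 ^ 2 := by
      rw [← Ψ.norm_sq, map_sub]; simp
    rw [NNReal.coe_one, one_mul, dist_eq_norm, dist_eq_norm]
    refine le_of_sq_le_sq ?_ (norm_nonneg _)
    rw [h1]
    have := sq_nonneg (Ψ.map.symm (x - b) - Ψ.map.symm (y - b)).2
    rw [Prod.fst_sub]
    linarith
  have := euclideanHausdorffMeasure_image_le
    (hP.lipschitzOnWith (s := (fun y => b + Ψ.map (y, g y)) '' A)) N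
  rw [Set.image_image] at this
  simpa [EuclideanSpace.euclideanHausdorffMeasure_eq_volume] using this

theorem Cylinder.image_le_volume (hg : LipschitzOnWith K g A) :
    Measure.euclideanHausdorffMeasure N ((fun y => b + Ψ.map (y, g y)) '' A) ≤
      ((1 + K : NNReal) : ENNReal) ^ N * volume A := by
  have := euclideanHausdorffMeasure_image_le (Ψ.lipschitzOnWith_graph b hg) N
  rwa [EuclideanSpace.euclideanHausdorffMeasure_eq_volume] at this

end

theorem setIntegral_inter_eq {X : Type*} [MeasurableSpace X] {μ : Measure X} {S U : Set X}
    (hS : MeasurableSet S) {k : X → F} (hk : ∀ x ∉ U, k x = 0) :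
    ∫ x in S, k x ∂μ = ∫ x in S ∩ U, k x ∂μ :=
  setIntegral_eq_of_subset_of_forall_sdiff_eq_zero hS
      Set.inter_subset_left fun x hx => hk x fun hxU => hx.2 ⟨hx.1, hxU⟩

theorem integral_map_restrict_eq {X Y : Type*} [MeasurableSpace X] [MeasurableSpace Y]
    [TopologicalSpace Y] [OpensMeasurableSpace Y] [SecondCountableTopology Y]
    [TopologicalSpace.PseudoMetrizableSpace Y]
    {μ : Measure X} {V : Set X} {γ : X → Y} (hγ : Measurable γ) {k : Y → F} (hk : Continuous k)
    (hV : ∀ y ∉ V, k (γ y) = 0) : ∫ x, k x ∂((μ.restrict V).map γ) = ∫ y, k (γ y) ∂μ := by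
  rw [integral_map hγ.aemeasurable hk.aestronglyMeasurable]
  exact setIntegral_eq_integral_of_forall_compl_eq_zero hV

variable [CompleteSpace F]

/-- The divergence theorem near a regular boundary point, up to a small relative error. -/
theorem IsOutwardNormal.approx_divergence {N : ℕ} {M : Set (Rn (N + 1))} (hM : IsOpen M)
    (hfin : Measure.euclideanHausdorffMeasure N (frontier M) < ⊤)
    {b ν : Rn (N + 1)} (h : IsOutwardNormal M b ν) {K : NNReal} (hK : 0 < K) :
    ∃ U : Set (Rn (N + 1)), IsOpen U ∧ b ∈ U ∧ ∀ ψ : Rn (N + 1) → F, ContDiff ℝ 1 ψ →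
      HasCompactSupport ψ → tsupport ψ ⊆ U → ∀ v : Rn (N + 1),
      ‖(∫ x in M, fderiv ℝ ψ x v) - (inner ℝ v ν : ℝ) •
          ∫ x in frontier M, ψ x ∂(Measure.euclideanHausdorffMeasure N)‖ ≤
        ((1 + K : ℝ) ^ N - 1 + K) * ‖v‖ *
          ∫ x in frontier M, ‖ψ x‖ ∂(Measure.euclideanHausdorffMeasure N) := by
  obtain ⟨Ψ⟩ := exists_cylinder ν h.norm_eq_one
  obtain ⟨g, V, r, hr, hV, h0V, hgm, hgc, hgl, hgr, hiff⟩ := h.exists_graph Ψ hK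
  set Θ : Rn N × ℝ → Rn (N + 1) := fun p => b + Ψ.map p with hΘ
  set γ : Rn N → Rn (N + 1) := fun y => Θ (y, g y) with hγ
  have hemb : IsOpenEmbedding Θ :=
    (Homeomorph.addLeft b).isOpenEmbedding.comp Ψ.map.toHomeomorph.isOpenEmbedding
  set Q : Set (Rn N × ℝ) := V ×ˢ Set.Ioo (-r) r with hQ
  set U := Θ '' Q with hU
  have hUo : IsOpen U := hemb.isOpenMap _ (hV.prod isOpen_Ioo)
  have hQM : ∀ p ∈ Q, (Θ p ∈ M ↔ p.2 < g p.1) := fun p hp => hiff p.1 hp.1 p.2 hp.2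
  -- Inside the box the frontier is the graph itself: a point above it has a neighbourhood free of
  -- `M`, and a point on it is a limit of points below.
  have hQf : ∀ p ∈ Q, (Θ p ∈ frontier M ↔ p.2 = g p.1) := by
    intro p hp
    rw [mem_frontier_iff_of_isOpen hM, hQM p hp, not_lt]
    constructor
    · rintro ⟨h1, h2⟩
      refine le_antisymm ?_ h2
      by_contra hlt
      push Not at hlt
      have hgcont : ContinuousAt (fun q : Rn N × ℝ => g q.1) p :=
        ((hgc.continuousOn.continuousAt (hV.mem_nhds hp.1))).comp (f := fun q : Rn N × ℝ => q.1)
          continuousAt_fst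
      have hev : ∀ᶠ q in 𝓝 p, q ∈ Q ∧ g q.1 < q.2 :=
        (eventually_mem_set.2 ((hV.prod isOpen_Ioo).mem_nhds hp)).and
          (hgcont.eventually_lt continuousAt_snd hlt)
      have : ∀ᶠ x in 𝓝 (Θ p), x ∉ M := by
        rw [← hemb.map_nhds_eq, eventually_map]
        filter_upwards [hev] with q hq hqM
        exact absurd ((hQM q hq.1).1 hqM) (not_lt.2 hq.2.le)
      exact (mem_closure_iff_frequently.1 h1) this
    · intro h1
      refine ⟨?_, h1.ge⟩
      have hlim : Tendsto (fun t : ℝ => Θ (p.1, t)) (𝓝[<] p.2) (𝓝 (Θ p)) := by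
        have : Continuous (fun t : ℝ => Θ (p.1, t)) := hemb.continuous.comp (by fun_prop)
        exact (this.tendsto p.2).mono_left nhdsWithin_le_nhds
      refine mem_closure_of_tendsto hlim ?_
      filter_upwards [self_mem_nhdsWithin, nhdsWithin_le_nhds (isOpen_Ioo.mem_nhds hp.2)]
        with t ht ht2
      exact (hQM (p.1, t) ⟨hp.1, ht2⟩).2 (h1 ▸ ht)
  have hγU : frontier M ∩ U = γ '' V := by
    ext x
    constructor
    · rintro ⟨hx, p, hp, rfl⟩
      refine ⟨p.1, hp.1, ?_⟩
      rw [hγ]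
      simp only [← (hQf p hp).1 hx]
    · rintro ⟨y, hy, rfl⟩
      have : (y, g y) ∈ Q := ⟨hy, hgr y hy⟩
      exact ⟨(hQf _ this).2 rfl, _, this, rfl⟩
  refine ⟨U, hUo, ⟨0, ⟨h0V, by simpa using hr⟩, by simp [hΘ]⟩, ?_⟩
  intro ψ hψ hc hsupp v
  have hψ0 : ∀ x ∉ U, ψ x = 0 := fun x hx => image_eq_zero_of_notMem_tsupport fun h => hx (hsupp h)
  have hdψ0 : ∀ x ∉ U, fderiv ℝ ψ x = 0 := fun x hx =>
    image_eq_zero_of_notMem_tsupport fun h => hx (hsupp (tsupport_fderiv_subset ℝ h))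
  set H := (Measure.euclideanHausdorffMeasure N : Measure (Rn (N + 1))) with hH
  have hfm : MeasurableSet (frontier M ∩ U) := isClosed_frontier.measurableSet.inter hUo.measurableSet
  set H' := H.restrict (frontier M ∩ U) with hH'
  have : IsFiniteMeasure H' := ⟨by
    rw [hH', Measure.restrict_apply_univ]
    exact (measure_mono Set.inter_subset_left).trans_lt hfin⟩
  have hγm : Measurable γ := hemb.continuous.measurable.comp (measurable_id.prodMk hgm)
  -- Lebesgue measure carried by the graph map; it replaces surface measure up to the factor `(1 +
  -- K)^N`, and it is the measure that `graph_divergence` produces.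
  set ρ := (volume.restrict V).map γ with hρ
  have himg : ∀ s : Set (Rn (N + 1)), s ∩ (frontier M ∩ U) = γ '' (γ ⁻¹' s ∩ V) := by
    intro s
    rw [hγU, Set.inter_comm, ← Set.image_inter_preimage, Set.inter_comm V]
  have hle1 : ρ ≤ H' := by
    rw [Measure.le_iff]
    intro s hs
    rw [hρ, Measure.map_apply hγm hs, Measure.restrict_apply (hγm hs), hH',
      Measure.restrict_apply hs, himg]
    exact Ψ.volume_le_image b
  have hle2 : H' ≤ ENNReal.ofReal ((1 + K : ℝ) ^ N) • ρ := by
    rw [Measure.le_iff]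
    intro s hs
    rw [Measure.smul_apply, hρ, Measure.map_apply hγm hs, Measure.restrict_apply (hγm hs), hH',
      Measure.restrict_apply hs, himg]
    refine (Ψ.image_le_volume b (hgl.mono Set.inter_subset_right)).trans (le_of_eq ?_)
    rw [smul_eq_mul]
    congr 1
    rw [ENNReal.ofReal_pow (by positivity)]
    congr 1
    rw [← NNReal.coe_one, ← NNReal.coe_add, ENNReal.ofReal_coe_nnreal]
  have hψi : Integrable ψ H' := by
    refine (hψ.continuous.integrable_of_hasCompactSupport hc)
  have hcomp := norm_integral_sub_le_of_le_smul hle1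
    (one_le_pow₀ (by simp) : (1 : ℝ) ≤ (1 + K : ℝ) ^ N) hle2 hψi
  have hγV : ∀ y ∉ V, γ y ∉ U := by
    rintro y hy ⟨p, hp, hpe⟩
    have := hemb.injective hpe
    rw [this] at hp
    exact hy hp.1
  obtain ⟨w, hw⟩ := Ψ.exists_eq v
  set α := (inner ℝ v ν : ℝ) with hα
  set ψ' : Rn N × ℝ → F := fun p => ψ (Θ p) with hψ'
  have hΘc : ContDiff ℝ 1 Θ := contDiff_const.add Ψ.map.contDiff
  have hψ'c : ContDiff ℝ 1 ψ' := hψ.comp hΘc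
  have hΘhomeo : IsClosedEmbedding Θ :=
    (Homeomorph.addLeft b).isClosedEmbedding.comp Ψ.map.toHomeomorph.isClosedEmbedding
  have hψ's : HasCompactSupport ψ' := hc.comp_isClosedEmbedding hΘhomeo
  have hψ't : ∀ p ∈ tsupport ψ', p.1 ∈ V := by
    intro p hp
    have h1 : Θ p ∈ tsupport ψ := tsupport_comp_subset_preimage ψ hemb.continuous hp
    obtain ⟨q, hq, hqe⟩ := hsupp h1
    rw [← hemb.injective hqe]; exact hq.1
  have hvol : ∫ x in M, fderiv ℝ ψ x v = ∫ p in {p : Rn N × ℝ | p.2 < g p.1},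
      fderiv ℝ ψ' p (w, α) := by
    rw [← (Ψ.measurePreserving_add b).setIntegral_preimage_emb (Ψ.measurableEmbedding_add b)]
    have hm : MeasurableSet {p : Rn N × ℝ | p.2 < g p.1} :=
      measurableSet_lt measurable_snd (hgm.comp measurable_fst)
    rw [← integral_indicator hm, ← integral_indicator
      ((Ψ.measurableEmbedding_add b).measurable hM.measurableSet)]
    congr 1
    funext p
    have hd : fderiv ℝ ψ' p (w, α) = fderiv ℝ ψ (Θ p) v := by
      have h1 := (hψ.differentiable one_ne_zero (Θ p)).hasFDerivAt
      have h2 : HasFDerivAt Θ (Ψ.map : (Rn N × ℝ) →L[ℝ] Rn (N + 1)) p :=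
        (Ψ.map.hasFDerivAt).const_add b
      have h3 : fderiv ℝ ψ' p = _ := (h1.comp p h2).fderiv
      rw [h3, hw]; rfl
    by_cases hp : p ∈ Q
    · by_cases hpM : Θ p ∈ M
      · rw [Set.indicator_of_mem (show p ∈ (fun p => b + Ψ.map p) ⁻¹' M from hpM)]
        rw [Set.indicator_of_mem (show p ∈ {p : Rn N × ℝ | p.2 < g p.1} from (hQM p hp).1 hpM), hd]
      · rw [Set.indicator_of_notMem (show p ∉ (fun p => b + Ψ.map p) ⁻¹' M from hpM)]
        rw [Set.indicator_of_notMem (show p ∉ {p : Rn N × ℝ | p.2 < g p.1} from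
          fun h => hpM ((hQM p hp).2 h))]
    · have h1 : Θ p ∉ U := by
        rintro ⟨q, hq, hqe⟩
        exact hp (hemb.injective hqe ▸ hq)
      have h2 : fderiv ℝ ψ (b + Ψ.map p) = 0 := hdψ0 _ h1
      rw [Set.indicator_apply_eq_zero.2 (fun _ => by rw [h2]; rfl),
        Set.indicator_apply_eq_zero.2 (fun _ => by rw [hd, hdψ0 _ h1]; rfl)]
  rw [hvol, graph_divergence hV hgm hgc hψ'c hψ's hψ't w α]
  have hρψ : ∫ y, ψ' (y, g y) = ∫ x, ψ x ∂ρ :=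
    (integral_map_restrict_eq hγm hψ.continuous fun y hy => hψ0 _ (hγV y hy)).symm
  have hρψn : ∫ y, ‖ψ' (y, g y)‖ = ∫ x, ‖ψ x‖ ∂ρ :=
    (integral_map_restrict_eq hγm hψ.continuous.norm
      fun y hy => by rw [hψ0 _ (hγV y hy), norm_zero]).symm
  have hmono : ∫ x, ‖ψ x‖ ∂ρ ≤ ∫ x, ‖ψ x‖ ∂H' :=
    integral_mono_measure hle1 (Eventually.of_forall fun x => norm_nonneg (ψ x)) hψi.norm
  have hnorms : |α| ≤ ‖v‖ ∧ ‖w‖ ≤ ‖v‖ := by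
    have := Ψ.norm_sq (w, α)
    rw [← hw] at this
    simp only at this
    constructor
    · refine abs_le_of_sq_le_sq ?_ (norm_nonneg _)
      nlinarith [sq_nonneg ‖w‖]
    · refine le_of_sq_le_sq ?_ (norm_nonneg _)
      nlinarith [sq_nonneg α]
  have hψγi : Integrable (fun y => ‖ψ' (y, g y)‖) := by
    have h1 : Integrable ψ ρ := hψi.mono_measure hle1
    rw [hρ] at h1
    have h2 := (integrable_map_measure hψ.continuous.aestronglyMeasurable hγm.aemeasurable).1 h1
    have h3 : IntegrableOn (fun y => ψ' (y, g y)) V := h2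
    exact ((integrableOn_iff_integrable_of_support_subset (by
      intro y hy
      by_contra hyV
      exact hy (hψ0 _ (hγV y hyV)))).1 h3).norm
  -- The slope of the graph is at most `K`, so the gradient term of `graph_divergence` is an error
  -- term, and the axial component of `v` alone contributes to the flux.
  have hgrad : ‖∫ y, fderiv ℝ g y w • ψ' (y, g y)‖ ≤ K * ‖v‖ * ∫ x, ‖ψ x‖ ∂ρ := by
    rw [← hρψn, ← integral_const_mul]
    refine norm_integral_le_of_norm_le (hψγi.const_mul _) (Eventually.of_forall fun y => ?_)
    by_cases hy : y ∈ V
    · rw [norm_smul]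
      refine mul_le_mul_of_nonneg_right ?_ (norm_nonneg _)
      have h1 : ‖fderiv ℝ g y‖ ≤ K := norm_fderiv_le_of_lipschitzOn ℝ (hV.mem_nhds hy) hgl
      calc ‖fderiv ℝ g y w‖ ≤ ‖fderiv ℝ g y‖ * ‖w‖ := ContinuousLinearMap.le_opNorm _ _
        _ ≤ K * ‖v‖ := mul_le_mul h1 hnorms.2 (norm_nonneg _) (by positivity)
    · have : ψ' (y, g y) = 0 := hψ0 _ (hγV y hy)
      simp [this]
  rw [setIntegral_inter_eq isClosed_frontier.measurableSet hψ0,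
    setIntegral_inter_eq (k := fun x => ‖ψ x‖) (U := U) isClosed_frontier.measurableSet
      (fun x hx => by rw [hψ0 x hx, norm_zero]), hρψ]
  have hI : 0 ≤ ∫ x, ‖ψ x‖ ∂H' := integral_nonneg fun x => norm_nonneg (ψ x)
  have hsplit : α • (∫ x, ψ x ∂ρ) - (∫ y, fderiv ℝ g y w • ψ' (y, g y)) - α • ∫ x, ψ x ∂H' =
      -(α • ((∫ x, ψ x ∂H') - ∫ x, ψ x ∂ρ)) - ∫ y, fderiv ℝ g y w • ψ' (y, g y) := by
    rw [smul_sub]; abel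
  rw [hsplit]
  have hcN : 0 ≤ (1 + K : ℝ) ^ N - 1 := sub_nonneg.2 (one_le_pow₀ (by simp))
  calc _ ≤ ‖α • ((∫ x, ψ x ∂H') - ∫ x, ψ x ∂ρ)‖ + ‖∫ y, fderiv ℝ g y w • ψ' (y, g y)‖ := by
        refine (norm_sub_le _ _).trans ?_
        rw [norm_neg]
    _ ≤ ‖v‖ * (((1 + K : ℝ) ^ N - 1) * ∫ x, ‖ψ x‖ ∂H') + K * ‖v‖ * ∫ x, ‖ψ x‖ ∂H' := by
        refine add_le_add ?_ (hgrad.trans (mul_le_mul_of_nonneg_left hmono (by positivity)))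
        rw [norm_smul]
        exact mul_le_mul hnorms.1 hcomp (norm_nonneg _) (norm_nonneg _)
    _ = _ := by ring

end


/-! ### The outgoing unit normal -/

theorem fderiv_apply_eq_inner_gradient {n : ℕ} (μ : Rn n → ℝ) (b v : Rn n) :
    fderiv ℝ μ b v = inner ℝ (gradient μ b) v := by
  simp [gradient]

/-- Starting at `b` along a `v` with `⟨v, ν⟩ < 0` one enters `M`, because the first defining
function increases. Then the second one is positive along the same short segment, so its derivative
in the direction `v` cannot be negative. -/
theorem IsOutwardNormal.inner_nonpos {n : ℕ} {M : Set (Rn n)} {b ν ν' : Rn n}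
    (h : IsOutwardNormal M b ν) (h' : IsOutwardNormal M b ν') {v : Rn n}
    (hv : inner ℝ v ν < 0) : inner ℝ v ν' ≤ 0 := by
  obtain ⟨μ, hμ, hb0, h0, hev, h1⟩ := h
  obtain ⟨μ', hμ', hb0', h0', hev', h1'⟩ := h'
  have hline : ∀ {f : Rn n → ℝ}, ContDiffAt ℝ 1 f b →
      HasDerivAt (fun t : ℝ => f (b + t • v)) (inner ℝ (gradient f b) v) 0 := by
    intro f hf
    have h2 : HasFDerivAt f (fderiv ℝ f b) (b + (0 : ℝ) • v) := by
      simpa using (hf.differentiableAt one_ne_zero).hasFDerivAt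
    have h3 : HasDerivAt (fun t : ℝ => b + t • v) v 0 := by
      simpa using ((hasDerivAt_id (0 : ℝ)).smul_const v).const_add b
    rw [← fderiv_apply_eq_inner_gradient]
    exact h2.comp_hasDerivAt 0 h3
  have hd := hline hμ
  have hd' := hline hμ'
  have hc : 0 < ‖gradient μ b‖ := norm_pos_iff.2 h0
  have hc' : 0 < ‖gradient μ' b‖ := norm_pos_iff.2 h0'
  have e1 : inner ℝ (gradient μ b) v = -(‖gradient μ b‖ * inner ℝ v ν) := by
    conv_lhs => rw [h1]
    rw [inner_neg_left, inner_smul_left, real_inner_comm]; simp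
  have e2 : inner ℝ (gradient μ' b) v = -(‖gradient μ' b‖ * inner ℝ v ν') := by
    conv_lhs => rw [h1']
    rw [inner_neg_left, inner_smul_left, real_inner_comm]; simp
  have hpos : 0 < inner ℝ (gradient μ b) v := by rw [e1]; nlinarith
  have hlim : Tendsto (fun t : ℝ => b + t • v) (𝓝[>] 0) (𝓝 b) := by
    have : Continuous (fun t : ℝ => b + t • v) := by fun_prop
    have := (this.tendsto 0).mono_left (nhdsWithin_le_nhds (s := Set.Ioi (0 : ℝ)))
    simpa using this
  have hs := (hasDerivAt_iff_tendsto_slope.1 hd).mono_left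
    (nhdsWithin_mono (0 : ℝ) (show Set.Ioi (0 : ℝ) ⊆ {0}ᶜ from fun x hx => ne_of_gt hx))
  have hs' := (hasDerivAt_iff_tendsto_slope.1 hd').mono_left
    (nhdsWithin_mono (0 : ℝ) (show Set.Ioi (0 : ℝ) ⊆ {0}ᶜ from fun x hx => ne_of_gt hx))
  have hge : 0 ≤ inner ℝ (gradient μ' b) v := by
    refine ge_of_tendsto hs' ?_
    filter_upwards [hs.eventually (lt_mem_nhds hpos), hlim.eventually hev, hlim.eventually hev',
      self_mem_nhdsWithin] with t ht hM hM' ht0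
    have ht0' : (0 : ℝ) < t := ht0
    rw [slope_def_field] at ht ⊢
    simp only [zero_smul, add_zero, sub_zero, hb0, hb0'] at ht ⊢
    have : 0 < μ (b + t • v) := by
      by_contra hle
      push Not at hle
      exact absurd ht (not_lt.2 (div_nonpos_of_nonpos_of_nonneg hle ht0'.le))
    exact (div_pos (hM'.1 (hM.2 this)) ht0').le
  rw [e2] at hge
  nlinarith

/-- Two distinct unit normals are separated by `v = ν' - ν`, for which `⟨v, ν⟩ < 0 < ⟨v, ν'⟩`. -/
theorem IsOutwardNormal.unique {n : ℕ} {M : Set (Rn n)} {b ν ν' : Rn n}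
    (h : IsOutwardNormal M b ν) (h' : IsOutwardNormal M b ν') : ν = ν' := by
  have h1 := h.norm_eq_one
  have h1' := h'.norm_eq_one
  have hle := real_inner_le_norm ν ν'
  rw [h1, h1', one_mul] at hle
  rcases hle.lt_or_eq with hlt | heq
  · have h2 : inner ℝ (ν' - ν) ν < 0 := by
      rw [inner_sub_left, real_inner_self_eq_norm_sq, h1, real_inner_comm]; linarith
    have h3 := h.inner_nonpos h' h2
    rw [inner_sub_left, real_inner_self_eq_norm_sq, h1'] at h3
    linarith
  · exact (inner_eq_one_iff_of_norm_eq_one h1 h1').1 heq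

theorem IsOutwardNormal.outwardNormal_eq {n : ℕ} {M : Set (Rn n)} {b ν : Rn n}
    (h : IsOutwardNormal M b ν) : outwardNormal M b = ν := by
  have hex : ∃ ν, IsOutwardNormal M b ν := ⟨ν, h⟩
  rw [outwardNormal, dif_pos hex]
  exact hex.choose_spec.unique h

theorem norm_outwardNormal_le {n : ℕ} (M : Set (Rn n)) (b : Rn n) : ‖outwardNormal M b‖ ≤ 1 := by
  by_cases h : ∃ ν, IsOutwardNormal M b ν
  · obtain ⟨ν, h⟩ := h
    rw [h.outwardNormal_eq, h.norm_eq_one]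
  · rw [outwardNormal, dif_neg h]; simp

/-- One defining function serves all frontier points near `b`: it vanishes there and its gradient
stays nonzero. The normal is thus its normalized gradient, which is continuous. -/
theorem IsOutwardNormal.eventually {n : ℕ} {M : Set (Rn n)} (hM : IsOpen M) {b ν : Rn n}
    (h : IsOutwardNormal M b ν) :
    (∀ᶠ x in 𝓝[frontier M] b, ∃ ν', IsOutwardNormal M x ν') ∧
      ContinuousWithinAt (outwardNormal M) (frontier M) b := by
  obtain ⟨μ, hμ, hb0, h0, hev, h1⟩ := id h
  set νx : Rn n → Rn n := fun x => -(‖gradient μ x‖⁻¹ • gradient μ x) with hνx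
  have hgc : ContinuousAt (gradient μ) b :=
    (InnerProductSpace.toDual ℝ (Rn n)).symm.continuous.continuousAt.comp
      (hμ.continuousAt_fderiv one_ne_zero)
  have hνc : ContinuousAt νx b :=
    ((hgc.norm.inv₀ (norm_ne_zero_iff.2 h0)).smul hgc).neg
  have hall : ∀ᶠ x in 𝓝[frontier M] b, IsOutwardNormal M x (νx x) := by
    filter_upwards [self_mem_nhdsWithin, nhdsWithin_le_nhds hev.eventually_nhds,
      nhdsWithin_le_nhds (hμ.eventually (by simp)),
      nhdsWithin_le_nhds (hgc.eventually_ne h0)] with x hx hevx hμx hgx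
    rw [mem_frontier_iff_of_isOpen hM] at hx
    have hμ0 : μ x = 0 := by
      refine le_antisymm ?_ ?_
      · by_contra hlt
        push Not at hlt
        exact hx.2 (hevx.self_of_nhds.2 hlt)
      · by_contra hlt
        push Not at hlt
        have hneg : ∀ᶠ x' in 𝓝 x, x' ∉ M := by
          filter_upwards [hevx, hμx.continuousAt.eventually_lt continuousAt_const hlt] with x' h1 h2
          exact fun h3 => absurd (h1.1 h3) (not_lt.2 h2.le)
        exact (mem_closure_iff_frequently.1 hx.1) hneg
    refine ⟨μ, hμx, hμ0, hgx, hevx, ?_⟩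
    have : ‖gradient μ x‖ ≠ 0 := norm_ne_zero_iff.2 hgx
    simp only [hνx]
    rw [smul_neg, neg_neg, smul_smul, mul_inv_cancel₀ this, one_smul]
  refine ⟨hall.mono fun x hx => ⟨_, hx⟩, ?_⟩
  have hνb : νx b = ν := by
    have : ‖gradient μ b‖ ≠ 0 := norm_ne_zero_iff.2 h0
    simp only [hνx]
    conv_lhs => rw [h1]
    rw [norm_neg, norm_smul, norm_norm, h.norm_eq_one, mul_one, smul_neg, neg_neg, smul_smul,
      inv_mul_cancel₀ this, one_smul]
  refine ContinuousWithinAt.congr_of_eventuallyEq hνc.continuousWithinAt ?_ ?_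
  · filter_upwards [hall] with x hx using hx.outwardNormal_eq
  · rw [h.outwardNormal_eq, hνb]

/-- The edges and corners of the boundary. -/
def edges {n : ℕ} (M : Set (Rn n)) : Set (Rn n) :=
  {b ∈ frontier M | ¬ ∃ ν, IsOutwardNormal M b ν}

theorem isClosed_edges {n : ℕ} {M : Set (Rn n)} (hM : IsOpen M) : IsClosed (edges M) := by
  rw [← isOpen_compl_iff, isOpen_iff_mem_nhds]
  intro b hb
  by_cases hf : b ∈ frontier M
  · have hν : ∃ ν, IsOutwardNormal M b ν := by
      by_contra hno
      exact hb ⟨hf, hno⟩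
    obtain ⟨ν, hν⟩ := hν
    have := (hν.eventually hM).1
    rw [eventually_nhdsWithin_iff] at this
    filter_upwards [this] with x hx hxe
    exact hxe.2 (hx hxe.1)
  · filter_upwards [isClosed_frontier.isOpen_compl.mem_nhds hf] with x hx hxe
    exact hx hxe.1

theorem continuousOn_outwardNormal {n : ℕ} {M : Set (Rn n)} (hM : IsOpen M) :
    ContinuousOn (outwardNormal M) (frontier M \ edges M) := by
  intro b hb
  have hν : ∃ ν, IsOutwardNormal M b ν := by
    by_contra hno
    exact hb.2 ⟨hb.1, hno⟩
  obtain ⟨ν, hν⟩ := hν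
  exact (hν.eventually hM).2.mono Set.sdiff_subset

theorem aestronglyMeasurable_outwardNormal {n : ℕ} {M : Set (Rn n)}
    (hM : IsPiecewiseC1Domain M) :
    AEStronglyMeasurable (outwardNormal M)
      ((Measure.euclideanHausdorffMeasure (n - 1)).restrict (frontier M)) := by
  have h0 : Measure.euclideanHausdorffMeasure (n - 1) (edges M) = 0 := hM.area_edges
  have hae : (frontier M : Set (Rn n)) =ᵐ[Measure.euclideanHausdorffMeasure (n - 1)]
      (frontier M \ edges M : Set (Rn n)) :=
    (sdiff_null_ae_eq_self h0).symm
  rw [Measure.restrict_congr_set hae]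
  exact (continuousOn_outwardNormal hM.isOpen).aestronglyMeasurable
    (isClosed_frontier.measurableSet.diff (isClosed_edges hM.isOpen).measurableSet)


/-! ### The divergence theorem off the edges, by a partition of unity -/

section

variable {F : Type*} [NormedAddCommGroup F] [NormedSpace ℝ F]

theorem integrable_inner_outwardNormal_smul {n : ℕ} {M : Set (Rn n)} (hM : IsPiecewiseC1Domain M)
    {φ : Rn n → F} (hφ : Continuous φ) (v : Rn n) :
    IntegrableOn (fun x => (inner ℝ v (outwardNormal M x) : ℝ) • φ x) (frontier M)
      (Measure.euclideanHausdorffMeasure (n - 1)) := by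
  have hcpt : IsCompact (frontier M) :=
    Metric.isCompact_of_isClosed_isBounded isClosed_frontier
      (hM.isBounded.closure.subset frontier_subset_closure)
  have : IsFiniteMeasure ((Measure.euclideanHausdorffMeasure (n - 1)).restrict (frontier M)) :=
    ⟨by rw [Measure.restrict_apply_univ]; exact hM.area_lt_top⟩
  obtain ⟨C, hC⟩ := hcpt.exists_bound_of_continuousOn hφ.continuousOn
  refine Integrable.of_bound (C := ‖v‖ * C) ?_ ?_
  · exact ((aestronglyMeasurable_const.inner (aestronglyMeasurable_outwardNormal hM)).smul
      hφ.aestronglyMeasurable)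
  · filter_upwards [ae_restrict_mem isClosed_frontier.measurableSet] with x hx
    rw [norm_smul]
    refine mul_le_mul ?_ (hC x hx) (norm_nonneg _) (norm_nonneg _)
    refine (norm_inner_le_norm _ _).trans ?_
    exact mul_le_of_le_one_right (norm_nonneg _) (norm_outwardNormal_le M x)

variable [CompleteSpace F]

/-- At interior and exterior points both sides vanish; at a regular boundary point the fixed normal
is replaced by the varying one, using its continuity. The error is measured by the integral of `‖ψ‖`
over the frontier, and so adds up over a partition of unity. -/
theorem exists_approx_divergence {N : ℕ} {M : Set (Rn (N + 1))} (hM : IsPiecewiseC1Domain M)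
    {b : Rn (N + 1)} (hb : b ∉ edges M) {ε : ℝ} (hε : 0 < ε) :
    ∃ U : Set (Rn (N + 1)), IsOpen U ∧ b ∈ U ∧ ∀ ψ : Rn (N + 1) → F, ContDiff ℝ 1 ψ →
      HasCompactSupport ψ → tsupport ψ ⊆ U → ∀ v : Rn (N + 1),
      ‖(∫ x in M, fderiv ℝ ψ x v) - ∫ x in frontier M, (inner ℝ v (outwardNormal M x) : ℝ) • ψ x
          ∂(Measure.euclideanHausdorffMeasure N)‖ ≤
        ε * ‖v‖ * ∫ x in frontier M, ‖ψ x‖ ∂(Measure.euclideanHausdorffMeasure N) := by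
  have hnn : ∀ ψ : Rn (N + 1) → F, ∀ v : Rn (N + 1), 0 ≤ ε * ‖v‖ * ∫ x in frontier M, ‖ψ x‖
      ∂(Measure.euclideanHausdorffMeasure N) := fun ψ v => by
    have : 0 ≤ ∫ x in frontier M, ‖ψ x‖ ∂(Measure.euclideanHausdorffMeasure N) :=
      integral_nonneg fun x => norm_nonneg _
    positivity
  by_cases hbM : b ∈ M
  · refine ⟨M, hM.isOpen, hbM, fun ψ hψ hc hs v => ?_⟩
    have h1 : ∫ x in M, fderiv ℝ ψ x v = 0 := by
      rw [← integral_fderiv_apply_eq_zero volume hψ hc v]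
      refine setIntegral_eq_integral_of_forall_compl_eq_zero fun x hx => ?_
      rw [image_eq_zero_of_notMem_tsupport fun h => hx (hs (tsupport_fderiv_subset ℝ h))]; rfl
    have h2 : ∀ x ∈ frontier M, ψ x = 0 := fun x hx =>
      image_eq_zero_of_notMem_tsupport fun h =>
        ((mem_frontier_iff_of_isOpen hM.isOpen).1 hx).2 (hs h)
    rw [h1, setIntegral_congr_fun (g := fun _ => 0) isClosed_frontier.measurableSet
      (fun x hx => by simp [h2 x hx])]
    simpa using hnn ψ v
  by_cases hbf : b ∈ frontier M
  · have hν : ∃ ν, IsOutwardNormal M b ν := by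
      by_contra hno
      exact hb ⟨hbf, hno⟩
    obtain ⟨ν, hν⟩ := hν
    -- One error comes from the graph, `(1 + K)^N - 1 + K`, and a further `K` from the variation of
    -- the normal on the neighbourhood.
    have hKex : ∃ K : NNReal, 0 < K ∧ (1 + K : ℝ) ^ N - 1 + K + K ≤ ε := by
      have hcont : Tendsto (fun t : ℝ => (1 + t) ^ N - 1 + t + t) (𝓝[>] 0) (𝓝 0) := by
        have : Continuous (fun t : ℝ => (1 + t) ^ N - 1 + t + t) := by fun_prop
        have := (this.tendsto 0).mono_left (nhdsWithin_le_nhds (s := Set.Ioi (0 : ℝ)))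
        simpa using this
      obtain ⟨t, ht, ht0⟩ := ((hcont.eventually (gt_mem_nhds hε)).and self_mem_nhdsWithin).exists
      have ht0' : (0 : ℝ) < t := ht0
      exact ⟨⟨t, ht0'.le⟩, ht0', ht.le⟩
    obtain ⟨K, hK, hKε⟩ := hKex
    obtain ⟨U, hU, hbU, hUψ⟩ := hν.approx_divergence (F := F) hM.isOpen hM.area_lt_top hK
    have hcont := (hν.eventually hM.isOpen).2
    rw [ContinuousWithinAt, hν.outwardNormal_eq] at hcont
    have hev : ∀ᶠ x in 𝓝 b, x ∈ frontier M → dist (outwardNormal M x) ν < K := by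
      rw [← eventually_nhdsWithin_iff]
      exact hcont.eventually (Metric.ball_mem_nhds ν (by exact_mod_cast hK))
    obtain ⟨W, hW, hWo, hbW⟩ := eventually_nhds_iff.1 hev
    refine ⟨U ∩ W, hU.inter hWo, ⟨hbU, hbW⟩, fun ψ hψ hc hs v => ?_⟩
    have h1 := hUψ ψ hψ hc (hs.trans Set.inter_subset_left) v
    have hi := integrable_inner_outwardNormal_smul hM hψ.continuous v
    have : IsFiniteMeasure ((Measure.euclideanHausdorffMeasure N).restrict (frontier M)) :=
      ⟨by rw [Measure.restrict_apply_univ]; exact hM.area_lt_top⟩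
    have hi2 : Integrable ψ ((Measure.euclideanHausdorffMeasure N).restrict (frontier M)) :=
      hψ.continuous.integrable_of_hasCompactSupport hc
    have h2 : ‖(inner ℝ v ν : ℝ) • (∫ x in frontier M, ψ x ∂(Measure.euclideanHausdorffMeasure N)) -
        ∫ x in frontier M, (inner ℝ v (outwardNormal M x) : ℝ) • ψ x
          ∂(Measure.euclideanHausdorffMeasure N)‖ ≤ K * ‖v‖ *
        ∫ x in frontier M, ‖ψ x‖ ∂(Measure.euclideanHausdorffMeasure N) := by
      have hi2' : Integrable (fun x => (inner ℝ v ν : ℝ) • ψ x)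
          ((Measure.euclideanHausdorffMeasure N).restrict (frontier M)) := hi2.smul _
      rw [← integral_smul, ← integral_sub hi2' hi, ← integral_const_mul]
      refine norm_integral_le_of_norm_le (hi2.norm.const_mul _) ?_
      filter_upwards [ae_restrict_mem isClosed_frontier.measurableSet] with x hx
      rw [← sub_smul, ← inner_sub_right, norm_smul]
      by_cases hxW : x ∈ W
      · refine mul_le_mul_of_nonneg_right ?_ (norm_nonneg _)
        refine (norm_inner_le_norm _ _).trans ?_
        have := hW x hxW hx
        rw [dist_comm, dist_eq_norm] at this
        rw [mul_comm]
        exact mul_le_mul_of_nonneg_right this.le (norm_nonneg _)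
      · have : ψ x = 0 := image_eq_zero_of_notMem_tsupport fun h => hxW (hs h).2
        simp [this]
    have h3 := norm_sub_le_norm_sub_add_norm_sub (∫ x in M, fderiv ℝ ψ x v)
      ((inner ℝ v ν : ℝ) • (∫ x in frontier M, ψ x ∂(Measure.euclideanHausdorffMeasure N)))
      (∫ x in frontier M, (inner ℝ v (outwardNormal M x) : ℝ) • ψ x
          ∂(Measure.euclideanHausdorffMeasure N))
    refine h3.trans ((add_le_add h1 h2).trans ?_)
    rw [← add_mul, ← add_mul]
    refine mul_le_mul_of_nonneg_right ?_ (integral_nonneg fun x => norm_nonneg _)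
    exact mul_le_mul_of_nonneg_right hKε (norm_nonneg _)
  · have hbc : b ∉ closure M := fun h => hbf ((mem_frontier_iff_of_isOpen hM.isOpen).2 ⟨h, hbM⟩)
    refine ⟨(closure M)ᶜ, isClosed_closure.isOpen_compl, hbc, fun ψ hψ hc hs v => ?_⟩
    have h1 : ∀ x ∈ M, fderiv ℝ ψ x v = 0 := fun x hx => by
      rw [image_eq_zero_of_notMem_tsupport fun h =>
        hs (tsupport_fderiv_subset ℝ h) (subset_closure hx)]; rfl
    have h2 : ∀ x ∈ frontier M, ψ x = 0 := fun x hx =>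
      image_eq_zero_of_notMem_tsupport fun h => hs h (frontier_subset_closure hx)
    rw [setIntegral_congr_fun (g := fun _ => 0) hM.isOpen.measurableSet h1,
      setIntegral_congr_fun (g := fun _ => 0) isClosed_frontier.measurableSet
      (fun x hx => by simp [h2 x hx])]
    simpa using hnn ψ v

/-- The divergence theorem for functions supported off the edges. -/
theorem divergence_off_edges {N : ℕ} {M : Set (Rn (N + 1))} (hM : IsPiecewiseC1Domain M)
    {φ : Rn (N + 1) → F} (hφ : ContDiff ℝ 1 φ) (hc : HasCompactSupport φ)
    (hd : Disjoint (tsupport φ) (edges M)) (v : Rn (N + 1)) :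
    ∫ x in M, fderiv ℝ φ x v = ∫ x in frontier M, (inner ℝ v (outwardNormal M x) : ℝ) • φ x
          ∂(Measure.euclideanHausdorffMeasure N) := by
  set H := (Measure.euclideanHausdorffMeasure N : Measure (Rn (N + 1))) with hH
  have hfinm : IsFiniteMeasure (H.restrict (frontier M)) :=
      ⟨by rw [Measure.restrict_apply_univ]; exact hM.area_lt_top⟩
  rw [← sub_eq_zero, ← norm_le_zero_iff]
  have key : ∀ ε : ℝ, 0 < ε → ‖(∫ x in M, fderiv ℝ φ x v) -
      ∫ x in frontier M, (inner ℝ v (outwardNormal M x) : ℝ) • φ x ∂H‖ ≤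
      ε * (‖v‖ * ∫ x in frontier M, ‖φ x‖ ∂H) := by
    intro ε hε
    have hex : ∀ x : tsupport φ, ∃ U : Set (Rn (N + 1)), IsOpen U ∧ (x : Rn (N + 1)) ∈ U ∧
      ∀ ψ : Rn (N + 1) → F, ContDiff ℝ 1 ψ →
      HasCompactSupport ψ → tsupport ψ ⊆ U → ∀ v : Rn (N + 1),
      ‖(∫ x in M, fderiv ℝ ψ x v) - ∫ x in frontier M, (inner ℝ v (outwardNormal M x) : ℝ) • ψ x
          ∂(Measure.euclideanHausdorffMeasure N)‖ ≤
        ε * ‖v‖ * ∫ x in frontier M, ‖ψ x‖ ∂(Measure.euclideanHausdorffMeasure N) := fun x =>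
      exists_approx_divergence hM (Set.disjoint_left.1 hd x.2) hε
    choose U hUo hxU hU using hex
    obtain ⟨t, ht⟩ := IsCompact.elim_finite_subcover hc U hUo
      (fun x hx => Set.mem_iUnion.2 ⟨⟨x, hx⟩, hxU ⟨x, hx⟩⟩)
    obtain ⟨ρ, hρ⟩ := SmoothPartitionOfUnity.exists_isSubordinate
      (modelWithCornersSelf ℝ (Rn (N + 1))) (isClosed_tsupport φ)
      (fun i : t => U i) (fun i => hUo i) (by
        intro x hx
        obtain ⟨i, hi, hxi⟩ := Set.mem_iUnion₂.1 (ht hx)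
        exact Set.mem_iUnion.2 ⟨⟨i, hi⟩, hxi⟩)
    have hsum : ∀ x, ∑ i : t, ρ i x • φ x = φ x := by
      intro x
      by_cases hx : x ∈ tsupport φ
      · rw [← Finset.sum_smul]
        have := ρ.sum_eq_one hx
        rw [finsum_eq_sum_of_fintype] at this
        rw [this, one_smul]
      · rw [image_eq_zero_of_notMem_tsupport hx]; simp
    have hρc : ∀ i, ContDiff ℝ 1 (fun x => ρ i x • φ x) := fun i =>
      (((ρ i).contMDiff.contDiff).of_le (by exact_mod_cast le_top)).smul hφ
    have hρs : ∀ i, HasCompactSupport (fun x => ρ i x • φ x) := fun i => hc.smul_left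
    have hρt : ∀ i : t, tsupport (fun x => ρ i x • φ x) ⊆ U i := fun i =>
      (tsupport_smul_subset_left (ρ i) φ).trans (hρ i)
    have hest := fun i : t => hU i _ (hρc i) (hρs i) (hρt i) v
    have hL : ∫ x in M, fderiv ℝ φ x v = ∑ i : t, ∫ x in M, fderiv ℝ (fun x => ρ i x • φ x) x v := by
      rw [← integral_finsetSum]
      · congr 1
        funext x
        have h1 : φ = fun x => ∑ i : t, ρ i x • φ x := funext fun x => (hsum x).symm
        conv_lhs => rw [h1]
        rw [fderiv_fun_sum fun i _ => (hρc i).differentiable one_ne_zero x]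
        simp
      · intro i _
        exact ((((hρc i).continuous_fderiv one_ne_zero).clm_apply
          continuous_const).integrable_of_hasCompactSupport ((hρs i).fderiv_apply ℝ v)).integrableOn
    have hR : ∫ x in frontier M, (inner ℝ v (outwardNormal M x) : ℝ) • φ x ∂H =
        ∑ i : t, ∫ x in frontier M, (inner ℝ v (outwardNormal M x) : ℝ) • (ρ i x • φ x) ∂H := by
      rw [← integral_finsetSum]
      · congr 1
        funext x
        rw [← Finset.smul_sum, hsum]
      · intro i _
        exact integrable_inner_outwardNormal_smul hM (hρc i).continuous v
    -- The partition functions are nonnegative with sum one on the support, so the norms add up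
    -- exactly and the total error does not depend on the number of pieces.
    have hN : ∫ x in frontier M, ‖φ x‖ ∂H = ∑ i : t, ∫ x in frontier M, ‖ρ i x • φ x‖ ∂H := by
      rw [← integral_finsetSum]
      · congr 1
        funext x
        have h1 : ∀ i : t, ‖ρ i x • φ x‖ = ρ i x * ‖φ x‖ := fun i => by
          rw [norm_smul, Real.norm_of_nonneg (ρ.nonneg i x)]
        simp_rw [h1]
        rw [← Finset.sum_mul]
        by_cases hx : x ∈ tsupport φ
        · have := ρ.sum_eq_one hx
          rw [finsum_eq_sum_of_fintype] at this
          rw [this, one_mul]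
        · rw [image_eq_zero_of_notMem_tsupport hx]; simp
      · intro i _
        exact ((hρc i).continuous.integrable_of_hasCompactSupport (hρs i)).norm
    rw [hL, hR, hN, ← Finset.sum_sub_distrib, Finset.mul_sum, Finset.mul_sum]
    refine (norm_sum_le _ _).trans (Finset.sum_le_sum fun i _ => ?_)
    rw [← mul_assoc]
    exact hest i
  have hlim : Tendsto (fun ε : ℝ => ε * (‖v‖ * ∫ x in frontier M, ‖φ x‖ ∂H)) (𝓝[>] 0) (𝓝 0) := by
    have : Continuous (fun ε : ℝ => ε * (‖v‖ * ∫ x in frontier M, ‖φ x‖ ∂H)) := by fun_prop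
    have := (this.tendsto 0).mono_left (nhdsWithin_le_nhds (s := Set.Ioi (0 : ℝ)))
    simpa using this
  refine ge_of_tendsto hlim ?_
  filter_upwards [self_mem_nhdsWithin] with ε hε using key ε hε

end


/-! ### Cutting off a set of area zero -/

/-- Hausdorff measure zero gives countable covers with small `∑ diam^N`. The covering sets need not
be open, so those meeting `K` are enlarged to balls centred in `K`, and compactness leaves finitely
many. The case `N = 0` is excluded because the enlargement must stay small after taking the power
`N`. -/
theorem exists_finite_cover {N : ℕ} (hN : N ≠ 0) {X : Type*} [MetricSpace X] [Nonempty X]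
    [MeasurableSpace X] [BorelSpace X] {K : Set X} (hK : IsCompact K)
    (h0 : Measure.hausdorffMeasure (N : ℝ) K = 0) {ε : ℝ} (hε : 0 < ε) :
    ∃ (s : Finset ℕ) (c : ℕ → X) (r : ℕ → ℝ), (∀ j ∈ s, c j ∈ K ∧ 0 < r j ∧ r j ≤ ε) ∧
      K ⊆ ⋃ j ∈ s, Metric.ball (c j) (r j) ∧ ∑ j ∈ s, r j ^ N ≤ ε := by
  obtain ⟨η, hη, hη1, hηε, hηN⟩ : ∃ η : ℝ, 0 < η ∧ η ≤ 1 ∧ 2 * η ≤ ε ∧ 2 ^ N * (3 * η) ≤ ε := by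
    refine ⟨min 1 (min (ε / 2) (ε / (2 ^ N * 3))), by positivity, min_le_left _ _, ?_, ?_⟩
    · have := (min_le_right 1 (min (ε / 2) (ε / (2 ^ N * 3)))).trans (min_le_left _ _)
      linarith
    · have := (min_le_right 1 (min (ε / 2) (ε / (2 ^ N * 3)))).trans (min_le_right _ _)
      rw [le_div_iff₀ (by positivity)] at this
      linarith
  rw [Measure.hausdorffMeasure_apply] at h0
  have h1 := (iSup₂_eq_bot.1 (by rw [h0]; rfl)) (ENNReal.ofReal η) (by simpa using hη)
  have h2 : (⨅ (t : ℕ → Set X) (_ : K ⊆ ⋃ n, t n) (_ : ∀ n, Metric.ediam (t n) ≤ ENNReal.ofReal η),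
      ∑' n, ⨆ _ : (t n).Nonempty, Metric.ediam (t n) ^ (N : ℝ)) < ENNReal.ofReal η := by
    rw [h1]; simpa using hη
  simp only [iInf_lt_iff] at h2
  obtain ⟨t, htK, htd, hsum⟩ := h2
  have hc : ∀ j, ∃ x, (t j ∩ K).Nonempty → x ∈ t j ∩ K := fun j => by
    by_cases h : (t j ∩ K).Nonempty
    · exact ⟨h.some, fun _ => h.some_mem⟩
    · exact ⟨Classical.arbitrary X, fun h' => absurd h' h⟩
  choose c hc using hc
  set d : ℕ → ℝ := fun j => Metric.diam (t j) with hd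
  -- The summand `η / 2^j` makes the radius positive even for one-point sets, and its sum over `j`
  -- is at most `2 η`.
  set r : ℕ → ℝ := fun j => d j + η * (1 / 2) ^ j with hr
  have hdj : ∀ j, d j ≤ η := fun j => by
    have := ENNReal.toReal_mono ENNReal.ofReal_ne_top (htd j)
    rwa [ENNReal.toReal_ofReal hη.le] at this
  have hpow : ∀ j : ℕ, 0 < (1 / 2 : ℝ) ^ j ∧ (1 / 2 : ℝ) ^ j ≤ 1 := fun j =>
    ⟨by positivity, pow_le_one₀ (by norm_num) (by norm_num)⟩
  have hd0 : ∀ j, 0 ≤ d j := fun j => Metric.diam_nonneg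
  have hr0 : ∀ j, 0 < r j := fun j => by
    have := hd0 j
    have := mul_pos hη (hpow j).1
    simp only [hr]; linarith
  have hrε : ∀ j, r j ≤ ε := fun j => by
    have h1 := hdj j
    have h2 : η * (1 / 2) ^ j ≤ η := mul_le_of_le_one_right hη.le (hpow j).2
    simp only [hr]; linarith
  have hcov : K ⊆ ⋃ j : {j : ℕ // (t j ∩ K).Nonempty}, Metric.ball (c j) (r j) := by
    intro x hx
    obtain ⟨j, hj⟩ := Set.mem_iUnion.1 (htK hx)
    have hne : (t j ∩ K).Nonempty := ⟨x, hj, hx⟩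
    refine Set.mem_iUnion.2 ⟨⟨j, hne⟩, ?_⟩
    have hbd : Bornology.IsBounded (t j) := by
      rw [Metric.isBounded_iff_ediam_ne_top]
      exact ((htd j).trans_lt ENNReal.ofReal_lt_top).ne
    have : dist x (c j) ≤ d j := Metric.dist_le_diam_of_mem hbd hj (hc j hne).1
    rw [Metric.mem_ball]
    have := mul_pos hη (hpow j).1
    simp only [hr]; linarith
  obtain ⟨s, hs⟩ := hK.elim_finite_subcover _ (fun j => Metric.isOpen_ball) hcov
  classical
  refine ⟨s.image Subtype.val, c, r, ?_, ?_, ?_⟩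
  · intro j hj
    obtain ⟨i, hi, rfl⟩ := Finset.mem_image.1 hj
    exact ⟨(hc _ i.2).2, hr0 _, hrε _⟩
  · intro x hx
    obtain ⟨i, hi, hxi⟩ := Set.mem_iUnion₂.1 (hs hx)
    exact Set.mem_iUnion₂.2 ⟨i, Finset.mem_image.2 ⟨i, hi, rfl⟩, hxi⟩
  · have hterm : ∀ j ∈ s.image Subtype.val, ENNReal.ofReal (d j ^ N) ≤
        ⨆ _ : (t j).Nonempty, Metric.ediam (t j) ^ (N : ℝ) := by
      intro j hj
      obtain ⟨i, hi, rfl⟩ := Finset.mem_image.1 hj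
      have hne : (t i).Nonempty := i.2.mono Set.inter_subset_left
      rw [iSup_pos hne, ENNReal.rpow_natCast, ENNReal.ofReal_pow (hd0 _)]
      refine pow_le_pow_left₀ (zero_le) ?_ N
      exact ENNReal.ofReal_toReal_le
    have hsd : ∑ j ∈ s.image Subtype.val, d j ^ N ≤ η := by
      have h3 : ENNReal.ofReal (∑ j ∈ s.image Subtype.val, d j ^ N) ≤ ENNReal.ofReal η := by
        rw [ENNReal.ofReal_sum_of_nonneg fun j _ => pow_nonneg (hd0 j) N]
        exact ((Finset.sum_le_sum hterm).trans (ENNReal.sum_le_tsum _)).trans hsum.le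
      exact (ENNReal.ofReal_le_ofReal_iff hη.le).1 h3
    have hgeo : ∑ j ∈ s.image Subtype.val, (1 / 2 : ℝ) ^ j ≤ 2 := by
      exact (summable_geometric_two.sum_le_tsum _ fun j _ => (hpow j).1.le).trans_eq
        tsum_geometric_two
    have hle : ∀ j, r j ^ N ≤ 2 ^ N * (d j ^ N + η * (1 / 2) ^ j) := by
      intro j
      have hb1 : η * (1 / 2) ^ j ≤ 1 :=
        (mul_le_of_le_one_right hη.le (hpow j).2).trans hη1
      have hb0 : 0 ≤ η * (1 / 2) ^ j := (mul_pos hη (hpow j).1).le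
      have h1 : r j ≤ 2 * max (d j) (η * (1 / 2) ^ j) := by
        have := le_max_left (d j) (η * (1 / 2) ^ j)
        have := le_max_right (d j) (η * (1 / 2) ^ j)
        simp only [hr]; linarith
      calc r j ^ N ≤ (2 * max (d j) (η * (1 / 2) ^ j)) ^ N := pow_le_pow_left₀ (hr0 j).le h1 N
        _ = 2 ^ N * (max (d j) (η * (1 / 2) ^ j)) ^ N := mul_pow _ _ _
        _ ≤ 2 ^ N * (d j ^ N + η * (1 / 2) ^ j) := by
          refine mul_le_mul_of_nonneg_left ?_ (by positivity)
          have h2 : (η * (1 / 2) ^ j) ^ N ≤ η * (1 / 2) ^ j := pow_le_of_le_one hb0 hb1 hN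
          rcases max_cases (d j) (η * (1 / 2) ^ j) with ⟨h, -⟩ | ⟨h, -⟩
          · rw [h]; linarith
          · rw [h]; have := pow_nonneg (hd0 j) N; linarith
    calc ∑ j ∈ s.image Subtype.val, r j ^ N
        ≤ ∑ j ∈ s.image Subtype.val, 2 ^ N * (d j ^ N + η * (1 / 2) ^ j) :=
          Finset.sum_le_sum fun j _ => hle j
      _ = 2 ^ N * (∑ j ∈ s.image Subtype.val, d j ^ N +
            η * ∑ j ∈ s.image Subtype.val, (1 / 2 : ℝ) ^ j) := by
          rw [← Finset.mul_sum, Finset.sum_add_distrib, Finset.mul_sum]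
      _ ≤ 2 ^ N * (3 * η) := by
          refine mul_le_mul_of_nonneg_left ?_ (by positivity)
          nlinarith
      _ ≤ ε := hηN

/-- Scaling: the gradient of a bump of radius `r` has size `1/r` on a volume of order `r^(N+1)`. -/
theorem exists_bump_gradient (N : ℕ) : ∃ C : ℝ, 0 ≤ C ∧ ∀ (c : Rn (N + 1)) (r : ℝ), 0 < r →
    ∃ χ : Rn (N + 1) → ℝ, ContDiff ℝ ∞ χ ∧ HasCompactSupport χ ∧ (∀ x, 0 ≤ χ x ∧ χ x ≤ 1) ∧
      (∀ x ∈ Metric.ball c r, χ x = 1) ∧ (∀ x, 2 * r ≤ dist x c → χ x = 0) ∧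
      ∫ x, ‖fderiv ℝ χ x‖ ≤ C * r ^ N := by
  let f : ContDiffBump (0 : Rn (N + 1)) := ⟨1, 2, one_pos, one_lt_two⟩
  have hf : ContDiff ℝ ∞ f := f.contDiff
  refine ⟨∫ x, ‖fderiv ℝ f x‖, integral_nonneg fun x => norm_nonneg _, fun c r hr => ?_⟩
  have hdist : ∀ x, ‖r⁻¹ • (x - c)‖ = r⁻¹ * dist x c := fun x => by
    rw [norm_smul, dist_eq_norm, Real.norm_of_nonneg (by positivity)]
  refine ⟨fun x => f (r⁻¹ • (x - c)), ?_, ?_, ?_, ?_, ?_, ?_⟩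
  · exact hf.comp (by fun_prop)
  · refine HasCompactSupport.intro (isCompact_closedBall c (2 * r)) fun x hx => ?_
    rw [Metric.mem_closedBall, not_le] at hx
    refine f.zero_of_le_dist ?_
    rw [dist_zero_right, hdist, inv_mul_eq_div, le_div_iff₀ hr]
    exact hx.le
  · exact fun x => ⟨f.nonneg, f.le_one⟩
  · intro x hx
    refine f.one_of_mem_closedBall ?_
    rw [mem_closedBall_zero_iff, hdist, inv_mul_eq_div, div_le_iff₀ hr, one_mul]
    exact (Metric.mem_ball.1 hx).le
  · intro x hx
    refine f.zero_of_le_dist ?_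
    rw [dist_zero_right, hdist, inv_mul_eq_div, le_div_iff₀ hr]
    exact hx
  · have hfd : ∀ x, fderiv ℝ (fun x => f (r⁻¹ • (x - c))) x =
        r⁻¹ • fderiv ℝ f (r⁻¹ • (x - c)) := by
      intro x
      have h1 : HasFDerivAt (fun x : Rn (N + 1) => r⁻¹ • (x - c))
          (r⁻¹ • ContinuousLinearMap.id ℝ (Rn (N + 1))) x :=
        ((hasFDerivAt_id x).sub_const c).const_smul r⁻¹
      have h2 := (hf.differentiable (by simp) (r⁻¹ • (x - c))).hasFDerivAt.comp x h1
      have h3 : fderiv ℝ (fun x => f (r⁻¹ • (x - c))) x = _ := h2.fderiv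
      rw [h3]; ext v; simp
    simp_rw [hfd, norm_smul]
    rw [integral_const_mul]
    have h4 := integral_sub_right_eq_self (μ := (volume : Measure (Rn (N + 1))))
      (fun x => ‖fderiv ℝ f (r⁻¹ • x)‖) c
    rw [h4, Measure.integral_comp_smul volume (fun x => ‖fderiv ℝ f x‖)]
    rw [finrank_euclideanSpace, Fintype.card_fin, smul_eq_mul, Real.norm_of_nonneg (by positivity),
      abs_of_nonneg (by positivity)]
    apply le_of_eq
    rw [inv_pow, inv_inv, pow_succ]
    field_simp

/-- The cutoff is the product of `1 - χⱼ` over bumps on the balls of a finite cover. All factors lie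
in `[0, 1]`, so its gradient is dominated by the sum of the gradients of the bumps, whose integrals
are of order `∑ rⱼ^N`. -/
theorem exists_cutoff_of_hausdorff_zero {N : ℕ} (hN : N ≠ 0) {K : Set (Rn (N + 1))}
    (hK : IsCompact K) (h0 : Measure.euclideanHausdorffMeasure N K = 0) {ε : ℝ} (hε : 0 < ε) :
    ∃ θ : Rn (N + 1) → ℝ, ContDiff ℝ ∞ θ ∧ (∀ x, 0 ≤ θ x ∧ θ x ≤ 1) ∧
      (∀ᶠ x in 𝓝ˢ K, θ x = 0) ∧ (∀ x, (∀ y ∈ K, ε < dist x y) → θ x = 1) ∧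
      Integrable (fun x => ‖fderiv ℝ θ x‖) ∧ ∫ x, ‖fderiv ℝ θ x‖ ≤ ε := by
  have h0' : Measure.hausdorffMeasure (N : ℝ) K = 0 := by
    rw [Measure.euclideanHausdorffMeasure_def, Measure.smul_apply, ENNReal.smul_def, smul_eq_mul,
      mul_eq_zero] at h0
    refine h0.resolve_left ?_
    exact_mod_cast Measure.addHaarScalarFactor_volume_hausdorffMeasure_ne_zero N
  obtain ⟨C, hC, hbump⟩ := exists_bump_gradient N
  obtain ⟨η, hη, hη2, hηC⟩ : ∃ η : ℝ, 0 < η ∧ 2 * η ≤ ε ∧ C * η ≤ ε := by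
    refine ⟨min (ε / 2) (ε / (C + 1)), by positivity, ?_, ?_⟩
    · have := min_le_left (ε / 2) (ε / (C + 1)); linarith
    · have := min_le_right (ε / 2) (ε / (C + 1))
      rw [le_div_iff₀ (by positivity)] at this
      have h2 : 0 ≤ min (ε / 2) (ε / (C + 1)) := by positivity
      nlinarith
  obtain ⟨s, c, r, hs, hcov, hsum⟩ := exists_finite_cover hN hK h0' hη
  have hr : ∀ j, ∃ χ : Rn (N + 1) → ℝ, j ∈ s → ContDiff ℝ ∞ χ ∧ HasCompactSupport χ ∧
      (∀ x, 0 ≤ χ x ∧ χ x ≤ 1) ∧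
      (∀ x ∈ Metric.ball (c j) (r j), χ x = 1) ∧ (∀ x, 2 * r j ≤ dist x (c j) → χ x = 0) ∧
      ∫ x, ‖fderiv ℝ χ x‖ ≤ C * r j ^ N := fun j => by
    by_cases hj : j ∈ s
    · obtain ⟨χ, hχ⟩ := hbump (c j) (r j) (hs j hj).2.1
      exact ⟨χ, fun _ => hχ⟩
    · exact ⟨0, fun h => absurd h hj⟩
  choose χ hχ using hr
  have hprod : ∀ s' ⊆ s, ContDiff ℝ ∞ (fun x => ∏ j ∈ s', (1 - χ j x)) ∧
      (∀ x, 0 ≤ ∏ j ∈ s', (1 - χ j x) ∧ ∏ j ∈ s', (1 - χ j x) ≤ 1) ∧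
      ∀ x, ‖fderiv ℝ (fun x => ∏ j ∈ s', (1 - χ j x)) x‖ ≤ ∑ j ∈ s', ‖fderiv ℝ (χ j) x‖ := by
    intro s'
    induction s' using Finset.induction_on with
    | empty => intro _; simpa using contDiff_const
    | insert a s' ha ih =>
      intro hsub
      obtain ⟨i1, i2, i3⟩ := ih ((Finset.subset_insert a s').trans hsub)
      obtain ⟨a1, -, a2, -, -, -⟩ := hχ a (hsub (Finset.mem_insert_self a s'))
      simp only [Finset.prod_insert ha, Finset.sum_insert ha]
      refine ⟨(contDiff_const.sub a1).mul i1, fun x => ⟨?_, ?_⟩, fun x => ?_⟩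
      · exact mul_nonneg (sub_nonneg.2 (a2 x).2) (i2 x).1
      · exact mul_le_one₀ (by linarith [(a2 x).1]) (i2 x).1 (i2 x).2
      · have d1 : DifferentiableAt ℝ (fun x => 1 - χ a x) x :=
          (contDiff_const.sub a1).differentiable (by simp) x
        have d2 : DifferentiableAt ℝ (fun x => ∏ j ∈ s', (1 - χ j x)) x :=
          i1.differentiable (by simp) x
        rw [fderiv_fun_mul d1 d2]
        refine (norm_add_le _ _).trans ?_
        rw [norm_smul, norm_smul, fderiv_const_sub, norm_neg, add_comm]
        refine add_le_add ?_ ?_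
        · refine mul_le_of_le_one_left (norm_nonneg _) ?_
          rw [Real.norm_of_nonneg (i2 x).1]; exact (i2 x).2
        · refine (mul_le_of_le_one_left (norm_nonneg _) ?_).trans (i3 x)
          rw [Real.norm_of_nonneg (by linarith [(a2 x).2])]; linarith [(a2 x).1]
  obtain ⟨p1, p2, p3⟩ := hprod s subset_rfl
  have hint : ∀ j ∈ s, Integrable (fun x => ‖fderiv ℝ (χ j) x‖) := fun j hj =>
    (((hχ j hj).1.continuous_fderiv (by simp)).integrable_of_hasCompactSupport
      ((hχ j hj).2.1.fderiv ℝ)).norm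
  refine ⟨_, p1, p2, ?_, ?_, ?_, ?_⟩
  · have : (⋃ j ∈ s, Metric.ball (c j) (r j)) ∈ 𝓝ˢ K :=
      (isOpen_biUnion fun j _ => Metric.isOpen_ball).mem_nhdsSet.2 hcov
    filter_upwards [this] with x hx
    obtain ⟨j, hj, hxj⟩ := Set.mem_iUnion₂.1 hx
    exact Finset.prod_eq_zero hj (by rw [(hχ j hj).2.2.2.1 x hxj, sub_self])
  · intro x hx
    refine Finset.prod_eq_one fun j hj => ?_
    rw [(hχ j hj).2.2.2.2.1 x, sub_zero]
    have h1 := hx (c j) (hs j hj).1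
    have h2 := (hs j hj).2.2
    linarith
  · refine (integrable_finsetSum s hint).mono' ?_ (Eventually.of_forall fun x => ?_)
    · exact (p1.continuous_fderiv (by simp)).norm.aestronglyMeasurable
    · rw [norm_norm]; exact p3 x
  · calc _ ≤ ∫ x, ∑ j ∈ s, ‖fderiv ℝ (χ j) x‖ :=
        integral_mono_of_nonneg (Eventually.of_forall fun x => norm_nonneg _)
          (integrable_finsetSum s hint) (Eventually.of_forall p3)
      _ = ∑ j ∈ s, ∫ x, ‖fderiv ℝ (χ j) x‖ := integral_finsetSum s hint
      _ ≤ ∑ j ∈ s, C * r j ^ N := Finset.sum_le_sum fun j hj => (hχ j hj).2.2.2.2.2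
      _ ≤ C * η := by rw [← Finset.mul_sum]; exact mul_le_mul_of_nonneg_left hsum hC
      _ ≤ ε := hηC

/-! ### The divergence theorem up to the edges -/

section

variable {F : Type*} [NormedAddCommGroup F] [NormedSpace ℝ F] [CompleteSpace F]

/-- The theorem off the edges is applied to `θₘ φ`, with cutoffs `θₘ` that vanish near the edges.
The term containing the gradient of `θₘ` is at most a constant times `1/(m+1)`; in the others `θₘ →
1` almost everywhere, for volume and for area. -/
theorem divergence_of_hasCompactSupport {N : ℕ} (hN : N ≠ 0) {M : Set (Rn (N + 1))}
    (hM : IsPiecewiseC1Domain M) {φ : Rn (N + 1) → F} (hφ : ContDiff ℝ 1 φ)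
    (hc : HasCompactSupport φ) (v : Rn (N + 1)) :
    ∫ x in M, fderiv ℝ φ x v = ∫ x in frontier M, (inner ℝ v (outwardNormal M x) : ℝ) • φ x
          ∂(Measure.euclideanHausdorffMeasure N) := by
  set H := (Measure.euclideanHausdorffMeasure N : Measure (Rn (N + 1))) with hH
  have hE : IsCompact (edges M) := by
    refine Metric.isCompact_of_isClosed_isBounded (isClosed_edges hM.isOpen)
      (hM.isBounded.closure.subset ?_)
    exact fun x hx => frontier_subset_closure hx.1
  have hE0 : H (edges M) = 0 := hM.area_edges
  -- A set of finite measure in dimension `N` is null in dimension `N + 1`.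
  have hEv : (volume : Measure (Rn (N + 1))) (edges M) = 0 := by
    rw [← EuclideanSpace.euclideanHausdorffMeasure_eq_volume]
    refine (Measure.euclideanHausdorffMeasure_zero_or_top (Nat.lt_succ_self N)
      (edges M)).resolve_right ?_
    rw [show Measure.euclideanHausdorffMeasure N (edges M) = 0 from hE0]
    simp
  have hδ : ∀ m : ℕ, (0 : ℝ) < 1 / (m + 1) := fun m => by positivity
  choose θ hθ1 hθ2 hθ3 hθ4 hθ5 hθ6 using fun m => exists_cutoff_of_hausdorff_zero hN hE hE0 (hδ m)
  have hpt : ∀ x ∉ edges M, ∀ᶠ m in atTop, θ m x = 1 := by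
    intro x hx
    obtain ⟨δ, hδ0, hδ1⟩ := Metric.isOpen_iff.1 hE.isClosed.isOpen_compl x hx
    filter_upwards [tendsto_one_div_add_atTop_nhds_zero_nat.eventually (gt_mem_nhds hδ0)] with m hm
    refine hθ4 m x fun y hy => ?_
    by_contra hle
    push Not at hle
    exact hδ1 (show y ∈ Metric.ball x δ by rw [Metric.mem_ball']; linarith) hy
  have hprodc : ∀ m, ContDiff ℝ 1 (fun x => θ m x • φ x) := fun m =>
    ((hθ1 m).of_le (by exact_mod_cast le_top)).smul hφ
  have hprods : ∀ m, HasCompactSupport (fun x => θ m x • φ x) := fun m => hc.smul_left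
  have hdisj : ∀ m, Disjoint (tsupport (fun x => θ m x • φ x)) (edges M) := by
    intro m
    rw [Set.disjoint_right]
    intro x hx
    have := (eventually_nhdsSet_iff_forall.1 (hθ3 m)) x hx
    rw [notMem_tsupport_iff_eventuallyEq]
    filter_upwards [this] with y hy
    simp [hy]
  have heq := fun m => divergence_off_edges hM (hprodc m) (hprods m) (hdisj m) v
  obtain ⟨B, hB⟩ := hφ.continuous.bounded_above_of_compact_support hc
  have hB0 : 0 ≤ B := (norm_nonneg _).trans (hB 0)
  have hdi : Integrable (fun x => fderiv ℝ φ x v) :=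
    ((hφ.continuous_fderiv one_ne_zero).clm_apply continuous_const).integrable_of_hasCompactSupport
      (hc.fderiv_apply ℝ v)
  have hsplit : ∀ m, ∫ x in M, fderiv ℝ (fun x => θ m x • φ x) x v =
      (∫ x in M, θ m x • fderiv ℝ φ x v) + ∫ x in M, fderiv ℝ (θ m) x v • φ x := by
    intro m
    rw [← integral_add]
    · congr 1
      funext x
      rw [fderiv_fun_smul ((hθ1 m).differentiable (by simp) x) (hφ.differentiable one_ne_zero x)]
      simp
    · refine (hdi.mono ?_ (Eventually.of_forall fun x => ?_)).integrableOn
      · exact ((hθ1 m).continuous.smul ((hφ.continuous_fderiv one_ne_zero).clm_apply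
          continuous_const)).aestronglyMeasurable
      · rw [norm_smul, Real.norm_of_nonneg (hθ2 m x).1]
        exact mul_le_of_le_one_left (norm_nonneg _) (hθ2 m x).2
    · refine Integrable.integrableOn ?_
      refine Continuous.integrable_of_hasCompactSupport ?_ hc.smul_left
      exact (((hθ1 m).continuous_fderiv (by simp)).clm_apply continuous_const).smul hφ.continuous
  have hlim2 : Tendsto (fun m => ∫ x in M, fderiv ℝ (θ m) x v • φ x) atTop (𝓝 0) := by
    have hb : Tendsto (fun m : ℕ => ‖v‖ * B * (1 / ((m : ℝ) + 1))) atTop (𝓝 0) := by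
      simpa using tendsto_one_div_add_atTop_nhds_zero_nat.const_mul (‖v‖ * B)
    refine squeeze_zero_norm (fun m => ?_) hb
    calc ‖∫ x in M, fderiv ℝ (θ m) x v • φ x‖ ≤ ∫ x in M, ‖v‖ * B * ‖fderiv ℝ (θ m) x‖ := by
          refine norm_integral_le_of_norm_le ((hθ5 m).const_mul _).integrableOn
            (Eventually.of_forall fun x => ?_)
          rw [norm_smul]
          calc _ ≤ (‖fderiv ℝ (θ m) x‖ * ‖v‖) * B :=
                mul_le_mul (ContinuousLinearMap.le_opNorm _ _) (hB x) (norm_nonneg _) (by positivity)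
            _ = _ := by ring
      _ ≤ ∫ x, ‖v‖ * B * ‖fderiv ℝ (θ m) x‖ :=
          setIntegral_le_integral ((hθ5 m).const_mul _)
            (Eventually.of_forall fun x => by positivity)
      _ ≤ _ := by
          rw [integral_const_mul]
          exact mul_le_mul_of_nonneg_left (hθ6 m) (by positivity)
  have hlim1 : Tendsto (fun m => ∫ x in M, θ m x • fderiv ℝ φ x v) atTop
      (𝓝 (∫ x in M, fderiv ℝ φ x v)) := by
    refine tendsto_integral_of_dominated_convergence (fun x => ‖fderiv ℝ φ x v‖) (fun m => ?_)
      hdi.norm.integrableOn (fun m => Eventually.of_forall fun x => ?_) ?_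
    · exact ((hθ1 m).continuous.smul ((hφ.continuous_fderiv one_ne_zero).clm_apply
          continuous_const)).aestronglyMeasurable
    · rw [norm_smul, Real.norm_of_nonneg (hθ2 m x).1]
      exact mul_le_of_le_one_left (norm_nonneg _) (hθ2 m x).2
    · have : ∀ᵐ x : Rn (N + 1), x ∉ edges M := measure_eq_zero_iff_ae_notMem.1 hEv
      filter_upwards [ae_restrict_of_ae this] with x hx
      refine tendsto_const_nhds.congr' ?_
      filter_upwards [hpt x hx] with m hm
      rw [hm, one_smul]
  have hi := integrable_inner_outwardNormal_smul hM hφ.continuous v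
  have hlim3 : Tendsto (fun m => ∫ x in frontier M, (inner ℝ v (outwardNormal M x) : ℝ) •
      (θ m x • φ x) ∂H) atTop (𝓝 (∫ x in frontier M, (inner ℝ v (outwardNormal M x) : ℝ) • φ x ∂H)) := by
    refine tendsto_integral_of_dominated_convergence
      (fun x => ‖(inner ℝ v (outwardNormal M x) : ℝ) • φ x‖) (fun m => ?_)
      hi.norm (fun m => Eventually.of_forall fun x => ?_) ?_
    · exact (integrable_inner_outwardNormal_smul hM (hprodc m).continuous v).aestronglyMeasurable
    · rw [smul_comm, norm_smul, Real.norm_of_nonneg (hθ2 m x).1]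
      exact mul_le_of_le_one_left (norm_nonneg _) (hθ2 m x).2
    · have : ∀ᵐ x ∂H, x ∉ edges M := measure_eq_zero_iff_ae_notMem.1 hE0
      filter_upwards [ae_restrict_of_ae this] with x hx
      refine tendsto_const_nhds.congr' ?_
      filter_upwards [hpt x hx] with m hm
      rw [hm, one_smul]
  have hlim4 := (hlim1.add hlim2).congr fun m => (hsplit m).symm.trans (heq m)
  rw [add_zero] at hlim4
  exact tendsto_nhds_unique hlim4 hlim3

/-- The divergence theorem for a bounded domain with piecewise `C¹` boundary. -/
theorem divergence_theorem {N : ℕ} (hN : N ≠ 0) {M : Set (Rn (N + 1))}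
    (hM : IsPiecewiseC1Domain M) {φ : Rn (N + 1) → F} (hφ : ContDiff ℝ 1 φ) (v : Rn (N + 1)) :
    ∫ x in M, fderiv ℝ φ x v = ∫ x in frontier M, (inner ℝ v (outwardNormal M x) : ℝ) • φ x
          ∂(Measure.euclideanHausdorffMeasure N) := by
  obtain ⟨R, hR0, hR⟩ := hM.isBounded.closure.subset_ball_lt 0 0
  let f : ContDiffBump (0 : Rn (N + 1)) := ⟨R, R + 1, hR0, by linarith⟩
  have h1 : ∀ x ∈ Metric.ball (0 : Rn (N + 1)) R, f x = 1 := fun x hx =>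
    f.one_of_mem_closedBall (Metric.ball_subset_closedBall hx)
  have h := divergence_of_hasCompactSupport hN hM
    (φ := fun x => f x • φ x) ((f.contDiff).smul hφ) f.hasCompactSupport.smul_right v
  have hMb : ∀ x ∈ M, (fun x => f x • φ x) =ᶠ[𝓝 x] φ := fun x hx => by
    filter_upwards [Metric.isOpen_ball.mem_nhds (hR (subset_closure hx))] with y hy
    rw [h1 y hy, one_smul]
  rw [setIntegral_congr_fun hM.isOpen.measurableSet
      (fun x hx => show fderiv ℝ (fun x => f x • φ x) x v = fderiv ℝ φ x v by
        rw [(hMb x hx).fderiv_eq]),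
    setIntegral_congr_fun isClosed_frontier.measurableSet
      (fun x hx => show (inner ℝ v (outwardNormal M x) : ℝ) • f x • φ x =
        (inner ℝ v (outwardNormal M x) : ℝ) • φ x by
        rw [h1 x (hR (frontier_subset_closure hx)), one_smul])] at h
  exact h

end


/-! ### Calculus in the Clifford algebra -/

section Clifford

variable {n : ℕ}

instance instFiniteDimensionalCl (n : ℕ) : FiniteDimensional ℂ (Cl n) :=
  Module.Finite.of_basis (clBasis n)

instance instFiniteDimensionalRealCl (n : ℕ) : FiniteDimensional ℝ (Cl n) :=
  FiniteDimensional.complexToReal (Cl n)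

instance instCompleteSpaceCl (n : ℕ) : CompleteSpace (Cl n) :=
  FiniteDimensional.complete ℂ (Cl n)

/-- Clifford multiplication as a continuous bilinear map. -/
def mulC (n : ℕ) : Cl n →L[ℝ] Cl n →L[ℝ] Cl n :=
  LinearMap.toContinuousLinearMap
    ((LinearMap.toContinuousLinearMap (𝕜 := ℝ) (E := Cl n) (F' := Cl n)).toLinearMap ∘ₗ
      LinearMap.mk₂ ℝ (fun a b : Cl n => a * b) add_mul
        (fun c a b => by
          rw [← Complex.coe_smul, ← Complex.coe_smul c (a * b), smul_mul_assoc])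
        mul_add
        (fun c a b => by
          rw [← Complex.coe_smul, ← Complex.coe_smul c (a * b), mul_smul_comm]))

@[simp] theorem mulC_apply (a b : Cl n) : mulC n a b = a * b := rfl

theorem norm_mul_le_mulC (a b : Cl n) : ‖a * b‖ ≤ ‖mulC n‖ * ‖a‖ * ‖b‖ :=
  (mulC n).le_opNorm₂ a b

/-- The vector part as a continuous linear map. -/
def vecC (n : ℕ) : (Fin n → ℂ) →L[ℂ] Cl n := LinearMap.toContinuousLinearMap (vec n)

@[simp] theorem vecC_apply (w : Fin n → ℂ) : vecC n w = vec n w := rfl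

theorem vec_mul_vec (w : Fin n → ℂ) :
    vec n w * vec n w = algebraMap ℂ (Cl n) (∑ i, w i ^ 2) := by
  have h := CliffordAlgebra.ι_sq_scalar (sqForm n) w
  have h2 : sqForm n w = ∑ i, w i ^ 2 := by
    simp [sqForm, QuadraticMap.weightedSumSquares_apply, sq]
  rw [← h2]
  exact h

theorem vec_eq_sum (w : Fin n → ℂ) : vec n w = ∑ k, w k • (e k : Cl n) := by
  simp only [e, ← map_smul, ← map_sum]
  congr 1
  funext i
  simp [Finset.sum_apply, Pi.single_apply]

theorem e_mul_e_add (k l : Fin n) :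
    (e k : Cl n) * e l + e l * e k = if k = l then 2 else 0 := by
  have h := vec_mul_vec (n := n) (Pi.single k 1 + Pi.single l 1)
  have hk := vec_mul_vec (n := n) (Pi.single k 1)
  have hl := vec_mul_vec (n := n) (Pi.single l 1)
  have hs : ∀ j : Fin n, ∑ i, (Pi.single j (1 : ℂ) : Fin n → ℂ) i ^ 2 = 1 := fun j => by
    rw [Finset.sum_eq_single j]
    · simp
    · intro i _ hi; simp [hi]
    · simp
  rw [hs, map_one] at hk hl
  rw [map_add, add_mul, mul_add, mul_add, hk, hl] at h
  have h2 : ∑ i, (Pi.single k (1 : ℂ) + Pi.single l 1 : Fin n → ℂ) i ^ 2 =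
      2 + if k = l then 2 else 0 := by
    simp only [Pi.add_apply, add_sq, Finset.sum_add_distrib, hs]
    have : ∑ i, 2 * (Pi.single k (1 : ℂ) : Fin n → ℂ) i * (Pi.single l (1 : ℂ) : Fin n → ℂ) i =
        if k = l then 2 else 0 := by
      rw [Finset.sum_eq_single k]
      · by_cases hkl : k = l
        · subst hkl; simp
        · simp [hkl]
      · intro i _ hi; simp [hi]
      · simp
    rw [this]; ring
  rw [h2] at h
  have h3 : (e k : Cl n) * e l + e l * e k = algebraMap ℂ (Cl n) (2 + if k = l then 2 else 0) - 2 := by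
    rw [← h]
    change vec n (Pi.single k 1) * vec n (Pi.single l 1) + vec n (Pi.single l 1) * vec n (Pi.single k 1) = _
    rw [← one_add_one_eq_two]; abel
  have h4 : algebraMap ℂ (Cl n) 2 = 2 := map_ofNat _ 2
  rw [h3]
  split_ifs <;> simp [h4]

theorem e_mul_self (k : Fin n) : (e k : Cl n) * e k = 1 := by
  have h := vec_mul_vec (n := n) (Pi.single k 1)
  have hs : ∑ i, (Pi.single k (1 : ℂ) : Fin n → ℂ) i ^ 2 = 1 := by
    rw [Finset.sum_eq_single k]
    · simp
    · intro i _ hi; simp [hi]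
    · simp
  rw [hs, map_one] at h
  exact h

/-- The symbol of the Dirac operator. -/
def diracSymbol (n : ℕ) : (Rn n →L[ℝ] Cl n) →L[ℝ] Cl n :=
  ∑ k : Fin n, (mulC n (e k)).comp
    (ContinuousLinearMap.apply ℝ (Cl n) (EuclideanSpace.single k (1 : ℝ)))

theorem dirac_eq (h : Rn n → Cl n) (x : Rn n) : dirac h x = diracSymbol n (fderiv ℝ h x) := by
  simp [dirac, diracSymbol]

theorem contDiff_dirac {h : Rn n → Cl n} {m k : ℕ∞} (hh : ContDiff ℝ k h) (hmk : m + 1 ≤ k) :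
    ContDiff ℝ m (dirac h) := by
  have : dirac h = fun x => diracSymbol n (fderiv ℝ h x) := funext (dirac_eq h)
  rw [this]
  exact (diracSymbol n).contDiff.comp (hh.fderiv_right (by exact_mod_cast hmk))

theorem continuous_dirac {h : Rn n → Cl n} (hh : ContDiff ℝ 1 h) : Continuous (dirac h) :=
  (contDiff_dirac (m := 0) (k := 1) hh (by simp)).continuous

theorem hasCompactSupport_dirac {h : Rn n → Cl n} (hc : HasCompactSupport h) :
    HasCompactSupport (dirac h) := by
  have : dirac h = fun x => diracSymbol n (fderiv ℝ h x) := funext (dirac_eq h)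
  rw [this]
  exact (hc.fderiv ℝ).comp_left (map_zero _)

theorem tsupport_dirac_subset (h : Rn n → Cl n) : tsupport (dirac h) ⊆ tsupport h := by
  have : dirac h = fun x => diracSymbol n (fderiv ℝ h x) := funext (dirac_eq h)
  rw [this]
  exact (tsupport_comp_subset (map_zero (diracSymbol n)) _).trans (tsupport_fderiv_subset ℝ)

theorem dirac_sub {h g : Rn n → Cl n} {x : Rn n} (hh : DifferentiableAt ℝ h x)
    (hg : DifferentiableAt ℝ g x) : dirac (fun x => h x - g x) x = dirac h x - dirac g x := by
  simp only [dirac_eq, fderiv_fun_sub hh hg, map_sub]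

theorem dirac_smul {η : Rn n → ℝ} {g : Rn n → Cl n} {x : Rn n} (hη : DifferentiableAt ℝ η x)
    (hg : DifferentiableAt ℝ g x) : dirac (fun x => η x • g x) x =
      η x • dirac g x + diracSymbol n ((fderiv ℝ η x).smulRight (g x)) := by
  simp only [dirac_eq, fderiv_fun_smul hη hg, map_add, map_smul]

/-- The square of the Dirac operator is the Laplacian. -/
theorem dirac_dirac {h : Rn n → Cl n} (hh : ContDiff ℝ 2 h) :
    dirac (dirac h) = Laplacian.laplacian h := by
  funext x
  have hd1 : Differentiable ℝ (fderiv ℝ h) :=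
    (hh.fderiv_right (m := 1) (by norm_num)).differentiable one_ne_zero
  have hd : ∀ k l : Fin n, fderiv ℝ (fun y => (e k : Cl n) * fderiv ℝ h y (EuclideanSpace.single k 1)) x
      (EuclideanSpace.single l 1) = e k * fderiv ℝ (fderiv ℝ h) x (EuclideanSpace.single l 1)
        (EuclideanSpace.single k 1) := by
    intro k l
    have h1 : HasFDerivAt (fun y => fderiv ℝ h y (EuclideanSpace.single k 1))
        ((ContinuousLinearMap.apply ℝ (Cl n) (EuclideanSpace.single k (1 : ℝ))).comp
          (fderiv ℝ (fderiv ℝ h) x)) x :=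
      (ContinuousLinearMap.apply ℝ (Cl n) (EuclideanSpace.single k (1 : ℝ))).hasFDerivAt.comp x
        (hd1 x).hasFDerivAt
    have h2 := ((mulC n (e k)).hasFDerivAt.comp x h1).fderiv
    have h3 : fderiv ℝ (fun y => (e k : Cl n) * fderiv ℝ h y (EuclideanSpace.single k 1)) x = _ := h2
    rw [h3]; rfl
  have hdiff : ∀ k : Fin n, DifferentiableAt ℝ
      (fun y => (e k : Cl n) * fderiv ℝ h y (EuclideanSpace.single k 1)) x := fun k =>
    (mulC n (e k)).differentiableAt.comp x ((hd1 x).clm_apply (differentiableAt_const _))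
  have hexp : dirac (dirac h) x = ∑ l : Fin n, ∑ k : Fin n, (e l : Cl n) * (e k *
      fderiv ℝ (fderiv ℝ h) x (EuclideanSpace.single l 1) (EuclideanSpace.single k 1)) := by
    rw [dirac]
    refine Finset.sum_congr rfl fun l _ => ?_
    have : dirac h = fun y => ∑ k : Fin n, (e k : Cl n) * fderiv ℝ h y (EuclideanSpace.single k 1) :=
      rfl
    rw [this, fderiv_fun_sum fun k _ => hdiff k, sum_apply, Finset.mul_sum]
    exact Finset.sum_congr rfl fun k _ => by rw [hd]
  have hsymm : ∀ v w, fderiv ℝ (fderiv ℝ h) x v w = fderiv ℝ (fderiv ℝ h) x w v := fun v w =>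
    (hh.contDiffAt.isSymmSndFDerivAt (by simp)) v w
  rw [hexp, InnerProductSpace.laplacian_eq_iteratedFDeriv_orthonormalBasis h
    (EuclideanSpace.basisFun (Fin n) ℝ)]
  set A : Fin n → Fin n → Cl n := fun l k =>
    fderiv ℝ (fderiv ℝ h) x (EuclideanSpace.single l 1) (EuclideanSpace.single k 1) with hA
  have hAs : ∀ l k, A l k = A k l := fun l k => hsymm _ _
  -- Adding the double sum to its transpose, the symmetry of second derivatives lets the
  -- anticommutation relations remove all off-diagonal terms.
  have h2 : (2 : ℂ) • ∑ l : Fin n, ∑ k : Fin n, (e l : Cl n) * (e k * A l k) =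
      (2 : ℂ) • ∑ l : Fin n, A l l := by
    rw [two_smul]
    nth_rewrite 2 [Finset.sum_comm]
    rw [← Finset.sum_add_distrib]
    simp_rw [← Finset.sum_add_distrib]
    rw [Finset.smul_sum]
    refine Finset.sum_congr rfl fun l _ => ?_
    rw [Finset.sum_eq_single l]
    · rw [← mul_assoc, e_mul_self, one_mul, two_smul]
    · intro k _ hk
      rw [hAs k l, ← mul_assoc, ← mul_assoc, ← add_mul, e_mul_e_add, if_neg (Ne.symm hk), zero_mul]
    · simp
  have h3 := smul_right_injective (Cl n) (two_ne_zero (α := ℂ)) h2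
  rw [h3]
  refine Finset.sum_congr rfl fun l _ => ?_
  rw [iteratedFDeriv_two_apply]
  simp [hA]

end Clifford


/-! ### The potential and the Cauchy kernel as functions of the quadratic form -/

/-- The square root with nonnegative real part. -/
def croot (ζ : ℂ) : ℂ := ζ ^ (1 / 2 : ℂ)

theorem croot_sq (ζ : ℂ) : croot ζ ^ 2 = ζ := by
  simp [croot]

theorem croot_ne_zero {ζ : ℂ} (h : ζ ≠ 0) : croot ζ ≠ 0 := fun h0 => h (by
  rw [← croot_sq ζ, h0]; simp)

theorem norm_croot_sq (ζ : ℂ) : ‖croot ζ‖ ^ 2 = ‖ζ‖ := by rw [← norm_pow, croot_sq]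

theorem arg_croot_mem (ζ : ℂ) (h : ζ ≠ 0) :
    croot ζ = Complex.exp (Complex.log ζ / 2) := by
  rw [croot, Complex.cpow_def_of_ne_zero h]
  congr 1; ring

theorem croot_re_nonneg (ζ : ℂ) : 0 ≤ (croot ζ).re := by
  by_cases h : ζ = 0
  · simp [croot, h]
  · rw [arg_croot_mem ζ h, Complex.exp_re]
    refine mul_nonneg (Real.exp_nonneg _) (Real.cos_nonneg_of_neg_pi_div_two_le_of_le ?_ ?_) <;>
    · have h1 := Complex.neg_pi_lt_log_im ζ
      have h2 := Complex.log_im_le_pi ζ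
      have h3 : (Complex.log ζ / 2).im = (Complex.log ζ).im / 2 := by
        rw [show (2 : ℂ) = ((2 : ℝ) : ℂ) by norm_num, Complex.div_ofReal_im]
      rw [h3]; linarith

theorem croot_re_pos {ζ : ℂ} (h : ζ ∈ Complex.slitPlane) : 0 < (croot ζ).re := by
  refine lt_of_le_of_ne (croot_re_nonneg ζ) fun h0 => ?_
  have h1 := croot_sq ζ
  set γ := croot ζ
  have hre : ζ.re = -(γ.im ^ 2) := by
    rw [← h1, sq, Complex.mul_re, ← h0]; ring
  have him : ζ.im = 0 := by
    rw [← h1, sq, Complex.mul_im, ← h0]; ring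
  rcases Complex.mem_slitPlane_iff.1 h with h2 | h2
  · rw [hre] at h2; nlinarith [sq_nonneg γ.im]
  · exact h2 him

theorem croot_mem_slitPlane {ζ : ℂ} (h : ζ ∈ Complex.slitPlane) : croot ζ ∈ Complex.slitPlane :=
  Complex.mem_slitPlane_iff.2 (Or.inl (croot_re_pos h))

theorem croot_eq_of_sq {γ : ℂ} (h : 0 < γ.re) : croot (γ ^ 2) = γ := by
  have h1 : (croot (γ ^ 2)) ^ 2 = γ ^ 2 := croot_sq _
  rcases sq_eq_sq_iff_eq_or_eq_neg.1 h1 with h2 | h2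
  · exact h2
  · have := croot_re_nonneg (γ ^ 2)
    rw [h2, Complex.neg_re] at this
    linarith

theorem hasDerivAt_croot {ζ : ℂ} (h : ζ ∈ Complex.slitPlane) :
    HasDerivAt croot (1 / (2 * croot ζ)) ζ := by
  have h1 := (hasDerivAt_id ζ).cpow_const (c := (1 / 2 : ℂ)) h
  have h0 : ζ ≠ 0 := Complex.slitPlane_ne_zero h
  refine h1.congr_deriv ?_
  have h2 : ζ ^ ((1 / 2 : ℂ) - 1) = croot ζ / ζ := by
    rw [Complex.cpow_sub _ _ h0, Complex.cpow_one]; rfl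
  simp only [id, mul_one]
  rw [h2]
  have h3 := croot_ne_zero h0
  have h4 := croot_sq ζ
  field_simp
  rw [h4]

theorem measurable_croot : Measurable croot := by
  unfold croot; fun_prop

/-- The potential as a function of the quadratic form. -/
def potOf (n : ℕ) (ζ : ℂ) : ℂ :=
  if n = 2 then Complex.log (croot ζ) / (2 * Real.pi)
  else croot ζ ^ (2 - n : ℤ) / (sphereArea n * (2 - n))

/-- The scalar factor of the Cauchy kernel as a function of the quadratic form. -/
def kerOf (n : ℕ) (ζ : ℂ) : ℂ := ((sphereArea n : ℂ) * croot ζ ^ n)⁻¹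

theorem potential_eq {n : ℕ} (w : Fin n → ℂ) : potential w = potOf n (∑ i, w i ^ 2) := rfl

theorem cauchyKernel_eq {n : ℕ} (w : Fin n → ℂ) :
    cauchyKernel w = kerOf n (∑ i, w i ^ 2) • vec n w := rfl

/-- The values of the quadratic form off the singular set. -/
def goodSet (n : ℕ) : Set ℂ := if Even n ∧ n ≠ 2 then {0}ᶜ else Complex.slitPlane

theorem isOpen_goodSet (n : ℕ) : IsOpen (goodSet n) := by
  unfold goodSet; split_ifs
  · exact isOpen_compl_singleton
  · exact Complex.isOpen_slitPlane

theorem slitPlane_subset_goodSet (n : ℕ) : Complex.slitPlane ⊆ goodSet n := by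
  unfold goodSet; split_ifs
  · exact fun ζ h => Complex.slitPlane_ne_zero h
  · exact subset_rfl

theorem ne_zero_of_mem_goodSet {n : ℕ} {ζ : ℂ} (h : ζ ∈ goodSet n) : ζ ≠ 0 := by
  unfold goodSet at h; split_ifs at h
  · exact h
  · exact Complex.slitPlane_ne_zero h

/-- For `w = x + iy` the quadratic form is `|x|² - |y|² + 2i x·y`. The closed negative half-axis,
where the root has its cut, thus corresponds to `x·y = 0` and `|x| ≤ |y|`. -/
theorem mem_singularSet_iff {n : ℕ} (w : Fin n → ℂ) :
    w ∈ singularSet n ↔ ∑ i, w i ^ 2 ∉ goodSet n := by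
  have hre : (∑ i, w i ^ 2).re = ∑ i, (w i).re ^ 2 - ∑ i, (w i).im ^ 2 := by
    rw [Complex.re_sum, ← Finset.sum_sub_distrib]
    exact Finset.sum_congr rfl fun i _ => by rw [sq, Complex.mul_re]; ring
  have him : (∑ i, w i ^ 2).im = 2 * ∑ i, (w i).re * (w i).im := by
    rw [Complex.im_sum, Finset.mul_sum]
    exact Finset.sum_congr rfl fun i _ => by rw [sq, Complex.mul_im]; ring
  unfold singularSet goodSet
  rw [Set.mem_ofPred_eq]
  split_ifs with h
  · simp
  · rw [Complex.mem_slitPlane_iff, hre, him]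
    constructor
    · rintro ⟨h1, h2⟩ (h3 | h3)
      · linarith
      · exact h3 (by rw [h1, mul_zero])
    · intro h1
      push Not at h1
      exact ⟨by linarith [h1.2], by linarith [h1.1]⟩

theorem sphereArea_two : sphereArea 2 = 2 * Real.pi := by
  simp [sphereArea]

theorem croot_zpow_even (ζ : ℂ) (m : ℤ) : croot ζ ^ (2 * m) = ζ ^ m := by
  rw [zpow_mul]
  congr 1
  rw [show (2 : ℤ) = ((2 : ℕ) : ℤ) by norm_num, zpow_natCast, croot_sq]

/-- On the slit plane this is the chain rule for the root. For even `n ≥ 4` only even powers of the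
root occur, so the potential is an integer power of `ζ` and is differentiable across the cut as
well. For `n = 2` the logarithm keeps the cut. -/
theorem hasDerivAt_potOf {n : ℕ} {ζ : ℂ} (h : ζ ∈ goodSet n) :
    HasDerivAt (potOf n) (kerOf n ζ / 2) ζ := by
  have h0 : ζ ≠ 0 := ne_zero_of_mem_goodSet h
  have hg0 := croot_ne_zero h0
  have hsq := croot_sq ζ
  by_cases h2 : n = 2
  · subst h2
    have hs : ζ ∈ Complex.slitPlane := by simpa [goodSet] using h
    have hf : potOf 2 = fun ζ => Complex.log (croot ζ) / (2 * Real.pi) := by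
      funext ζ; simp [potOf]
    rw [hf]
    have h1 := ((hasDerivAt_croot hs).clog (croot_mem_slitPlane hs)).div_const (2 * Real.pi : ℂ)
    refine h1.congr_deriv ?_
    rw [kerOf, sphereArea_two]
    have : (Real.pi : ℂ) ≠ 0 := by exact_mod_cast Real.pi_ne_zero
    push_cast
    field_simp
  · have hf : potOf n = fun ζ => croot ζ ^ (2 - n : ℤ) / (sphereArea n * (2 - n)) := by
      funext ζ; simp [potOf, h2]
    rw [hf]
    have hn2 : (2 : ℂ) - n ≠ 0 := by
      intro h3
      have : (n : ℂ) = 2 := by linear_combination -h3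
      exact h2 (by exact_mod_cast this)
    have key : HasDerivAt (fun ζ => croot ζ ^ (2 - n : ℤ)) ((2 - n) / 2 * (croot ζ ^ n)⁻¹) ζ := by
      by_cases hs : ζ ∈ Complex.slitPlane
      · have h1 := (hasDerivAt_zpow (2 - n : ℤ) (croot ζ) (Or.inl hg0)).comp ζ (hasDerivAt_croot hs)
        refine h1.congr_deriv ?_
        have h3 : croot ζ ^ (2 - (n : ℤ) - 1) = croot ζ * (croot ζ ^ n)⁻¹ := by
          rw [show (2 - (n : ℤ) - 1) = 1 - n by omega, zpow_sub₀ hg0, zpow_one, zpow_natCast]; rfl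
        rw [h3]
        push_cast
        field_simp
      · have hev : Even n ∧ n ≠ 2 := by
          by_contra hno
          simp only [goodSet, if_neg hno] at h
          exact hs h
        obtain ⟨m, hm⟩ := hev.1
        have hf2 : (fun ζ => croot ζ ^ (2 - n : ℤ)) = fun ζ => ζ ^ (1 - m : ℤ) := by
          funext ζ
          rw [show (2 - n : ℤ) = 2 * (1 - m) by omega, croot_zpow_even]
        rw [hf2]
        refine (hasDerivAt_zpow (1 - m : ℤ) ζ (Or.inl h0)).congr_deriv ?_
        have h3 : croot ζ ^ n = ζ ^ m := by
          rw [hm, ← two_mul, pow_mul, hsq]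
        rw [h3, show (1 - (m : ℤ) - 1) = -m by omega, zpow_neg, zpow_natCast, hm]
        push_cast
        ring_nf
    refine (key.div_const _).congr_deriv ?_
    rw [kerOf, mul_inv]
    by_cases hs : (sphereArea n : ℂ) = 0
    · simp [hs]
    · field_simp

theorem hasDerivAt_kerOf {n : ℕ} {ζ : ℂ} (h : ζ ∈ goodSet n) :
    HasDerivAt (kerOf n) (-(n / 2) * kerOf n ζ / ζ) ζ := by
  have h0 : ζ ≠ 0 := ne_zero_of_mem_goodSet h
  have hg0 := croot_ne_zero h0
  have hsq := croot_sq ζ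
  have key : HasDerivAt (fun ζ => croot ζ ^ n) (n / 2 * croot ζ ^ n / ζ) ζ := by
    by_cases hs : ζ ∈ Complex.slitPlane
    · have h1 := (hasDerivAt_croot hs).pow n
      refine h1.congr_deriv ?_
      rcases n with _ | n
      · simp
      · rw [Nat.add_sub_cancel, pow_succ]
        field_simp
        rw [hsq]
    · have hev : Even n ∧ n ≠ 2 := by
        by_contra hno
        simp only [goodSet, if_neg hno] at h
        exact hs h
      obtain ⟨m, hm⟩ := hev.1
      have hf2 : (fun ζ => croot ζ ^ n) = fun ζ => ζ ^ m := by
        funext ζ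
        rw [hm, ← two_mul, pow_mul, croot_sq]
      rw [hf2]
      refine (hasDerivAt_pow m ζ).congr_deriv ?_
      have h3 : croot ζ ^ n = ζ ^ m := congrFun hf2 ζ
      rw [h3, hm]
      rcases m with _ | m
      · simp
      · rw [Nat.add_sub_cancel, pow_succ]
        push_cast
        field_simp
        ring
  have hn0 : croot ζ ^ n ≠ 0 := pow_ne_zero _ hg0
  have hf : kerOf n = fun ζ => (sphereArea n : ℂ)⁻¹ * (croot ζ ^ n)⁻¹ := by
    funext ζ; rw [kerOf, mul_inv]
  rw [hf]
  refine ((key.inv hn0).const_mul _).congr_deriv ?_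
  field_simp

theorem contDiffOn_potOf (n : ℕ) : ContDiffOn ℝ ∞ (potOf n) (goodSet n) :=
  (DifferentiableOn.contDiffOn (fun _ h => (hasDerivAt_potOf h).differentiableAt.differentiableWithinAt)
    (isOpen_goodSet n)).restrict_scalars ℝ

theorem contDiffOn_kerOf (n : ℕ) : ContDiffOn ℝ ∞ (kerOf n) (goodSet n) :=
  (DifferentiableOn.contDiffOn (fun _ h => (hasDerivAt_kerOf h).differentiableAt.differentiableWithinAt)
    (isOpen_goodSet n)).restrict_scalars ℝ

/-! ### The kernels as functions of a real point -/

section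

variable {n : ℕ} (z : Fin n → ℂ)

/-- The quadratic form of `x - z`. -/
def quad (x : Rn n) : ℂ := ∑ i, shift x z i ^ 2

/-- The complex linear form `v ↦ ∑ vᵢ wᵢ`, as a real linear form. -/
def dotC (w : Fin n → ℂ) : Rn n →L[ℝ] ℂ :=
  ∑ i, (EuclideanSpace.proj i : Rn n →L[ℝ] ℝ).smulRight (w i)

theorem dotC_apply (w : Fin n → ℂ) (v : Rn n) : dotC w v = ∑ i, (v i : ℂ) * w i := by
  simp [dotC]

theorem dotC_single (w : Fin n → ℂ) (k : Fin n) : dotC w (EuclideanSpace.single k 1) = w k := by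
  rw [dotC_apply, Finset.sum_eq_single k]
  · simp
  · intro i _ hi; simp [hi]
  · simp

theorem contDiff_shift : ContDiff ℝ ∞ (fun x : Rn n => shift x z) := by
  rw [contDiff_pi]
  intro i
  unfold shift
  have : ContDiff ℝ ∞ (fun x : Rn n => ((x i : ℝ) : ℂ)) :=
    Complex.ofRealCLM.contDiff.comp (EuclideanSpace.proj i : Rn n →L[ℝ] ℝ).contDiff
  exact this.sub contDiff_const

theorem hasFDerivAt_quad (x : Rn n) : HasFDerivAt (quad z) ((2 : ℂ) • dotC (shift x z)) x := by
  have h1 : ∀ i, HasFDerivAt (fun x : Rn n => shift x z i)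
      (Complex.ofRealCLM.comp (EuclideanSpace.proj i : Rn n →L[ℝ] ℝ)) x := fun i => by
    unfold shift
    exact ((Complex.ofRealCLM.comp (EuclideanSpace.proj i : Rn n →L[ℝ] ℝ)).hasFDerivAt).sub_const _
  have h2 := HasFDerivAt.fun_sum (u := Finset.univ) fun i _ => (h1 i).pow 2
  refine h2.congr_fderiv ?_
  ext v
  simp [dotC_apply, Finset.mul_sum, sum_apply]
  refine Finset.sum_congr rfl fun i _ => by ring

theorem contDiff_quad : ContDiff ℝ ∞ (quad z) := by
  unfold quad
  exact ContDiff.sum fun i _ => ((contDiff_pi.1 (contDiff_shift z)) i).pow 2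

theorem mem_singularPoints_iff (x : Rn n) : x ∈ singularPoints z ↔ quad z x ∉ goodSet n :=
  mem_singularSet_iff _

theorem isClosed_singularPoints : IsClosed (singularPoints z) := by
  have : singularPoints z = (quad z ⁻¹' goodSet n)ᶜ := by
    ext x; exact mem_singularPoints_iff z x
  rw [this]
  exact ((isOpen_goodSet n).preimage (contDiff_quad z).continuous).isClosed_compl

theorem singularPoints_compl : (singularPoints z)ᶜ = quad z ⁻¹' goodSet n := by
  ext x
  rw [Set.mem_compl_iff, mem_singularPoints_iff, not_not]; rfl

theorem contDiffOn_potential :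
    ContDiffOn ℝ ∞ (fun x : Rn n => potential (shift x z)) (singularPoints z)ᶜ := by
  rw [singularPoints_compl]
  exact (contDiffOn_potOf n).comp (contDiff_quad z).contDiffOn fun x hx => hx

theorem contDiffOn_cauchyKernel :
    ContDiffOn ℝ ∞ (fun x : Rn n => cauchyKernel (shift x z)) (singularPoints z)ᶜ := by
  rw [singularPoints_compl]
  have hA : ContDiffOn ℝ ∞ (fun x : Rn n => kerOf n (quad z x)) (quad z ⁻¹' goodSet n) :=
    (contDiffOn_kerOf n).comp (contDiff_quad z).contDiffOn fun x hx => hx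
  have h1 : ContDiff ℝ ∞ (fun w : Fin n → ℂ => vecC n w) :=
    ContDiff.restrict_scalars (𝕜 := ℝ) (𝕜' := ℂ) (vecC n).contDiff
  have hB : ContDiffOn ℝ ∞ (fun x : Rn n => vecC n (shift x z)) (quad z ⁻¹' goodSet n) :=
    (h1.comp (contDiff_shift z)).contDiffOn
  exact hA.smul hB

theorem hasFDerivAt_potential {x : Rn n} (hx : x ∉ singularPoints z) :
    HasFDerivAt (fun x : Rn n => potential (shift x z)) (kerOf n (quad z x) • dotC (shift x z)) x := by
  have hg : quad z x ∈ goodSet n := by rwa [mem_singularPoints_iff, not_not] at hx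
  have h1 := ((hasDerivAt_potOf hg).hasFDerivAt.restrictScalars ℝ).comp x (hasFDerivAt_quad z x)
  refine h1.congr_fderiv ?_
  ext v
  simp
  ring

theorem hasFDerivAt_cauchyKernel {x : Rn n} (hx : x ∉ singularPoints z) :
    HasFDerivAt (fun x : Rn n => cauchyKernel (shift x z))
      (kerOf n (quad z x) • ∑ i, (EuclideanSpace.proj i : Rn n →L[ℝ] ℝ).smulRight (e i : Cl n) +
        ((-(n : ℂ) * kerOf n (quad z x) / quad z x) • dotC (shift x z)).smulRight
          (vec n (shift x z))) x := by
  have hg : quad z x ∈ goodSet n := by rwa [mem_singularPoints_iff, not_not] at hx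
  have h1 := ((hasDerivAt_kerOf hg).hasFDerivAt.restrictScalars ℝ).comp x (hasFDerivAt_quad z x)
  have h2 : HasFDerivAt (fun x : Rn n => vec n (shift x z))
      (∑ i, (EuclideanSpace.proj i : Rn n →L[ℝ] ℝ).smulRight (e i : Cl n)) x := by
    have h3 : HasFDerivAt (fun x : Rn n => ∑ i, shift x z i • (e i : Cl n)) _ x :=
      HasFDerivAt.fun_sum (u := Finset.univ) fun i _ =>
      (show HasFDerivAt (fun x : Rn n => shift x z i • (e i : Cl n))
        ((EuclideanSpace.proj i : Rn n →L[ℝ] ℝ).smulRight (e i : Cl n)) x from by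
        have h4 : HasFDerivAt (fun x : Rn n => shift x z i)
            (Complex.ofRealCLM.comp (EuclideanSpace.proj i : Rn n →L[ℝ] ℝ)) x := by
          unfold shift
          exact ((Complex.ofRealCLM.comp
            (EuclideanSpace.proj i : Rn n →L[ℝ] ℝ)).hasFDerivAt).sub_const _
        refine (h4.smul_const (e i : Cl n)).congr_fderiv ?_
        ext v; simp)
    simpa only [vec_eq_sum] using h3
  have h5 := HasFDerivAt.smul h1 h2
  refine h5.congr_fderiv ?_
  ext v
  simp only [add_apply, smul_apply,
    ContinuousLinearMap.smulRight_apply, ContinuousLinearMap.comp_apply]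
  congr 1
  congr 1
  simp
  ring

end


/-! ### Integration by parts against a kernel that is smooth near the support -/

section

variable {X E F G : Type*} [NormedAddCommGroup X] [NormedSpace ℝ X]
  [NormedAddCommGroup E] [NormedSpace ℝ E] [NormedAddCommGroup F] [NormedSpace ℝ F]
  [NormedAddCommGroup G] [NormedSpace ℝ G]

theorem contDiff_bilinear_of_tsupport (B : E →L[ℝ] F →L[ℝ] G) {K : X → E} {h : X → F} {U : Set X}
    {m : WithTop ℕ∞} (hU : IsOpen U) (hK : ContDiffOn ℝ m K U) (hh : ContDiff ℝ m h)
    (hs : tsupport h ⊆ U) : ContDiff ℝ m (fun x => B (K x) (h x)) := by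
  rw [contDiff_iff_contDiffAt]
  intro x
  by_cases hx : x ∈ tsupport h
  · exact B.isBoundedBilinearMap.contDiff.contDiffAt.comp x
      (((hK x (hs hx)).contDiffAt (hU.mem_nhds (hs hx))).prodMk hh.contDiffAt)
  · refine (contDiffAt_const (c := (0 : G))).congr_of_eventuallyEq ?_
    filter_upwards [notMem_tsupport_iff_eventuallyEq.1 hx] with y hy
    rw [hy]; simp

theorem fderiv_bilinear_of_tsupport (B : E →L[ℝ] F →L[ℝ] G) {K : X → E} {h : X → F} {U : Set X}
    (hU : IsOpen U) (hK : ContDiffOn ℝ 1 K U) (hh : ContDiff ℝ 1 h)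
    (hs : tsupport h ⊆ U) (x v : X) : fderiv ℝ (fun x => B (K x) (h x)) x v =
      B (K x) (fderiv ℝ h x v) + B (fderiv ℝ K x v) (h x) := by
  by_cases hx : x ∈ tsupport h
  · have h1 := ((hK x (hs hx)).contDiffAt (hU.mem_nhds (hs hx))).differentiableAt one_ne_zero
    rw [(B.hasFDerivAt_of_bilinear h1.hasFDerivAt
      (hh.differentiable one_ne_zero x).hasFDerivAt).fderiv]
    simp
  · have h1 := notMem_tsupport_iff_eventuallyEq.1 hx
    have h2 : (fun x => B (K x) (h x)) =ᶠ[𝓝 x] fun _ => 0 := by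
      filter_upwards [h1] with y hy
      rw [hy]; simp
    have h3 : fderiv ℝ h x = 0 := by rw [h1.fderiv_eq]; simp [Pi.zero_def]
    rw [h2.fderiv_eq, h3, h1.eq_of_nhds]
    simp

omit [NormedSpace ℝ X] in
theorem hasCompactSupport_bilinear (B : E →L[ℝ] F →L[ℝ] G) (K : X → E) {h : X → F}
    (hc : HasCompactSupport h) : HasCompactSupport (fun x => B (K x) (h x)) :=
  hc.mono' (fun x hx => subset_tsupport h fun h0 => hx (by simp [h0]))

variable [MeasurableSpace X] [BorelSpace X] [FiniteDimensional ℝ X]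

theorem integrable_bilinear_of_tsupport (μ : Measure X) [IsLocallyFiniteMeasure μ]
    (B : E →L[ℝ] F →L[ℝ] G) {K : X → E} {h : X → F} {U : Set X}
    (hU : IsOpen U) (hK : ContinuousOn K U) (hh : Continuous h) (hc : HasCompactSupport h)
    (hs : tsupport h ⊆ U) : Integrable (fun x => B (K x) (h x)) μ :=
  (contDiff_bilinear_of_tsupport B hU (contDiffOn_zero.2 hK) (contDiff_zero.2 hh)
    hs).continuous.integrable_of_hasCompactSupport (hasCompactSupport_bilinear B K hc)

theorem integral_bilinear_fderiv [CompleteSpace G] (μ : Measure X) [μ.IsAddHaarMeasure]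
    (B : E →L[ℝ] F →L[ℝ] G) {K : X → E} {h : X → F} {U : Set X}
    (hU : IsOpen U) (hK : ContDiffOn ℝ 1 K U) (hh : ContDiff ℝ 1 h) (hc : HasCompactSupport h)
    (hs : tsupport h ⊆ U) (v : X) :
    Integrable (fun x => B (fderiv ℝ K x v) (h x)) μ ∧
    Integrable (fun x => B (K x) (fderiv ℝ h x v)) μ ∧
    ∫ x, B (fderiv ℝ K x v) (h x) ∂μ = -∫ x, B (K x) (fderiv ℝ h x v) ∂μ := by
  have hdK : ContinuousOn (fun x => fderiv ℝ K x v) U :=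
    (hK.continuousOn_fderiv_of_isOpen hU le_rfl).clm_apply continuousOn_const
  have hdh : Continuous (fun x => fderiv ℝ h x v) :=
    (hh.continuous_fderiv one_ne_zero).clm_apply continuous_const
  have h1 := integrable_bilinear_of_tsupport μ B hU hdK hh.continuous hc hs
  have hcd : HasCompactSupport (fun x => fderiv ℝ h x v) := hc.fderiv_apply ℝ v
  have hsd : tsupport (fun x => fderiv ℝ h x v) ⊆ U :=
    (tsupport_fderiv_apply_subset ℝ v).trans hs
  have h2 := integrable_bilinear_of_tsupport μ B hU hK.continuousOn hdh hcd hsd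
  refine ⟨h1, h2, ?_⟩
  have h3 := integral_fderiv_apply_eq_zero μ (contDiff_bilinear_of_tsupport B hU hK hh hs)
    (hasCompactSupport_bilinear B K hc) v
  simp only [fderiv_bilinear_of_tsupport B hU hK hh hs] at h3
  rw [integral_add h2 h1] at h3
  exact eq_neg_of_add_eq_zero_right h3

end

/-! ### Integration by parts for the potential and the Cauchy kernel -/

section

variable {n : ℕ} (z : Fin n → ℂ)

theorem sum_fderiv_potential {x : Rn n} (hx : x ∉ singularPoints z) :
    ∑ k, fderiv ℝ (fun x : Rn n => potential (shift x z)) x (EuclideanSpace.single k 1) • (e k : Cl n)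
      = cauchyKernel (shift x z) := by
  rw [(hasFDerivAt_potential z hx).fderiv, cauchyKernel_eq, vec_eq_sum, Finset.smul_sum]
  refine Finset.sum_congr rfl fun k _ => ?_
  rw [smul_apply, dotC_single, smul_smul]
  rfl

/-- Differentiating the vector factor gives `∑ eₖ² = n` times the scalar factor. Since the latter is
homogeneous of degree `-n/2` in the quadratic form, its derivative contributes `-n` times itself
after `vec * vec` is replaced by that form. -/
theorem sum_fderiv_cauchyKernel {x : Rn n} (hx : x ∉ singularPoints z) :
    ∑ k, fderiv ℝ (fun x : Rn n => cauchyKernel (shift x z)) x (EuclideanSpace.single k 1) *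
      (e k : Cl n) = 0 := by
  have hg : quad z x ∈ goodSet n := by rwa [mem_singularPoints_iff, not_not] at hx
  have hq := ne_zero_of_mem_goodSet hg
  rw [(hasFDerivAt_cauchyKernel z hx).fderiv]
  have h1 : ∀ k : Fin n, (kerOf n (quad z x) •
      ∑ i, (EuclideanSpace.proj i : Rn n →L[ℝ] ℝ).smulRight (e i : Cl n) +
        ((-(n : ℂ) * kerOf n (quad z x) / quad z x) • dotC (shift x z)).smulRight
          (vec n (shift x z))) (EuclideanSpace.single k 1) * (e k : Cl n) =
      kerOf n (quad z x) • (1 : Cl n) + (-(n : ℂ) * kerOf n (quad z x) / quad z x) •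
        (vec n (shift x z) * (shift x z k • e k)) := fun k => by
    rw [add_apply, smul_apply, ContinuousLinearMap.smulRight_apply, smul_apply, dotC_single,
      sum_apply, Finset.sum_eq_single k]
    · have hp : (EuclideanSpace.proj k : Rn n →L[ℝ] ℝ) (EuclideanSpace.single k 1) = 1 := by simp
      simp only [ContinuousLinearMap.smulRight_apply, add_mul, smul_mul_assoc, smul_eq_mul]
      rw [hp, one_smul, e_mul_self, mul_smul_comm, smul_smul]
    · intro i _ hi; simp [hi]
    · simp
  rw [Finset.sum_congr rfl fun k _ => h1 k, Finset.sum_add_distrib, ← Finset.smul_sum,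
    ← Finset.smul_sum, ← Finset.mul_sum, ← vec_eq_sum, vec_mul_vec]
  have h2 : ∑ i, shift x z i ^ 2 = quad z x := rfl
  rw [h2, Finset.sum_const, Finset.card_univ, Fintype.card_fin, Algebra.algebraMap_eq_smul_one,
    smul_smul, div_mul_cancel₀ _ hq, ← Nat.cast_smul_eq_nsmul ℂ, smul_smul, ← add_smul]
  ring_nf
  simp

theorem isOpen_compl_singularPoints : IsOpen (singularPoints z)ᶜ :=
  (isClosed_singularPoints z).isOpen_compl

/-- Off the singular points the Cauchy kernel is the Dirac derivative of the potential. -/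
theorem integral_potential_smul_dirac {h : Rn n → Cl n} (hh : ContDiff ℝ 1 h)
    (hc : HasCompactSupport h) (hs : tsupport h ⊆ (singularPoints z)ᶜ) :
    Integrable (fun x => potential (shift x z) • dirac h x) ∧
    Integrable (fun x => cauchyKernel (shift x z) * h x) ∧
    ∫ x, potential (shift x z) • dirac h x = -∫ x, cauchyKernel (shift x z) * h x := by
  have h1 := fun k : Fin n => integral_bilinear_fderiv volume
    ((ContinuousLinearMap.lsmul ℝ ℂ : ℂ →L[ℝ] Cl n →L[ℝ] Cl n))
    (isOpen_compl_singularPoints z) ((contDiffOn_potential z).of_le (by simp))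
    (h := fun x => (e k : Cl n) * h x)
    ((mulC n (e k)).contDiff.comp hh) (hc.comp_left (g := fun a => (e k : Cl n) * a) (mul_zero _))
    ((tsupport_comp_subset (g := fun a => (e k : Cl n) * a) (mul_zero _) h).trans hs)
    (EuclideanSpace.single k 1)
  have hd : ∀ (k : Fin n) (x : Rn n), fderiv ℝ (fun x => (e k : Cl n) * h x) x
      (EuclideanSpace.single k 1) = e k * fderiv ℝ h x (EuclideanSpace.single k 1) := fun k x => by
    have := ((mulC n (e k)).hasFDerivAt.comp x (hh.differentiable one_ne_zero x).hasFDerivAt).fderiv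
    change fderiv ℝ (fun x => (e k : Cl n) * h x) x = _ at this
    rw [this]; simp
  simp only [ContinuousLinearMap.lsmul_apply, hd] at h1
  have ea : (fun x => potential (shift x z) • dirac h x) = fun x => ∑ k : Fin n,
      potential (shift x z) • ((e k : Cl n) * fderiv ℝ h x (EuclideanSpace.single k 1)) := by
    funext x; rw [dirac, Finset.smul_sum]
  have eb : (fun x => cauchyKernel (shift x z) * h x) = fun x => ∑ k : Fin n,
      fderiv ℝ (fun x : Rn n => potential (shift x z)) x (EuclideanSpace.single k 1) •
        ((e k : Cl n) * h x) := by
    funext x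
    by_cases hx : x ∈ singularPoints z
    · have : h x = 0 := by
        by_contra h0
        exact hs (subset_tsupport h h0) hx
      simp [this]
    · rw [← sum_fderiv_potential z hx, Finset.sum_mul]
      simp only [smul_mul_assoc]
  rw [ea, eb]
  refine ⟨integrable_finsetSum _ fun k _ => (h1 k).2.1, integrable_finsetSum _ fun k _ => (h1 k).1, ?_⟩
  rw [integral_finsetSum _ fun k _ => (h1 k).2.1, integral_finsetSum _ fun k _ => (h1 k).1,
    ← Finset.sum_neg_distrib]
  exact Finset.sum_congr rfl fun k _ => by rw [(h1 k).2.2, neg_neg]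

/-- The Cauchy kernel is annihilated by the Dirac operator off the singular points. -/
theorem integral_cauchyKernel_mul_dirac {h : Rn n → Cl n} (hh : ContDiff ℝ 1 h)
    (hc : HasCompactSupport h) (hs : tsupport h ⊆ (singularPoints z)ᶜ) :
    ∫ x, cauchyKernel (shift x z) * dirac h x = 0 := by
  have h1 := fun k : Fin n => integral_bilinear_fderiv volume (mulC n)
    (isOpen_compl_singularPoints z) ((contDiffOn_cauchyKernel z).of_le (by simp))
    (h := fun x => (e k : Cl n) * h x)
    ((mulC n (e k)).contDiff.comp hh) (hc.comp_left (g := fun a => (e k : Cl n) * a) (mul_zero _))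
    ((tsupport_comp_subset (g := fun a => (e k : Cl n) * a) (mul_zero _) h).trans hs)
    (EuclideanSpace.single k 1)
  have hd : ∀ (k : Fin n) (x : Rn n), fderiv ℝ (fun x => (e k : Cl n) * h x) x
      (EuclideanSpace.single k 1) = e k * fderiv ℝ h x (EuclideanSpace.single k 1) := fun k x => by
    have := ((mulC n (e k)).hasFDerivAt.comp x (hh.differentiable one_ne_zero x).hasFDerivAt).fderiv
    change fderiv ℝ (fun x => (e k : Cl n) * h x) x = _ at this
    rw [this]; simp
  simp only [mulC_apply, hd] at h1
  have ea : (fun x => cauchyKernel (shift x z) * dirac h x) = fun x => ∑ k : Fin n,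
      cauchyKernel (shift x z) * ((e k : Cl n) * fderiv ℝ h x (EuclideanSpace.single k 1)) := by
    funext x; rw [dirac, Finset.mul_sum]
  have eb : (fun x => ∑ k : Fin n,
      fderiv ℝ (fun x : Rn n => cauchyKernel (shift x z)) x (EuclideanSpace.single k 1) *
        ((e k : Cl n) * h x)) = fun _ => 0 := by
    funext x
    by_cases hx : x ∈ singularPoints z
    · have : h x = 0 := by
        by_contra h0
        exact hs (subset_tsupport h h0) hx
      simp [this]
    · simp only [← mul_assoc]
      rw [← Finset.sum_mul, sum_fderiv_cauchyKernel z hx, zero_mul]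
  rw [ea, integral_finsetSum _ fun k _ => (h1 k).2.1]
  have h3 : ∀ k : Fin n, ∫ x, cauchyKernel (shift x z) *
      ((e k : Cl n) * fderiv ℝ h x (EuclideanSpace.single k 1)) =
      -∫ x, fderiv ℝ (fun x : Rn n => cauchyKernel (shift x z)) x (EuclideanSpace.single k 1) *
        ((e k : Cl n) * h x) := fun k => by rw [(h1 k).2.2, neg_neg]
  simp only [h3]
  rw [Finset.sum_neg_distrib, ← integral_finsetSum _ fun k _ => (h1 k).1, eb]
  simp

/-- The real part of a complex vector. -/
def rePart : Rn n := WithLp.toLp 2 fun i => (z i).re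

/-- The imaginary part of a complex vector. -/
def imPart : Rn n := WithLp.toLp 2 fun i => (z i).im

theorem quad_eq (x : Rn n) : quad z x = ((‖x - rePart z‖ ^ 2 - ‖imPart z‖ ^ 2 : ℝ) : ℂ) -
    ((2 * inner ℝ (x - rePart z) (imPart z) : ℝ) : ℂ) * Complex.I := by
  rw [EuclideanSpace.real_norm_sq_eq, EuclideanSpace.real_norm_sq_eq, PiLp.inner_apply]
  push_cast
  rw [quad, ← Finset.sum_sub_distrib, Finset.mul_sum, Finset.sum_mul, ← Finset.sum_sub_distrib]
  refine Finset.sum_congr rfl fun i _ => ?_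
  simp only [shift, rePart, imPart, PiLp.sub_apply, Complex.ofReal_sub]
  conv_lhs => rw [← Complex.re_add_im (z i)]
  simp only [RCLike.inner_apply, conj_trivial, Complex.ofReal_mul, Complex.ofReal_sub]
  linear_combination ((z i).im : ℂ) ^ 2 * Complex.I_sq

theorem quad_re (x : Rn n) : (quad z x).re = ‖x - rePart z‖ ^ 2 - ‖imPart z‖ ^ 2 := by
  rw [quad_eq, Complex.sub_re, Complex.re_ofReal_mul, Complex.ofReal_re, Complex.I_re]; ring

theorem quad_im (x : Rn n) : (quad z x).im = -(2 * inner ℝ (x - rePart z) (imPart z)) := by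
  rw [quad_eq, Complex.sub_im, Complex.im_ofReal_mul, Complex.ofReal_im, Complex.I_im]; ring

/-- The imaginary part of the form vanishes only on the hyperplane through `Re z` orthogonal to `Im
z`. If `Im z = 0`, the form is positive except at the single point `Re z`. -/
theorem ae_quad_mem_slitPlane (hn : n ≠ 0) : ∀ᵐ x : Rn n, quad z x ∈ Complex.slitPlane := by
  by_cases hb : imPart z = 0
  · have : Nonempty (Fin n) := ⟨⟨0, Nat.pos_of_ne_zero hn⟩⟩
    have : Nontrivial (Rn n) := inferInstance
    have h0 : ∀ᵐ x : Rn n, x ≠ rePart z := by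
      rw [ae_iff]; simp
    filter_upwards [h0] with x hx
    rw [Complex.mem_slitPlane_iff]
    left
    rw [quad_re, hb, norm_zero]
    have : 0 < ‖x - rePart z‖ := norm_pos_iff.2 (sub_ne_zero.2 hx)
    have := pow_pos this 2
    linarith
  · have h0 : volume {x : Rn n | inner ℝ (x - rePart z) (imPart z) = 0} = 0 := by
      have h1 : volume ((ℝ ∙ imPart z)ᗮ : Set (Rn n)) = 0 := by
        refine Measure.addHaar_submodule _ _ fun h => hb ?_
        have : imPart z ∈ ((ℝ ∙ imPart z)ᗮ) := by rw [h]; trivial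
        rw [Submodule.mem_orthogonal_singleton_iff_inner_right] at this
        exact inner_self_eq_zero.1 this
      have h2 : {x : Rn n | inner ℝ (x - rePart z) (imPart z) = 0} =
          (fun x => x - rePart z) ⁻¹' ((ℝ ∙ imPart z)ᗮ : Set (Rn n)) := by
        ext x
        simp only [Set.mem_ofPred_eq, Set.mem_preimage, SetLike.mem_coe,
          Submodule.mem_orthogonal_singleton_iff_inner_left]
      rw [h2, (measurePreserving_sub_right volume (rePart z)).measure_preimage
        (Submodule.closed_of_finiteDimensional _).measurableSet.nullMeasurableSet, h1]
    have h3 : ∀ᵐ x : Rn n, inner ℝ (x - rePart z) (imPart z) ≠ 0 := by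
      rw [ae_iff]; simpa using h0
    filter_upwards [h3] with x hx
    rw [Complex.mem_slitPlane_iff]
    right
    rw [quad_im]
    exact neg_ne_zero.2 (mul_ne_zero two_ne_zero hx)

theorem regPotential_eq (ε : ℝ) (h : Rn n → Cl n) : regPotential z ε h =
    ∫ x in {x : Rn n | ε < (croot (quad z x)).re}, potential (shift x z) • h x := rfl

theorem measurable_quad : Measurable (quad z) := (contDiff_quad z).continuous.measurable

theorem measurableSet_lt_croot (ε : ℝ) : MeasurableSet {x : Rn n | ε < (croot (quad z x)).re} :=
  measurableSet_lt measurable_const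
    (Complex.measurable_re.comp (measurable_croot.comp (measurable_quad z)))

theorem tendsto_setIntegral_lt_croot (hn : n ≠ 0) {f : Rn n → Cl n} (hf : Integrable f) :
    Tendsto (fun ε : ℝ => ∫ x in {x : Rn n | ε < (croot (quad z x)).re}, f x) (𝓝[>] 0)
      (𝓝 (∫ x, f x)) := by
  simp_rw [← integral_indicator (measurableSet_lt_croot z _)]
  refine tendsto_integral_filter_of_dominated_convergence (fun x => ‖f x‖) ?_ ?_ hf.norm ?_
  · exact Eventually.of_forall fun ε =>
      hf.aestronglyMeasurable.indicator (measurableSet_lt_croot z ε)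
  · exact Eventually.of_forall fun ε => Eventually.of_forall fun x => norm_indicator_le_norm_self _ _
  · filter_upwards [ae_quad_mem_slitPlane z hn] with x hx
    refine tendsto_const_nhds.congr' ?_
    have h1 : ∀ᶠ ε : ℝ in 𝓝[>] 0, ε < (croot (quad z x)).re :=
      eventually_nhdsWithin_of_eventually_nhds (eventually_lt_nhds (croot_re_pos hx))
    filter_upwards [h1] with ε hε
    rw [Set.indicator_of_mem (by exact hε)]

/-- Off the singular points the generalized Cauchy kernel is the function `cauchyKernel`. -/
theorem tendsto_regCauchy_of_tsupport (hn : n ≠ 0) {h : Rn n → Cl n} (hh : ContDiff ℝ 1 h)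
    (hc : HasCompactSupport h) (hs : tsupport h ⊆ (singularPoints z)ᶜ) :
    Tendsto (fun ε => regCauchy z ε h) (𝓝[>] 0) (𝓝 (∫ x, cauchyKernel (shift x z) * h x)) := by
  obtain ⟨h1, -, h3⟩ := integral_potential_smul_dirac z hh hc hs
  have h4 := (tendsto_setIntegral_lt_croot z hn h1).neg
  rw [h3, neg_neg] at h4
  exact h4

/-- The equation `Δφ = DC` in weak form. It is exact at every `ε`, because all derivatives stand on
the test function and only `D² = Δ` is used. -/
theorem regSource_eq_neg_regCauchy (ε : ℝ) {h : Rn n → Cl n} (hh : ContDiff ℝ 2 h) :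
    regSource z ε h = -regCauchy z ε (dirac h) := by
  rw [regSource, regCauchy, neg_neg, dirac_dirac hh]

/-- Off the singular points the extended source vanishes. -/
theorem tendsto_regSource_of_tsupport (hn : n ≠ 0) {h : Rn n → Cl n} (hh : ContDiff ℝ 2 h)
    (hc : HasCompactSupport h) (hs : tsupport h ⊆ (singularPoints z)ᶜ) :
    Tendsto (fun ε => regSource z ε h) (𝓝[>] 0) (𝓝 0) := by
  have hd : ContDiff ℝ 1 (dirac h) := contDiff_dirac (m := 1) (k := 2) hh (by norm_num)
  have h1 := (tendsto_regCauchy_of_tsupport z hn hd (hasCompactSupport_dirac hc)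
    ((tsupport_dirac_subset h).trans hs)).neg
  rw [integral_cauchyKernel_mul_dirac z (hh.of_le (by norm_num)) hc hs, neg_zero] at h1
  exact h1.congr fun ε => (regSource_eq_neg_regCauchy z ε hh).symm

end


/-! ### Singular integrals in the plane -/

theorem hasDerivAt_inv_croot_pow (j : ℕ) {ζ : ℂ} (h : ζ ∈ Complex.slitPlane) :
    HasDerivAt (fun ζ => (croot ζ ^ j)⁻¹) (-(j / 2) * (croot ζ ^ (j + 2))⁻¹) ζ := by
  have h0 : croot ζ ≠ 0 := croot_ne_zero (Complex.slitPlane_ne_zero h)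
  refine (((hasDerivAt_croot h).fun_pow j).fun_inv (pow_ne_zero _ h0)).congr_deriv ?_
  rcases j with _ | j
  · simp
  · rw [Nat.add_sub_cancel, show j + 1 + 2 = j + 3 by ring]
    field_simp
    ring

/-- The complex number `u - 2 i β s`. -/
def planar (β u s : ℝ) : ℂ := (u : ℂ) - ((2 * β * s : ℝ) : ℂ) * Complex.I

theorem planar_re (β u s : ℝ) : (planar β u s).re = u := by simp [planar]

theorem planar_im (β u s : ℝ) : (planar β u s).im = -(2 * β * s) := by simp [planar]

theorem planar_mem_slitPlane {β s : ℝ} (hβ : β ≠ 0) (hs : s ≠ 0) (u : ℝ) :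
    planar β u s ∈ Complex.slitPlane := by
  rw [Complex.mem_slitPlane_iff, planar_im]
  right
  simp [hβ, hs]

theorem continuous_planar (β : ℝ) : Continuous (fun p : ℝ × ℝ => planar β p.1 p.2) := by
  unfold planar; fun_prop

theorem hasDerivAt_planar (β u s : ℝ) : HasDerivAt (fun u => planar β u s) 1 u := by
  unfold planar
  simpa using (Complex.ofRealCLM.hasDerivAt (x := u)).sub_const (((2 * β * s : ℝ) : ℂ) * Complex.I)

theorem hasDerivAt_inv_croot_pow_planar (j : ℕ) {β s : ℝ} (hβ : β ≠ 0) (hs : s ≠ 0) (u : ℝ) :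
    HasDerivAt (fun u => (croot (planar β u s) ^ j)⁻¹)
      (-(j / 2) * (croot (planar β u s) ^ (j + 2))⁻¹) u := by
  have := (hasDerivAt_inv_croot_pow j (planar_mem_slitPlane hβ hs u)).comp u
    (hasDerivAt_planar β u s)
  rw [mul_one] at this
  exact this

theorem continuous_inv_croot_pow_planar (j : ℕ) {β s : ℝ} (hβ : β ≠ 0) (hs : s ≠ 0) :
    Continuous (fun u => (croot (planar β u s) ^ j)⁻¹) :=
  continuous_iff_continuousAt.2 fun u => (hasDerivAt_inv_croot_pow_planar j hβ hs u).continuousAt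

/-- Writing the root as `p + iq`, one has `u = p² - q²` and `pq = -βs`. Eliminating `q` on the curve
`p = ε` gives a parabola in the `(u, s)` plane, so the cutoff region meets each line `s = const` in
a half-line. -/
theorem lt_croot_planar_iff {β ε s : ℝ} (hβ : β ≠ 0) (hε : 0 < ε) (hs : s ≠ 0) (u : ℝ) :
    ε < (croot (planar β u s)).re ↔ ε ^ 2 - (β * s / ε) ^ 2 < u := by
  have hp := croot_re_pos (planar_mem_slitPlane hβ hs u)
  have hsq := croot_sq (planar β u s)
  set γ := croot (planar β u s)
  have h1 : γ.re ^ 2 - γ.im ^ 2 = u := by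
    rw [← planar_re β u s, ← hsq, sq γ, Complex.mul_re]; ring
  have h2 : γ.re * γ.im = -(β * s) := by
    have : 2 * (γ.re * γ.im) = -(2 * β * s) := by
      rw [← planar_im β u s, ← hsq, sq γ, Complex.mul_im]; ring
    linarith
  -- After substituting `βs = -pq`, the signed distance from the parabola has the factor `p² - ε²`,
  -- and the other factor is positive.
  have h3 : u - (ε ^ 2 - (β * s / ε) ^ 2) = (γ.re ^ 2 - ε ^ 2) * (1 + γ.im ^ 2 / ε ^ 2) := by
    have : β * s / ε = -(γ.re * γ.im) / ε := by rw [h2]; ring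
    rw [this, ← h1]
    field_simp
    ring
  have h4 : 0 < 1 + γ.im ^ 2 / ε ^ 2 := by positivity
  rw [← sub_pos (b := ε ^ 2 - (β * s / ε) ^ 2), h3, mul_pos_iff_of_pos_right h4, sub_pos,
    pow_lt_pow_iff_left₀ hε.le hp.le two_ne_zero]

theorem croot_planar_edge {β ε : ℝ} (hε : 0 < ε) (s : ℝ) :
    croot (planar β (ε ^ 2 - (β * s / ε) ^ 2) s) =
      (ε : ℂ) - ((β * s / ε : ℝ) : ℂ) * Complex.I := by
  have h1 : planar β (ε ^ 2 - (β * s / ε) ^ 2) s =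
      ((ε : ℂ) - ((β * s / ε : ℝ) : ℂ) * Complex.I) ^ 2 := by
    have : (2 * β * s : ℝ) = 2 * (ε * (β * s / ε)) := by field_simp
    rw [planar, this]
    push_cast
    linear_combination (-(((β : ℂ) * s / ε) ^ 2)) * Complex.I_sq
  rw [h1, croot_eq_of_sq]
  simpa using hε

theorem integrable_inv_sqrt_abs (R : ℝ) :
    IntegrableOn (fun u : ℝ => (√|u|)⁻¹) (Set.Icc (-R) R) := by
  have h1 : IntegrableOn (fun u : ℝ => u ^ (-(1 / 2) : ℝ)) (Set.Ioo 0 (|R| + 1)) :=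
    (intervalIntegral.integrableOn_Ioo_rpow_iff (by positivity)).2 (by norm_num)
  have h2 := h1.integrable_indicator measurableSet_Ioo
  have h3 := (h2.add h2.comp_neg).integrableOn (s := Set.Icc (-R) R)
  refine h3.congr ?_
  have h0 : ∀ᵐ u : ℝ ∂volume.restrict (Set.Icc (-R) R), u ≠ 0 :=
    ae_restrict_of_ae (by rw [ae_iff]; simp)
  filter_upwards [h0, ae_restrict_mem measurableSet_Icc] with u hu hu2
  have hR : |u| < |R| + 1 := by
    have := abs_le.2 hu2
    linarith [le_abs_self R]
  have h4 : ∀ x : ℝ, 0 < x → x ^ (-(1 / 2) : ℝ) = (√x)⁻¹ := fun x hx => by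
    rw [Real.rpow_neg hx.le, Real.sqrt_eq_rpow]
  rcases lt_or_gt_of_ne hu with h5 | h5
  · rw [abs_of_neg h5] at hR ⊢
    simp only [Pi.add_apply]
    rw [Set.indicator_of_notMem (by simp [h5.le]),
      Set.indicator_of_mem (by simp [h5]; exact hR), zero_add, h4 _ (by linarith)]
  · rw [abs_of_pos h5] at hR ⊢
    simp only [Pi.add_apply]
    rw [Set.indicator_of_mem (by simp [h5]; exact hR),
      Set.indicator_of_notMem (by simp [h5.le]), add_zero, h4 _ h5]

/-- From `a² + b² ≥ |a b|`. The two-dimensional singularity is dominated by a product of locally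
integrable singularities in `u` and in `s`. -/
theorem norm_inv_planar_le {β u s : ℝ} (hβ : β ≠ 0) (hu : u ≠ 0) (hs : s ≠ 0) :
    ‖planar β u s‖⁻¹ ≤ (√|u|)⁻¹ * ((√|2 * β|)⁻¹ * (√|s|)⁻¹) := by
  rw [← mul_inv, ← mul_inv, ← Real.sqrt_mul (abs_nonneg _), ← Real.sqrt_mul (abs_nonneg _)]
  refine inv_anti₀ (Real.sqrt_pos.2 (by positivity)) (Real.sqrt_le_iff.2 ⟨norm_nonneg _, ?_⟩)
  rw [← Complex.normSq_eq_norm_sq, Complex.normSq_apply, planar_re, planar_im, ← abs_mul,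
    ← abs_mul, abs_le]
  constructor <;> nlinarith [sq_nonneg (u + 2 * β * s), sq_nonneg (u - 2 * β * s), sq_nonneg u,
    sq_nonneg (2 * β * s)]

theorem norm_inv_croot_pow_le {j : ℕ} (hj : j ≤ 2) (ζ : ℂ) :
    ‖(croot ζ ^ j)⁻¹‖ ≤ 1 + ‖ζ‖ + ‖ζ‖⁻¹ := by
  have h1 := norm_croot_sq ζ
  have h0 := norm_nonneg (croot ζ)
  rw [norm_inv, norm_pow, ← h1]
  set r := ‖croot ζ‖
  have h2 : 0 ≤ (r ^ 2)⁻¹ := by positivity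
  interval_cases j
  · simp only [pow_zero, inv_one]; nlinarith
  · rw [pow_one]
    rcases h0.eq_or_lt with h | h
    · rw [← h]; simp
    · have : r⁻¹ * r = 1 := inv_mul_cancel₀ h.ne'
      have h3 : (r ^ 2)⁻¹ = r⁻¹ ^ 2 := by rw [inv_pow]
      rw [h3]
      nlinarith [sq_nonneg (r⁻¹ - 1), sq_nonneg r, inv_pos.2 h]
  · nlinarith

theorem norm_log_croot_le (ζ : ℂ) :
    ‖Complex.log (croot ζ)‖ ≤ 5 * (1 + ‖ζ‖ + ‖ζ‖⁻¹) := by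
  have h1 := norm_croot_sq ζ
  have h0 := norm_nonneg (croot ζ)
  have h2 : ‖Complex.log (croot ζ)‖ ≤ |Real.log ‖croot ζ‖| + Real.pi := by
    rw [← Complex.log_re]
    refine (Complex.norm_le_abs_re_add_abs_im _).trans (add_le_add le_rfl ?_)
    rw [Complex.log_im]; exact Complex.abs_arg_le_pi _
  have h3 : |Real.log ‖croot ζ‖| ≤ 1 + ‖ζ‖ + ‖ζ‖⁻¹ := by
    rcases h0.eq_or_lt with h | h
    · rw [← h]; simp; positivity
    · have h4 : |Real.log (‖croot ζ‖ ^ 2)| ≤ ‖ζ‖ + ‖ζ‖⁻¹ := by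
        rw [h1]
        have hz : 0 < ‖ζ‖ := by rw [← h1]; positivity
        have := Real.log_le_sub_one_of_pos hz
        have h5 := Real.log_le_sub_one_of_pos (inv_pos.2 hz)
        rw [Real.log_inv] at h5
        have := inv_pos.2 hz
        rw [abs_le]; constructor <;> linarith
      rw [Real.log_pow, abs_mul] at h4
      simp only [Nat.cast_ofNat, Nat.abs_ofNat] at h4
      have := abs_nonneg (Real.log ‖croot ζ‖)
      linarith
  have h6 : 0 ≤ ‖ζ‖ + ‖ζ‖⁻¹ := by positivity
  have := Real.pi_le_four
  linarith

theorem ae_fst_ne_snd_ne : ∀ᵐ p : ℝ × ℝ, p.1 ≠ 0 ∧ p.2 ≠ 0 := by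
  have h0 : ∀ᵐ q : ℝ, q ≠ 0 := by rw [ae_iff]; simp
  exact (Measure.quasiMeasurePreserving_fst.ae h0).and (Measure.quasiMeasurePreserving_snd.ae h0)

theorem exists_box {F : Type*} [NormedAddCommGroup F] {H : ℝ × ℝ → F} (hc : HasCompactSupport H) :
    ∃ R : ℝ, 0 < R ∧ ∀ p, p ∉ Set.Icc (-R) R ×ˢ Set.Icc (-R) R → H p = 0 := by
  obtain ⟨R, hR⟩ := hc.isCompact.isBounded.subset_closedBall 0
  refine ⟨max R 1, by positivity, fun p hp => ?_⟩
  by_contra h0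
  have h1 := hR (subset_tsupport H h0)
  rw [mem_closedBall_zero_iff, Prod.norm_def, max_le_iff, Real.norm_eq_abs, Real.norm_eq_abs] at h1
  exact hp ⟨abs_le.1 (h1.1.trans (le_max_left _ _)), abs_le.1 (h1.2.trans (le_max_left _ _))⟩

section Base

variable {F : Type*} [NormedAddCommGroup F] [NormedSpace ℂ F]

theorem integrable_planar {β : ℝ} (hβ : β ≠ 0) {κ : ℂ → ℂ} (hκm : Measurable κ) {A : ℝ}
    (hκ : ∀ ζ, ‖κ ζ‖ ≤ A * (1 + ‖ζ‖ + ‖ζ‖⁻¹)) {H : ℝ × ℝ → F} (hH : Continuous H)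
    (hc : HasCompactSupport H) : Integrable (fun p : ℝ × ℝ => κ (planar β p.1 p.2) • H p) := by
  obtain ⟨R, hR0, hR⟩ := exists_box hc
  obtain ⟨C, hC⟩ := hH.bounded_above_of_compact_support hc
  obtain ⟨Z, hZ⟩ := ((isCompact_Icc (a := -R) (b := R)).prod (isCompact_Icc (a := -R) (b := R))
    ).exists_bound_of_continuousOn (continuous_planar β).continuousOn
  have hA : 0 ≤ A := by
    have := (norm_nonneg _).trans (hκ 1)
    simp at this; linarith
  have hC0 : 0 ≤ C := (norm_nonneg _).trans (hC 0)
  set g : ℝ → ℝ := Set.indicator (Set.Icc (-R) R) fun u => (√|u|)⁻¹ with hg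
  set b : ℝ → ℝ := Set.indicator (Set.Icc (-R) R) fun _ => 1 with hb
  have ig : Integrable g := (integrable_inv_sqrt_abs R).integrable_indicator measurableSet_Icc
  have ib : Integrable b :=
    (integrable_indicator_iff measurableSet_Icc).2 (integrableOn_const (by simp))
  have i1 : Integrable fun p : ℝ × ℝ => g p.1 * g p.2 := ig.mul_prod ig
  have i2 : Integrable fun p : ℝ × ℝ => b p.1 * b p.2 := ib.mul_prod ib
  have i3 : Integrable fun p : ℝ × ℝ => (A * (1 + Z) * C) * (b p.1 * b p.2) +
      (A * (√|2 * β|)⁻¹ * C) * (g p.1 * g p.2) := (i2.const_mul _).add (i1.const_mul _)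
  refine i3.mono' ?_ ?_
  · exact (hκm.comp (continuous_planar β).measurable).aestronglyMeasurable.smul
      hH.aestronglyMeasurable
  · filter_upwards [ae_fst_ne_snd_ne] with p hp
    by_cases hpb : p ∈ Set.Icc (-R) R ×ˢ Set.Icc (-R) R
    · have e1 : b p.1 = 1 := Set.indicator_of_mem hpb.1 _
      have e2 : b p.2 = 1 := Set.indicator_of_mem hpb.2 _
      have e3 : g p.1 = (√|p.1|)⁻¹ := Set.indicator_of_mem hpb.1 _
      have e4 : g p.2 = (√|p.2|)⁻¹ := Set.indicator_of_mem hpb.2 _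
      rw [e1, e2, e3, e4, norm_smul]
      have h1 := hκ (planar β p.1 p.2)
      have h2 := norm_inv_planar_le hβ hp.1 hp.2
      have h3 := hZ p hpb
      calc _ ≤ (A * (1 + Z + (√|p.1|)⁻¹ * ((√|2 * β|)⁻¹ * (√|p.2|)⁻¹))) * C := by
            refine mul_le_mul (h1.trans ?_) (hC p) (norm_nonneg _) ?_
            · gcongr
            · refine mul_nonneg hA ?_
              have := (norm_nonneg _).trans h3
              positivity
        _ = _ := by ring
    · rw [hR p hpb, smul_zero, norm_zero]
      have : 0 ≤ Z := (norm_nonneg _).trans (hZ (0, 0) (by simp [hR0.le]))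
      have hb0 : ∀ x, 0 ≤ b x := fun x => Set.indicator_nonneg (fun _ _ => zero_le_one) x
      have hg0 : ∀ x, 0 ≤ g x := fun x => Set.indicator_nonneg (fun _ _ => by positivity) x
      have := hb0 p.1; have := hb0 p.2; have := hg0 p.1; have := hg0 p.2
      positivity

end Base

/-! ### Boundary terms on the curve `Re γ = ε` -/

section Flux

variable {F : Type*} [NormedAddCommGroup F] [NormedSpace ℂ F]

/-- The oscillating integrals along the line `Re γ = ε` are small compared with `1 / ε`. -/
theorem tendsto_flux (j : ℕ) {K : ℝ × ℝ → F} (hK : ContDiff ℝ ∞ K) {R : ℝ}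
    (hR : ∀ ε ∈ Set.Icc (0 : ℝ) 1, ∀ q, R < |q| → K (ε, q) = 0) :
    Tendsto (fun ε : ℝ => (ε : ℂ) • ∫ q : ℝ, (((ε : ℂ) - (q : ℂ) * Complex.I) ^ (j + 1))⁻¹ • K (ε, q))
      (𝓝[>] 0) (𝓝 0) := by
  have hne : ∀ {ε : ℝ}, 0 < ε → ∀ q : ℝ, (ε : ℂ) - (q : ℂ) * Complex.I ≠ 0 := fun hε q h => by
    have := congrArg Complex.re h
    simp at this
    exact hε.ne' this
  have hcs : ∀ {K : ℝ × ℝ → F} (_ : ∀ ε ∈ Set.Icc (0 : ℝ) 1, ∀ q, R < |q| → K (ε, q) = 0) {ε : ℝ}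
      (_ : ε ∈ Set.Icc (0 : ℝ) 1), HasCompactSupport (fun q => K (ε, q)) := fun hR ε hε =>
    HasCompactSupport.intro (isCompact_Icc (a := -R) (b := R)) fun q hq => hR ε hε q (by
      by_contra h
      exact hq (abs_le.1 (not_lt.1 h)))
  have hIoc : ∀ᶠ ε : ℝ in 𝓝[>] 0, ε ∈ Set.Ioc (0 : ℝ) 1 := Ioc_mem_nhdsGT one_pos
  have hcont : ∀ {ε : ℝ}, 0 < ε → ∀ j : ℕ, Continuous fun q : ℝ =>
      (((ε : ℂ) - (q : ℂ) * Complex.I) ^ j)⁻¹ := fun hε j =>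
    Continuous.inv₀ (by fun_prop) fun q => pow_ne_zero _ (hne hε q)
  induction j generalizing K with
  | zero =>
    obtain ⟨C, hC⟩ := (isCompact_Icc.prod isCompact_Icc :
      IsCompact (Set.Icc (0 : ℝ) 1 ×ˢ Set.Icc (-R) R)).exists_bound_of_continuousOn
      hK.continuous.continuousOn
    simp_rw [← integral_smul]
    have hz : ∀ q : ℝ, (0 : F) = 0 := fun _ => rfl
    rw [show (0 : F) = ∫ _ : ℝ, (0 : F) by simp]
    refine tendsto_integral_filter_of_dominated_convergence
      (Set.indicator (Set.Icc (-R) R) fun _ => C) ?_ ?_ ?_ ?_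
    · filter_upwards [hIoc] with ε hε
      have : Continuous fun q : ℝ => K (ε, q) := hK.continuous.comp (by fun_prop)
      exact (((hcont hε.1 (0 + 1)).smul this).const_smul _).aestronglyMeasurable
    · filter_upwards [hIoc] with ε hε
      refine Eventually.of_forall fun q => ?_
      by_cases hq : q ∈ Set.Icc (-R) R
      · rw [Set.indicator_of_mem hq, smul_smul, norm_smul]
        -- For the first power the factor `ε / (ε - iq)` is bounded by one and tends to zero for `q
        -- ≠ 0`, so dominated convergence suffices.
        have h1 : ‖(ε : ℂ) * (((ε : ℂ) - (q : ℂ) * Complex.I) ^ (0 + 1))⁻¹‖ ≤ 1 := by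
          rw [zero_add, pow_one, norm_mul, norm_inv, ← div_eq_mul_inv,
            div_le_one (norm_pos_iff.2 (hne hε.1 q))]
          have := Complex.abs_re_le_norm ((ε : ℂ) - (q : ℂ) * Complex.I)
          simpa using this
        calc _ ≤ 1 * C := mul_le_mul h1 (hC (ε, q) ⟨⟨hε.1.le, hε.2⟩, hq⟩) (norm_nonneg _) zero_le_one
          _ = C := one_mul C
      · rw [Set.indicator_of_notMem hq, hR ε ⟨hε.1.le, hε.2⟩ q (by
          by_contra h
          exact hq (abs_le.1 (not_lt.1 h)))]
        simp
    · exact (integrable_indicator_iff measurableSet_Icc).2 (integrableOn_const (by simp))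
    · have h0 : ∀ᵐ q : ℝ, q ≠ 0 := by rw [ae_iff]; simp
      filter_upwards [h0] with q hq
      have h1 : ContinuousAt (fun ε : ℝ => (ε : ℂ) •
          (((ε : ℂ) - (q : ℂ) * Complex.I) ^ (0 + 1))⁻¹ • K (ε, q)) 0 := by
        refine ContinuousAt.smul (by fun_prop) (ContinuousAt.smul ?_ ?_)
        · refine ContinuousAt.inv₀ (by fun_prop) ?_
          simp [hq]
        · exact (hK.continuous.comp (by fun_prop : Continuous fun ε : ℝ => (ε, q))).continuousAt
      have h2 := h1.tendsto
      simp only [Complex.ofReal_zero, zero_smul] at h2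
      exact h2.mono_left nhdsWithin_le_nhds
  | succ j ih =>
    set K' : ℝ × ℝ → F := fun p => fderiv ℝ K p (0, 1) with hK'
    have hd : ∀ ε q, HasDerivAt (fun q => K (ε, q)) (K' (ε, q)) q := fun ε q => by
      have h1 : HasDerivAt (fun q : ℝ => (ε, q)) ((0 : ℝ), (1 : ℝ)) q :=
        (hasDerivAt_const q ε).prodMk (hasDerivAt_id q)
      exact ((hK.differentiable (by simp)) (ε, q)).hasFDerivAt.comp_hasDerivAt q h1
    have hK's : ContDiff ℝ ∞ K' := (hK.fderiv_right (m := ∞) (by simp)).clm_apply contDiff_const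
    have hK'R : ∀ ε ∈ Set.Icc (0 : ℝ) 1, ∀ q, R < |q| → K' (ε, q) = 0 := fun ε hε q hq => by
      have h1 : (fun q => K (ε, q)) =ᶠ[𝓝 q] fun _ => 0 := by
        filter_upwards [(isOpen_lt continuous_const continuous_abs).mem_nhds hq] with q' hq'
        exact hR ε hε q' hq'
      rw [← (hd ε q).deriv, h1.deriv_eq, deriv_const]
    -- The derivative of `(ε - iq)^(-(j+1))` in `q` is `(j+1) i (ε - iq)^(-(j+2))`. Integration by
    -- parts therefore lowers the exponent by one and moves a derivative to `K`, with this constant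
    -- in front.
    have h1 := (ih hK's hK'R).const_smul (-((j + 1 : ℂ) * Complex.I)⁻¹)
    rw [smul_zero] at h1
    refine h1.congr' ?_
    filter_upwards [hIoc] with ε hε
    have hε' : ε ∈ Set.Icc (0 : ℝ) 1 := ⟨hε.1.le, hε.2⟩
    have hKc : Continuous fun q : ℝ => K (ε, q) := hK.continuous.comp (by fun_prop)
    have hKc' : Continuous fun q : ℝ => K' (ε, q) := hK's.continuous.comp (by fun_prop)
    have i1 : Integrable fun q : ℝ => (((ε : ℂ) - (q : ℂ) * Complex.I) ^ (j + 1))⁻¹ • K (ε, q) :=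
      ((hcont hε.1 _).smul hKc).integrable_of_hasCompactSupport (hcs hR hε').smul_left
    have i2 : Integrable fun q : ℝ => (((ε : ℂ) - (q : ℂ) * Complex.I) ^ (j + 1))⁻¹ • K' (ε, q) :=
      ((hcont hε.1 _).smul hKc').integrable_of_hasCompactSupport (hcs hK'R hε').smul_left
    have i3 : Integrable fun q : ℝ => (((ε : ℂ) - (q : ℂ) * Complex.I) ^ (j + 1 + 1))⁻¹ • K (ε, q) :=
      ((hcont hε.1 _).smul hKc).integrable_of_hasCompactSupport (hcs hR hε').smul_left
    have i4 : Integrable fun q : ℝ => ((j + 1 : ℂ) * Complex.I) •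
      (((ε : ℂ) - (q : ℂ) * Complex.I) ^ (j + 1 + 1))⁻¹ • K (ε, q) := i3.smul _
    have hdd : ∀ q : ℝ, HasDerivAt (fun q : ℝ => (((ε : ℂ) - (q : ℂ) * Complex.I) ^ (j + 1))⁻¹ • K (ε, q))
        ((((ε : ℂ) - (q : ℂ) * Complex.I) ^ (j + 1))⁻¹ • K' (ε, q) + ((j + 1 : ℂ) * Complex.I) •
          (((ε : ℂ) - (q : ℂ) * Complex.I) ^ (j + 1 + 1))⁻¹ • K (ε, q)) q := fun q => by
      have a1 : HasDerivAt (fun q : ℝ => (ε : ℂ) - (q : ℂ) * Complex.I) (-Complex.I) q := by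
        simpa using ((Complex.ofRealCLM.hasDerivAt (x := q)).mul_const Complex.I).const_sub (ε : ℂ)
      have a2 := (a1.fun_pow (j + 1)).fun_inv (pow_ne_zero _ (hne hε.1 q))
      refine (a2.smul (hd ε q)).congr_deriv ?_
      congr 1
      rw [smul_smul]
      congr 1
      rw [Nat.add_sub_cancel]
      have := hne hε.1 q
      field_simp
      push_cast
      ring
    have h2 := integral_eq_zero_of_hasDerivAt_of_integrable hdd (i2.add i4) i1
    rw [integral_add i2 i4, integral_smul] at h2
    have h3 : (j + 1 : ℂ) * Complex.I ≠ 0 := by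
      refine mul_ne_zero ?_ Complex.I_ne_zero
      exact_mod_cast Nat.succ_ne_zero j
    rw [smul_comm]
    congr 1
    rw [eq_neg_of_add_eq_zero_left h2, smul_neg, neg_smul, neg_neg, smul_smul, inv_mul_cancel₀ h3,
      one_smul]

end Flux


/-! ### Convergence of the regularized planar integrals -/

section

variable {F : Type*} [NormedAddCommGroup F] [NormedSpace ℂ F]

/-- A smooth weight that vanishes near zero and is one away from zero. -/
structure IsAxisWeight (w : ℝ → ℝ) : Prop where
  smooth : ContDiff ℝ ∞ w
  norm_le : ∀ s, |w s| ≤ 1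
  eq_zero : ∀ s, |s| ≤ 1 → w s = 0
  eq_one : ∀ s, 2 ≤ |s| → w s = 1

theorem IsAxisWeight.tendsto {w : ℝ → ℝ} (hw : IsAxisWeight w) {s : ℝ} (hs : s ≠ 0) :
    Tendsto (fun τ : ℝ => w (s / τ)) (𝓝[>] 0) (𝓝 1) := by
  refine tendsto_const_nhds.congr' ?_
  have h1 : ∀ᶠ τ : ℝ in 𝓝[>] 0, τ < |s| / 2 :=
    eventually_nhdsWithin_of_eventually_nhds (eventually_lt_nhds (by positivity))
  filter_upwards [h1, self_mem_nhdsWithin] with τ hτ h0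
  have h0' : 0 < τ := h0
  rw [hw.eq_one]
  rw [abs_div, abs_of_pos h0', le_div_iff₀ h0']
  linarith

/-- The kernel `κ` of the complex variable `u - 2 i β s` defines a generalized function of `u, s`
by cutting off either where `Re √ ≤ ε` or near the axis `s = 0`, with the same limit. -/
def PlanarLimit (β : ℝ) (κ : ℂ → ℂ) (H : ℝ × ℝ → F) (L : F) : Prop :=
  Tendsto (fun ε : ℝ => ∫ p in {p : ℝ × ℝ | ε < (croot (planar β p.1 p.2)).re},
    κ (planar β p.1 p.2) • H p) (𝓝[>] 0) (𝓝 L) ∧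
  ∀ w : ℝ → ℝ, IsAxisWeight w → Tendsto (fun τ : ℝ => ∫ p : ℝ × ℝ,
    (w (p.2 / τ) : ℂ) • κ (planar β p.1 p.2) • H p) (𝓝[>] 0) (𝓝 L)

theorem measurableSet_lt_croot_planar (β ε : ℝ) :
    MeasurableSet {p : ℝ × ℝ | ε < (croot (planar β p.1 p.2)).re} :=
  measurableSet_lt measurable_const
    (Complex.measurable_re.comp (measurable_croot.comp (continuous_planar β).measurable))

theorem planarLimit_of_integrable {β : ℝ} (hβ : β ≠ 0) {κ : ℂ → ℂ} {H : ℝ × ℝ → F}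
    (hi : Integrable fun p : ℝ × ℝ => κ (planar β p.1 p.2) • H p) :
    PlanarLimit β κ H (∫ p : ℝ × ℝ, κ (planar β p.1 p.2) • H p) := by
  constructor
  · simp_rw [← integral_indicator (measurableSet_lt_croot_planar β _)]
    refine tendsto_integral_filter_of_dominated_convergence
      (fun p => ‖κ (planar β p.1 p.2) • H p‖) ?_ ?_ hi.norm ?_
    · exact Eventually.of_forall fun ε =>
        hi.aestronglyMeasurable.indicator (measurableSet_lt_croot_planar β ε)
    · exact Eventually.of_forall fun ε => Eventually.of_forall fun x =>
        norm_indicator_le_norm_self _ _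
    · filter_upwards [ae_fst_ne_snd_ne] with p hp
      refine tendsto_const_nhds.congr' ?_
      have h1 : ∀ᶠ ε : ℝ in 𝓝[>] 0, ε < (croot (planar β p.1 p.2)).re :=
        eventually_nhdsWithin_of_eventually_nhds
          (eventually_lt_nhds (croot_re_pos (planar_mem_slitPlane hβ hp.2 p.1)))
      filter_upwards [h1] with ε hε
      rw [Set.indicator_of_mem (by exact hε)]
  · intro w hw
    refine tendsto_integral_filter_of_dominated_convergence
      (fun p => ‖κ (planar β p.1 p.2) • H p‖) ?_ ?_ hi.norm ?_
    · refine Eventually.of_forall fun τ => ?_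
      have : Measurable fun p : ℝ × ℝ => (w (p.2 / τ) : ℂ) :=
        Complex.measurable_ofReal.comp (hw.smooth.continuous.measurable.comp (by fun_prop))
      exact this.aestronglyMeasurable.smul hi.aestronglyMeasurable
    · refine Eventually.of_forall fun τ => Eventually.of_forall fun p => ?_
      rw [norm_smul, Complex.norm_real]
      exact mul_le_of_le_one_left (norm_nonneg _) (hw.norm_le _)
    · filter_upwards [ae_fst_ne_snd_ne] with p hp
      have h1 := (Complex.continuous_ofReal.tendsto 1).comp (hw.tendsto hp.2)
      have h2 := h1.smul_const (κ (planar β p.1 p.2) • H p)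
      simpa using h2

theorem measurable_inv_croot_pow (j : ℕ) : Measurable fun ζ => (croot ζ ^ j)⁻¹ :=
  (measurable_croot.pow_const j).inv

/-- The kernel is integrable after cutting off where `Re √ ≤ ε`. -/
theorem integrableOn_lt_croot_planar (j : ℕ) (β : ℝ) {ε : ℝ} (hε : 0 < ε) {H : ℝ × ℝ → F}
    (hH : Continuous H) (hc : HasCompactSupport H) :
    IntegrableOn (fun p : ℝ × ℝ => (croot (planar β p.1 p.2) ^ j)⁻¹ • H p)
      {p : ℝ × ℝ | ε < (croot (planar β p.1 p.2)).re} := by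
  have hi := (hH.integrable_of_hasCompactSupport (μ := volume) hc).norm.const_mul ((ε ^ j)⁻¹)
  refine Integrable.mono' hi.integrableOn ?_ ?_
  · exact ((measurable_inv_croot_pow j).comp (continuous_planar β).measurable
      ).aestronglyMeasurable.smul hH.aestronglyMeasurable
  · filter_upwards [ae_restrict_mem (measurableSet_lt_croot_planar β ε)] with p hp
    rw [norm_smul, norm_inv, norm_pow]
    have h1 : ε ≤ ‖croot (planar β p.1 p.2)‖ :=
      (le_of_lt hp).trans ((le_abs_self _).trans (Complex.abs_re_le_norm _))
    gcongr

/-- The kernel is integrable after cutting off near the axis. -/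
theorem integrable_axisWeight_planar (j : ℕ) {β : ℝ} (hβ : β ≠ 0) {w : ℝ → ℝ}
    (hw : IsAxisWeight w) {τ : ℝ} (hτ : 0 < τ) {H : ℝ × ℝ → F}
    (hH : Continuous H) (hc : HasCompactSupport H) :
    Integrable (fun p : ℝ × ℝ => (w (p.2 / τ) : ℂ) • (croot (planar β p.1 p.2) ^ j)⁻¹ • H p) := by
  have hi := (hH.integrable_of_hasCompactSupport (μ := volume) hc).norm.const_mul
    ((√(|2 * β| * τ) ^ j)⁻¹)
  refine Integrable.mono' hi ?_ ?_
  · have : Measurable fun p : ℝ × ℝ => (w (p.2 / τ) : ℂ) :=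
      Complex.measurable_ofReal.comp (hw.smooth.continuous.measurable.comp (by fun_prop))
    exact this.aestronglyMeasurable.smul (((measurable_inv_croot_pow j).comp
      (continuous_planar β).measurable).aestronglyMeasurable.smul hH.aestronglyMeasurable)
  · refine Eventually.of_forall fun p => ?_
    by_cases hp : |p.2 / τ| ≤ 1
    · rw [hw.eq_zero _ hp]
      simp only [Complex.ofReal_zero, zero_smul, norm_zero]
      positivity
    · rw [norm_smul, norm_smul, Complex.norm_real, norm_inv, norm_pow]
      have h1 : √(|2 * β| * τ) ≤ ‖croot (planar β p.1 p.2)‖ := by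
        refine Real.sqrt_le_iff.2 ⟨norm_nonneg _, ?_⟩
        rw [norm_croot_sq]
        have h2 := Complex.abs_im_le_norm (planar β p.1 p.2)
        rw [planar_im, abs_neg, abs_mul] at h2
        rw [not_le, abs_div, abs_of_pos hτ, one_lt_div hτ] at hp
        exact (mul_le_mul_of_nonneg_left hp.le (abs_nonneg _)).trans h2
      have h3 : 0 < √(|2 * β| * τ) := Real.sqrt_pos.2 (by positivity)
      calc _ ≤ 1 * ((√(|2 * β| * τ) ^ j)⁻¹ * ‖H p‖) := by
            refine mul_le_mul (hw.norm_le _) ?_ (by positivity) zero_le_one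
            gcongr
        _ = _ := one_mul _

/-- Integration by parts along a line parallel to the real axis. -/
theorem integral_inv_croot_pow_add_two {j : ℕ} (hj : j ≠ 0) {β s : ℝ} (hβ : β ≠ 0) (hs : s ≠ 0)
    {h h' : ℝ → F} (hd : ∀ u, HasDerivAt h (h' u) u) (hh : Continuous h) (hh' : Continuous h')
    (hc : HasCompactSupport h) (hc' : HasCompactSupport h') :
    ∫ u, (croot (planar β u s) ^ (j + 2))⁻¹ • h u =
      (2 / j : ℂ) • ∫ u, (croot (planar β u s) ^ j)⁻¹ • h' u := by
  have c1 := continuous_inv_croot_pow_planar j hβ hs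
  have c2 := continuous_inv_croot_pow_planar (j + 2) hβ hs
  have i1 : Integrable fun u => (croot (planar β u s) ^ j)⁻¹ • h u :=
    (c1.smul hh).integrable_of_hasCompactSupport (μ := volume) hc.smul_left
  have i2 : Integrable fun u => (croot (planar β u s) ^ j)⁻¹ • h' u :=
    (c1.smul hh').integrable_of_hasCompactSupport (μ := volume) hc'.smul_left
  have i3 : Integrable fun u => (croot (planar β u s) ^ (j + 2))⁻¹ • h u :=
    (c2.smul hh).integrable_of_hasCompactSupport (μ := volume) hc.smul_left
  have i4 : Integrable fun u => (-(j / 2 : ℂ)) • (croot (planar β u s) ^ (j + 2))⁻¹ • h u :=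
    i3.smul _
  have h1 : ∀ u, HasDerivAt (fun u => (croot (planar β u s) ^ j)⁻¹ • h u)
      ((croot (planar β u s) ^ j)⁻¹ • h' u +
        (-(j / 2 : ℂ)) • (croot (planar β u s) ^ (j + 2))⁻¹ • h u) u := fun u => by
    refine ((hasDerivAt_inv_croot_pow_planar j hβ hs u).smul (hd u)).congr_deriv ?_
    rw [smul_smul]
  have h2 := integral_eq_zero_of_hasDerivAt_of_integrable h1 (i2.add i4) i1
  rw [integral_add i2 i4, integral_smul] at h2
  have hj' : (j : ℂ) ≠ 0 := by exact_mod_cast hj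
  rw [eq_neg_of_add_eq_zero_left h2, neg_smul, neg_neg, smul_smul]
  rw [show (2 / j : ℂ) * (j / 2) = 1 by field_simp, one_smul]

theorem integral_Ioi_inv_croot_pow_add_two [CompleteSpace F] {j : ℕ} (hj : j ≠ 0) {β s : ℝ}
    (hβ : β ≠ 0) (hs : s ≠ 0)
    {h h' : ℝ → F} (hd : ∀ u, HasDerivAt h (h' u) u) (hh : Continuous h) (hh' : Continuous h')
    (hc : HasCompactSupport h) (hc' : HasCompactSupport h') (a : ℝ) :
    ∫ u in Set.Ioi a, (croot (planar β u s) ^ (j + 2))⁻¹ • h u =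
      (2 / j : ℂ) • ((∫ u in Set.Ioi a, (croot (planar β u s) ^ j)⁻¹ • h' u) +
        (croot (planar β a s) ^ j)⁻¹ • h a) := by
  have c1 := continuous_inv_croot_pow_planar j hβ hs
  have c2 := continuous_inv_croot_pow_planar (j + 2) hβ hs
  have i2 : Integrable fun u => (croot (planar β u s) ^ j)⁻¹ • h' u :=
    (c1.smul hh').integrable_of_hasCompactSupport (μ := volume) hc'.smul_left
  have i3 : Integrable fun u => (croot (planar β u s) ^ (j + 2))⁻¹ • h u :=
    (c2.smul hh).integrable_of_hasCompactSupport (μ := volume) hc.smul_left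
  have i4 : Integrable fun u => (-(j / 2 : ℂ)) • (croot (planar β u s) ^ (j + 2))⁻¹ • h u :=
    i3.smul _
  have h1 : ∀ u, HasDerivAt (fun u => (croot (planar β u s) ^ j)⁻¹ • h u)
      ((croot (planar β u s) ^ j)⁻¹ • h' u +
        (-(j / 2 : ℂ)) • (croot (planar β u s) ^ (j + 2))⁻¹ • h u) u := fun u => by
    refine ((hasDerivAt_inv_croot_pow_planar j hβ hs u).smul (hd u)).congr_deriv ?_
    rw [smul_smul]
  have h2 := setIntegral_Ioi_deriv (a := a) (fun u _ => h1 u) hc.smul_left (i2.add i4).integrableOn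
  rw [integral_add i2.integrableOn i4.integrableOn, integral_smul] at h2
  have hj' : (j : ℂ) ≠ 0 := by exact_mod_cast hj
  have h3 : (∫ u in Set.Ioi a, (croot (planar β u s) ^ j)⁻¹ • h' u) +
      (croot (planar β a s) ^ j)⁻¹ • h a =
      (j / 2 : ℂ) • ∫ u in Set.Ioi a, (croot (planar β u s) ^ (j + 2))⁻¹ • h u := by
    rw [neg_smul] at h2
    rw [← sub_eq_zero, ← sub_eq_zero.2 h2]
    abel
  rw [h3, smul_smul, show (2 / j : ℂ) * (j / 2) = 1 by field_simp, one_smul]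

/-- The partial derivative in the first variable. -/
def dFst (H : ℝ × ℝ → F) (p : ℝ × ℝ) : F := fderiv ℝ H p (1, 0)

theorem contDiff_dFst {H : ℝ × ℝ → F} (hH : ContDiff ℝ ∞ H) : ContDiff ℝ ∞ (dFst H) :=
  (hH.fderiv_right (m := ∞) (by simp)).clm_apply contDiff_const

theorem hasCompactSupport_dFst {H : ℝ × ℝ → F} (hc : HasCompactSupport H) :
    HasCompactSupport (dFst H) := hc.fderiv_apply ℝ _

theorem hasDerivAt_dFst {H : ℝ × ℝ → F} (hH : ContDiff ℝ ∞ H) (u s : ℝ) :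
    HasDerivAt (fun u => H (u, s)) (dFst H (u, s)) u := by
  have h1 : HasDerivAt (fun u : ℝ => (u, s)) ((1 : ℝ), (0 : ℝ)) u :=
    (hasDerivAt_id u).prodMk (hasDerivAt_const u s)
  exact ((hH.differentiable (by simp)) (u, s)).hasFDerivAt.comp_hasDerivAt u h1

theorem integral_slice_inv_croot_pow_add_two {j : ℕ} (hj : j ≠ 0) {β s : ℝ} (hβ : β ≠ 0)
    (hs : s ≠ 0) {H : ℝ × ℝ → F} (hH : ContDiff ℝ ∞ H) (hc : HasCompactSupport H) :
    ∫ u, (croot (planar β u s) ^ (j + 2))⁻¹ • H (u, s) =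
      (2 / j : ℂ) • ∫ u, (croot (planar β u s) ^ j)⁻¹ • dFst H (u, s) :=
  integral_inv_croot_pow_add_two hj hβ hs (hasDerivAt_dFst hH · s)
    (hH.continuous.comp (by fun_prop)) ((contDiff_dFst hH).continuous.comp (by fun_prop))
    (hc.slice_right s) ((hasCompactSupport_dFst hc).slice_right s)

theorem ae_ne_zero : ∀ᵐ s : ℝ, s ≠ 0 := by rw [ae_iff]; simp

/-- On each line `s = const ≠ 0` the region is a half-line that ends on the parabola, where the root
equals `ε - i βs/ε`. The boundary values, integrated over `s`, take the form of the flux integral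
with `q = βs/ε`; this substitution produces the factor `ε/β`. -/
theorem setIntegral_lt_croot_planar_add_two [CompleteSpace F] {j : ℕ} (hj : j ≠ 0) {β : ℝ}
    (hβ : 0 < β) {ε : ℝ} (hε : 0 < ε) {H : ℝ × ℝ → F} (hH : ContDiff ℝ ∞ H)
    (hc : HasCompactSupport H) :
    ∫ p in {p : ℝ × ℝ | ε < (croot (planar β p.1 p.2)).re},
        (croot (planar β p.1 p.2) ^ (j + 2))⁻¹ • H p =
      (2 / j : ℂ) • ((∫ p in {p : ℝ × ℝ | ε < (croot (planar β p.1 p.2)).re},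
        (croot (planar β p.1 p.2) ^ j)⁻¹ • dFst H p) +
        (β⁻¹ : ℂ) • (ε : ℂ) • ∫ q : ℝ, (((ε : ℂ) - (q : ℂ) * Complex.I) ^ j)⁻¹ •
          H (ε ^ 2 - q ^ 2, ε * q / β)) := by
  set A := {p : ℝ × ℝ | ε < (croot (planar β p.1 p.2)).re} with hA
  have mA : MeasurableSet A := measurableSet_lt_croot_planar β ε
  have hslice : ∀ (k : ℕ) (G : ℝ × ℝ → F), Continuous G → HasCompactSupport G →
      Integrable (fun s => ∫ u in Set.Ioi (ε ^ 2 - (β * s / ε) ^ 2),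
        (croot (planar β u s) ^ k)⁻¹ • G (u, s)) ∧
      ∫ p in A, (croot (planar β p.1 p.2) ^ k)⁻¹ • G p =
        ∫ s, ∫ u in Set.Ioi (ε ^ 2 - (β * s / ε) ^ 2), (croot (planar β u s) ^ k)⁻¹ • G (u, s) :=
    fun k G hG hGc => by
    have hi := (integrable_indicator_iff mA).2 (integrableOn_lt_croot_planar k β hε hG hGc)
    have h1 : ∀ s : ℝ, s ≠ 0 → ∫ u, A.indicator (fun p : ℝ × ℝ =>
        (croot (planar β p.1 p.2) ^ k)⁻¹ • G p) (u, s) =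
        ∫ u in Set.Ioi (ε ^ 2 - (β * s / ε) ^ 2), (croot (planar β u s) ^ k)⁻¹ • G (u, s) :=
      fun s hs => by
      rw [← integral_indicator measurableSet_Ioi]
      congr 1
      funext u
      by_cases hu : u ∈ Set.Ioi (ε ^ 2 - (β * s / ε) ^ 2)
      · rw [Set.indicator_of_mem hu, Set.indicator_of_mem]
        exact (lt_croot_planar_iff hβ.ne' hε hs u).2 hu
      · rw [Set.indicator_of_notMem hu, Set.indicator_of_notMem]
        exact fun h => hu ((lt_croot_planar_iff hβ.ne' hε hs u).1 h)
    have h2 : (fun s => ∫ u, A.indicator (fun p : ℝ × ℝ =>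
        (croot (planar β p.1 p.2) ^ k)⁻¹ • G p) (u, s)) =ᵐ[volume] fun s =>
        ∫ u in Set.Ioi (ε ^ 2 - (β * s / ε) ^ 2), (croot (planar β u s) ^ k)⁻¹ • G (u, s) := by
      filter_upwards [ae_ne_zero] with s hs using h1 s hs
    refine ⟨(hi.integral_prod_right).congr h2, ?_⟩
    rw [← integral_indicator mA, Measure.volume_eq_prod, integral_prod_symm _ hi,
      integral_congr_ae h2]
  obtain ⟨-, e1⟩ := hslice (j + 2) H hH.continuous hc
  obtain ⟨i2, e2⟩ := hslice j (dFst H) (contDiff_dFst hH).continuous (hasCompactSupport_dFst hc)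
  set g : ℝ → F := fun q => (((ε : ℂ) - (q : ℂ) * Complex.I) ^ j)⁻¹ • H (ε ^ 2 - q ^ 2, ε * q / β)
    with hg
  have hne : ∀ q : ℝ, (ε : ℂ) - (q : ℂ) * Complex.I ≠ 0 := fun q h => by
    have := congrArg Complex.re h
    simp at this
    exact hε.ne' this
  have hgc : Continuous g := by
    refine Continuous.smul (Continuous.inv₀ (by fun_prop) fun q => pow_ne_zero _ (hne q)) ?_
    exact hH.continuous.comp (by fun_prop)
  have hq : ∀ s : ℝ, ε * (β / ε * s) / β = s := fun s => by field_simp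
  have e3 : ∀ s : ℝ, (croot (planar β (ε ^ 2 - (β * s / ε) ^ 2) s) ^ j)⁻¹ •
      H (ε ^ 2 - (β * s / ε) ^ 2, s) = g (β / ε * s) := fun s => by
    rw [croot_planar_edge hε, hg]
    simp only
    rw [hq, show β * s / ε = β / ε * s by ring]
  have hgi : Integrable fun s => g (β / ε * s) := by
    refine Continuous.integrable_of_hasCompactSupport (hgc.comp (by fun_prop)) ?_
    obtain ⟨R, hR0, hR⟩ := exists_box hc
    refine HasCompactSupport.intro (isCompact_Icc (a := -R) (b := R)) fun s hs => ?_
    rw [hg]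
    simp only
    rw [hq, hR _ (fun h => hs h.2), smul_zero]
  rw [e1, e2]
  have e4 : (fun s => ∫ u in Set.Ioi (ε ^ 2 - (β * s / ε) ^ 2),
      (croot (planar β u s) ^ (j + 2))⁻¹ • H (u, s)) =ᵐ[volume] fun s => (2 / j : ℂ) •
      ((∫ u in Set.Ioi (ε ^ 2 - (β * s / ε) ^ 2), (croot (planar β u s) ^ j)⁻¹ • dFst H (u, s)) +
        g (β / ε * s)) := by
    filter_upwards [ae_ne_zero] with s hs
    rw [← e3]
    exact integral_Ioi_inv_croot_pow_add_two hj hβ.ne' hs (hasDerivAt_dFst hH · s)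
      (hH.continuous.comp (by fun_prop)) ((contDiff_dFst hH).continuous.comp (by fun_prop))
      (hc.slice_right s) ((hasCompactSupport_dFst hc).slice_right s) _
  rw [integral_congr_ae e4, integral_smul, integral_add i2 hgi, Measure.integral_comp_mul_left]
  congr 2
  rw [abs_of_pos (by positivity), inv_div, smul_smul, ← Complex.coe_smul]
  congr 1
  push_cast
  rw [div_eq_mul_inv, mul_comm]

theorem integral_axisWeight_planar_add_two {j : ℕ} (hj : j ≠ 0) {β : ℝ} (hβ : β ≠ 0)
    {w : ℝ → ℝ} (hw : IsAxisWeight w) {τ : ℝ} (hτ : 0 < τ) {H : ℝ × ℝ → F}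
    (hH : ContDiff ℝ ∞ H) (hc : HasCompactSupport H) :
    ∫ p : ℝ × ℝ, (w (p.2 / τ) : ℂ) • (croot (planar β p.1 p.2) ^ (j + 2))⁻¹ • H p =
      (2 / j : ℂ) • ∫ p : ℝ × ℝ, (w (p.2 / τ) : ℂ) • (croot (planar β p.1 p.2) ^ j)⁻¹ • dFst H p := by
  rw [Measure.volume_eq_prod,
    integral_prod_symm _ (integrable_axisWeight_planar (j + 2) hβ hw hτ hH.continuous hc),
    integral_prod_symm _ (integrable_axisWeight_planar j hβ hw hτ (contDiff_dFst hH).continuous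
      (hasCompactSupport_dFst hc)), ← integral_smul]
  refine integral_congr_ae ?_
  filter_upwards [ae_ne_zero] with s hs
  simp only [integral_smul]
  rw [integral_slice_inv_croot_pow_add_two hj hβ hs hH hc, smul_comm]

/-- Both ways of cutting off obey the same recursion. They differ only by the flux term, to which
`tendsto_flux` applies because `H(ε² - q², εq/β)` is smooth up to `ε = 0`. -/
theorem PlanarLimit.add_two [CompleteSpace F] {j : ℕ} {β : ℝ} (hβ : 0 < β) {H : ℝ × ℝ → F}
    (hH : ContDiff ℝ ∞ H) (hc : HasCompactSupport H) {L : F}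
    (h : PlanarLimit β (fun ζ => (croot ζ ^ (j + 1))⁻¹) (dFst H) L) :
    PlanarLimit β (fun ζ => (croot ζ ^ (j + 1 + 2))⁻¹) H ((2 / (j + 1 : ℕ) : ℂ) • L) := by
  have hj : j + 1 ≠ 0 := Nat.succ_ne_zero j
  constructor
  · obtain ⟨R, hR0, hR⟩ := exists_box hc
    have hK : ContDiff ℝ ∞ fun p : ℝ × ℝ => H (p.1 ^ 2 - p.2 ^ 2, p.1 * p.2 / β) :=
      hH.comp (by fun_prop)
    -- For `0 ≤ ε ≤ 1` and `|q| > R + 1`, the first argument satisfies `ε² - q² < 1 - (R + 1)² <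
    -- -R`, outside the box.
    have h1 := tendsto_flux j hK (R := R + 1) fun ε hε q hq => by
      refine hR _ fun hm => ?_
      have h2 := hm.1.1
      have h3 : (R + 1) ^ 2 < |q| ^ 2 := by gcongr
      rw [sq_abs] at h3
      have h4 : ε ^ 2 ≤ 1 := pow_le_one₀ hε.1 hε.2
      simp only at h2
      nlinarith
    have h2 := (h.1.add (h1.const_smul (β⁻¹ : ℂ))).const_smul (2 / (j + 1 : ℕ) : ℂ)
    rw [smul_zero, add_zero] at h2
    refine h2.congr' ?_
    filter_upwards [self_mem_nhdsWithin] with ε hε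
    exact (setIntegral_lt_croot_planar_add_two hj hβ hε hH hc).symm
  · intro w hw
    refine ((h.2 w hw).const_smul (2 / (j + 1 : ℕ) : ℂ)).congr' ?_
    filter_upwards [self_mem_nhdsWithin] with τ hτ
    exact (integral_axisWeight_planar_add_two hj hβ.ne' hw hτ hH hc).symm

/-- Up to `γ⁻²` the kernel is locally integrable in the plane, which starts the recursion in steps
of two for odd and even exponents. -/
theorem exists_planarLimit_inv_croot_pow [CompleteSpace F] {β : ℝ} (hβ : 0 < β) (j : ℕ) :
    ∀ {H : ℝ × ℝ → F}, ContDiff ℝ ∞ H → HasCompactSupport H →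
      ∃ L, PlanarLimit β (fun ζ => (croot ζ ^ j)⁻¹) H L := by
  induction j using Nat.strong_induction_on with
  | _ j ih =>
    intro H hH hc
    rcases le_or_gt j 2 with hj | hj
    · exact ⟨_, planarLimit_of_integrable hβ.ne' (integrable_planar hβ.ne' (measurable_inv_croot_pow j)
        (A := 1) (fun ζ => by rw [one_mul]; exact norm_inv_croot_pow_le hj ζ) hH.continuous hc)⟩
    · obtain ⟨i, rfl⟩ : ∃ i, j = i + 1 + 2 := ⟨j - 3, by omega⟩
      obtain ⟨L, hL⟩ := ih (i + 1) (by omega) (contDiff_dFst hH) (hasCompactSupport_dFst hc)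
      exact ⟨_, hL.add_two hβ hH hc⟩

theorem PlanarLimit.const_mul {β : ℝ} {κ : ℂ → ℂ} {H : ℝ × ℝ → F} {L : F}
    (h : PlanarLimit β κ H L) (c : ℂ) : PlanarLimit β (fun ζ => c * κ ζ) H (c • L) := by
  constructor
  · refine (h.1.const_smul c).congr fun ε => ?_
    rw [← integral_smul]
    simp only [smul_smul]
  · intro w hw
    refine ((h.2 w hw).const_smul c).congr fun τ => ?_
    rw [← integral_smul]
    congr 1
    funext p
    rw [mul_smul, smul_comm c]

theorem potOf_two (ζ : ℂ) : potOf 2 ζ = Complex.log (croot ζ) / (2 * Real.pi) := by simp [potOf]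

theorem potOf_eq {n : ℕ} (hn : 3 ≤ n) (ζ : ℂ) :
    potOf n ζ = (sphereArea n * (2 - n) : ℂ)⁻¹ * (croot ζ ^ (n - 2))⁻¹ := by
  rw [potOf, if_neg (by omega), show (2 - n : ℤ) = -((n - 2 : ℕ) : ℤ) by omega, zpow_neg,
    zpow_natCast, div_eq_mul_inv, mul_comm]

theorem kerOf_eq (n : ℕ) (ζ : ℂ) : kerOf n ζ = (sphereArea n : ℂ)⁻¹ * (croot ζ ^ n)⁻¹ := by
  rw [kerOf, mul_inv]

theorem measurable_potOf (n : ℕ) : Measurable (potOf n) := by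
  unfold potOf
  split_ifs
  · exact (Complex.measurable_log.comp measurable_croot).div_const _
  · exact (measurable_croot.pow_const _).div_const _

theorem exists_planarLimit_potOf [CompleteSpace F] {β : ℝ} (hβ : 0 < β) {n : ℕ} (hn : 2 ≤ n)
    {H : ℝ × ℝ → F} (hH : ContDiff ℝ ∞ H) (hc : HasCompactSupport H) :
    ∃ L, PlanarLimit β (potOf n) H L := by
  rcases hn.eq_or_lt with rfl | hn
  · refine ⟨_, planarLimit_of_integrable hβ.ne' (integrable_planar hβ.ne' (measurable_potOf 2)
      (A := 5) (fun ζ => ?_) hH.continuous hc)⟩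
    rw [potOf_two, norm_div]
    have h1 : (1 : ℝ) ≤ ‖(2 * Real.pi : ℂ)‖ := by
      rw [norm_mul, Complex.norm_real, Real.norm_of_nonneg Real.pi_pos.le, Complex.norm_ofNat]
      linarith [Real.pi_gt_three]
    exact (div_le_self (norm_nonneg _) h1).trans (norm_log_croot_le ζ)
  · obtain ⟨L, hL⟩ := exists_planarLimit_inv_croot_pow hβ (n - 2) hH hc
    have h1 : potOf n = fun ζ => (sphereArea n * (2 - n) : ℂ)⁻¹ * (croot ζ ^ (n - 2))⁻¹ :=
      funext (potOf_eq hn)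
    rw [h1]
    exact ⟨_, hL.const_mul _⟩

end


/-! ### Estimates of the singular integrals over lines `s = const` -/

section

variable {F : Type*} [NormedAddCommGroup F] [NormedSpace ℂ F]

/-- The function `H` vanishes off the square `[-R, R]²`. -/
def BoxSupported (R : ℝ) (H : ℝ × ℝ → F) : Prop :=
  ∀ p, p ∉ Set.Icc (-R) R ×ˢ Set.Icc (-R) R → H p = 0

omit [NormedSpace ℂ F] in
theorem BoxSupported.hasCompactSupport {R : ℝ} {H : ℝ × ℝ → F} (h : BoxSupported R H) :
    HasCompactSupport H :=
  HasCompactSupport.intro (isCompact_Icc.prod isCompact_Icc) h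

theorem BoxSupported.dFst {R : ℝ} {H : ℝ × ℝ → F} (h : BoxSupported R H) :
    BoxSupported R (dFst H) := fun p hp => by
  have h1 : H =ᶠ[𝓝 p] fun _ => 0 := by
    filter_upwards [(isClosed_Icc.prod isClosed_Icc).isOpen_compl.mem_nhds hp] with q hq
    exact h q hq
  rw [ComplexDistance.dFst, h1.fderiv_eq]
  simp

/-- The singular integral over the line at height `s`. -/
def lineIntegral (β : ℝ) (κ : ℂ → ℂ) (H : ℝ × ℝ → F) (s : ℝ) : F :=
  ∫ u, κ (planar β u s) • H (u, s)

/-- The jump of the singular integrals across the axis is bounded by `i` derivatives. -/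
def JumpBound (F : Type*) [NormedAddCommGroup F] [NormedSpace ℂ F] (β R : ℝ) (κ : ℂ → ℂ) (i : ℕ) :
    Prop :=
  ∃ C : ℝ, 0 ≤ C ∧ ∀ H : ℝ × ℝ → F, ContDiff ℝ ∞ H → BoxSupported R H → ∀ B : ℝ,
    (∀ l ≤ i, ∀ p, ‖(dFst^[l] H) p‖ ≤ B) → ∀ η > 0, ∀ᶠ s : ℝ in 𝓝[>] 0,
      ‖lineIntegral β κ H s - lineIntegral β κ H (-s)‖ ≤ C * B + η

theorem norm_inv_croot_planar_le {β u s : ℝ} (hu : u ≠ 0) :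
    ‖croot (planar β u s)‖⁻¹ ≤ (√|u|)⁻¹ := by
  refine inv_anti₀ (Real.sqrt_pos.2 (by positivity)) (Real.sqrt_le_iff.2 ⟨norm_nonneg _, ?_⟩)
  rw [norm_croot_sq]
  have := Complex.abs_re_le_norm (planar β u s)
  rwa [planar_re] at this

/-- Kernels no worse than `γ⁻¹` are bounded by an integrable function of `u`, uniformly in `s`. Each
slice integral is then bounded by the supremum of `H`, and no cancellation between the two sides is
needed. -/
theorem jumpBound_of_norm_le {β R : ℝ} {κ : ℂ → ℂ} {A : ℝ} (hA : 0 ≤ A)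
    (hκ : ∀ ζ, ‖κ ζ‖ ≤ A * (1 + ‖ζ‖ + ‖croot ζ‖⁻¹)) (i : ℕ) : JumpBound F β R κ i := by
  obtain ⟨Z, hZ⟩ := ((isCompact_Icc (a := -R) (b := R)).prod (isCompact_Icc (a := (-1 : ℝ)) (b := 1))
    ).exists_bound_of_continuousOn (continuous_planar β).continuousOn
  set b : ℝ → ℝ := Set.indicator (Set.Icc (-R) R) fun u => A * (1 + |Z| + (√|u|)⁻¹) with hb
  have ib : Integrable b := by
    rw [hb, integrable_indicator_iff measurableSet_Icc]
    exact ((integrableOn_const (by simp)).add (integrable_inv_sqrt_abs R)).const_mul A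
  have hb0 : ∀ u, 0 ≤ b u := fun u => Set.indicator_nonneg (fun u _ => by positivity) u
  set C := ∫ u, b u with hC
  have hC0 : 0 ≤ C := integral_nonneg hb0
  have key : ∀ H : ℝ × ℝ → F, BoxSupported R H → ∀ B : ℝ, (∀ p, ‖H p‖ ≤ B) → ∀ s ∈ Set.Icc (-1 : ℝ) 1,
      ‖lineIntegral β κ H s‖ ≤ C * B := fun H hs B hB s hs1 => by
    rw [lineIntegral, hC, ← integral_mul_const]
    have hB0 : 0 ≤ B := (norm_nonneg _).trans (hB 0)
    refine norm_integral_le_of_norm_le (ib.mul_const B) ?_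
    filter_upwards [ae_ne_zero] with u hu
    by_cases hu2 : u ∈ Set.Icc (-R) R
    · rw [norm_smul, hb, Set.indicator_of_mem hu2]
      refine mul_le_mul ((hκ _).trans ?_) (hB _) (norm_nonneg _) (by positivity)
      have h1 := hZ (u, s) ⟨hu2, hs1⟩
      have h2 := le_abs_self Z
      have h3 := norm_inv_croot_planar_le (β := β) (s := s) hu
      simp only at h1
      gcongr
      linarith
    · rw [hs (u, s) fun h => hu2 h.1, smul_zero, norm_zero]
      exact mul_nonneg (hb0 u) hB0
  refine ⟨2 * C, by positivity, fun H _ hs B hB η hη => ?_⟩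
  filter_upwards [Ioc_mem_nhdsGT one_pos] with s hs1
  have h1 := key H hs B (hB 0 (Nat.zero_le _)) s ⟨by linarith [hs1.1], hs1.2⟩
  have h2 := key H hs B (hB 0 (Nat.zero_le _)) (-s) ⟨by linarith [hs1.2], by linarith [hs1.1]⟩
  calc _ ≤ ‖lineIntegral β κ H s‖ + ‖lineIntegral β κ H (-s)‖ := norm_sub_le _ _
    _ ≤ _ := by linarith

theorem integrable_poisson {v : ℝ} (hv : v ≠ 0) :
    Integrable (fun u : ℝ => |v| / (u ^ 2 + v ^ 2)) ∧ ∫ u : ℝ, |v| / (u ^ 2 + v ^ 2) = Real.pi := by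
  have h1 : (fun u : ℝ => |v| / (u ^ 2 + v ^ 2)) =
      fun u => |v|⁻¹ * (1 + (|v|⁻¹ * u) ^ 2)⁻¹ := by
    funext u
    have h2 : |v| ≠ 0 := abs_ne_zero.2 hv
    rw [← sq_abs v]
    field_simp
    ring
  rw [h1]
  refine ⟨(integrable_inv_one_add_sq.comp_mul_left' (inv_ne_zero (abs_ne_zero.2 hv))).const_mul _, ?_⟩
  rw [integral_const_mul, Measure.integral_comp_mul_left (fun x => (1 + x ^ 2)⁻¹),
    integral_univ_inv_one_add_sq, inv_inv, abs_abs, smul_eq_mul, ← mul_assoc,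
    inv_mul_cancel₀ (abs_ne_zero.2 hv), one_mul]

/-- The kernel is `1/ζ`, and with `v = 2βs` the difference `1/(u - iv) - 1/(u + iv) = 2iv/(u² + v²)`
is `2i` times a Poisson kernel of mass `π`, whence the constant `2π`. What is left involves `H(u, s)
- H(u, -s)`, which is of order `s` against a kernel of order `(|u| s)^(-1/2)`, and so tends to zero.
-/
theorem jumpBound_inv {β : ℝ} (hβ : 0 < β) (R : ℝ) (i : ℕ) :
    JumpBound F β R (fun ζ => (croot ζ ^ 2)⁻¹) i := by
  refine ⟨2 * Real.pi, by positivity, fun H hH hs B hB η hη => ?_⟩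
  have hc := hs.hasCompactSupport
  have hB0 : 0 ≤ B := (norm_nonneg _).trans (hB 0 (Nat.zero_le _) 0)
  -- The Lipschitz constant is not controlled by `B`. It enters only the part of order `√s`, which
  -- is absorbed by `η` for `s` small depending on `H`.
  obtain ⟨Lp, hLp⟩ := hH.lipschitzWith_of_hasCompactSupport hc (by simp)
  set g : ℝ → ℝ := Set.indicator (Set.Icc (-R) R) fun u => (√|u|)⁻¹ with hg
  have ig : Integrable g := (integrable_inv_sqrt_abs R).integrable_indicator measurableSet_Icc
  have hg0 : ∀ u, 0 ≤ g u := fun u => Set.indicator_nonneg (fun u _ => by positivity) u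
  set E : ℝ := (√|2 * β|)⁻¹ * (2 * Lp) * ∫ u, g u with hE
  have hlim : Tendsto (fun s : ℝ => E * √s) (𝓝[>] 0) (𝓝 0) := by
    have : Continuous fun s : ℝ => E * √s := by fun_prop
    have h := this.tendsto 0
    simp only [Real.sqrt_zero, mul_zero] at h
    exact h.mono_left nhdsWithin_le_nhds
  filter_upwards [self_mem_nhdsWithin, hlim.eventually_lt_const hη] with s hs0 hsη
  have hs0' : 0 < s := hs0
  have hv : 2 * β * s ≠ 0 := by positivity
  simp only [lineIntegral, croot_sq]
  have hne : ∀ {s : ℝ}, s ≠ 0 → ∀ u, planar β u s ≠ 0 := fun hs u =>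
    Complex.slitPlane_ne_zero (planar_mem_slitPlane hβ.ne' hs u)
  have hcont : ∀ {s : ℝ}, s ≠ 0 → Continuous fun u => (planar β u s)⁻¹ := fun hs =>
    Continuous.inv₀ ((continuous_planar β).comp (by fun_prop : Continuous fun u : ℝ => (u, _)))
      (hne hs)
  have hHs : ∀ s : ℝ, Continuous fun u => H (u, s) := fun s => hH.continuous.comp (by fun_prop)
  have i1 : Integrable fun u => (planar β u s)⁻¹ • H (u, s) :=
    ((hcont hs0'.ne').smul (hHs s)).integrable_of_hasCompactSupport (hc.slice_right s).smul_left
  have i2 : Integrable fun u => (planar β u (-s))⁻¹ • H (u, -s) :=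
    ((hcont (neg_ne_zero.2 hs0'.ne')).smul (hHs (-s))).integrable_of_hasCompactSupport
      (hc.slice_right (-s)).smul_left
  obtain ⟨ip, ep⟩ := integrable_poisson hv
  rw [← integral_sub i1 i2]
  have hbd : ∀ᵐ u : ℝ, ‖(planar β u s)⁻¹ • H (u, s) - (planar β u (-s))⁻¹ • H (u, -s)‖ ≤
      2 * B * (|2 * β * s| / (u ^ 2 + (2 * β * s) ^ 2)) +
        (√|2 * β|)⁻¹ * (2 * Lp) * √s * g u := by
    filter_upwards [ae_ne_zero] with u hu
    have e1 : (planar β u s)⁻¹ • H (u, s) - (planar β u (-s))⁻¹ • H (u, -s) =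
        ((planar β u s)⁻¹ - (planar β u (-s))⁻¹) • H (u, s) +
          (planar β u (-s))⁻¹ • (H (u, s) - H (u, -s)) := by
      rw [sub_smul, smul_sub]; abel
    rw [e1]
    refine (norm_add_le _ _).trans (add_le_add ?_ ?_)
    · rw [norm_smul]
      have e2 : (planar β u s)⁻¹ - (planar β u (-s))⁻¹ =
          ((2 * (2 * β * s) / (u ^ 2 + (2 * β * s) ^ 2) : ℝ) : ℂ) * Complex.I := by
        have e3 : planar β u s * planar β u (-s) = ((u ^ 2 + (2 * β * s) ^ 2 : ℝ) : ℂ) := by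
          rw [planar, planar]; push_cast
          linear_combination (-(2 * β * s : ℂ) ^ 2) * Complex.I_sq
        rw [inv_sub_inv (hne hs0'.ne' u) (hne (neg_ne_zero.2 hs0'.ne') u), e3, planar, planar]
        push_cast
        ring
      rw [e2, norm_mul, Complex.norm_I, mul_one, Complex.norm_real, Real.norm_eq_abs, abs_div,
        abs_mul, abs_of_pos (show (0 : ℝ) < u ^ 2 + (2 * β * s) ^ 2 by positivity), abs_two]
      calc _ ≤ 2 * |2 * β * s| / (u ^ 2 + (2 * β * s) ^ 2) * B := by
            gcongr; exact hB 0 (Nat.zero_le _) _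
        _ = _ := by ring
    · by_cases hu2 : u ∈ Set.Icc (-R) R
      · rw [norm_smul, norm_inv, hg, Set.indicator_of_mem hu2]
        have e2 := norm_inv_planar_le hβ.ne' hu (neg_ne_zero.2 hs0'.ne')
        have e3 := hLp.dist_le_mul (u, s) (u, -s)
        rw [dist_eq_norm, Prod.dist_eq, dist_self, max_eq_right dist_nonneg, Real.dist_eq,
          sub_neg_eq_add, abs_of_pos (by linarith)] at e3
        rw [abs_neg, abs_of_pos hs0'] at e2
        calc _ ≤ ((√|u|)⁻¹ * ((√|2 * β|)⁻¹ * (√s)⁻¹)) * (Lp * (s + s)) := by gcongr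
          _ = (√|2 * β|)⁻¹ * (2 * Lp) * ((√s)⁻¹ * s) * (√|u|)⁻¹ := by ring
          _ = _ := by
            congr 2
            rw [inv_mul_eq_div, Real.div_sqrt]
      · rw [hs (u, s) fun h => hu2 h.1, hs (u, -s) fun h => hu2 h.1, sub_zero, smul_zero, norm_zero]
        have := hg0 u
        positivity
  refine (norm_integral_le_of_norm_le ((ip.const_mul _).add (ig.const_mul _)) hbd).trans ?_
  rw [integral_add' (ip.const_mul _) (ig.const_mul _), integral_const_mul, integral_const_mul, ep]
  have e4 : (√|2 * β|)⁻¹ * (2 * Lp) * √s * ∫ u, g u = E * √s := by rw [hE]; ring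
  rw [e4]
  linarith

/-- For `s ≠ 0` the kernel is smooth along the line, so integration by parts has no boundary term;
two powers of the root cost one derivative in `u`. -/
theorem JumpBound.add_two {j : ℕ} {β R : ℝ} (hβ : 0 < β) {i : ℕ}
    (h : JumpBound F β R (fun ζ => (croot ζ ^ (j + 1))⁻¹) i) :
    JumpBound F β R (fun ζ => (croot ζ ^ (j + 1 + 2))⁻¹) (i + 1) := by
  obtain ⟨C, hC, hb⟩ := h
  refine ⟨2 * C, by positivity, fun H hH hs B hB η hη => ?_⟩
  have h1 := hb (dFst H) (contDiff_dFst hH) hs.dFst B (fun l hl p => by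
    have := hB (l + 1) (by omega) p
    rwa [Function.iterate_succ_apply] at this) (η / 2) (by positivity)
  filter_upwards [self_mem_nhdsWithin, h1] with s hs0 h2
  have hs0' : 0 < s := hs0
  have e1 : ∀ s : ℝ, s ≠ 0 → lineIntegral β (fun ζ => (croot ζ ^ (j + 1 + 2))⁻¹) H s =
      (2 / (j + 1 : ℕ) : ℂ) • lineIntegral β (fun ζ => (croot ζ ^ (j + 1))⁻¹) (dFst H) s :=
    fun s hs1 => integral_slice_inv_croot_pow_add_two (Nat.succ_ne_zero j) hβ.ne' hs1 hH
      hs.hasCompactSupport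
  rw [e1 s hs0'.ne', e1 (-s) (neg_ne_zero.2 hs0'.ne'), ← smul_sub, norm_smul]
  have h3 : ‖(2 / (j + 1 : ℕ) : ℂ)‖ ≤ 2 := by
    rw [norm_div, Complex.norm_ofNat, Complex.norm_natCast]
    exact div_le_self (by norm_num) (by exact_mod_cast Nat.succ_le_succ (Nat.zero_le j))
  calc _ ≤ 2 * (C * B + η / 2) := mul_le_mul h3 h2 (norm_nonneg _) (by norm_num)
    _ = _ := by ring

theorem norm_inv_croot_le (ζ : ℂ) : ‖(croot ζ ^ 1)⁻¹‖ ≤ 1 * (1 + ‖ζ‖ + ‖croot ζ‖⁻¹) := by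
  rw [pow_one, norm_inv, one_mul]
  linarith [norm_nonneg ζ]

/-- Neither the first nor the second power costs a derivative, and the induction goes in steps of
two; hence the integer part of `j / 2` for the exponent `j + 1`. -/
theorem jumpBound_inv_croot_pow {β : ℝ} (hβ : 0 < β) (R : ℝ) (j : ℕ) :
    JumpBound F β R (fun ζ => (croot ζ ^ (j + 1))⁻¹) (j / 2) := by
  induction j using Nat.strong_induction_on with
  | _ j ih =>
    rcases j with _ | _ | j
    · exact jumpBound_of_norm_le zero_le_one norm_inv_croot_le _
    · exact jumpBound_inv hβ R _
    · have := (ih j (by omega)).add_two hβ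
      rw [show (j + 1 + 1) / 2 = j / 2 + 1 by omega]
      exact this

theorem JumpBound.const_mul {β R : ℝ} {κ : ℂ → ℂ} {i : ℕ} (h : JumpBound F β R κ i) (c : ℂ) :
    JumpBound F β R (fun ζ => c * κ ζ) i := by
  obtain ⟨C, hC, hb⟩ := h
  refine ⟨‖c‖ * C, by positivity, fun H hH hs B hB η hη => ?_⟩
  filter_upwards [hb H hH hs B hB (η / (‖c‖ + 1)) (by positivity)] with s h2
  have e1 : ∀ s, lineIntegral β (fun ζ => c * κ ζ) H s = c • lineIntegral β κ H s := fun s => by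
    rw [lineIntegral, lineIntegral, ← integral_smul]
    simp only [smul_smul]
  rw [e1, e1, ← smul_sub, norm_smul]
  have h3 : ‖c‖ * (η / (‖c‖ + 1)) ≤ η := by
    rw [mul_div_assoc', div_le_iff₀ (by positivity)]
    nlinarith [norm_nonneg c]
  calc _ ≤ ‖c‖ * (C * B + η / (‖c‖ + 1)) := by gcongr
    _ ≤ _ := by linarith

theorem norm_log_croot_le' (ζ : ℂ) :
    ‖Complex.log (croot ζ)‖ ≤ 6 * (1 + ‖ζ‖ + ‖croot ζ‖⁻¹) := by
  have h1 := norm_croot_sq ζ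
  have h0 := norm_nonneg (croot ζ)
  have h2 : ‖Complex.log (croot ζ)‖ ≤ |Real.log ‖croot ζ‖| + Real.pi := by
    rw [← Complex.log_re]
    refine (Complex.norm_le_abs_re_add_abs_im _).trans (add_le_add le_rfl ?_)
    rw [Complex.log_im]; exact Complex.abs_arg_le_pi _
  have h3 : |Real.log ‖croot ζ‖| ≤ 1 + ‖ζ‖ + ‖croot ζ‖⁻¹ := by
    rcases h0.eq_or_lt with h | h
    · rw [← h]; simp; positivity
    · have := Real.log_le_sub_one_of_pos h
      have h5 := Real.log_le_sub_one_of_pos (inv_pos.2 h)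
      rw [Real.log_inv] at h5
      have := inv_pos.2 h
      rw [← h1, abs_le]; constructor <;> nlinarith [sq_nonneg (‖croot ζ‖ - 1)]
  have h6 : 0 ≤ ‖ζ‖ + ‖croot ζ‖⁻¹ := by positivity
  have := Real.pi_le_four
  linarith

theorem jumpBound_kerOf {β : ℝ} (hβ : 0 < β) (R : ℝ) {n : ℕ} (hn : 2 ≤ n) :
    JumpBound F β R (kerOf n) ((n - 1) / 2) := by
  have h1 := (jumpBound_inv_croot_pow (F := F) hβ R (n - 1)).const_mul (sphereArea n : ℂ)⁻¹
  rw [show n - 1 + 1 = n by omega] at h1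
  rwa [show kerOf n = fun ζ => (sphereArea n : ℂ)⁻¹ * (croot ζ ^ n)⁻¹ from funext (kerOf_eq n)]

/-- The exponent is `n - 2 = (n - 3) + 1`. For `n = 2` the truncated count is zero, which is right
for the logarithm. -/
theorem jumpBound_potOf {β : ℝ} (hβ : 0 < β) (R : ℝ) {n : ℕ} (hn : 2 ≤ n) :
    JumpBound F β R (potOf n) ((n - 3) / 2) := by
  rcases hn.eq_or_lt with rfl | hn
  · have h1 := (jumpBound_of_norm_le (F := F) (β := β) (R := R) (by norm_num) norm_log_croot_le'
      ((2 - 3) / 2)).const_mul (2 * Real.pi : ℂ)⁻¹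
    rwa [show potOf 2 = fun ζ => (2 * Real.pi : ℂ)⁻¹ * Complex.log (croot ζ) from funext fun ζ => by
      rw [potOf_two, div_eq_mul_inv, mul_comm]]
  · have h1 := (jumpBound_inv_croot_pow (F := F) hβ R (n - 3)).const_mul
      (sphereArea n * (2 - n) : ℂ)⁻¹
    rw [show n - 3 + 1 = n - 2 by omega] at h1
    rwa [show potOf n = fun ζ => (sphereArea n * (2 - n) : ℂ)⁻¹ * (croot ζ ^ (n - 2))⁻¹ from
      funext (potOf_eq hn)]

end


/-! ### Bounds for derivatives -/

section

variable {X Y F : Type*} [NormedAddCommGroup X] [NormedSpace ℝ X]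
  [NormedAddCommGroup Y] [NormedSpace ℝ Y] [NormedAddCommGroup F] [NormedSpace ℝ F]

theorem exists_iteratedFDeriv_bound {P : X → Y} (hP : ContDiff ℝ ∞ P) {K : Set X}
    (hK : IsCompact K) (k : ℕ) :
    ∃ D : ℝ, 1 ≤ D ∧ ∀ i ≤ k, ∀ x ∈ K, ‖iteratedFDeriv ℝ i P x‖ ≤ D := by
  have h1 : ∀ i : ℕ, ∃ D : ℝ, ∀ x ∈ K, ‖iteratedFDeriv ℝ i P x‖ ≤ D := fun i =>
    hK.exists_bound_of_continuousOn
      (hP.continuous_iteratedFDeriv (m := i) (by exact_mod_cast le_top)).continuousOn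
  choose D hD using h1
  refine ⟨1 + ∑ i ∈ Finset.range (k + 1), |D i|, ?_, fun i hi x hx => (hD i x hx).trans ?_⟩
  · have : 0 ≤ ∑ i ∈ Finset.range (k + 1), |D i| := Finset.sum_nonneg fun _ _ => abs_nonneg _
    linarith
  · have := Finset.single_le_sum (f := fun i => |D i|) (fun _ _ => abs_nonneg _)
      (Finset.mem_range.2 (Nat.lt_succ_of_le hi))
    linarith [le_abs_self (D i)]

theorem iteratedFDeriv_eq_zero_of_notMem_tsupport {f : X → F} {x : X} (hx : x ∉ tsupport f) (i : ℕ) :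
    iteratedFDeriv ℝ i f x = 0 := by
  have h1 : x ∉ tsupport (iteratedFDeriv ℝ i f) := fun h => hx (tsupport_iteratedFDeriv_subset i h)
  exact image_eq_zero_of_notMem_tsupport h1

/-- Composition with a smooth map and multiplication by a smooth compactly supported function is
bounded in the `C^k` norms. -/
theorem exists_bound_smul_comp {M : X → ℝ} (hM : ContDiff ℝ ∞ M) (hMc : HasCompactSupport M)
    {P : X → Y} (hP : ContDiff ℝ ∞ P) (k : ℕ) :
    ∃ C : ℝ, 0 ≤ C ∧ ∀ g : Y → F, ContDiff ℝ ∞ g → ∀ B : ℝ,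
      (∀ i ≤ k, ∀ y, ‖iteratedFDeriv ℝ i g y‖ ≤ B) →
      ∀ i ≤ k, ∀ x, ‖iteratedFDeriv ℝ i (fun x => M x • g (P x)) x‖ ≤ C * B := by
  obtain ⟨D, hD1, hD⟩ := exists_iteratedFDeriv_bound hP hMc k
  obtain ⟨E, hE1, hE⟩ := exists_iteratedFDeriv_bound hM hMc k
  refine ⟨2 ^ k * (E * (k.factorial * D ^ k)), by positivity, fun g hg B hB i hi x => ?_⟩
  have hB0 : 0 ≤ B := (norm_nonneg _).trans (hB 0 (Nat.zero_le _) 0)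
  by_cases hx : x ∈ tsupport M
  · have h1 := norm_iteratedFDeriv_smul_le hM (hg.comp hP) x (n := i) (by exact_mod_cast le_top)
    refine h1.trans ?_
    -- The bound for compositions asks for `‖iteratedFDeriv ℝ i P x‖ ≤ D^i`, which follows from `D ≥
    -- 1`. The result is enlarged to a constant that does not depend on `l`.
    have h2 : ∀ l ≤ k, ‖iteratedFDeriv ℝ l (g ∘ P) x‖ ≤ k.factorial * D ^ k * B := fun l hl => by
      refine (norm_iteratedFDeriv_comp_le hg hP (n := l) (by exact_mod_cast le_top) x
        (fun i hi => hB i (hi.trans hl) _) (D := D) fun i h1 hi =>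
          (hD i (hi.trans hl) x hx).trans (le_self_pow₀ hD1 (by omega))).trans ?_
      have h3 : (l.factorial : ℝ) ≤ k.factorial := by exact_mod_cast Nat.factorial_le hl
      have h4 : D ^ l ≤ D ^ k := pow_le_pow_right₀ hD1 hl
      have h5 : 0 ≤ D ^ l := by positivity
      calc (l.factorial : ℝ) * B * D ^ l = l.factorial * D ^ l * B := by ring
        _ ≤ _ := by gcongr
    calc _ ≤ ∑ l ∈ Finset.range (i + 1), (i.choose l : ℝ) * (E * (k.factorial * D ^ k * B)) := by
          refine Finset.sum_le_sum fun l hl => ?_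
          have hl' : l ≤ i := Nat.lt_succ_iff.1 (Finset.mem_range.1 hl)
          rw [mul_assoc]
          have a1 := hE l (hl'.trans hi) x hx
          have a2 := h2 (i - l) (by omega)
          gcongr
      _ = 2 ^ i * (E * (k.factorial * D ^ k * B)) := by
          rw [← Finset.sum_mul]
          congr 1
          exact_mod_cast Nat.sum_range_choose i
      _ ≤ 2 ^ k * (E * (k.factorial * D ^ k * B)) := by
          have : (2 : ℝ) ^ i ≤ 2 ^ k := pow_le_pow_right₀ one_le_two hi
          gcongr
      _ = _ := by ring
  · rw [iteratedFDeriv_eq_zero_of_notMem_tsupport (fun h => hx (tsupport_smul_subset_left _ _ h)),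
      norm_zero]
    positivity

/-- Pointwise application of a smooth compactly supported family of linear maps is bounded in the
`C^k` norms. -/
theorem exists_bound_clm_apply {G : Type*} [NormedAddCommGroup G] [NormedSpace ℝ G]
    {M : X → F →L[ℝ] G} (hM : ContDiff ℝ ∞ M) (hMc : HasCompactSupport M) (k : ℕ) :
    ∃ C : ℝ, 0 ≤ C ∧ ∀ g : X → F, ContDiff ℝ ∞ g → ∀ B : ℝ,
      (∀ i ≤ k, ∀ y, ‖iteratedFDeriv ℝ i g y‖ ≤ B) →
      ∀ i ≤ k, ∀ x, ‖iteratedFDeriv ℝ i (fun x => M x (g x)) x‖ ≤ C * B := by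
  obtain ⟨E, hE1, hE⟩ := exists_iteratedFDeriv_bound hM hMc k
  refine ⟨2 ^ k * E, by positivity, fun g hg B hB i hi x => ?_⟩
  have hB0 : 0 ≤ B := (norm_nonneg _).trans (hB 0 (Nat.zero_le _) 0)
  by_cases hx : x ∈ tsupport M
  · refine (norm_iteratedFDeriv_clm_apply hM hg x (n := i) (by exact_mod_cast le_top)).trans ?_
    calc _ ≤ ∑ l ∈ Finset.range (i + 1), (i.choose l : ℝ) * (E * B) := by
          refine Finset.sum_le_sum fun l hl => ?_
          have hl' : l ≤ i := Nat.lt_succ_iff.1 (Finset.mem_range.1 hl)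
          rw [mul_assoc]
          have a1 := hE l (hl'.trans hi) x hx
          have a2 := hB (i - l) (by omega) x
          gcongr
      _ = 2 ^ i * (E * B) := by
          rw [← Finset.sum_mul]
          congr 1
          exact_mod_cast Nat.sum_range_choose i
      _ ≤ 2 ^ k * (E * B) := by
          have : (2 : ℝ) ^ i ≤ 2 ^ k := pow_le_pow_right₀ one_le_two hi
          gcongr
      _ = _ := by ring
  · have h2 : x ∉ tsupport (fun x => M x (g x)) := fun h => hx (by
      refine closure_mono (fun y hy => ?_) h
      exact fun h0 => hy (by simp [h0]))
    rw [iteratedFDeriv_eq_zero_of_notMem_tsupport h2, norm_zero]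
    positivity

/-- The derivative along a fixed vector. -/
def dAlong (v : X) (f : X → F) (x : X) : F := fderiv ℝ f x v

theorem contDiff_dAlong (v : X) {f : X → F} (hf : ContDiff ℝ ∞ f) : ContDiff ℝ ∞ (dAlong v f) :=
  (hf.fderiv_right (m := ∞) (by simp)).clm_apply contDiff_const

theorem norm_iterate_dAlong_le (v : X) (hv : ‖v‖ ≤ 1) (l : ℕ) {f : X → F} (hf : ContDiff ℝ ∞ f)
    (x : X) : ‖((dAlong v)^[l] f) x‖ ≤ ‖iteratedFDeriv ℝ l f x‖ := by
  induction l generalizing f with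
  | zero => simp
  | succ l ih =>
    rw [Function.iterate_succ_apply]
    refine (ih (contDiff_dAlong v hf)).trans ?_
    have h1 := norm_iteratedFDeriv_clm_apply_const (c := v) (x := x) (n := l) (N := ∞)
      (hf.fderiv_right (m := ∞) (by simp)).contDiffAt (by exact_mod_cast le_top)
    rw [← norm_iteratedFDeriv_fderiv]
    exact h1.trans (mul_le_of_le_one_left (norm_nonneg _) hv)

theorem exists_smooth_plateau {a b δ : ℝ} (hab : a < b) (hδ : 0 < δ) :
    ∃ c : ℝ → ℝ, ContDiff ℝ ∞ c ∧ (∀ t ∈ Set.Icc a b, c t = 1) ∧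
      tsupport c ⊆ Set.Icc (a - δ) (b + δ) ∧ ∀ t, |c t| ≤ 1 := by
  let φ : ContDiffBump ((a + b) / 2) := ⟨(b - a) / 2, (b - a) / 2 + δ, by linarith, by linarith⟩
  refine ⟨φ, φ.contDiff, fun t ht => φ.one_of_mem_closedBall ?_, ?_, fun t => ?_⟩
  · rw [Real.closedBall_eq_Icc]
    change t ∈ Set.Icc ((a + b) / 2 - (b - a) / 2) ((a + b) / 2 + (b - a) / 2)
    constructor <;> linarith [ht.1, ht.2]
  · rw [φ.tsupport_eq, Real.closedBall_eq_Icc]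
    change Set.Icc ((a + b) / 2 - ((b - a) / 2 + δ)) ((a + b) / 2 + ((b - a) / 2 + δ)) ⊆ _
    exact Set.Icc_subset_Icc (by linarith) (by linarith)
  · rw [abs_of_nonneg φ.nonneg]; exact φ.le_one

end

/-! ### Integrals depending on parameters -/

section

variable {Ω : Type*} [MeasurableSpace Ω] (μ : Measure Ω) [IsFiniteMeasure μ]
  {W : Type} [NormedAddCommGroup W] [NormedSpace ℝ W] [MeasurableSpace W] [BorelSpace W]
  [SecondCountableTopology W] {ι : Ω → W} (hι : Measurable ι)

omit [IsFiniteMeasure μ] [NormedSpace ℝ W] in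
include hι in
theorem aestronglyMeasurable_comp_param {P F : Type} [NormedAddCommGroup P] [NormedAddCommGroup F]
    {G : P × W → F} (hG : Continuous G) (p : P) : AEStronglyMeasurable (fun θ => G (p, ι θ)) μ := by
  have h1 : StronglyMeasurable fun w => G (p, w) := (hG.comp (by fun_prop)).stronglyMeasurable
  exact (h1.comp_measurable hι).aestronglyMeasurable

include hι in
theorem hasFDerivAt_integral_param {P F : Type} [NormedAddCommGroup P] [NormedSpace ℝ P]
    [NormedAddCommGroup F] [NormedSpace ℝ F] {G : P × W → F}
    (hG : ContDiff ℝ ∞ G) (hc : HasCompactSupport G) (p : P) :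
    HasFDerivAt (fun p => ∫ θ, G (p, ι θ) ∂μ)
      (∫ θ, (fderiv ℝ G (p, ι θ)).comp (ContinuousLinearMap.inl ℝ P W) ∂μ) p := by
  have hG' : Continuous fun q => (fderiv ℝ G q).comp (ContinuousLinearMap.inl ℝ P W) :=
    (hG.continuous_fderiv (by simp)).clm_comp continuous_const
  obtain ⟨C, hC⟩ := hG.continuous.bounded_above_of_compact_support hc
  obtain ⟨D, hD⟩ := (hG.continuous_fderiv (by simp)).bounded_above_of_compact_support (hc.fderiv ℝ)
  refine hasFDerivAt_integral_of_dominated_of_fderiv_le (bound := fun _ => D * 1) univ_mem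
    (F' := fun p θ => (fderiv ℝ G (p, ι θ)).comp (ContinuousLinearMap.inl ℝ P W)) ?_ ?_ ?_ ?_ ?_ ?_
  · exact Eventually.of_forall fun p => aestronglyMeasurable_comp_param μ hι hG.continuous p
  · exact Integrable.of_bound (aestronglyMeasurable_comp_param μ hι hG.continuous p) C
      (Eventually.of_forall fun θ => hC _)
  · exact aestronglyMeasurable_comp_param μ hι hG' p
  · refine Eventually.of_forall fun θ p _ => (ContinuousLinearMap.opNorm_comp_le _ _).trans ?_
    have : 0 ≤ D := (norm_nonneg _).trans (hD (p, ι θ))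
    exact mul_le_mul (hD _) (ContinuousLinearMap.norm_inl_le_one ℝ P W) (norm_nonneg _) this
  · exact integrable_const _
  · refine Eventually.of_forall fun θ p _ => ?_
    exact ((hG.differentiable (by simp)) (p, ι θ)).hasFDerivAt.comp p
      (hasFDerivAt_prodMk_left p (ι θ))

include hι in
theorem contDiff_integral_param {P F : Type} [NormedAddCommGroup P] [NormedSpace ℝ P]
    [NormedAddCommGroup F] [NormedSpace ℝ F] {G : P × W → F}
    (hG : ContDiff ℝ ∞ G) (hc : HasCompactSupport G) :
    ContDiff ℝ ∞ (fun p => ∫ θ, G (p, ι θ) ∂μ) := by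
  -- The target space must vary in the induction, because the derivative of the integral takes
  -- values in `P →L[ℝ] F`.
  have key : ∀ (m : ℕ) (F : Type) [NormedAddCommGroup F] [NormedSpace ℝ F] (G : P × W → F),
      ContDiff ℝ ∞ G → HasCompactSupport G → ContDiff ℝ m (fun p => ∫ θ, G (p, ι θ) ∂μ) := by
    intro m
    induction m with
    | zero =>
      intro F _ _ G hG hc
      exact contDiff_zero.2 (continuous_iff_continuousAt.2 fun p =>
        (hasFDerivAt_integral_param μ hι hG hc p).continuousAt)
    | succ m ih =>
      intro F _ _ G hG hc
      push_cast
      rw [contDiff_succ_iff_fderiv]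
      refine ⟨fun p => (hasFDerivAt_integral_param μ hι hG hc p).differentiableAt, by simp, ?_⟩
      have h1 : fderiv ℝ (fun p => ∫ θ, G (p, ι θ) ∂μ) =
          fun p => ∫ θ, (fderiv ℝ G (p, ι θ)).comp (ContinuousLinearMap.inl ℝ P W) ∂μ :=
        funext fun p => (hasFDerivAt_integral_param μ hι hG hc p).fderiv
      rw [h1]
      exact ih (P →L[ℝ] F) (fun q => (fderiv ℝ G q).comp (ContinuousLinearMap.inl ℝ P W))
        ((hG.fderiv_right (m := ∞) (by simp)).clm_comp contDiff_const)
        ((hc.fderiv ℝ).comp_left (g := fun L : P × W →L[ℝ] F =>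
          L.comp (ContinuousLinearMap.inl ℝ P W)) (by simp))
  exact contDiff_infty.2 fun m => key m F G hG hc

include hι in
theorem dAlong_integral_param {P F : Type} [NormedAddCommGroup P] [NormedSpace ℝ P]
    [NormedAddCommGroup F] [NormedSpace ℝ F] [CompleteSpace F] {G : P × W → F}
    (hG : ContDiff ℝ ∞ G) (hc : HasCompactSupport G) (v : P) :
    dAlong v (fun p => ∫ θ, G (p, ι θ) ∂μ) = fun p => ∫ θ, dAlong (v, (0 : W)) G (p, ι θ) ∂μ := by
  funext p
  rw [dAlong, (hasFDerivAt_integral_param μ hι hG hc p).fderiv, ContinuousLinearMap.integral_apply]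
  · rfl
  · have hG' : Continuous fun q => (fderiv ℝ G q).comp (ContinuousLinearMap.inl ℝ P W) :=
      (hG.continuous_fderiv (by simp)).clm_comp continuous_const
    have hc' : HasCompactSupport fun q => (fderiv ℝ G q).comp (ContinuousLinearMap.inl ℝ P W) :=
      (hc.fderiv ℝ).comp_left (g := fun L : P × W →L[ℝ] F =>
          L.comp (ContinuousLinearMap.inl ℝ P W)) (by simp)
    obtain ⟨C, hC⟩ := hG'.bounded_above_of_compact_support hc'
    exact Integrable.of_bound (aestronglyMeasurable_comp_param μ hι hG' p) C
      (Eventually.of_forall fun θ => hC _)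

include hι in
theorem norm_iterate_dAlong_integral_param_le {P F : Type} [NormedAddCommGroup P] [NormedSpace ℝ P]
    [NormedAddCommGroup F] [NormedSpace ℝ F] [CompleteSpace F] {G : P × W → F}
    (hG : ContDiff ℝ ∞ G) (hc : HasCompactSupport G) (v : P) (hv : ‖v‖ ≤ 1) (l : ℕ) {B : ℝ}
    (hB : ∀ q, ‖iteratedFDeriv ℝ l G q‖ ≤ B) (p : P) :
    ‖((dAlong v)^[l] fun p => ∫ θ, G (p, ι θ) ∂μ) p‖ ≤ B * μ.real Set.univ := by
  have key : ∀ (l : ℕ) (G : P × W → F), ContDiff ℝ ∞ G → HasCompactSupport G →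
      ((dAlong v)^[l] fun p => ∫ θ, G (p, ι θ) ∂μ) =
        fun p => ∫ θ, ((dAlong (v, (0 : W)))^[l] G) (p, ι θ) ∂μ := by
    intro l
    induction l with
    | zero => intro G _ _; rfl
    | succ l ih =>
      intro G hG hc
      rw [Function.iterate_succ_apply, dAlong_integral_param μ hι hG hc,
        ih _ (contDiff_dAlong _ hG) (hc.fderiv_apply ℝ _), Function.iterate_succ_apply]
  rw [key l G hG hc]
  refine norm_integral_le_of_norm_le_const (Eventually.of_forall fun θ => ?_)
  refine (norm_iterate_dAlong_le _ ?_ l hG _).trans (hB _)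
  rw [Prod.norm_def]; simpa using hv

end


/-! ### Polar coordinates with the squared radius -/

/-- The variable is `t = r²`, since the real part of the quadratic form is affine in `|y|²`. The
weight is the Jacobian `dr/dt` times `r^(N-1)`, and it is smooth for `t > 0`. -/
theorem integral_polar {N : ℕ} (hN : N ≠ 0) {F : Type*} [NormedAddCommGroup F] [NormedSpace ℝ F]
    {Φ : Rn N → F} (hΦ : Integrable Φ) :
    ∫ y, Φ y = ∫ t in Set.Ioi (0 : ℝ), (1 / 2 * t ^ ((1 : ℝ) / 2 - 1) * √t ^ (N - 1)) •
      ∫ θ : Metric.sphere (0 : Rn N) 1, Φ (√t • (θ : Rn N)) ∂(volume : Measure (Rn N)).toSphere := by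
  have : Nonempty (Fin N) := ⟨⟨0, Nat.pos_of_ne_zero hN⟩⟩
  have : Nontrivial (Rn N) := inferInstance
  have hdim : Module.finrank ℝ (Rn N) = N := by simp
  set μ : Measure (Rn N) := volume with hμ
  have hmp := μ.measurePreserving_homeomorphUnitSphereProd
  have hemb : MeasurableEmbedding (homeomorphUnitSphereProd (Rn N)) :=
    Homeomorph.measurableEmbedding _
  set G : Metric.sphere (0 : Rn N) 1 × Set.Ioi (0 : ℝ) → F := fun q => Φ ((q.2 : ℝ) • (q.1 : Rn N))
    with hG
  have e0 : ∀ x : ({(0 : Rn N)}ᶜ : Set (Rn N)), G (homeomorphUnitSphereProd (Rn N) x) = Φ x := by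
    intro x
    have hx : ‖(x : Rn N)‖ ≠ 0 := norm_ne_zero_iff.2 x.2
    simp [hG, smul_smul, hx]
  have e1 : ∫ y, Φ y ∂μ = ∫ x : ({(0 : Rn N)}ᶜ : Set (Rn N)), Φ x ∂(μ.comap (↑)) := by
    rw [integral_subtype_comap (measurableSet_singleton _).compl fun x => Φ x,
      restrict_compl_singleton]
  have i1 : Integrable (fun x : ({(0 : Rn N)}ᶜ : Set (Rn N)) => Φ x) (μ.comap (↑)) := by
    have hm : MeasurableSet ({(0 : Rn N)}ᶜ : Set (Rn N)) := (measurableSet_singleton _).compl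
    have := (MeasurableEmbedding.subtype_coe hm).integrable_map_iff (g := Φ) (μ := μ.comap (↑))
    rw [map_comap_subtype_coe hm, restrict_compl_singleton] at this
    exact this.1 hΦ
  have e2 : ∫ x : ({(0 : Rn N)}ᶜ : Set (Rn N)), Φ x ∂(μ.comap (↑)) =
      ∫ q, G q ∂(μ.toSphere.prod (.volumeIoiPow (Module.finrank ℝ (Rn N) - 1))) := by
    rw [← hmp.integral_comp hemb]
    simp only [e0]
  have i2 : Integrable G (μ.toSphere.prod (.volumeIoiPow (Module.finrank ℝ (Rn N) - 1))) := by
    rw [← hmp.integrable_comp_emb hemb]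
    refine i1.congr (Eventually.of_forall fun x => (e0 x).symm)
  set J : ℝ → F := fun r => ∫ θ : Metric.sphere (0 : Rn N) 1, Φ (r • (θ : Rn N)) ∂μ.toSphere with hJ
  have e3 : ∫ q, G q ∂(μ.toSphere.prod (.volumeIoiPow (Module.finrank ℝ (Rn N) - 1))) =
      ∫ r in Set.Ioi (0 : ℝ), r ^ (N - 1) • J r := by
    rw [integral_prod_symm _ i2, hdim]
    simp only [Measure.volumeIoiPow, ENNReal.ofReal]
    rw [integral_withDensity_eq_integral_smul
      ((measurable_subtype_coe.pow_const _).real_toNNReal),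
      integral_subtype_comap measurableSet_Ioi fun a => Real.toNNReal (a ^ (N - 1)) • J a]
    refine setIntegral_congr_fun measurableSet_Ioi fun x hx => ?_
    rw [NNReal.smul_def, Real.coe_toNNReal _ (pow_nonneg (le_of_lt hx) _)]
  rw [e1, e2, e3, ← integral_comp_rpow_Ioi_of_pos (g := fun r => r ^ (N - 1) • J r)
    (show (0 : ℝ) < 1 / 2 by norm_num)]
  refine setIntegral_congr_fun measurableSet_Ioi fun t _ => ?_
  rw [← Real.sqrt_eq_rpow, smul_smul]

/-! ### The spherical mean of a function around an axis -/

section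

variable {N : ℕ} {e : Rn (N + 1)} (Ψ : Cylinder e) (a : Rn (N + 1)) (β : ℝ)

/-- The squared distance from the axis, shifted so that it is the real part of the quadratic form. -/
theorem quad_cylinder {z : Fin (N + 1) → ℂ} (ha : rePart z = a) (hb : imPart z = β • e)
    (he : ‖e‖ = 1) (y : Rn N) (s : ℝ) :
    quad z (a + Ψ.map (y, s)) = planar β (‖y‖ ^ 2 + s ^ 2 - β ^ 2) s := by
  rw [quad_eq, ha, hb, add_sub_cancel_left, Ψ.norm_sq, inner_smul_right, Ψ.inner_axis, norm_smul, he,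
    planar, Real.norm_eq_abs, mul_one, sq_abs, mul_assoc]

/-- The operator integrates `g` over the spheres `|y|² = t`, with `t = u - s² + β²`, and multiplies
by the polar weight. It is smooth and bounded in `C^k` norms because `g` is used only for `t ≥ t₀ >
0`, away from the axis where `√t` is singular. The kernel enters only through its values on the line
and factors out. -/
theorem exists_sphericalMean (hN : N ≠ 0) {t₀ T : ℝ} (ht₀ : 0 < t₀) (hT : t₀ < T) {R : ℝ}
    (hR : 0 < R) {F : Type} [NormedAddCommGroup F] [NormedSpace ℂ F] [CompleteSpace F] :
    ∃ (A : (Rn (N + 1) → F) → ℝ × ℝ → F) (R' : ℝ),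
      (∀ g, ContDiff ℝ ∞ g → ContDiff ℝ ∞ (A g) ∧ BoxSupported R' (A g)) ∧
      (∀ k : ℕ, ∃ C : ℝ, 0 ≤ C ∧ ∀ g, ContDiff ℝ ∞ g → ∀ B : ℝ,
        (∀ i ≤ k, ∀ x, ‖iteratedFDeriv ℝ i g x‖ ≤ B) →
        ∀ l ≤ k, ∀ p, ‖(dFst^[l] (A g)) p‖ ≤ C * B) ∧
      ∀ g, (∀ y s, g (a + Ψ.map (y, s)) ≠ 0 → t₀ ≤ ‖y‖ ^ 2 ∧ ‖y‖ ^ 2 ≤ T ∧ |s| ≤ R) →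
        ∀ (κ : ℂ → ℂ) (s : ℝ),
          Integrable (fun y => κ (planar β (‖y‖ ^ 2 + s ^ 2 - β ^ 2) s) • g (a + Ψ.map (y, s))) →
          ∫ y, κ (planar β (‖y‖ ^ 2 + s ^ 2 - β ^ 2) s) • g (a + Ψ.map (y, s)) =
            lineIntegral β κ (A g) s := by
  -- `c₁` truncates the weight near `[t₀, T]`. `c₂` truncates the root `√t` and is one on the
  -- support of `c₁`, so the radius is exact wherever the weight is nonzero. `c₃` truncates in `s`;
  -- `c₄` makes the integrand compactly supported when the sphere variable is extended to all of `Rn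
  -- N`.
  obtain ⟨c₁, c₁s, c₁1, c₁t, -⟩ := exists_smooth_plateau hT (δ := t₀ / 2) (by positivity)
  obtain ⟨c₂, c₂s, c₂1, c₂t, -⟩ := exists_smooth_plateau (a := t₀ - t₀ / 2) (b := T + t₀ / 2)
    (by linarith) (δ := t₀ / 4) (by positivity)
  obtain ⟨c₃, c₃s, c₃1, c₃t, -⟩ := exists_smooth_plateau (a := -R) (b := R) (by linarith) one_pos
  let c₄ : ContDiffBump (0 : Rn N) := ⟨1, 2, one_pos, one_lt_two⟩
  set m₀ : ℝ → ℝ := fun t => 1 / 2 * t ^ ((1 : ℝ) / 2 - 1) * √t ^ (N - 1) with hm₀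
  have hm₀s : ContDiffOn ℝ ∞ m₀ (Set.Ioi 0) := by
    have h1 : ContDiffOn ℝ ∞ (fun t : ℝ => t ^ ((1 : ℝ) / 2 - 1)) (Set.Ioi 0) := fun t ht =>
      (Real.contDiffAt_rpow_const_of_ne (ne_of_gt ht)).contDiffWithinAt
    have h2 : ContDiffOn ℝ ∞ (fun t : ℝ => √t) (Set.Ioi 0) := fun t ht =>
      (Real.contDiffAt_sqrt (ne_of_gt ht)).contDiffWithinAt
    exact (contDiffOn_const.mul h1).mul (h2.pow _)
  have hsq : ContDiffOn ℝ ∞ (fun t : ℝ => √t) (Set.Ioi 0) := fun t ht =>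
    (Real.contDiffAt_sqrt (ne_of_gt ht)).contDiffWithinAt
  have hc₁pos : tsupport c₁ ⊆ Set.Ioi 0 := fun t ht => by
    have := (c₁t ht).1
    exact lt_of_lt_of_le (by linarith) this
  have hc₂pos : tsupport c₂ ⊆ Set.Ioi 0 := fun t ht => by
    have := (c₂t ht).1
    exact lt_of_lt_of_le (by linarith) this
  set m : ℝ → ℝ := fun t => m₀ t * c₁ t with hm
  set r : ℝ → ℝ := fun t => √t * c₂ t with hr
  have hms : ContDiff ℝ ∞ m :=
    contDiff_bilinear_of_tsupport (ContinuousLinearMap.mul ℝ ℝ) isOpen_Ioi hm₀s c₁s hc₁pos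
  have hrs : ContDiff ℝ ∞ r :=
    contDiff_bilinear_of_tsupport (ContinuousLinearMap.mul ℝ ℝ) isOpen_Ioi hsq c₂s hc₂pos
  set M : (ℝ × ℝ) × Rn N → ℝ := fun q =>
    m (q.1.1 - q.1.2 ^ 2 + β ^ 2) * c₃ q.1.2 * c₄ q.2 with hM
  set P : (ℝ × ℝ) × Rn N → Rn (N + 1) := fun q =>
    a + Ψ.map (r (q.1.1 - q.1.2 ^ 2 + β ^ 2) • q.2, q.1.2) with hP
  have hMs : ContDiff ℝ ∞ M := by
    refine ((hms.comp (by fun_prop)).mul (c₃s.comp (by fun_prop))).mul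
      (c₄.contDiff.comp contDiff_snd)
  have hPs : ContDiff ℝ ∞ P := by
    refine contDiff_const.add (Ψ.map.contDiff.comp (ContDiff.prodMk ?_ (by fun_prop)))
    exact (hrs.comp (by fun_prop)).smul contDiff_snd
  set R' : ℝ := (T + t₀ / 2) + (R + 1) ^ 2 + β ^ 2 + (R + 1) with hR'
  have hMz : ∀ q, M q ≠ 0 → (q.1 ∈ Set.Icc (-R') R' ×ˢ Set.Icc (-R') R') ∧
      q.2 ∈ Metric.closedBall (0 : Rn N) 2 := fun q hq => by
    have h1 : m (q.1.1 - q.1.2 ^ 2 + β ^ 2) ≠ 0 := fun h => hq (by simp [hM, h])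
    have h2 : c₃ q.1.2 ≠ 0 := fun h => hq (by simp [hM, h])
    have h3 : c₄ q.2 ≠ 0 := fun h => hq (by simp [hM, h])
    have h4 := c₁t (subset_tsupport c₁ fun h => h1 (by simp [hm, h]) :
      q.1.1 - q.1.2 ^ 2 + β ^ 2 ∈ tsupport c₁)
    have h5 := c₃t (subset_tsupport c₃ h2)
    have h6 : q.2 ∈ tsupport c₄ := subset_tsupport c₄ h3
    rw [c₄.tsupport_eq] at h6
    have h7 : q.1.2 ^ 2 ≤ (R + 1) ^ 2 := sq_le_sq' (by linarith [h5.1]) (by linarith [h5.2])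
    have h8 : 0 ≤ q.1.2 ^ 2 := sq_nonneg _
    have h9 : 0 ≤ β ^ 2 := sq_nonneg _
    have h10 : 0 ≤ (R + 1) ^ 2 := sq_nonneg _
    refine ⟨⟨⟨?_, ?_⟩, ⟨?_, ?_⟩⟩, h6⟩ <;> linarith [h4.1, h4.2, h5.1, h5.2]
  have hMc : HasCompactSupport M := by
    refine HasCompactSupport.intro (((isCompact_Icc (a := -R') (b := R')).prod
      (isCompact_Icc (a := -R') (b := R'))).prod (isCompact_closedBall (0 : Rn N) 2)) fun q hq => ?_
    by_contra h
    exact hq (hMz q h)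
  have hι : Measurable (fun θ : Metric.sphere (0 : Rn N) 1 => (θ : Rn N)) := measurable_subtype_coe
  have hGs : ∀ g : Rn (N + 1) → F, ContDiff ℝ ∞ g → ContDiff ℝ ∞ (fun q => M q • g (P q)) :=
    fun g hg => hMs.smul (hg.comp hPs)
  have hGc : ∀ g : Rn (N + 1) → F, HasCompactSupport (fun q => M q • g (P q)) := fun g =>
    hMc.smul_right
  refine ⟨fun g p => ∫ θ : Metric.sphere (0 : Rn N) 1, M (p, (θ : Rn N)) • g (P (p, (θ : Rn N)))
    ∂(volume : Measure (Rn N)).toSphere, R', fun g hg => ⟨?_, fun p hp => ?_⟩, fun k => ?_, ?_⟩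
  · exact contDiff_integral_param _ hι (hGs g hg) (hGc g)
  · have : ∀ θ : Metric.sphere (0 : Rn N) 1, M (p, (θ : Rn N)) = 0 := fun θ => by
      by_contra h
      exact hp (hMz _ h).1
    simp [this]
  · obtain ⟨C, hC, hb⟩ := exists_bound_smul_comp (F := F) hMs hMc hPs k
    refine ⟨C * (volume : Measure (Rn N)).toSphere.real Set.univ, by positivity,
      fun g hg B hB l hl p => ?_⟩
    have h1 := norm_iterate_dAlong_integral_param_le (volume : Measure (Rn N)).toSphere hι
      (hGs g hg) (hGc g) ((1 : ℝ), (0 : ℝ)) (by simp) l (hb g hg B hB l hl) p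
    calc _ ≤ _ := h1
      _ = _ := by ring
  · intro g hg κ s hi
    symm
    rw [lineIntegral, ← integral_add_right_eq_self _ (s ^ 2 - β ^ 2),
      ← setIntegral_eq_integral_of_forall_compl_eq_zero (s := Set.Ioi (0 : ℝ)), integral_polar hN hi]
    · symm
      refine setIntegral_congr_fun measurableSet_Ioi fun t ht => ?_
      have ht' : 0 < t := ht
      have hn : ∀ θ : Metric.sphere (0 : Rn N) 1, ‖√t • (θ : Rn N)‖ ^ 2 = t := fun θ => by
        rw [norm_smul, Real.norm_of_nonneg (Real.sqrt_nonneg _), mul_pow, Real.sq_sqrt ht'.le]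
        simp
      simp only [hn]
      rw [integral_smul, smul_comm, ← integral_smul]
      rw [show t + (s ^ 2 - β ^ 2) = t + s ^ 2 - β ^ 2 by ring]
      congr 2
      funext θ
      have e1 : t + s ^ 2 - β ^ 2 - s ^ 2 + β ^ 2 = t := by ring
      have hc4 : c₄ (θ : Rn N) = 1 := c₄.one_of_mem_closedBall (by
        change (θ : Rn N) ∈ Metric.closedBall 0 1
        simp)
      simp only [hM, hP, e1, hc4, mul_one]
      change m₀ t • _ = _
      have hc3 : |s| ≤ R → c₃ s = 1 := fun h => c₃1 s (abs_le.1 h)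
      have hrt : ‖r t • (θ : Rn N)‖ ^ 2 = r t ^ 2 := by
        rw [norm_smul, mul_pow, Real.norm_eq_abs, sq_abs]; simp
      have hgz : ∀ {t : ℝ} {y : Rn N}, ‖y‖ ^ 2 = t → ¬ (t₀ ≤ t ∧ t ≤ T ∧ |s| ≤ R) →
          g (a + Ψ.map (y, s)) = 0 := fun {t y} hy hno => by
        by_contra h
        have := hg y s h
        rw [hy] at this
        exact hno this
      by_cases hs : |s| ≤ R
      · by_cases htT : t₀ ≤ t ∧ t ≤ T
        · have h2 : c₁ t = 1 := c₁1 t ⟨htT.1, htT.2⟩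
          have h3 : c₂ t = 1 := c₂1 t ⟨by linarith [htT.1], by linarith [htT.2]⟩
          simp only [hm, hr, h2, h3, mul_one, hc3 hs]
        -- In the transition zone of `c₁` the root is still untruncated, so the points fall outside
        -- the support of `g`.
        · rw [hgz (hn θ) (fun h => htT ⟨h.1, h.2.1⟩), smul_zero]
          by_cases hmz : c₁ t = 0
          · simp [hm, hmz]
          · have h4 := c₁t (subset_tsupport c₁ hmz)
            have h3 : c₂ t = 1 := c₂1 t ⟨h4.1, h4.2⟩
            rw [hgz (y := r t • (θ : Rn N)) (t := t) (by
              rw [hrt, hr]; simp only [h3, mul_one]; exact Real.sq_sqrt ht'.le)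
              (fun h => htT ⟨h.1, h.2.1⟩), smul_zero]
      · rw [hgz rfl fun h => hs h.2.2, hgz rfl fun h => hs h.2.2, smul_zero, smul_zero]
    · intro t ht
      have h1 : m t = 0 := by
        have : c₁ t = 0 := by
          by_contra h
          exact ht (hc₁pos (subset_tsupport c₁ h))
        simp [hm, this]
      have e1 : t + (s ^ 2 - β ^ 2) - s ^ 2 + β ^ 2 = t := by ring
      beta_reduce
      simp only [hM, e1, h1, zero_mul, zero_smul, integral_zero, smul_zero]

end


/-! ### Kernels bounded on annuli -/

/-- A measurable kernel that is bounded on annuli. -/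
structure IsAnnularKernel (κ : ℂ → ℂ) : Prop where
  measurable : Measurable κ
  bound : ∀ δ > 0, ∀ Z : ℝ, ∃ C : ℝ, 0 ≤ C ∧ ∀ ζ, δ ≤ ‖ζ‖ → ‖ζ‖ ≤ Z → ‖κ ζ‖ ≤ C

theorem IsAnnularKernel.const_mul {κ : ℂ → ℂ} (h : IsAnnularKernel κ) (c : ℂ) :
    IsAnnularKernel (fun ζ => c * κ ζ) := by
  refine ⟨h.measurable.const_mul c, fun δ hδ Z => ?_⟩
  obtain ⟨C, hC, hb⟩ := h.bound δ hδ Z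
  refine ⟨‖c‖ * C, by positivity, fun ζ h1 h2 => ?_⟩
  rw [norm_mul]
  exact mul_le_mul_of_nonneg_left (hb ζ h1 h2) (norm_nonneg _)

theorem isAnnularKernel_inv_croot_pow (j : ℕ) : IsAnnularKernel (fun ζ => (croot ζ ^ j)⁻¹) := by
  refine ⟨measurable_inv_croot_pow j, fun δ hδ Z => ⟨(√δ ^ j)⁻¹, by positivity, fun ζ h1 _ => ?_⟩⟩
  rw [norm_inv, norm_pow]
  have h2 : √δ ≤ ‖croot ζ‖ := Real.sqrt_le_iff.2 ⟨norm_nonneg _, by rwa [norm_croot_sq]⟩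
  have h3 : 0 < √δ := Real.sqrt_pos.2 hδ
  gcongr

theorem isAnnularKernel_log_croot : IsAnnularKernel (fun ζ => Complex.log (croot ζ)) := by
  refine ⟨Complex.measurable_log.comp measurable_croot, fun δ hδ Z =>
    ⟨5 * (1 + |Z| + δ⁻¹), by positivity, fun ζ h1 h2 => (norm_log_croot_le ζ).trans ?_⟩⟩
  have := le_abs_self Z
  have h3 : ‖ζ‖⁻¹ ≤ δ⁻¹ := inv_anti₀ hδ h1
  linarith

theorem isAnnularKernel_kerOf (n : ℕ) : IsAnnularKernel (kerOf n) := by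
  rw [show kerOf n = fun ζ => (sphereArea n : ℂ)⁻¹ * (croot ζ ^ n)⁻¹ from funext (kerOf_eq n)]
  exact (isAnnularKernel_inv_croot_pow n).const_mul _

theorem isAnnularKernel_potOf {n : ℕ} (hn : 2 ≤ n) : IsAnnularKernel (potOf n) := by
  rcases hn.eq_or_lt with rfl | hn
  · rw [show potOf 2 = fun ζ => (2 * Real.pi : ℂ)⁻¹ * Complex.log (croot ζ) from funext fun ζ => by
      rw [potOf_two, div_eq_mul_inv, mul_comm]]
    exact isAnnularKernel_log_croot.const_mul _
  · rw [show potOf n = fun ζ => (sphereArea n * (2 - n) : ℂ)⁻¹ * (croot ζ ^ (n - 2))⁻¹ from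
      funext (potOf_eq hn)]
    exact (isAnnularKernel_inv_croot_pow _).const_mul _

theorem exists_bound_of_tsupport {X F : Type*} [TopologicalSpace X] [NormedAddCommGroup F]
    {q : X → ℂ} (hq : Continuous q) {g : X → F} (hc : HasCompactSupport g) {κ : ℂ → ℂ}
    (hκ : IsAnnularKernel κ) {δ : ℝ} (hδ : 0 < δ) :
    ∃ C : ℝ, 0 ≤ C ∧ ∀ x, g x ≠ 0 → δ ≤ ‖q x‖ → ‖κ (q x)‖ ≤ C := by
  obtain ⟨Z, hZ⟩ := hc.isCompact.exists_bound_of_continuousOn hq.continuousOn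
  obtain ⟨C, hC, hb⟩ := hκ.bound δ hδ Z
  exact ⟨C, hC, fun x hx h1 => hb _ h1 (hZ x (subset_tsupport g hx))⟩

theorem integrable_kernel_comp {X F : Type*} [TopologicalSpace X] [MeasurableSpace X] [BorelSpace X]
    (μ : Measure X) [IsFiniteMeasureOnCompacts μ]
    [NormedAddCommGroup F] [NormedSpace ℂ F] {q : X → ℂ} (hq : Continuous q) {g : X → F}
    (hg : Continuous g) (hc : HasCompactSupport g) {κ : ℂ → ℂ} (hκ : IsAnnularKernel κ)
    {W : X → ℂ} (hW : Measurable W) (hW1 : ∀ x, ‖W x‖ ≤ 1) {δ : ℝ} (hδ : 0 < δ)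
    (hWδ : ∀ x, g x ≠ 0 → W x ≠ 0 → δ ≤ ‖q x‖) :
    Integrable (fun x => (W x * κ (q x)) • g x) μ := by
  obtain ⟨C, hC, hb⟩ := exists_bound_of_tsupport hq hc hκ hδ
  refine ((hg.integrable_of_hasCompactSupport hc).norm.const_mul C).mono'
    ((hW.mul (hκ.measurable.comp hq.measurable)).aestronglyMeasurable.smul
      (hg.stronglyMeasurable_of_hasCompactSupport hc).aestronglyMeasurable)
    (Eventually.of_forall fun x => ?_)
  by_cases h1 : g x = 0
  · simp [h1]
  by_cases h2 : W x = 0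
  · simp only [h2, zero_mul, zero_smul, norm_zero]; positivity
  rw [norm_smul, norm_mul]
  have h3 := hb x h1 (hWδ x h1 h2)
  calc _ ≤ 1 * C * ‖g x‖ := by
        gcongr
        exact hW1 x
    _ = _ := by ring

/-! ### Axial coordinates -/

section

variable {N : ℕ} {e : Rn (N + 1)} (Ψ : Cylinder e) (a : Rn (N + 1)) (β : ℝ)

/-- The coordinate along the axis through `a` in the direction `e`. -/
def axial (a e : Rn (N + 1)) (x : Rn (N + 1)) : ℝ := inner ℝ (x - a) e

theorem axial_cylinder (y : Rn N) (s : ℝ) : axial a e (a + Ψ.map (y, s)) = s := by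
  rw [axial, add_sub_cancel_left, Ψ.inner_axis]

theorem contDiff_axial (e : Rn (N + 1)) : ContDiff ℝ ∞ (axial a e) :=
  (contDiff_id.sub contDiff_const).inner ℝ contDiff_const

/-- The squared distance from the axis through `a` in the direction `e`. -/
def axisDistSq (a e : Rn (N + 1)) (x : Rn (N + 1)) : ℝ := ‖x - a‖ ^ 2 - axial a e x ^ 2

theorem axisDistSq_cylinder (y : Rn N) (s : ℝ) : axisDistSq a e (a + Ψ.map (y, s)) = ‖y‖ ^ 2 := by
  rw [axisDistSq, axial_cylinder, add_sub_cancel_left, Ψ.norm_sq]; ring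

theorem contDiff_axisDistSq (e : Rn (N + 1)) : ContDiff ℝ ∞ (axisDistSq a e) :=
  ((contDiff_id.sub contDiff_const).norm_sq ℝ).sub ((contDiff_axial a e).pow 2)

include Ψ in
theorem exists_cylinder_coord (x : Rn (N + 1)) : ∃ y s, x = a + Ψ.map (y, s) := by
  obtain ⟨y, hy⟩ := Ψ.exists_eq (x - a)
  exact ⟨y, _, by rw [← hy]; abel⟩

theorem integral_cylinder {F : Type*} [NormedAddCommGroup F] [NormedSpace ℝ F]
    {f : Rn (N + 1) → F} (hf : Integrable f) :
    Integrable (fun s => ∫ y, f (a + Ψ.map (y, s))) ∧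
    (∀ᵐ s : ℝ, Integrable (fun y => f (a + Ψ.map (y, s)))) ∧
    ∫ x, f x = ∫ s, ∫ y, f (a + Ψ.map (y, s)) := by
  have h1 : Integrable (fun p : Rn N × ℝ => f (a + Ψ.map p)) (volume.prod volume) :=
    (Ψ.integrable_comp_iff a f).2 hf
  refine ⟨h1.integral_prod_right, h1.prod_left_ae, ?_⟩
  rw [← Ψ.integral_comp a f, Measure.volume_eq_prod, integral_prod_symm _ h1]

/-- The form vanishes only where `s = 0` and `|y| = |β|`. Near the axis the kernels may jump across
the disk but stay bounded, so that this region, where polar coordinates degenerate, needs only an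
absolute estimate. -/
theorem norm_planar_ge_of_near {t s : ℝ} (ht0 : 0 ≤ t) (ht : t ≤ β ^ 2 / 4) :
    β ^ 2 / 2 ≤ ‖planar β (t + s ^ 2 - β ^ 2) s‖ := by
  refine abs_le_of_sq_le_sq' (a := β ^ 2 / 2) ?_ (norm_nonneg _) |>.2
  rw [← Complex.normSq_eq_norm_sq, Complex.normSq_apply, planar_re, planar_im]
  nlinarith [sq_nonneg (t - β ^ 2), mul_nonneg ht0 (sq_nonneg s), sq_nonneg (s ^ 2), sq_nonneg (β ^ 2),
    mul_nonneg (sq_nonneg β) (sub_nonneg.2 ht), mul_nonneg (sq_nonneg β) (sq_nonneg s), sq_nonneg t]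

theorem norm_planar_ge_of_axial (u s : ℝ) : |2 * β * s| ≤ ‖planar β u s‖ := by
  have := Complex.abs_im_le_norm (planar β u s)
  rwa [planar_im, abs_neg] at this

/-- A cutoff function that is one near the axis, and where the kernels are bounded. -/
theorem exists_axisCutoff (e : Rn (N + 1)) {β : ℝ} (hβ : β ≠ 0) : ∃ χ : Rn (N + 1) → ℝ,
    ContDiff ℝ ∞ χ ∧ (∀ x, |χ x| ≤ 1) ∧ (∀ x, χ x ≠ 0 → axisDistSq a e x ≤ β ^ 2 / 4) ∧
    (∀ x, 1 - χ x ≠ 0 → axisDistSq a e x ∉ Set.Icc 0 (β ^ 2 / 8)) := by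
  have hb : 0 < β ^ 2 / 8 := by positivity
  obtain ⟨c, cs, c1, ct, cb⟩ := exists_smooth_plateau (a := -(β ^ 2 / 8)) (b := β ^ 2 / 8)
    (by linarith) hb
  refine ⟨fun x => c (axisDistSq a e x), cs.comp (contDiff_axisDistSq a e), fun x => cb _,
    fun x hx => ?_, fun x hx h => hx ?_⟩
  · have := (ct (subset_tsupport c hx)).2
    linarith
  · change 1 - c (axisDistSq a e x) = 0
    rw [c1 _ ⟨by linarith [h.1], h.2⟩, sub_self]

theorem axisCutoff_support {β R : ℝ} (hR0 : 0 < R) {χ : Rn (N + 1) → ℝ}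
    (χo : ∀ x, 1 - χ x ≠ 0 → axisDistSq a e x ∉ Set.Icc 0 (β ^ 2 / 8)) {y : Rn N} {s : ℝ}
    (h1 : 1 - χ (a + Ψ.map (y, s)) ≠ 0) (h2 : ‖a + Ψ.map (y, s) - a‖ ≤ R) :
    β ^ 2 / 8 ≤ ‖y‖ ^ 2 ∧ ‖y‖ ^ 2 ≤ R ^ 2 + β ^ 2 ∧ |s| ≤ R := by
  rw [add_sub_cancel_left] at h2
  have h5 : ‖y‖ ^ 2 + s ^ 2 ≤ R ^ 2 := by
    rw [← Ψ.norm_sq (y, s)]; gcongr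
  have h6 := χo _ h1
  rw [axisDistSq_cylinder] at h6
  refine ⟨?_, by nlinarith [sq_nonneg s, sq_nonneg β],
    abs_le_of_sq_le_sq (by nlinarith [sq_nonneg ‖y‖]) hR0.le⟩
  by_contra hlt
  exact h6 ⟨by positivity, (not_le.1 hlt).le⟩

/-- Reduction of an integral over space to a planar one. -/
theorem integral_eq_integral_planar {F : Type} [NormedAddCommGroup F] [NormedSpace ℂ F]
    {z : Fin (N + 1) → ℂ} (ha : rePart z = a) (hb : imPart z = β • e) (he : ‖e‖ = 1)
    {g : Rn (N + 1) → F} {H : ℝ × ℝ → F}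
    (hH : ∀ (κ : ℂ → ℂ) (s : ℝ),
      Integrable (fun y => κ (planar β (‖y‖ ^ 2 + s ^ 2 - β ^ 2) s) • g (a + Ψ.map (y, s))) →
      ∫ y, κ (planar β (‖y‖ ^ 2 + s ^ 2 - β ^ 2) s) • g (a + Ψ.map (y, s)) = lineIntegral β κ H s)
    (k : ℂ → ℝ → ℂ) (hi : Integrable fun x => k (quad z x) (axial a e x) • g x)
    (hp : Integrable fun p : ℝ × ℝ => k (planar β p.1 p.2) p.2 • H p) :
    ∫ x, k (quad z x) (axial a e x) • g x = ∫ p : ℝ × ℝ, k (planar β p.1 p.2) p.2 • H p := by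
  obtain ⟨-, h1, h2⟩ := integral_cylinder Ψ a hi
  rw [h2, Measure.volume_eq_prod, integral_prod_symm _ hp]
  refine integral_congr_ae ?_
  filter_upwards [h1] with s hs
  simp only [quad_cylinder Ψ a β ha hb he, axial_cylinder] at hs ⊢
  exact hH (fun ζ => k ζ s) s hs

include Ψ in
/-- The regularizations of the potential converge, and the limit does not change if the
potential is cut off near the hyperplane `axial = 0` instead. -/
theorem exists_tendsto_regPotential_of_imPart_ne_zero (hN : N ≠ 0) {z : Fin (N + 1) → ℂ}
    (ha : rePart z = a) (hb : imPart z = β • e) (he : ‖e‖ = 1) (hβ : 0 < β)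
    {h : Rn (N + 1) → Cl (N + 1)} (hh : ContDiff ℝ ∞ h) (hc : HasCompactSupport h) :
    ∃ L, Tendsto (fun ε => regPotential z ε h) (𝓝[>] 0) (𝓝 L) ∧
      ∀ w : ℝ → ℝ, IsAxisWeight w → Tendsto (fun τ : ℝ => ∫ x,
        (w (axial a e x / τ) : ℂ) • potential (shift x z) • h x) (𝓝[>] 0) (𝓝 L) := by
  have hn : 2 ≤ N + 1 := by omega
  have hκ := isAnnularKernel_potOf hn
  have hq := (contDiff_quad z).continuous
  -- The test function is split into a part near the axis, where the potential is bounded and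
  -- dominated convergence applies, and a part away from it, to which the spherical mean applies.
  obtain ⟨χ, χs, χ1, χn, χo⟩ := exists_axisCutoff a e hβ.ne'
  set h₁ : Rn (N + 1) → Cl (N + 1) := fun x => χ x • h x with hh₁
  set h₂ : Rn (N + 1) → Cl (N + 1) := fun x => (1 - χ x) • h x with hh₂
  have h₁s : ContDiff ℝ ∞ h₁ := χs.smul hh
  have h₂s : ContDiff ℝ ∞ h₂ := (contDiff_const.sub χs).smul hh
  have h₁c : HasCompactSupport h₁ := hc.smul_left
  have h₂c : HasCompactSupport h₂ := hc.smul_left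
  have hsum : ∀ x, h x = h₁ x + h₂ x := fun x => by
    simp only [hh₁, hh₂, ← add_smul]; rw [add_sub_cancel, one_smul]
  have hwm : ∀ (w : ℝ → ℝ), IsAxisWeight w → ∀ τ : ℝ,
      Measurable fun x : Rn (N + 1) => (w (axial a e x / τ) : ℂ) := fun w hw τ =>
    Complex.measurable_ofReal.comp (hw.smooth.continuous.measurable.comp
      ((contDiff_axial a e).continuous.measurable.div_const τ))
  have hwm2 : ∀ (w : ℝ → ℝ), IsAxisWeight w → ∀ τ : ℝ,
      Measurable fun p : ℝ × ℝ => (w (p.2 / τ) : ℂ) := fun w hw τ =>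
    Complex.measurable_ofReal.comp (hw.smooth.continuous.measurable.comp (by fun_prop))
  have hwδ : ∀ (w : ℝ → ℝ), IsAxisWeight w → ∀ τ : ℝ, 0 < τ → ∀ s u : ℝ, (w (s / τ) : ℂ) ≠ 0 →
      2 * β * τ ≤ ‖planar β u s‖ := fun w hw τ hτ s u hws => by
    have h1 : ¬ |s / τ| ≤ 1 := fun h => hws (by rw [hw.eq_zero _ h]; simp)
    rw [not_le, abs_div, abs_of_pos hτ, one_lt_div hτ] at h1
    refine le_trans ?_ (norm_planar_ge_of_axial β u s)
    rw [abs_mul, abs_of_pos (by positivity : 0 < 2 * β)]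
    gcongr
  have hsl : Integrable fun x => potential (shift x z) • h₁ x := by
    have h1 := integrable_kernel_comp volume hq h₁s.continuous h₁c hκ (W := fun _ => 1)
      measurable_const (by simp) (δ := β ^ 2 / 2) (by positivity) fun x hx _ => by
        obtain ⟨y, s, rfl⟩ := exists_cylinder_coord Ψ a x
        rw [quad_cylinder Ψ a β ha hb he]
        have h2 := χn (a + Ψ.map (y, s)) fun h0 => hx (by simp [hh₁, h0])
        rw [axisDistSq_cylinder] at h2
        exact norm_planar_ge_of_near β (by positivity) h2
    simp only [one_mul] at h1
    exact h1
  have near1 := tendsto_setIntegral_lt_croot z (Nat.succ_ne_zero N) hsl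
  have near2 : ∀ w : ℝ → ℝ, IsAxisWeight w → Tendsto (fun τ : ℝ => ∫ x,
      (w (axial a e x / τ) : ℂ) • potential (shift x z) • h₁ x) (𝓝[>] 0)
      (𝓝 (∫ x, potential (shift x z) • h₁ x)) := fun w hw => by
    refine tendsto_integral_filter_of_dominated_convergence
      (fun x => ‖potential (shift x z) • h₁ x‖) ?_ ?_ hsl.norm ?_
    · exact Eventually.of_forall fun τ =>
        (hwm w hw τ).aestronglyMeasurable.smul hsl.aestronglyMeasurable
    · refine Eventually.of_forall fun τ => Eventually.of_forall fun x => ?_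
      rw [norm_smul, Complex.norm_real]
      exact mul_le_of_le_one_left (norm_nonneg _) (hw.norm_le _)
    · have h0 : ∀ᵐ x : Rn (N + 1), quad z x ∈ Complex.slitPlane ∧ axial a e x ≠ 0 := by
        have h1 : ∀ᵐ x : Rn (N + 1), axial a e x ≠ 0 := by
          have h2 : ∀ᵐ p : Rn N × ℝ, p.2 ≠ 0 :=
            Measure.quasiMeasurePreserving_snd.ae ae_ne_zero
          have h3 := (Ψ.measurePreserving_add a).quasiMeasurePreserving
          have h4 := (Ψ.measurableEmbedding_add a)
          rw [← (Ψ.measurePreserving_add a).map_eq, h4.ae_map_iff]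
          filter_upwards [h2] with p hp
          rwa [show p = (p.1, p.2) from rfl, axial_cylinder]
        exact (ae_quad_mem_slitPlane z (Nat.succ_ne_zero N)).and h1
      filter_upwards [h0] with x hx
      have h1 := (Complex.continuous_ofReal.tendsto 1).comp (hw.tendsto hx.2)
      have h2 := h1.smul_const (potential (shift x z) • h₁ x)
      simpa using h2
  obtain ⟨R, hR0, hR⟩ : ∃ R : ℝ, 0 < R ∧ ∀ x, h x ≠ 0 → ‖x - a‖ ≤ R := by
    obtain ⟨R, hR⟩ := hc.isCompact.isBounded.subset_closedBall a
    refine ⟨max R 1, by positivity, fun x hx => ?_⟩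
    have := hR (subset_tsupport h hx)
    rw [mem_closedBall_iff_norm] at this
    exact this.trans (le_max_left _ _)
  have ht₀ : 0 < β ^ 2 / 8 := by positivity
  obtain ⟨A, R', hA1, -, hA3⟩ := exists_sphericalMean Ψ a β hN (F := Cl (N + 1)) ht₀
    (T := R ^ 2 + β ^ 2) (by nlinarith [sq_nonneg R]) hR0
  obtain ⟨As, Ab⟩ := hA1 h₂ h₂s
  have hAe := hA3 h₂ fun y s hys => axisCutoff_support Ψ a hR0 χo
    (fun h0 => hys (by simp [hh₂, h0])) (hR _ fun h0 => hys (by simp [hh₂, h0]))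
  have Ac := Ab.hasCompactSupport
  obtain ⟨L₂, hL1, hL2⟩ := exists_planarLimit_potOf hβ hn As Ac
  refine ⟨(∫ x, potential (shift x z) • h₁ x) + L₂, ?_, fun w hw => ?_⟩
  · refine (near1.add hL1).congr' ?_
    filter_upwards [self_mem_nhdsWithin] with ε hε
    have hε' : 0 < ε := hε
    have hεδ : ∀ ζ : ℂ, ε < (croot ζ).re → ε ^ 2 ≤ ‖ζ‖ := fun ζ hζ => by
      rw [← norm_croot_sq]
      have : ε ≤ ‖croot ζ‖ := hζ.le.trans ((le_abs_self _).trans (Complex.abs_re_le_norm _))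
      gcongr
    classical
    -- The cutoff `Re γ > ε` is a function of the quadratic form alone. Absorbed into the kernel, it
    -- passes through the spherical mean unchanged.
    set V : ℂ → ℂ := fun ζ => if ε < (croot ζ).re then 1 else 0 with hV
    have hVm : Measurable V := Measurable.ite
      (measurableSet_lt measurable_const (Complex.measurable_re.comp measurable_croot))
      measurable_const measurable_const
    have hV1 : ∀ ζ, ‖V ζ‖ ≤ 1 := fun ζ => by simp only [hV]; split_ifs <;> simp
    have hVδ : ∀ ζ, V ζ ≠ 0 → ε ^ 2 ≤ ‖ζ‖ := fun ζ hζ => hεδ ζ (by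
      by_contra h0
      exact hζ (if_neg h0))
    have hx : ∀ (X : Type) [MeasureSpace X] (q : X → ℂ) (hq : Measurable q) (g : X → Cl (N + 1)),
        ∫ x in {x | ε < (croot (q x)).re}, potOf (N + 1) (q x) • g x =
          ∫ x, (V (q x) * potOf (N + 1) (q x)) • g x := fun X _ q hq g => by
      have hms : MeasurableSet {x | ε < (croot (q x)).re} := measurableSet_lt measurable_const
        (Complex.measurable_re.comp (measurable_croot.comp hq))
      rw [← integral_indicator hms]
      congr 1
      funext x
      by_cases hx : ε < (croot (q x)).re
      · rw [Set.indicator_of_mem (by exact hx)]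
        simp only [hV, if_pos hx, one_mul]
      · rw [Set.indicator_of_notMem (by exact hx)]
        simp only [hV, if_neg hx, zero_mul, zero_smul]
    have i2 := integrable_kernel_comp volume hq h₂s.continuous h₂c hκ (W := fun x => V (quad z x))
      (hVm.comp hq.measurable) (fun x => hV1 _) (δ := ε ^ 2) (by positivity) fun x _ => hVδ _
    have ip := integrable_kernel_comp volume (continuous_planar β) As.continuous Ac hκ
      (W := fun p => V (planar β p.1 p.2)) (hVm.comp (continuous_planar β).measurable)
      (fun x => hV1 _) (δ := ε ^ 2) (by positivity) fun x _ => hVδ _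
    have i1 := integrable_kernel_comp volume hq h₁s.continuous h₁c hκ (W := fun x => V (quad z x))
      (hVm.comp hq.measurable) (fun x => hV1 _) (δ := ε ^ 2) (by positivity) fun x _ => hVδ _
    have h7 := integral_eq_integral_planar Ψ a β ha hb he hAe
      (fun ζ _ => V ζ * potOf (N + 1) ζ) i2 ip
    rw [regPotential_eq]
    have h8 : ∀ h : Rn (N + 1) → Cl (N + 1),
        ∫ x in {x : Rn (N + 1) | ε < (croot (quad z x)).re}, potential (shift x z) • h x =
        ∫ x, (V (quad z x) * potOf (N + 1) (quad z x)) • h x := fun h =>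
      hx (Rn (N + 1)) (quad z) hq.measurable h
    rw [h8, h8, hx (ℝ × ℝ) (fun p => planar β p.1 p.2) (continuous_planar β).measurable, ← h7,
      ← integral_add i1 i2]
    congr 1
    funext x
    rw [hsum x, smul_add]
  · refine ((near2 w hw).add (hL2 w hw)).congr' ?_
    filter_upwards [self_mem_nhdsWithin] with τ hτ
    have hτ' : 0 < τ := hτ
    have hδ : 0 < 2 * β * τ := by positivity
    have hW1 : ∀ s : ℝ, ‖(w s : ℂ)‖ ≤ 1 := fun s => by rw [Complex.norm_real]; exact hw.norm_le s
    have hxδ : ∀ x : Rn (N + 1), (w (axial a e x / τ) : ℂ) ≠ 0 → 2 * β * τ ≤ ‖quad z x‖ := fun x => by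
      obtain ⟨y, s, rfl⟩ := exists_cylinder_coord Ψ a x
      rw [quad_cylinder Ψ a β ha hb he, axial_cylinder]
      exact hwδ w hw τ hτ' s _
    have i2 := integrable_kernel_comp volume hq h₂s.continuous h₂c hκ
      (hwm w hw τ) (fun x => hW1 _) hδ fun x _ => hxδ x
    have i1 := integrable_kernel_comp volume hq h₁s.continuous h₁c hκ
      (hwm w hw τ) (fun x => hW1 _) hδ fun x _ => hxδ x
    have ip := integrable_kernel_comp volume (continuous_planar β) As.continuous Ac hκ
      (hwm2 w hw τ) (fun x => hW1 _) hδ fun p _ => hwδ w hw τ hτ' p.2 p.1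
    have h7 := integral_eq_integral_planar Ψ a β ha hb he hAe
      (fun ζ s => (w (s / τ) : ℂ) * potOf (N + 1) ζ) i2 ip
    have h8 : ∀ x, potential (shift x z) = potOf (N + 1) (quad z x) := fun x => rfl
    simp only [smul_smul, h8]
    rw [← h7, ← integral_add i1 i2]
    congr 1
    funext x
    rw [hsum x, smul_add]

end


/-! ### The order of the extended source -/

section

variable {n : ℕ} (z : Fin n → ℂ)

/-- Green's formula for the potential, with a weight that vanishes near the singular points. -/
theorem integral_weight_potential_laplacian {c : Rn n → ℝ} (hc : ContDiff ℝ ∞ c)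
    (hcs : tsupport c ⊆ (singularPoints z)ᶜ) {h : Rn n → Cl n} (hh : ContDiff ℝ ∞ h)
    (hhc : HasCompactSupport h) :
    Integrable (fun x => cauchyKernel (shift x z) *
      diracSymbol n ((fderiv ℝ c x).smulRight (h x))) ∧
    Integrable (fun x => potential (shift x z) •
      diracSymbol n ((fderiv ℝ c x).smulRight (dirac h x))) ∧
    ∫ x, (c x : ℂ) • potential (shift x z) • Laplacian.laplacian h x =
      (∫ x, cauchyKernel (shift x z) * diracSymbol n ((fderiv ℝ c x).smulRight (h x))) -
      ∫ x, potential (shift x z) • diracSymbol n ((fderiv ℝ c x).smulRight (dirac h x)) := by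
  have hd : ContDiff ℝ ∞ (dirac h) := contDiff_dirac (m := ⊤) (k := ⊤) hh (by simp)
  have hdc := hasCompactSupport_dirac hhc
  have hO := isOpen_compl_singularPoints z
  have hsub : ∀ g : Rn n → Cl n, tsupport (fun x => c x • g x) ⊆ (singularPoints z)ᶜ := fun g =>
    (tsupport_smul_subset_left c g).trans hcs
  have h1s : ContDiff ℝ ∞ (fun x => c x • h x) := hc.smul hh
  have h2s : ContDiff ℝ ∞ (fun x => c x • dirac h x) := hc.smul hd
  have h1c : HasCompactSupport (fun x => c x • h x) := hhc.smul_left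
  have h2c : HasCompactSupport (fun x => c x • dirac h x) := hdc.smul_left
  have hfc : Continuous (fderiv ℝ c) := hc.continuous_fderiv (by simp)
  have hsr : ∀ g : Rn n → Cl n, Continuous g → Continuous fun x =>
      diracSymbol n ((fderiv ℝ c x).smulRight (g x)) := fun g hg =>
    (diracSymbol n).continuous.comp
      ((ContinuousLinearMap.smulRightL ℝ (Rn n) (Cl n)).continuous₂.comp (hfc.prodMk hg))
  have hsz : ∀ g : Rn n → Cl n, HasCompactSupport g → HasCompactSupport fun x =>
      diracSymbol n ((fderiv ℝ c x).smulRight (g x)) := fun g hg =>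
    hg.mono' fun x hx => subset_tsupport g fun h0 => hx (by simp [h0])
  have hst : ∀ g : Rn n → Cl n, tsupport (fun x => diracSymbol n ((fderiv ℝ c x).smulRight (g x))) ⊆
      (singularPoints z)ᶜ := fun g => by
    refine (closure_mono fun x hx => ?_).trans ((tsupport_fderiv_subset ℝ (f := c)).trans hcs)
    exact fun h0 => hx (by simp [h0])
  have i1 : Integrable (fun x => cauchyKernel (shift x z) *
      diracSymbol n ((fderiv ℝ c x).smulRight (h x))) :=
    integrable_bilinear_of_tsupport volume (mulC n) hO (contDiffOn_cauchyKernel z).continuousOn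
      (hsr h hh.continuous) (hsz h hhc) (hst h)
  have i2 : Integrable (fun x => potential (shift x z) •
      diracSymbol n ((fderiv ℝ c x).smulRight (dirac h x))) :=
    integrable_bilinear_of_tsupport volume (ContinuousLinearMap.lsmul ℝ ℂ : ℂ →L[ℝ] Cl n →L[ℝ] Cl n)
      hO (contDiffOn_potential z).continuousOn (hsr _ hd.continuous) (hsz _ hdc) (hst _)
  have i3 : Integrable (fun x => cauchyKernel (shift x z) * (c x • dirac h x)) :=
    integrable_bilinear_of_tsupport volume (mulC n) hO (contDiffOn_cauchyKernel z).continuousOn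
      h2s.continuous h2c (hsub _)
  have hΔ : Continuous (Laplacian.laplacian h) := by
    rw [← dirac_dirac (hh.of_le (by norm_cast))]
    exact continuous_dirac (hd.of_le (by simp))
  have hΔc : HasCompactSupport (Laplacian.laplacian h) := by
    rw [← dirac_dirac (hh.of_le (by norm_cast))]
    exact hasCompactSupport_dirac hdc
  have i4 : Integrable (fun x => potential (shift x z) • (c x • Laplacian.laplacian h x)) :=
    integrable_bilinear_of_tsupport volume (ContinuousLinearMap.lsmul ℝ ℂ : ℂ →L[ℝ] Cl n →L[ℝ] Cl n)
      hO (contDiffOn_potential z).continuousOn (hc.continuous.smul hΔ) hΔc.smul_left (hsub _)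
  refine ⟨i1, i2, ?_⟩
  -- Two integrations by parts: `C = Dφ` tested on `c Dh`, and `CD = 0` tested on `c h`. In both,
  -- only the terms with the gradient of `c` remain.
  obtain ⟨-, -, e1⟩ := integral_potential_smul_dirac z (h2s.of_le (by simp)) h2c (hsub _)
  have e2 := integral_cauchyKernel_mul_dirac z (h1s.of_le (by simp)) h1c (hsub _)
  have d1 : ∀ x, dirac (fun x => c x • h x) x = c x • dirac h x +
      diracSymbol n ((fderiv ℝ c x).smulRight (h x)) := fun x =>
    dirac_smul (hc.differentiable (by simp) x) (hh.differentiable (by simp) x)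
  have d2 : ∀ x, dirac (fun x => c x • dirac h x) x = c x • Laplacian.laplacian h x +
      diracSymbol n ((fderiv ℝ c x).smulRight (dirac h x)) := fun x => by
    rw [dirac_smul (hc.differentiable (by simp) x) (hd.differentiable (by simp) x),
      dirac_dirac (hh.of_le (by norm_cast))]
  simp only [d1, mul_add] at e2
  simp only [d2, smul_add] at e1
  rw [integral_add i3 i1] at e2
  rw [integral_add i4 i2] at e1
  have e3 : (fun x => (c x : ℂ) • potential (shift x z) • Laplacian.laplacian h x) =
      fun x => potential (shift x z) • (c x • Laplacian.laplacian h x) := by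
    funext x
    rw [smul_comm, Complex.coe_smul]
  rw [e3, eq_sub_of_add_eq e1, eq_neg_of_add_eq_zero_left e2, neg_neg]

theorem diracSymbol_innerSL_smulRight (v : Rn n) (d : ℝ) (b : Cl n) :
    diracSymbol n ((d • innerSL ℝ v).smulRight b) = d • (vec n (fun i => (v i : ℂ)) * b) := by
  rw [vec_eq_sum, Finset.sum_mul, Finset.smul_sum, diracSymbol, sum_apply]
  refine Finset.sum_congr rfl fun k _ => ?_
  simp only [ContinuousLinearMap.comp_apply, ContinuousLinearMap.apply_apply, mulC_apply,
    ContinuousLinearMap.smulRight_apply, smul_apply, innerSL_apply_apply, smul_eq_mul]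
  rw [EuclideanSpace.inner_single_right]
  simp only [one_mul, conj_trivial, smul_mul_assoc]
  rw [← Complex.coe_smul, ← Complex.coe_smul, mul_smul_comm, smul_smul]
  push_cast
  rfl

end

/-! ### Jumps of the integrals over parallel hyperplanes -/

section

variable {N : ℕ} {e : Rn (N + 1)} (Ψ : Cylinder e) (a : Rn (N + 1)) (β : ℝ)

/-- The jump across the hyperplane `axial = 0` of the integrals over parallel hyperplanes. -/
theorem exists_jump_slice_bound (hN : N ≠ 0) (hβ : 0 < β) {κ : ℂ → ℂ} {i : ℕ}
    (hκ : IsAnnularKernel κ) (hJ : ∀ R', JumpBound (Cl (N + 1)) β R' κ i) {R : ℝ} (hR0 : 0 < R) :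
    ∃ C : ℝ, 0 ≤ C ∧ ∀ H : Rn (N + 1) → Cl (N + 1), ContDiff ℝ ∞ H →
      (∀ x, H x ≠ 0 → ‖x - a‖ ≤ R) →
      (∀ s ≠ 0, Integrable fun y =>
        κ (planar β (‖y‖ ^ 2 + s ^ 2 - β ^ 2) s) • H (a + Ψ.map (y, s))) ∧
      ∀ B : ℝ, (∀ l ≤ i, ∀ x, ‖iteratedFDeriv ℝ l H x‖ ≤ B) → ∀ η > 0, ∀ᶠ s : ℝ in 𝓝[>] 0,
        ‖(∫ y, κ (planar β (‖y‖ ^ 2 + s ^ 2 - β ^ 2) s) • H (a + Ψ.map (y, s))) -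
          ∫ y, κ (planar β (‖y‖ ^ 2 + (-s) ^ 2 - β ^ 2) (-s)) • H (a + Ψ.map (y, -s))‖ ≤
            C * B + η := by
  obtain ⟨χ, χs, χ1, χn, χo⟩ := exists_axisCutoff a e hβ.ne'
  have ht₀ : 0 < β ^ 2 / 8 := by positivity
  obtain ⟨A, R', hA1, hA2, hA3⟩ := exists_sphericalMean Ψ a β hN (F := Cl (N + 1)) ht₀
    (T := R ^ 2 + β ^ 2) (by nlinarith [sq_nonneg R]) hR0
  obtain ⟨C₂, hC₂, hA2⟩ := hA2 i
  obtain ⟨C₃, hC₃, hJ⟩ := hJ R'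
  -- The bump is one on the support of `H`; it only makes the multiplier `1 - χ` compactly
  -- supported, so that multiplication is bounded in `C^i` norms.
  let b : ContDiffBump a := ⟨R, 2 * R, hR0, by linarith⟩
  have hbM : ContDiff ℝ ∞ fun x => (1 - χ x) * b x := (contDiff_const.sub χs).mul b.contDiff
  have hbc : HasCompactSupport fun x => (1 - χ x) * b x := b.hasCompactSupport.mul_left
  obtain ⟨C₁, hC₁, hM⟩ := exists_bound_smul_comp (F := Cl (N + 1)) hbM hbc contDiff_id i
  have hqc : ∀ s : ℝ, Continuous fun y : Rn N => planar β (‖y‖ ^ 2 + s ^ 2 - β ^ 2) s := fun s => by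
    unfold planar; fun_prop
  obtain ⟨Z, hZ⟩ := ((isCompact_closedBall (0 : Rn N) R).prod
    (isCompact_Icc (a := (-1 : ℝ)) (b := 1))).exists_bound_of_continuousOn
    (f := fun p : Rn N × ℝ => planar β (‖p.1‖ ^ 2 + p.2 ^ 2 - β ^ 2) p.2)
    (by unfold planar; fun_prop)
  obtain ⟨C₀, hC₀, hκb⟩ := hκ.bound (β ^ 2 / 2) (by positivity) Z
  set v := volume.real (Metric.closedBall (0 : Rn N) R) with hv
  refine ⟨2 * (C₀ * v) + C₃ * (C₂ * C₁), by positivity, fun H hH hHR => ?_⟩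
  have hcs : ∀ s : ℝ, ∀ y : Rn N, H (a + Ψ.map (y, s)) ≠ 0 → y ∈ Metric.closedBall (0 : Rn N) R :=
    fun s y hy => by
    have := hHR _ hy
    rw [add_sub_cancel_left] at this
    rw [mem_closedBall_zero_iff]
    refine le_trans (abs_le_of_sq_le_sq' ?_ (norm_nonneg _)).2 this
    rw [Ψ.norm_sq]; nlinarith [sq_nonneg s]
  have hint : ∀ G : Rn (N + 1) → Cl (N + 1), Continuous G → (∀ x, G x ≠ 0 → H x ≠ 0) → ∀ s ≠ 0,
      Integrable fun y => κ (planar β (‖y‖ ^ 2 + s ^ 2 - β ^ 2) s) • G (a + Ψ.map (y, s)) :=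
    fun G hG hGH s hs => by
    have hGc : HasCompactSupport fun y => G (a + Ψ.map (y, s)) :=
      HasCompactSupport.intro (isCompact_closedBall (0 : Rn N) R) fun y hy => by
        by_contra h0
        exact hy (hcs s y (hGH _ h0))
    have := integrable_kernel_comp volume (hqc s)
      (g := fun y => G (a + Ψ.map (y, s))) (hG.comp (by fun_prop)) hGc hκ (W := fun _ => 1)
      measurable_const (by simp) (δ := |2 * β * s|) (by positivity)
      fun y _ _ => norm_planar_ge_of_axial β _ s
    simpa only [one_mul] using this
  refine ⟨hint H hH.continuous fun x hx => hx, fun B hB η hη => ?_⟩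
  have hB0 : 0 ≤ B := (norm_nonneg _).trans (hB 0 (Nat.zero_le _) 0)
  set G : Rn (N + 1) → Cl (N + 1) := fun x => ((1 - χ x) * b x) • H x with hG
  have hGs : ContDiff ℝ ∞ G := hbM.smul hH
  have hGH : ∀ x, G x ≠ 0 → H x ≠ 0 := fun x hx h0 => hx (by simp [hG, h0])
  have hsum : ∀ x, H x = χ x • H x + G x := fun x => by
    by_cases h0 : H x = 0
    · simp [hG, h0]
    · have h1 : b x = 1 := b.one_of_mem_closedBall (by
        change x ∈ Metric.closedBall a R
        rw [mem_closedBall_iff_norm]; exact hHR x h0)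
      simp only [hG, h1, mul_one, ← add_smul]
      rw [add_sub_cancel, one_smul]
  have hAe := hA3 G fun y s hys => axisCutoff_support Ψ a hR0 χo
    (fun h0 => hys (by simp [hG, h0])) (hHR _ (hGH _ hys))
  obtain ⟨As, Ab⟩ := hA1 G hGs
  have hAb := hA2 G hGs (C₁ * B) fun l hl x => hM H hH B hB l hl x
  have hjump := hJ (A G) As Ab _ hAb η hη
  have hnear : ∀ s : ℝ, s ≠ 0 → s ∈ Set.Icc (-1 : ℝ) 1 →
      ‖∫ y, κ (planar β (‖y‖ ^ 2 + s ^ 2 - β ^ 2) s) • (χ (a + Ψ.map (y, s)) • H (a + Ψ.map (y, s)))‖ ≤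
        C₀ * v * B := fun s hs hs1 => by
    have h1 : Integrable ((Metric.closedBall (0 : Rn N) R).indicator fun _ => C₀ * B) :=
      (integrable_indicator_iff Metric.isClosed_closedBall.measurableSet).2
        (integrableOn_const (isCompact_closedBall _ _).measure_ne_top)
    refine (norm_integral_le_of_norm_le h1 (Eventually.of_forall fun y => ?_)).trans (le_of_eq ?_)
    · by_cases hz : χ (a + Ψ.map (y, s)) • H (a + Ψ.map (y, s)) = 0
      · rw [hz, smul_zero, norm_zero]
        exact Set.indicator_nonneg (fun _ _ => by positivity) _
      · have hχ : χ (a + Ψ.map (y, s)) ≠ 0 := fun h0 => hz (by simp [h0])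
        have hH0 : H (a + Ψ.map (y, s)) ≠ 0 := fun h0 => hz (by simp [h0])
        have hy := hcs s y hH0
        rw [Set.indicator_of_mem hy, norm_smul, norm_smul, Real.norm_eq_abs]
        have h2 := χn _ hχ
        rw [axisDistSq_cylinder] at h2
        have h3 := hκb _ (norm_planar_ge_of_near β (s := s) (by positivity) h2) (hZ (y, s) ⟨hy, hs1⟩)
        have h4 : ‖H (a + Ψ.map (y, s))‖ ≤ B := by
          have := hB 0 (Nat.zero_le _) (a + Ψ.map (y, s))
          rwa [norm_iteratedFDeriv_zero] at this
        calc _ ≤ C₀ * (1 * B) := by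
              gcongr
              exact χ1 _
          _ = _ := by ring
    · rw [integral_indicator Metric.isClosed_closedBall.measurableSet, setIntegral_const, ← hv,
        smul_eq_mul]
      ring
  -- The first term is bounded on each side separately by the supremum of `H`. Only the line
  -- integral needs the cancellation across the axis.
  have hdec : ∀ s : ℝ, s ≠ 0 → ∫ y, κ (planar β (‖y‖ ^ 2 + s ^ 2 - β ^ 2) s) • H (a + Ψ.map (y, s)) =
      (∫ y, κ (planar β (‖y‖ ^ 2 + s ^ 2 - β ^ 2) s) •
        (χ (a + Ψ.map (y, s)) • H (a + Ψ.map (y, s)))) + lineIntegral β κ (A G) s := fun s hs => by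
    have j1 := hint (fun x => χ x • H x) (χs.continuous.smul hH.continuous)
      (fun x hx h0 => hx (by simp [h0])) s hs
    have j2 := hint G hGs.continuous hGH s hs
    rw [← hAe κ s j2, ← integral_add j1 j2]
    congr 1
    funext y
    rw [← smul_add, ← hsum]
  filter_upwards [hjump, Ioc_mem_nhdsGT one_pos] with s hs hs1
  have n1 := hnear s hs1.1.ne' ⟨by linarith [hs1.1], hs1.2⟩
  have n2 := hnear (-s) (neg_ne_zero.2 hs1.1.ne') ⟨by linarith [hs1.2], by linarith [hs1.1]⟩
  rw [hdec s hs1.1.ne', hdec (-s) (neg_ne_zero.2 hs1.1.ne'), add_sub_add_comm]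
  refine (norm_add_le _ _).trans ?_
  have n3 := (norm_sub_le _ _).trans (add_le_add n1 n2)
  linarith

theorem exists_even_axisWeight : ∃ w : ℝ → ℝ, IsAxisWeight w ∧ ∀ s, w (-s) = w s := by
  let b : ContDiffBump (0 : ℝ) := ⟨1, 2, one_pos, one_lt_two⟩
  refine ⟨fun s => 1 - b s, ⟨contDiff_const.sub b.contDiff, fun s => ?_, fun s hs => ?_,
    fun s hs => ?_⟩, fun s => by change 1 - b (-s) = 1 - b s; rw [b.neg]⟩
  · rw [abs_of_nonneg (sub_nonneg.2 b.le_one)]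
    linarith [b.nonneg (x := s)]
  · rw [b.one_of_mem_closedBall (by
      change s ∈ Metric.closedBall 0 1
      rwa [mem_closedBall_zero_iff]), sub_self]
  · rw [b.zero_of_le_dist (by
      change 2 ≤ dist s 0
      rwa [dist_zero_right]), sub_zero]

end


theorem IsAxisWeight.deriv_eq_zero {w : ℝ → ℝ} (hw : IsAxisWeight w) {s : ℝ}
    (hs : |s| < 1 ∨ 2 < |s|) : deriv w s = 0 := by
  rcases hs with hs | hs
  · have h1 : w =ᶠ[𝓝 s] fun _ => 0 := by
      filter_upwards [(isOpen_lt continuous_abs continuous_const).mem_nhds hs] with t ht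
      exact hw.eq_zero t (le_of_lt ht)
    rw [h1.deriv_eq, deriv_const]
  · have h1 : w =ᶠ[𝓝 s] fun _ => 1 := by
      filter_upwards [(isOpen_lt continuous_const continuous_abs).mem_nhds hs] with t ht
      exact hw.eq_one t (le_of_lt ht)
    rw [h1.deriv_eq, deriv_const]

theorem IsAxisWeight.integrable_deriv {w : ℝ → ℝ} (hw : IsAxisWeight w) :
    Integrable (deriv w) := by
  refine (hw.smooth.continuous_deriv (by simp)).integrable_of_hasCompactSupport
    (HasCompactSupport.intro (isCompact_Icc (a := (-2 : ℝ)) (b := 2)) fun s hs =>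
      hw.deriv_eq_zero (Or.inr ?_))
  by_contra h
  exact hs (abs_le.1 (not_lt.1 h))

/-- Pairing with the odd kernel `w'(s/τ)/τ` sees only the jump at zero. -/
theorem norm_integral_odd_le {F : Type*} [NormedAddCommGroup F] [NormedSpace ℝ F]
    {w : ℝ → ℝ} (hw : IsAxisWeight w) (hev : ∀ s, w (-s) = w s) {Q : ℝ → F} {K δ τ : ℝ}
    (hτ : 0 < τ) (hτδ : 2 * τ < δ) (hQ : ∀ s, 0 < s → s < δ → ‖Q s - Q (-s)‖ ≤ K)
    (hi : Integrable fun s => (deriv w (s / τ) / τ) • Q s) :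
    ‖∫ s, (deriv w (s / τ) / τ) • Q s‖ ≤ (∫ s, |deriv w s|) / 2 * K := by
  set d : ℝ → ℝ := fun s => deriv w (s / τ) / τ with hd
  have hodd : ∀ s, d (-s) = -d s := fun s => by
    have h1 : deriv (fun t => w (-t)) (s / τ) = -deriv w (-(s / τ)) := deriv_comp_neg w (s / τ)
    rw [show (fun t => w (-t)) = w from funext hev] at h1
    simp only [hd, neg_div, h1, neg_neg]
  have hdi : Integrable fun s => |d s| :=
    ((hw.integrable_deriv.comp_div hτ.ne').div_const τ).abs
  have hdI : ∫ s, |d s| = ∫ s, |deriv w s| := by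
    have h1 : (fun s => |d s|) = fun s => τ⁻¹ * |deriv w (s / τ)| := by
      funext s
      rw [hd, abs_div, abs_of_pos hτ, div_eq_inv_mul]
    rw [h1, integral_const_mul, Measure.integral_comp_div (fun t => |deriv w t|), abs_of_pos hτ,
      smul_eq_mul, ← mul_assoc, inv_mul_cancel₀ hτ.ne', one_mul]
  have hi' : Integrable fun s => d (-s) • Q (-s) := hi.comp_neg
  -- Averaging with the reflection `s ↦ -s` turns the odd weight into a pairing with `Q(s) - Q(-s)`.
  -- The total mass of the weight does not depend on `τ`, and its support lies in `τ ≤ |s| ≤ 2τ`.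
  have e1 : (2 : ℝ) • ∫ s, d s • Q s = ∫ s, d s • (Q s - Q (-s)) := by
    have h1 : ∫ s, d (-s) • Q (-s) = ∫ s, d s • Q s :=
      integral_neg_eq_self (fun s => d s • Q s) volume
    rw [two_smul]
    nth_rewrite 2 [← h1]
    rw [← integral_add hi hi']
    congr 1
    funext s
    rw [hodd, neg_smul, smul_sub, sub_eq_add_neg]
  have hb : ∀ s, ‖d s • (Q s - Q (-s))‖ ≤ |d s| * K := fun s => by
    rw [norm_smul, Real.norm_eq_abs]
    by_cases h0 : d s = 0
    · rw [h0, abs_zero, zero_mul, zero_mul]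
    have h1 : 1 ≤ |s / τ| ∧ |s / τ| ≤ 2 := by
      by_contra h
      refine h0 ?_
      rw [hd]
      simp only
      rw [hw.deriv_eq_zero ?_, zero_div]
      rw [not_and_or, not_le, not_le] at h
      exact h
    rw [abs_div, abs_of_pos hτ, le_div_iff₀ hτ, div_le_iff₀ hτ] at h1
    refine mul_le_mul_of_nonneg_left ?_ (abs_nonneg _)
    rcases lt_or_ge 0 s with hs | hs
    · rw [abs_of_pos hs] at h1
      exact hQ s hs (by linarith)
    · rw [abs_of_nonpos hs] at h1
      have := hQ (-s) (by linarith) (by linarith)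
      rwa [neg_neg, norm_sub_rev] at this
  have h2 := norm_integral_le_of_norm_le (hdi.mul_const K) (Eventually.of_forall hb)
  rw [← e1, norm_smul, integral_mul_const, hdI, Real.norm_two] at h2
  linarith

/-! ### The order of the source when the imaginary part is nonzero -/

section

variable {N : ℕ} {e : Rn (N + 1)} (Ψ : Cylinder e) (a : Rn (N + 1)) (β : ℝ)

include Ψ in
/-- The extended source has order `max 1 ⌊(n-1)/2⌋` on the disk where it is not a function. -/
theorem exists_regSource_bound_of_imPart_ne_zero (hN : N ≠ 0) {z : Fin (N + 1) → ℂ}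
    (ha : rePart z = a) (hb : imPart z = β • e) (he : ‖e‖ = 1) (hβ : 0 < β) {R : ℝ} (hR0 : 0 < R) :
    ∃ C : ℝ, 0 ≤ C ∧ ∀ h : Rn (N + 1) → Cl (N + 1), ContDiff ℝ ∞ h →
      (∀ x, h x ≠ 0 → ‖x - a‖ ≤ R) → ∀ B : ℝ,
      (∀ i ≤ max 1 (N / 2), ∀ x, ‖iteratedFDeriv ℝ i h x‖ ≤ B) →
      ∀ L, Tendsto (fun ε => regSource z ε h) (𝓝[>] 0) (𝓝 L) → ‖L‖ ≤ C * B := by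
  have hn : 2 ≤ N + 1 := by omega
  obtain ⟨w, hw, hev⟩ := exists_even_axisWeight
  obtain ⟨C₁, hC₁, hk⟩ := exists_jump_slice_bound Ψ a β hN hβ (isAnnularKernel_kerOf (N + 1))
    (fun R' => jumpBound_kerOf hβ R' hn) hR0
  obtain ⟨C₂, hC₂, hp⟩ := exists_jump_slice_bound Ψ a β hN hβ (isAnnularKernel_potOf hn)
    (fun R' => jumpBound_potOf hβ R' hn) hR0
  set ê : Cl (N + 1) := vec (N + 1) (fun i => (e i : ℂ)) with hê
  let b : ContDiffBump a := ⟨R, 2 * R, hR0, by linarith⟩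
  have hvs : ContDiff ℝ ∞ fun x : Rn (N + 1) => vec (N + 1) (shift x z) :=
    ((vecC (N + 1)).restrictScalars ℝ).contDiff.comp (contDiff_shift z)
  obtain ⟨C₃, hC₃, hM⟩ := exists_bound_clm_apply
    (M := fun x => b x • (mulC (N + 1) (vec (N + 1) (shift x z))).comp (mulC (N + 1) ê))
    (b.contDiff.smul (((mulC (N + 1)).contDiff.comp hvs).clm_comp contDiff_const))
    b.hasCompactSupport.smul_right ((N + 1 - 1) / 2)
  set Λ : (Rn (N + 1) →L[ℝ] Cl (N + 1)) →L[ℝ] Cl (N + 1) :=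
    (mulC (N + 1) ê).comp (diracSymbol (N + 1)) with hΛ
  set D := ∫ s, |deriv w s| with hD
  have hD0 : 0 ≤ D := integral_nonneg fun s => abs_nonneg _
  refine ⟨D / 2 * (C₁ * C₃ + C₂ * ‖Λ‖), by positivity, fun h hh hhR B hB L hL => ?_⟩
  have hhc : HasCompactSupport h :=
    HasCompactSupport.intro (isCompact_closedBall a R) fun x hx => by
      by_contra h0
      exact hx (mem_closedBall_iff_norm.2 (hhR x h0))
  have hd : ContDiff ℝ ∞ (dirac h) := contDiff_dirac (m := ⊤) (k := ⊤) hh (by simp)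
  set H₁ : Rn (N + 1) → Cl (N + 1) := fun x => vec (N + 1) (shift x z) * (ê * h x) with hH₁
  set H₂ : Rn (N + 1) → Cl (N + 1) := fun x => ê * dirac h x with hH₂
  have H₁s : ContDiff ℝ ∞ H₁ := ((mulC (N + 1)).contDiff.comp hvs).clm_apply
    ((mulC (N + 1) ê).contDiff.comp hh)
  have H₂s : ContDiff ℝ ∞ H₂ := (mulC (N + 1) ê).contDiff.comp hd
  have H₁R : ∀ x, H₁ x ≠ 0 → ‖x - a‖ ≤ R := fun x hx => hhR x fun h0 => hx (by simp [hH₁, h0])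
  have hts : tsupport h ⊆ Metric.closedBall a R :=
    closure_minimal (fun x hx => mem_closedBall_iff_norm.2 (hhR x hx)) Metric.isClosed_closedBall
  have H₂R : ∀ x, H₂ x ≠ 0 → ‖x - a‖ ≤ R := fun x hx => by
    refine mem_closedBall_iff_norm.1 (hts (tsupport_dirac_subset h (subset_tsupport _ fun h0 => ?_)))
    exact hx (by simp [hH₂, h0])
  have H₁B : ∀ l ≤ (N + 1 - 1) / 2, ∀ x, ‖iteratedFDeriv ℝ l H₁ x‖ ≤ C₃ * B := by
    have e1 : H₁ = fun x => (b x • (mulC (N + 1) (vec (N + 1) (shift x z))).comp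
        (mulC (N + 1) ê)) (h x) := by
      funext x
      by_cases h0 : h x = 0
      · simp [hH₁, h0]
      · rw [b.one_of_mem_closedBall (mem_closedBall_iff_norm.2 (hhR x h0)), one_smul]
        rfl
    rw [e1]
    exact hM h hh B fun i hi => hB i (le_max_of_le_right hi)
  -- One derivative of `h` is spent in `Dh`, so `l + 1` derivatives are needed. This is where the
  -- maximum with one enters: for `N = 1` the index `l` is zero but a first derivative is still
  -- used.
  have H₂B : ∀ l ≤ (N + 1 - 3) / 2, ∀ x, ‖iteratedFDeriv ℝ l H₂ x‖ ≤ ‖Λ‖ * B := fun l hl x => by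
    have e1 : H₂ = Λ ∘ fderiv ℝ h := by
      funext x
      simp only [hH₂, hΛ, dirac_eq]
      rfl
    rw [e1]
    refine (Λ.norm_iteratedFDeriv_comp_left
      ((hh.fderiv_right (m := ∞) (by simp)).contDiffAt (x := x)) (n := l)
      (by exact_mod_cast le_top)).trans (mul_le_mul_of_nonneg_left ?_ (norm_nonneg _))
    rw [norm_iteratedFDeriv_fderiv]
    refine hB (l + 1) ?_ x
    omega
  obtain ⟨hki, hkb⟩ := hk H₁ H₁s H₁R
  obtain ⟨hpi, hpb⟩ := hp H₂ H₂s H₂R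
  replace hkb := hkb _ H₁B
  replace hpb := hpb _ H₂B
  -- The slice integral of the two boundary terms of Green's formula. The gradient of the weight is
  -- along the axis, and `ê` has been absorbed into `H₁` and `H₂`.
  set Q : ℝ → Cl (N + 1) := fun s =>
    (∫ y, kerOf (N + 1) (planar β (‖y‖ ^ 2 + s ^ 2 - β ^ 2) s) • H₁ (a + Ψ.map (y, s))) -
      ∫ y, potOf (N + 1) (planar β (‖y‖ ^ 2 + s ^ 2 - β ^ 2) s) • H₂ (a + Ψ.map (y, s)) with hQ
  have hrep : ∀ τ : ℝ, 0 < τ → Integrable (fun s => (deriv w (s / τ) / τ) • Q s) ∧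
      ∫ x, (w (axial a e x / τ) : ℂ) • potential (shift x z) • Laplacian.laplacian h x =
        ∫ s, (deriv w (s / τ) / τ) • Q s := fun τ hτ => by
    have hcd : ContDiff ℝ ∞ fun x => w (axial a e x / τ) :=
      hw.smooth.comp ((contDiff_axial a e).div_const τ)
    have hcs : tsupport (fun x => w (axial a e x / τ)) ⊆ (singularPoints z)ᶜ := by
      have h1 : tsupport (fun x => w (axial a e x / τ)) ⊆ {x | τ ≤ |axial a e x|} := by
        refine closure_minimal (fun x hx => ?_)
          (isClosed_le continuous_const (contDiff_axial a e).continuous.abs)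
        by_contra h0
        refine hx (hw.eq_zero _ ?_)
        rw [abs_div, abs_of_pos hτ, div_le_one hτ]
        exact (not_le.1 h0).le
      intro x hx hxS
      have h2 := h1 hx
      obtain ⟨y, s, rfl⟩ := exists_cylinder_coord Ψ a x
      rw [mem_singularPoints_iff, quad_cylinder Ψ a β ha hb he] at hxS
      refine hxS (slitPlane_subset_goodSet _ (planar_mem_slitPlane hβ.ne' ?_ _))
      rintro rfl
      rw [Set.mem_ofPred_eq, axial_cylinder, abs_zero] at h2
      linarith
    have hfd : ∀ x, fderiv ℝ (fun x => w (axial a e x / τ)) x =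
        (deriv w (axial a e x / τ) / τ) • innerSL ℝ e := fun x => by
      have h1 : HasFDerivAt (axial a e) (innerSL ℝ e) x := by
        have h2 := (innerSL ℝ e).hasFDerivAt (x := x - a)
        have h3 := h2.comp x ((hasFDerivAt_id x).sub_const a)
        refine (h3.congr_of_eventuallyEq (Eventually.of_forall fun y => ?_))
        simp only [axial, Function.comp_apply, id, innerSL_apply_apply]
        exact real_inner_comm _ _
      have h2 : HasDerivAt (fun t => w (t / τ)) (deriv w (axial a e x / τ) / τ) (axial a e x) := by
        have := ((hw.smooth.differentiable (by simp)) (axial a e x / τ)).hasDerivAt.comp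
          (axial a e x) ((hasDerivAt_id (axial a e x)).div_const τ)
        rw [div_eq_mul_one_div]
        exact this
      exact (h2.comp_hasFDerivAt x h1).fderiv
    obtain ⟨i1, i2, e1⟩ := integral_weight_potential_laplacian z hcd hcs hh hhc
    simp only [hfd, diracSymbol_innerSL_smulRight, ← hê] at i1 i2 e1
    rw [← integral_sub i1 i2] at e1
    have e2 : ∀ x, cauchyKernel (shift x z) * (deriv w (axial a e x / τ) / τ) • (ê * h x) -
        potential (shift x z) • (deriv w (axial a e x / τ) / τ) • (ê * dirac h x) =
        (deriv w (axial a e x / τ) / τ) • (kerOf (N + 1) (quad z x) • H₁ x -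
          potOf (N + 1) (quad z x) • H₂ x) := fun x => by
      rw [cauchyKernel_eq, potential_eq, smul_sub, hH₁, hH₂]
      simp only [quad]
      rw [← Complex.coe_smul, ← Complex.coe_smul, ← Complex.coe_smul, ← Complex.coe_smul,
        mul_smul_comm, smul_mul_assoc, smul_comm (potOf (N + 1) _)]
    have i3 := i1.sub i2
    simp only [Pi.sub_def, e2] at i3
    simp only [e2] at e1
    obtain ⟨j1, j2, j3⟩ := integral_cylinder Ψ a i3
    have e3 : ∀ s : ℝ, s ≠ 0 → ∫ y, (deriv w (axial a e (a + Ψ.map (y, s)) / τ) / τ) •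
        (kerOf (N + 1) (quad z (a + Ψ.map (y, s))) • H₁ (a + Ψ.map (y, s)) -
          potOf (N + 1) (quad z (a + Ψ.map (y, s))) • H₂ (a + Ψ.map (y, s))) =
        (deriv w (s / τ) / τ) • Q s := fun s hs => by
      simp only [axial_cylinder, quad_cylinder Ψ a β ha hb he]
      rw [integral_smul, integral_sub (hki s hs) (hpi s hs)]
    refine ⟨j1.congr ?_, ?_⟩
    · filter_upwards [ae_ne_zero] with s hs
      exact e3 s hs
    · rw [e1, j3]
      refine integral_congr_ae ?_
      filter_upwards [ae_ne_zero] with s hs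
      exact e3 s hs
  have hbound : ∀ η > 0, ‖L‖ ≤ D / 2 * (C₁ * (C₃ * B) + C₂ * (‖Λ‖ * B) + 2 * η) := fun η hη => by
    have h1 := (hkb η hη).and (hpb η hη)
    obtain ⟨δ, hδ, h1⟩ := mem_nhdsGT_iff_exists_Ioo_subset.1 h1
    have hΔc : HasCompactSupport (Laplacian.laplacian h) := by
      rw [← dirac_dirac (hh.of_le (by norm_cast))]
      exact hasCompactSupport_dirac (hasCompactSupport_dirac hhc)
    have hΔs : ContDiff ℝ ∞ (Laplacian.laplacian h) := by
      rw [← dirac_dirac (hh.of_le (by norm_cast))]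
      exact contDiff_dirac (m := ⊤) (k := ⊤) hd (by simp)
    -- The limit of the regularizations can be computed with the weight `w(s/τ)` instead, for which
    -- the representation by `Q` is available.
    obtain ⟨L', hL', hLw⟩ := exists_tendsto_regPotential_of_imPart_ne_zero Ψ a β hN ha hb he hβ
      hΔs hΔc
    obtain rfl := tendsto_nhds_unique hL hL'
    refine le_of_tendsto (hLw w hw).norm ?_
    filter_upwards [Ioo_mem_nhdsGT (show (0 : ℝ) < δ / 2 by have := hδ.out; linarith)] with τ hτ
    obtain ⟨q1, q2⟩ := hrep τ hτ.1
    rw [q2]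
    refine norm_integral_odd_le hw hev hτ.1 (δ := δ) (by linarith [hτ.2]) (fun s hs hsδ => ?_) q1
    obtain ⟨r1, r2⟩ := h1 ⟨hs, hsδ⟩
    rw [hQ]
    simp only
    rw [sub_sub_sub_comm]
    refine (norm_sub_le _ _).trans ((add_le_add r1 r2).trans (le_of_eq ?_))
    ring
  have hlim : Tendsto (fun η : ℝ => D / 2 * (C₁ * (C₃ * B) + C₂ * (‖Λ‖ * B) + 2 * η)) (𝓝[>] 0)
      (𝓝 (D / 2 * (C₁ * (C₃ * B) + C₂ * (‖Λ‖ * B) + 2 * 0))) :=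
    Tendsto.mono_left (Continuous.tendsto (by fun_prop) _) nhdsWithin_le_nhds
  refine (ge_of_tendsto hlim (by filter_upwards [self_mem_nhdsWithin] with η hη using hbound η hη)
    ).trans (le_of_eq ?_)
  ring

end


/-! ### The potential centred at a real point -/

section

variable {n : ℕ} {z : Fin n → ℂ}

theorem quad_of_imPart_eq_zero (hz : imPart z = 0) (x : Rn n) :
    quad z x = ((‖x - rePart z‖ ^ 2 : ℝ) : ℂ) := by
  rw [quad_eq, hz]; simp

theorem norm_croot_quad (hz : imPart z = 0) (x : Rn n) : ‖croot (quad z x)‖ = ‖x - rePart z‖ := by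
  have h1 := norm_croot_sq (quad z x)
  rw [quad_of_imPart_eq_zero hz, Complex.norm_real, Real.norm_eq_abs, abs_of_nonneg (by positivity)] at h1
  rw [quad_of_imPart_eq_zero hz]
  exact (sq_eq_sq₀ (norm_nonneg _) (norm_nonneg _)).1 h1

/-- The exponent `n - 1` is cruder than needed for `n ≥ 3` but covers the logarithm too. It is still
locally integrable, and it suffices on shells, where the other term carries the kernel of the same
order. -/
theorem exists_norm_potOf_le (hn : 2 ≤ n) : ∃ A : ℝ, 0 ≤ A ∧ ∀ ζ,
    ‖potOf n ζ‖ ≤ A * (1 + ‖ζ‖ + (‖croot ζ‖ ^ (n - 1))⁻¹) := by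
  rcases hn.eq_or_lt with rfl | hn
  · refine ⟨6 / ‖(2 * Real.pi : ℂ)‖, by positivity, fun ζ => ?_⟩
    rw [potOf_two, norm_div, div_mul_eq_mul_div]
    gcongr
    simpa using norm_log_croot_le' ζ
  · refine ⟨‖(sphereArea n * (2 - n) : ℂ)⁻¹‖, norm_nonneg _, fun ζ => ?_⟩
    rw [potOf_eq hn, norm_mul, norm_inv (croot ζ ^ (n - 2)), norm_pow]
    refine mul_le_mul_of_nonneg_left ?_ (norm_nonneg _)
    set r := ‖croot ζ‖ with hr
    rcases le_or_gt r 1 with h1 | h1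
    · rcases (norm_nonneg (croot ζ)).eq_or_lt with h0 | h0
      · rw [hr, ← h0, zero_pow (by omega), zero_pow (by omega), inv_zero]
        positivity
      · have h2 : r ^ (n - 1) ≤ r ^ (n - 2) := pow_le_pow_of_le_one h0.le h1 (by omega)
        have h3 := inv_anti₀ (pow_pos h0 (n - 1)) h2
        linarith [norm_nonneg ζ]
    · have h2 : (r ^ (n - 2))⁻¹ ≤ 1 := inv_le_one_of_one_le₀ (one_le_pow₀ h1.le)
      have h3 : 0 ≤ (r ^ (n - 1))⁻¹ := by positivity
      linarith [norm_nonneg ζ]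

theorem exists_norm_potential_le (hn : 2 ≤ n) (hz : imPart z = 0) : ∃ A : ℝ, 0 ≤ A ∧ ∀ x : Rn n,
    ‖potential (shift x z)‖ ≤
      A * (1 + ‖x - rePart z‖ ^ 2 + (‖x - rePart z‖ ^ (n - 1))⁻¹) := by
  obtain ⟨A, hA, h⟩ := exists_norm_potOf_le hn
  refine ⟨A, hA, fun x => ?_⟩
  have h1 := h (quad z x)
  rw [norm_croot_quad hz, quad_of_imPart_eq_zero hz, Complex.norm_real, Real.norm_eq_abs,
    abs_of_nonneg (by positivity), ← quad_of_imPart_eq_zero hz] at h1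
  exact h1

theorem exists_norm_cauchyKernel_le (hz : imPart z = 0) : ∃ A : ℝ, 0 ≤ A ∧ ∀ x : Rn n,
    ‖cauchyKernel (shift x z)‖ ≤ A * (‖x - rePart z‖ * (‖x - rePart z‖ ^ n)⁻¹) := by
  refine ⟨‖(sphereArea n : ℂ)⁻¹‖ * ‖vecC n‖, by positivity, fun x => ?_⟩
  rw [cauchyKernel_eq, norm_smul, kerOf_eq, norm_mul, norm_inv (croot _ ^ n), norm_pow]
  have h1 : ‖croot (∑ i, shift x z i ^ 2)‖ = ‖x - rePart z‖ := norm_croot_quad hz x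
  rw [h1]
  have h2 : ‖shift x z‖ ≤ ‖x - rePart z‖ := by
    refine (pi_norm_le_iff_of_nonneg (norm_nonneg _)).2 fun i => ?_
    have h3 : shift x z i = (((x - rePart z) i : ℝ) : ℂ) := by
      have h4 : (z i).im = 0 := congrArg (fun v : Rn n => v i) hz
      apply Complex.ext
      · simp [shift, rePart]
      · simp [shift, h4]
    rw [h3, Complex.norm_real]
    exact PiLp.norm_apply_le _ i
  have h3 : ‖vec n (shift x z)‖ ≤ ‖vecC n‖ * ‖x - rePart z‖ :=
    ((vecC n).le_opNorm _).trans (by gcongr)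
  calc _ ≤ ‖(sphereArea n : ℂ)⁻¹‖ * (‖x - rePart z‖ ^ n)⁻¹ * (‖vecC n‖ * ‖x - rePart z‖) := by gcongr
    _ = _ := by ring

theorem measurable_potential (z : Fin n → ℂ) : Measurable fun x : Rn n => potential (shift x z) :=
  (measurable_potOf n).comp (measurable_quad z)

theorem integrable_potential_smul (hn : 2 ≤ n) (hz : imPart z = 0) {h : Rn n → Cl n}
    (hh : Continuous h) (hc : HasCompactSupport h) :
    Integrable fun x => potential (shift x z) • h x := by
  obtain ⟨A, hA, hb⟩ := exists_norm_potential_le hn hz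
  have h1 : LocallyIntegrable (fun x : Rn n => (‖x‖ ^ (n - 1))⁻¹) := by
    refine locallyIntegrable_of_norm_le_rpow (C := 1) (α := ((n - 1 : ℕ) : ℝ)) ?_ ?_ ?_ ?_
    · simp; omega
    · simp only [finrank_euclideanSpace, Fintype.card_fin]; exact_mod_cast (by omega : n - 1 < n)
    · refine Eventually.of_forall fun x => ?_
      rw [Real.rpow_neg (norm_nonneg _), Real.rpow_natCast, norm_inv, norm_pow, norm_norm, one_mul]
    · exact (measurable_norm.pow_const _).inv.aestronglyMeasurable
  have h2 : LocallyIntegrable (fun x : Rn n => A * (1 + ‖x‖ ^ 2 + (‖x‖ ^ (n - 1))⁻¹)) := by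
    have h3 : Continuous fun x : Rn n => 1 + ‖x‖ ^ 2 := by fun_prop
    exact (h3.locallyIntegrable.add h1).smul A
  have hg : Continuous fun x => ‖h (x + rePart z)‖ := by fun_prop
  have hgc : HasCompactSupport fun x => ‖h (x + rePart z)‖ :=
    (hc.comp_homeomorph (Homeomorph.addRight (rePart z))).norm
  have h4 := (h2.integrable_smul_left_of_hasCompactSupport hg hgc).comp_sub_right (rePart z)
  refine h4.mono' ((measurable_potential z).aestronglyMeasurable.smul
    hh.aestronglyMeasurable) (Eventually.of_forall fun x => ?_)
  rw [norm_smul, sub_add_cancel, smul_eq_mul, mul_comm]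
  gcongr
  exact hb x

theorem tendsto_regPotential_of_imPart_eq_zero (hn : 2 ≤ n) (hz : imPart z = 0) {h : Rn n → Cl n}
    (hh : Continuous h) (hc : HasCompactSupport h) :
    Tendsto (fun ε => regPotential z ε h) (𝓝[>] 0) (𝓝 (∫ x, potential (shift x z) • h x)) :=
  tendsto_setIntegral_lt_croot z (by omega) (integrable_potential_smul hn hz hh hc)

set_option maxHeartbeats 1000000 in
/-- A source at a real point has order one. -/
theorem exists_regSource_bound_of_imPart_eq_zero (hn : 2 ≤ n) (hz : imPart z = 0) :
    ∃ C : ℝ, 0 ≤ C ∧ ∀ h : Rn n → Cl n, ContDiff ℝ ∞ h → HasCompactSupport h → ∀ B : ℝ,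
      (∀ i ≤ 1, ∀ x, ‖iteratedFDeriv ℝ i h x‖ ≤ B) →
      ∀ L, Tendsto (fun ε => regSource z ε h) (𝓝[>] 0) (𝓝 L) → ‖L‖ ≤ C * B := by
  obtain ⟨w, hw, -⟩ := exists_even_axisWeight
  obtain ⟨A₁, hA₁, hφ⟩ := exists_norm_potential_le hn hz
  obtain ⟨A₂, hA₂, hC⟩ := exists_norm_cauchyKernel_le hz
  obtain ⟨W, hW⟩ : ∃ W, ∀ s, ‖deriv w s‖ ≤ W :=
    (hw.smooth.continuous_deriv (by simp)).bounded_above_of_compact_support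
      (HasCompactSupport.intro (isCompact_Icc (a := (-2 : ℝ)) (b := 2)) fun s hs =>
        hw.deriv_eq_zero (Or.inr (by
          by_contra h
          exact hs (abs_le.1 (not_lt.1 h)))))
  have hW0 : 0 ≤ W := (norm_nonneg _).trans (hW 0)
  set σ := ‖diracSymbol n‖ with hσ
  set V := volume.real (Metric.ball (0 : Rn n) 1) with hV
  set a := rePart z with ha
  refine ⟨(‖mulC n‖ * (2 * A₂) * (σ * (4 * W)) + (6 * A₁) * (σ * (4 * W) * σ)) * (2 ^ n * V),
    by positivity, fun h hh hc B hB L hL => ?_⟩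
  have hd : ContDiff ℝ ∞ (dirac h) := contDiff_dirac (m := ⊤) (k := ⊤) hh (by simp)
  have hB0 : 0 ≤ B := (norm_nonneg _).trans (hB 0 (Nat.zero_le _) 0)
  have hb0 : ∀ x, ‖h x‖ ≤ B := fun x => by
    have := hB 0 (Nat.zero_le _) x
    rwa [norm_iteratedFDeriv_zero] at this
  have hb1 : ∀ x, ‖dirac h x‖ ≤ σ * B := fun x => by
    have := hB 1 le_rfl x
    rw [norm_iteratedFDeriv_one] at this
    rw [dirac_eq]
    exact ((diracSymbol n).le_opNorm _).trans (by gcongr)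
  have hΔe : Laplacian.laplacian h = dirac (dirac h) := (dirac_dirac (hh.of_le (by norm_cast))).symm
  have hΔs : Continuous (Laplacian.laplacian h) := by
    rw [hΔe]; exact continuous_dirac (hd.of_le (by simp))
  have hΔc : HasCompactSupport (Laplacian.laplacian h) := by
    rw [hΔe]; exact hasCompactSupport_dirac (hasCompactSupport_dirac hc)
  have hi := integrable_potential_smul hn hz hΔs hΔc
  obtain rfl := tendsto_nhds_unique hL (tendsto_regPotential_of_imPart_eq_zero hn hz hΔs hΔc)
  -- A weight in the squared distance is smooth at the centre. As the potential is locally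
  -- integrable, inserting the weight does not change the limit.
  have hlim : Tendsto (fun τ : ℝ => ∫ x, (w (‖x - a‖ ^ 2 / τ ^ 2) : ℂ) •
      potential (shift x z) • Laplacian.laplacian h x) (𝓝[>] 0)
      (𝓝 (∫ x, potential (shift x z) • Laplacian.laplacian h x)) := by
    refine tendsto_integral_filter_of_dominated_convergence
      (fun x => ‖potential (shift x z) • Laplacian.laplacian h x‖) ?_ ?_ hi.norm ?_
    · refine Eventually.of_forall fun τ => ?_
      have h1 : Continuous fun x : Rn n => (w (‖x - a‖ ^ 2 / τ ^ 2) : ℂ) :=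
        Complex.continuous_ofReal.comp (hw.smooth.continuous.comp (by fun_prop))
      exact h1.aestronglyMeasurable.smul hi.aestronglyMeasurable
    · refine Eventually.of_forall fun τ => Eventually.of_forall fun x => ?_
      rw [norm_smul, Complex.norm_real]
      exact mul_le_of_le_one_left (norm_nonneg _) (hw.norm_le _)
    · have : Nonempty (Fin n) := ⟨⟨0, by omega⟩⟩
      have h0 : ∀ᵐ x : Rn n, x ≠ a := by
        rw [ae_iff]; simp
      filter_upwards [h0] with x hx
      refine tendsto_const_nhds.congr' ?_
      have hr : 0 < ‖x - a‖ := norm_pos_iff.2 (sub_ne_zero.2 hx)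
      filter_upwards [Ioo_mem_nhdsGT (show (0 : ℝ) < ‖x - a‖ / 2 by positivity)] with τ hτ
      rw [hw.eq_one, Complex.ofReal_one, one_smul]
      have := hτ.1
      rw [abs_of_nonneg (by positivity), le_div_iff₀ (by positivity)]
      nlinarith [hτ.2]
  refine le_of_tendsto hlim.norm ?_
  filter_upwards [Ioo_mem_nhdsGT (show (0 : ℝ) < 1 from one_pos)] with τ hτ
  have hτ0 := hτ.1
  set c : Rn n → ℝ := fun x => w (‖x - a‖ ^ 2 / τ ^ 2) with hc'
  have hcd : ContDiff ℝ ∞ c :=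
    hw.smooth.comp (((contDiff_id.sub contDiff_const).norm_sq ℝ).div_const _)
  have hcs : tsupport c ⊆ (singularPoints z)ᶜ := by
    have h1 : tsupport c ⊆ {x | τ ^ 2 ≤ ‖x - a‖ ^ 2} := by
      refine closure_minimal (fun x hx => ?_) (isClosed_le continuous_const (by fun_prop))
      by_contra h0
      refine hx (hw.eq_zero _ ?_)
      rw [abs_of_nonneg (by positivity), div_le_one (by positivity)]
      exact (not_le.1 h0).le
    intro x hx hxS
    have h2 : τ ^ 2 ≤ ‖x - a‖ ^ 2 := h1 hx
    rw [mem_singularPoints_iff, quad_of_imPart_eq_zero hz] at hxS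
    refine hxS (slitPlane_subset_goodSet _ (Complex.ofReal_mem_slitPlane.2 ?_))
    exact lt_of_lt_of_le (by positivity) h2
  have hfd : ∀ x, fderiv ℝ c x = (deriv w (‖x - a‖ ^ 2 / τ ^ 2) / τ ^ 2) •
      ((2 : ℝ) • innerSL ℝ (x - a)) := fun x => by
    have h1 : HasFDerivAt (fun x : Rn n => ‖x - a‖ ^ 2) ((2 : ℝ) • innerSL ℝ (x - a)) x := by
      have := ((hasFDerivAt_id x).sub_const a).norm_sq
      refine this.congr_fderiv ?_
      rw [ContinuousLinearMap.comp_id, two_smul, two_smul]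
      rfl
    have h2 : HasDerivAt (fun t => w (t / τ ^ 2)) (deriv w (‖x - a‖ ^ 2 / τ ^ 2) / τ ^ 2)
        (‖x - a‖ ^ 2) := by
      have := ((hw.smooth.differentiable (by simp)) (‖x - a‖ ^ 2 / τ ^ 2)).hasDerivAt.comp
        (‖x - a‖ ^ 2) ((hasDerivAt_id (‖x - a‖ ^ 2)).div_const (τ ^ 2))
      rw [div_eq_mul_one_div]
      exact this
    exact (h2.comp_hasFDerivAt x h1).fderiv
  have hshell : ∀ x, fderiv ℝ c x ≠ 0 → τ ≤ ‖x - a‖ ∧ ‖x - a‖ ≤ 2 * τ := fun x hx => by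
    have h1 : 1 ≤ |‖x - a‖ ^ 2 / τ ^ 2| ∧ |‖x - a‖ ^ 2 / τ ^ 2| ≤ 2 := by
      by_contra h0
      refine hx ?_
      rw [hfd, hw.deriv_eq_zero, zero_div, zero_smul]
      rwa [not_and_or, not_le, not_le] at h0
    rw [abs_of_nonneg (by positivity), le_div_iff₀ (by positivity), div_le_iff₀ (by positivity)] at h1
    constructor
    · exact (abs_le_of_sq_le_sq' (by linarith) (norm_nonneg _)).2
    · exact (abs_le_of_sq_le_sq' (by nlinarith) (by positivity)).2
  have hfn : ∀ x, fderiv ℝ c x ≠ 0 → ‖fderiv ℝ c x‖ ≤ 4 * W / τ := fun x hx => by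
    have h1 := (hshell x hx).2
    rw [hfd, norm_smul, norm_smul, norm_div, innerSL_apply_norm, Real.norm_two, norm_pow,
      Real.norm_of_nonneg hτ0.le]
    calc _ ≤ W / τ ^ 2 * (2 * (2 * τ)) := by gcongr; exact hW _
      _ = _ := by field_simp; ring
  obtain ⟨i1, i2, e1⟩ := integral_weight_potential_laplacian z hcd hcs hh hc
  have hσb : ∀ (x : Rn n) (b : Cl n), fderiv ℝ c x ≠ 0 →
      ‖diracSymbol n ((fderiv ℝ c x).smulRight b)‖ ≤ σ * (4 * W / τ) * ‖b‖ := fun x b hx => by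
    refine ((diracSymbol n).le_opNorm _).trans ?_
    rw [ContinuousLinearMap.norm_smulRight_apply, mul_assoc]
    gcongr
    exact hfn x hx
  have hτn : τ ^ n = τ ^ (n - 1) * τ := by rw [← pow_succ]; congr 1; omega
  have hvol : volume.real (Metric.closedBall a (2 * τ)) = (2 * τ) ^ n * V := by
    rw [Measure.addHaar_real_closedBall _ _ (by positivity)]
    simp [hV]
  have hset : ∀ (G : Rn n → Cl n) (K : ℝ), (∀ x, fderiv ℝ c x = 0 → G x = 0) → 0 ≤ K →
      (∀ x, fderiv ℝ c x ≠ 0 → ‖G x‖ ≤ K) → ‖∫ x, G x‖ ≤ K * ((2 * τ) ^ n * V) := by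
    intro G K h1 hK h2
    have h3 : ∀ x, x ∉ Metric.closedBall a (2 * τ) → G x = 0 := fun x hx => by
      by_contra h0
      exact hx (mem_closedBall_iff_norm.2 (hshell x fun h4 => h0 (h1 x h4)).2)
    rw [← setIntegral_eq_integral_of_forall_compl_eq_zero h3, ← hvol]
    refine norm_setIntegral_le_of_norm_le_const (isCompact_closedBall _ _).measure_lt_top
      fun x _ => ?_
    by_cases h4 : fderiv ℝ c x = 0
    · rw [h1 x h4, norm_zero]; exact hK
    · exact h2 x h4
  rw [e1]
  have hz0 : ∀ x (b : Cl n), fderiv ℝ c x = 0 →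
      diracSymbol n ((fderiv ℝ c x).smulRight b) = 0 := fun x b hx => by
    rw [hx]; simp
  -- The powers of `τ` balance: the kernel is of order `τ^(1-n)`, the gradient of the weight of
  -- order `1/τ`, and the shell has volume of order `τ^n`. The same count with the crude bound for
  -- the potential handles the second term.
  have n1 := hset (fun x => cauchyKernel (shift x z) * diracSymbol n ((fderiv ℝ c x).smulRight (h x)))
    (‖mulC n‖ * (A₂ * (2 * τ * (τ ^ n)⁻¹)) * (σ * (4 * W / τ) * B))
    (fun x hx => by simp only [hz0 x _ hx, mul_zero]) (by positivity) fun x hx => by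
      obtain ⟨r1, r2⟩ := hshell x hx
      refine (norm_mul_le_mulC _ _).trans ?_
      gcongr
      · refine (hC x).trans ?_
        gcongr
      · exact (hσb x _ hx).trans (by gcongr; exact hb0 x)
  have n2 := hset (fun x => potential (shift x z) •
      diracSymbol n ((fderiv ℝ c x).smulRight (dirac h x)))
    ((A₁ * (6 * (τ ^ (n - 1))⁻¹)) * (σ * (4 * W / τ) * (σ * B)))
    (fun x hx => by simp only [hz0 x _ hx, smul_zero]) (by positivity) fun x hx => by
      obtain ⟨r1, r2⟩ := hshell x hx
      rw [norm_smul]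
      gcongr
      · refine (hφ x).trans ?_
        gcongr
        have q1 : 1 ≤ (τ ^ (n - 1))⁻¹ :=
          (one_le_inv₀ (by positivity)).2 (pow_le_one₀ hτ0.le hτ.2.le)
        have q2 : (‖x - a‖ ^ (n - 1))⁻¹ ≤ (τ ^ (n - 1))⁻¹ := by gcongr
        have q3 : ‖x - a‖ ^ 2 ≤ 4 := by nlinarith [hτ.2, norm_nonneg (x - a)]
        linarith
      · exact (hσb x _ hx).trans (by gcongr; exact hb1 x)
  refine (norm_sub_le _ _).trans ((add_le_add n1 n2).trans (le_of_eq ?_))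
  rw [hτn, mul_pow, hτn]
  field_simp

end


/-! ### Mollification -/

section

variable {n : ℕ}

/-- Mollification, as an average of translates. -/
def average {G : Type} [NormedAddCommGroup G] [NormedSpace ℝ G] (ψ : Rn n → ℝ) (δ : ℝ)
    (g : Rn n → G) (x : Rn n) : G := ∫ t, ψ t • g (x - δ • t)

theorem mollify_eq_average (ψ : Rn n → ℝ) {δ : ℝ} (hδ : 0 < δ) (g : Rn n → Cl n) :
    mollify ψ δ g = average ψ δ g := by
  funext x
  have h1 := Measure.integral_comp_inv_smul_of_nonneg volume
    (fun t : Rn n => ψ t • g (x - δ • t)) hδ.le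
  rw [average, mollify, convolution_def]
  have h2 : ∀ t : Rn n, ContinuousLinearMap.lsmul ℝ ℝ ((δ ^ n)⁻¹ * ψ (δ⁻¹ • t)) (g (x - t)) =
      (δ ^ n)⁻¹ • (ψ (δ⁻¹ • t) • g (x - δ • (δ⁻¹ • t))) := fun t => by
    rw [smul_inv_smul₀ hδ.ne', ContinuousLinearMap.lsmul_apply, mul_smul]
  simp_rw [h2]
  rw [integral_smul, h1, finrank_euclideanSpace, Fintype.card_fin, smul_smul,
    inv_mul_cancel₀ (by positivity), one_smul]

theorem contDiff_mollify {ψ : Rn n → ℝ} (hψ : IsMollifier ψ) {δ : ℝ} (hδ : 0 < δ)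
    {g : Rn n → Cl n} (hg : Continuous g) : ContDiff ℝ ∞ (mollify ψ δ g) := by
  refine HasCompactSupport.contDiff_convolution_left (n := ⊤) _ ?_ ?_ hg.locallyIntegrable
  · exact (hψ.compact.comp_smul (inv_ne_zero hδ.ne')).mul_left
  · exact contDiff_const.mul (hψ.smooth.comp (contDiff_const_smul _))

variable {G : Type} [NormedAddCommGroup G] [NormedSpace ℝ G]

theorem integrable_average {ψ : Rn n → ℝ} (hψ : IsMollifier ψ) (δ : ℝ) {g : Rn n → G}
    (hg : Continuous g) (x : Rn n) : Integrable fun t => ψ t • g (x - δ • t) := by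
  have hc := hψ.smooth.continuous
  exact Continuous.integrable_of_hasCompactSupport (by fun_prop) hψ.compact.smul_right

theorem average_sub {ψ : Rn n → ℝ} (hψ : IsMollifier ψ) (δ : ℝ) {g h : Rn n → G}
    (hg : Continuous g) (hh : Continuous h) :
    average ψ δ (g - h) = average ψ δ g - average ψ δ h := by
  funext x
  simp only [average, Pi.sub_apply, smul_sub]
  exact integral_sub (integrable_average hψ δ hg x) (integrable_average hψ δ hh x)

theorem hasFDerivAt_average {ψ : Rn n → ℝ} (hψ : IsMollifier ψ) (δ : ℝ) {g : Rn n → G}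
    (hg : ContDiff ℝ 1 g) (hc : HasCompactSupport g) (x : Rn n) :
    HasFDerivAt (average ψ δ g) (average ψ δ (fderiv ℝ g) x) x := by
  have hf := hg.continuous_fderiv one_ne_zero
  have hψc := hψ.smooth.continuous
  have hgc := hg.continuous
  obtain ⟨D, hD⟩ := hf.bounded_above_of_compact_support (hc.fderiv ℝ)
  refine hasFDerivAt_integral_of_dominated_of_fderiv_le (bound := fun t => ‖ψ t‖ * D) univ_mem
    (F := fun x t => ψ t • g (x - δ • t)) (F' := fun x t => ψ t • fderiv ℝ g (x - δ • t))
    ?_ ?_ ?_ ?_ ?_ ?_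
  · exact Eventually.of_forall fun x => (integrable_average hψ δ hgc x).aestronglyMeasurable
  · exact integrable_average hψ δ hgc x
  · exact (integrable_average hψ δ hf x).aestronglyMeasurable
  · refine Eventually.of_forall fun t y _ => ?_
    rw [norm_smul]
    exact mul_le_mul_of_nonneg_left (hD _) (norm_nonneg _)
  · exact (hψc.norm.integrable_of_hasCompactSupport hψ.compact.norm).mul_const D
  · refine Eventually.of_forall fun t y _ => ?_
    have h1 := ((hg.differentiable one_ne_zero (y - δ • t)).hasFDerivAt.comp y
      ((hasFDerivAt_id y).sub_const (δ • t))).const_smul (ψ t)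
    exact h1

theorem fderiv_average {ψ : Rn n → ℝ} (hψ : IsMollifier ψ) (δ : ℝ) {g : Rn n → G}
    (hg : ContDiff ℝ 1 g) (hc : HasCompactSupport g) :
    fderiv ℝ (average ψ δ g) = average ψ δ (fderiv ℝ g) :=
  funext fun x => (hasFDerivAt_average hψ δ hg hc x).fderiv

theorem dirac_average {ψ : Rn n → ℝ} (hψ : IsMollifier ψ) (δ : ℝ) {g : Rn n → Cl n}
    (hg : ContDiff ℝ 1 g) (hc : HasCompactSupport g) :
    dirac (average ψ δ g) = average ψ δ (dirac g) := by
  funext x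
  rw [dirac_eq, fderiv_average hψ δ hg hc, average, average, ← ContinuousLinearMap.integral_comp_comm
    _ (integrable_average hψ δ (hg.continuous_fderiv one_ne_zero) x)]
  simp only [map_smul, ← dirac_eq]

theorem exists_radius {ψ : Rn n → ℝ} (hψ : IsMollifier ψ) :
    ∃ T : ℝ, 0 < T ∧ ∀ t, ψ t ≠ 0 → ‖t‖ ≤ T := by
  obtain ⟨T, hT, h⟩ := hψ.compact.isCompact.isBounded.exists_pos_norm_le
  exact ⟨T, hT, fun t ht => h t (subset_tsupport ψ ht)⟩

theorem exists_of_average_ne_zero {ψ : Rn n → ℝ} {T : ℝ} (hT : ∀ t, ψ t ≠ 0 → ‖t‖ ≤ T)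
    {δ : ℝ} (hδ : 0 ≤ δ) {g : Rn n → G} {x : Rn n} (hx : average ψ δ g x ≠ 0) :
    ∃ y, g y ≠ 0 ∧ ‖x - y‖ ≤ δ * T := by
  by_contra! h
  refine hx (integral_eq_zero_of_ae (Eventually.of_forall fun t => ?_))
  change ψ t • g (x - δ • t) = 0
  by_cases h1 : ψ t = 0
  · rw [h1, zero_smul]
  by_cases h2 : g (x - δ • t) = 0
  · rw [h2, smul_zero]
  have h3 := h _ h2
  rw [sub_sub_cancel, norm_smul, Real.norm_of_nonneg hδ] at h3
  exact absurd (mul_le_mul_of_nonneg_left (hT t h1) hδ) (not_le.2 h3)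

theorem tsupport_average_subset {ψ : Rn n → ℝ} (hψ : IsMollifier ψ) {g : Rn n → G}
    (hc : HasCompactSupport g) {U : Set (Rn n)} (hU : IsOpen U) (hs : tsupport g ⊆ U) :
    ∃ K : Set (Rn n), IsCompact K ∧ K ⊆ U ∧ tsupport g ⊆ K ∧
      ∀ᶠ δ in 𝓝[>] 0, tsupport (average ψ δ g) ⊆ K := by
  obtain ⟨T, hT, hψT⟩ := exists_radius hψ
  obtain ⟨r, hr, h⟩ := hc.isCompact.exists_cthickening_subset_open hU hs
  refine ⟨_, hc.isCompact.cthickening, h, Metric.self_subset_cthickening _, ?_⟩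
  filter_upwards [Ioo_mem_nhdsGT (show 0 < r / T by positivity)] with δ hδ
  refine closure_minimal (fun x hx => ?_) Metric.isClosed_cthickening
  obtain ⟨y, hy, hxy⟩ := exists_of_average_ne_zero hψT hδ.1.le hx
  refine Metric.mem_cthickening_of_dist_le x y r _ (subset_tsupport g hy) ?_
  rw [dist_eq_norm]
  have := (lt_div_iff₀ hT).1 hδ.2
  linarith

theorem hasCompactSupport_average {ψ : Rn n → ℝ} (hψ : IsMollifier ψ) {g : Rn n → G}
    (hc : HasCompactSupport g) {δ : ℝ} (hδ : 0 ≤ δ) : HasCompactSupport (average ψ δ g) := by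
  obtain ⟨T, hT, hψT⟩ := exists_radius hψ
  refine HasCompactSupport.intro (hc.isCompact.cthickening (r := δ * T)) fun x hx => ?_
  by_contra h
  obtain ⟨y, hy, hxy⟩ := exists_of_average_ne_zero hψT hδ h
  refine hx (Metric.mem_cthickening_of_dist_le x y _ _ (subset_tsupport g hy) ?_)
  rwa [dist_eq_norm]

theorem eventually_norm_average_sub_le [CompleteSpace G] {ψ : Rn n → ℝ} (hψ : IsMollifier ψ)
    {g : Rn n → G} (hg : Continuous g) (hc : HasCompactSupport g) {ε : ℝ} (hε : 0 < ε) :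
    ∀ᶠ δ in 𝓝[>] 0, ∀ x, ‖average ψ δ g x - g x‖ ≤ ε := by
  obtain ⟨T, hT, hψT⟩ := exists_radius hψ
  have hψc := hψ.smooth.continuous
  have hψi : Integrable fun t => ‖ψ t‖ := hψc.norm.integrable_of_hasCompactSupport hψ.compact.norm
  -- The mollifier may change sign, so the integral of its modulus can exceed one and has to enter
  -- the choice of the modulus of continuity.
  set I := ∫ t, ‖ψ t‖ with hI
  have hI0 : 0 ≤ I := integral_nonneg fun t => norm_nonneg _
  obtain ⟨r, hr, h⟩ := Metric.uniformContinuous_iff.1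
    (hc.uniformContinuous_of_continuous hg) (ε / (I + 1)) (by positivity)
  filter_upwards [Ioo_mem_nhdsGT (show 0 < r / T by positivity)] with δ hδ x
  have h1 : average ψ δ g x - g x = ∫ t, ψ t • (g (x - δ • t) - g x) := by
    simp only [smul_sub]
    rw [integral_sub (integrable_average hψ δ hg x)
      ((hψc.integrable_of_hasCompactSupport hψ.compact).smul_const _), integral_smul_const,
      hψ.integral_one, one_smul]
    rfl
  rw [h1]
  refine (norm_integral_le_of_norm_le (hψi.mul_const (ε / (I + 1)))
    (Eventually.of_forall fun t => ?_)).trans ?_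
  · rw [norm_smul]
    by_cases h2 : ψ t = 0
    · rw [h2, norm_zero, zero_mul, zero_mul]
    refine mul_le_mul_of_nonneg_left ?_ (norm_nonneg _)
    rw [← dist_eq_norm]
    refine (h ?_).le
    rw [dist_eq_norm, sub_sub_cancel_left, norm_neg, norm_smul, Real.norm_of_nonneg hδ.1.le]
    have h3 := (lt_div_iff₀ hT).1 hδ.2
    have h4 := mul_le_mul_of_nonneg_left (hψT t h2) hδ.1.le
    linarith
  · rw [integral_mul_const, ← hI, mul_div_assoc', div_le_iff₀ (by positivity)]
    nlinarith

/-- Mollifications converge in the `C^k` norm. -/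
theorem eventually_norm_iteratedFDeriv_average_sub_le {ψ : Rn n → ℝ} (hψ : IsMollifier ψ) (k : ℕ) :
    ∀ (G : Type) [NormedAddCommGroup G] [NormedSpace ℝ G] [CompleteSpace G] (g : Rn n → G),
      ContDiff ℝ k g → HasCompactSupport g → ∀ ε > 0, ∀ᶠ δ in 𝓝[>] 0, ∀ x,
        ‖iteratedFDeriv ℝ k (average ψ δ g - g) x‖ ≤ ε := by
  induction k with
  | zero =>
    intro G _ _ _ g hg hc ε hε
    simp only [norm_iteratedFDeriv_zero]
    exact eventually_norm_average_sub_le hψ hg.continuous hc hε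
  | succ k ih =>
    intro G _ _ _ g hg hc ε hε
    have h1 : ContDiff ℝ 1 g := hg.of_le (by exact_mod_cast Nat.le_add_left 1 k)
    have h2 := ih _ (fderiv ℝ g) (hg.fderiv_right (by exact_mod_cast le_rfl)) (hc.fderiv ℝ) ε hε
    filter_upwards [h2] with δ h2 x
    rw [← norm_iteratedFDeriv_fderiv]
    -- The derivative falls on `g` under the average, so the induction continues with `fderiv ℝ g`
    -- and a new target space.
    have h3 : fderiv ℝ (average ψ δ g - g) = average ψ δ (fderiv ℝ g) - fderiv ℝ g := by
      funext y
      exact ((hasFDerivAt_average hψ δ h1 hc y).sub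
        (h1.differentiable one_ne_zero y).hasFDerivAt).fderiv
    rw [h3]
    exact h2 x

theorem exists_isMollifier (n : ℕ) : ∃ ψ : Rn n → ℝ, IsMollifier ψ := by
  let b : ContDiffBump (0 : Rn n) := ⟨1, 2, one_pos, one_lt_two⟩
  exact ⟨b.normed volume, b.contDiff_normed, b.hasCompactSupport_normed, b.integral_normed⟩

end


/-! ### The action of the extended source -/

section

variable {n : ℕ}

theorem rePart_imPart_cases (hn : 2 ≤ n) (z : Fin n → ℂ) : imPart z = 0 ∨
    ∃ N, N ≠ 0 ∧ n = N + 1 ∧ ∃ (e : Rn n) (β : ℝ), 0 < β ∧ ‖e‖ = 1 ∧ imPart z = β • e := by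
  by_cases h : imPart z = 0
  · exact Or.inl h
  refine Or.inr ⟨n - 1, by omega, by omega, ‖imPart z‖⁻¹ • imPart z, ‖imPart z‖, norm_pos_iff.2 h,
    norm_smul_inv_norm h, ?_⟩
  rw [smul_inv_smul₀ (norm_ne_zero_iff.2 h)]

theorem exists_tendsto_regPotential (hn : 2 ≤ n) (z : Fin n → ℂ) {h : Rn n → Cl n}
    (hh : ContDiff ℝ ∞ h) (hc : HasCompactSupport h) :
    ∃ L, Tendsto (fun ε => regPotential z ε h) (𝓝[>] 0) (𝓝 L) := by
  rcases rePart_imPart_cases hn z with hz | ⟨N, hN, rfl, e, β, hβ, he, hz⟩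
  · exact ⟨_, tendsto_regPotential_of_imPart_eq_zero hn hz hh.continuous hc⟩
  · obtain ⟨Ψ⟩ := exists_cylinder e he
    obtain ⟨L, hL, -⟩ := exists_tendsto_regPotential_of_imPart_ne_zero Ψ (rePart z) β hN rfl hz he
      hβ hh hc
    exact ⟨L, hL⟩

theorem exists_tendsto_regCauchy (hn : 2 ≤ n) (z : Fin n → ℂ) {h : Rn n → Cl n}
    (hh : ContDiff ℝ ∞ h) (hc : HasCompactSupport h) :
    ∃ L, Tendsto (fun ε => regCauchy z ε h) (𝓝[>] 0) (𝓝 L) := by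
  obtain ⟨L, hL⟩ := exists_tendsto_regPotential hn z (contDiff_dirac (m := ⊤) (k := ⊤) hh (by simp))
    (hasCompactSupport_dirac hc)
  exact ⟨-L, hL.neg⟩

theorem exists_tendsto_regSource (hn : 2 ≤ n) (z : Fin n → ℂ) {h : Rn n → Cl n}
    (hh : ContDiff ℝ ∞ h) (hc : HasCompactSupport h) :
    ∃ L, Tendsto (fun ε => regSource z ε h) (𝓝[>] 0) (𝓝 L) := by
  obtain ⟨L, hL⟩ := exists_tendsto_regCauchy hn z (contDiff_dirac (m := ⊤) (k := ⊤) hh (by simp))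
    (hasCompactSupport_dirac hc)
  exact ⟨-L, hL.neg.congr fun ε => (regSource_eq_neg_regCauchy z ε (hh.of_le (by norm_cast))).symm⟩

/-- The extended source is a generalized function of order at most `max 1 ⌊(n-1)/2⌋`. -/
theorem exists_regSource_bound (hn : 2 ≤ n) (z : Fin n → ℂ) {R : ℝ} (hR : 0 < R) :
    ∃ C : ℝ, 0 ≤ C ∧ ∀ h : Rn n → Cl n, ContDiff ℝ ∞ h →
      (∀ x, h x ≠ 0 → ‖x - rePart z‖ ≤ R) → ∀ B : ℝ,
      (∀ i ≤ max 1 ((n - 1) / 2), ∀ x, ‖iteratedFDeriv ℝ i h x‖ ≤ B) →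
      ∀ L, Tendsto (fun ε => regSource z ε h) (𝓝[>] 0) (𝓝 L) → ‖L‖ ≤ C * B := by
  rcases rePart_imPart_cases hn z with hz | ⟨N, hN, rfl, e, β, hβ, he, hz⟩
  · obtain ⟨C, hC, h⟩ := exists_regSource_bound_of_imPart_eq_zero hn hz
    refine ⟨C, hC, fun g hg hgR B hB L hL => h g hg ?_ B
      (fun i hi => hB i (le_max_of_le_left hi)) L hL⟩
    refine HasCompactSupport.intro (isCompact_closedBall (rePart z) R) fun x hx => ?_
    by_contra h0
    exact hx (mem_closedBall_iff_norm.2 (hgR x h0))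
  · obtain ⟨Ψ⟩ := exists_cylinder e he
    exact exists_regSource_bound_of_imPart_ne_zero Ψ (rePart z) β hN rfl hz he hβ hR

variable (z : Fin n → ℂ)

theorem integrableOn_potential_smul (hn : 2 ≤ n) {ε : ℝ} (hε : 0 < ε) {h : Rn n → Cl n}
    (hh : Continuous h) (hc : HasCompactSupport h) :
    IntegrableOn (fun x => potential (shift x z) • h x) {x | ε < (croot (quad z x)).re} := by
  have hms := measurableSet_lt_croot z ε
  rw [← integrable_indicator_iff hms]
  set s := {x : Rn n | ε < (croot (quad z x)).re} with hs
  have h1 := integrable_kernel_comp volume (contDiff_quad z).continuous hh hc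
    (isAnnularKernel_potOf hn) (W := s.indicator fun _ => 1) (measurable_const.indicator hms)
    (fun x => (norm_indicator_le_norm_self _ x).trans (by simp)) (δ := ε ^ 2) (by positivity)
    fun x _ hx => by
      have h2 : x ∈ s := Set.mem_of_indicator_ne_zero hx
      have h3 : ε < (croot (quad z x)).re := h2
      rw [← norm_croot_sq]
      have := Complex.re_le_norm (croot (quad z x))
      gcongr
      linarith
  refine h1.congr (Eventually.of_forall fun x => ?_)
  by_cases hx : x ∈ s
  · simp only [Set.indicator_of_mem hx, one_mul]; rfl
  · simp only [Set.indicator_of_notMem hx, zero_mul, zero_smul]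

theorem regPotential_sub (hn : 2 ≤ n) {ε : ℝ} (hε : 0 < ε) {g h : Rn n → Cl n}
    (hg : Continuous g) (hgc : HasCompactSupport g) (hh : Continuous h)
    (hhc : HasCompactSupport h) :
    regPotential z ε (g - h) = regPotential z ε g - regPotential z ε h := by
  simp only [regPotential_eq, Pi.sub_apply, smul_sub]
  exact integral_sub (integrableOn_potential_smul z hn hε hg hgc)
    (integrableOn_potential_smul z hn hε hh hhc)

theorem regCauchy_sub (hn : 2 ≤ n) {ε : ℝ} (hε : 0 < ε) {g h : Rn n → Cl n}
    (hg : ContDiff ℝ 1 g) (hgc : HasCompactSupport g) (hh : ContDiff ℝ 1 h)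
    (hhc : HasCompactSupport h) :
    regCauchy z ε (g - h) = regCauchy z ε g - regCauchy z ε h := by
  have h1 : dirac (g - h) = dirac g - dirac h := funext fun x =>
    dirac_sub (hg.differentiable one_ne_zero x) (hh.differentiable one_ne_zero x)
  rw [regCauchy, h1, regPotential_sub z hn hε (continuous_dirac hg) (hasCompactSupport_dirac hgc)
    (continuous_dirac hh) (hasCompactSupport_dirac hhc), regCauchy, regCauchy]
  abel

theorem regSource_sub (hn : 2 ≤ n) {ε : ℝ} (hε : 0 < ε) {g h : Rn n → Cl n}
    (hg : ContDiff ℝ 2 g) (hgc : HasCompactSupport g) (hh : ContDiff ℝ 2 h)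
    (hhc : HasCompactSupport h) :
    regSource z ε (g - h) = regSource z ε g - regSource z ε h := by
  have h1 : dirac (g - h) = dirac g - dirac h := funext fun x =>
    dirac_sub (hg.differentiable two_ne_zero x) (hh.differentiable two_ne_zero x)
  rw [regSource_eq_neg_regCauchy z ε (h := g - h) (hg.sub hh), h1, regCauchy_sub z hn hε
    (contDiff_dirac (m := 1) (k := 2) hg (by norm_num)) (hasCompactSupport_dirac hgc)
    (contDiff_dirac (m := 1) (k := 2) hh (by norm_num)) (hasCompactSupport_dirac hhc),
    regSource_eq_neg_regCauchy z ε hg, regSource_eq_neg_regCauchy z ε hh]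
  abel

variable {z}

theorem tendsto_regSource_sub (hn : 2 ≤ n) {g h : Rn n → Cl n}
    (hg : ContDiff ℝ ∞ g) (hgc : HasCompactSupport g) (hh : ContDiff ℝ ∞ h)
    (hhc : HasCompactSupport h) {L L' : Cl n}
    (hL : Tendsto (fun ε => regSource z ε g) (𝓝[>] 0) (𝓝 L))
    (hL' : Tendsto (fun ε => regSource z ε h) (𝓝[>] 0) (𝓝 L')) :
    Tendsto (fun ε => regSource z ε (g - h)) (𝓝[>] 0) (𝓝 (L - L')) := by
  refine (hL.sub hL').congr' ?_
  filter_upwards [self_mem_nhdsWithin] with ε hε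
  exact (regSource_sub z hn hε (hg.of_le (by norm_cast)) hgc (hh.of_le (by norm_cast)) hhc).symm

variable (z)

/-- The extended source acts on functions of class `C^k`, `k = max 1 ⌊(n-1)/2⌋`. -/
theorem exists_hasAction_regSource (hn : 2 ≤ n) {F : Rn n → Cl n}
    (hF : ContDiff ℝ ((max 1 ((n - 1) / 2) : ℕ) : WithTop ℕ∞) F) (hFc : HasCompactSupport F) :
    ∃ w, HasAction (regSource z) F w := by
  set k := max 1 ((n - 1) / 2) with hk
  obtain ⟨R, hR0, hR⟩ : ∃ R, 0 < R ∧ tsupport F ⊆ Metric.ball (rePart z) R := by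
    obtain ⟨R, hR⟩ := hFc.isCompact.isBounded.subset_ball (rePart z)
    exact ⟨max R 1, by positivity, hR.trans (Metric.ball_subset_ball (le_max_left _ _))⟩
  obtain ⟨C, hC, hb⟩ := exists_regSource_bound hn z hR0
  -- Smooth approximants of `F` within `η` in the `C^k` norm, all supported in one ball, so that a
  -- single constant of the order bound serves for every mollifier.
  let P : ℝ → (Rn n → Cl n) → Prop := fun η h => ContDiff ℝ ∞ h ∧
    (∀ x, h x ≠ 0 → ‖x - rePart z‖ ≤ R) ∧ ∀ i ≤ k, ∀ x, ‖iteratedFDeriv ℝ i (h - F) x‖ ≤ η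
  have hPc : ∀ η h, P η h → HasCompactSupport h := fun η h hP =>
    HasCompactSupport.intro (isCompact_closedBall (rePart z) R) fun x hx => by
      by_contra h0
      exact hx (mem_closedBall_iff_norm.2 (hP.2.1 x h0))
  have hA : ∀ ψ, IsMollifier ψ → ∀ η > 0, ∀ᶠ δ in 𝓝[>] 0, P η (mollify ψ δ F) := by
    intro ψ hψ η hη
    obtain ⟨K, -, hK, -, hev⟩ := tsupport_average_subset hψ hFc Metric.isOpen_ball hR
    have h1 : ∀ᶠ δ in 𝓝[>] 0, ∀ i ∈ Finset.range (k + 1), ∀ x,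
        ‖iteratedFDeriv ℝ i (average ψ δ F - F) x‖ ≤ η := by
      refine (Finset.eventually_all _).2 fun i hi => ?_
      exact eventually_norm_iteratedFDeriv_average_sub_le hψ i _ F (hF.of_le (by
        exact_mod_cast Nat.lt_succ_iff.1 (Finset.mem_range.1 hi))) hFc η hη
    filter_upwards [hev, h1, self_mem_nhdsWithin] with δ h2 h3 hδ
    refine ⟨contDiff_mollify hψ hδ hF.continuous, ?_, ?_⟩
    · rw [mollify_eq_average ψ hδ]
      intro x hx
      exact (mem_ball_iff_norm.1 (hK (h2 (subset_tsupport _ hx)))).le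
    · rw [mollify_eq_average ψ hδ]
      exact fun i hi => h3 i (Finset.mem_range.2 (Nat.lt_succ_of_le hi))
  -- The order bound applied to a difference: the source takes nearby values on nearby approximants.
  -- Values along any approximating sequence are Cauchy, and their limit does not depend on the
  -- mollifier.
  have hB : ∀ η η' h h' L L', P η h → P η' h' →
      Tendsto (fun ε => regSource z ε h) (𝓝[>] 0) (𝓝 L) →
      Tendsto (fun ε => regSource z ε h') (𝓝[>] 0) (𝓝 L') → ‖L - L'‖ ≤ C * (η + η') := by
    intro η η' h h' L L' hP hP' hL hL'
    refine hb (h - h') (hP.1.sub hP'.1) (fun x hx => ?_) _ (fun i hi x => ?_) _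
      (tendsto_regSource_sub hn hP.1 (hPc _ _ hP) hP'.1 (hPc _ _ hP') hL hL')
    · by_cases h0 : h x = 0
      · refine hP'.2.1 x fun h1 => hx ?_
        rw [Pi.sub_apply, h0, h1, sub_zero]
      · exact hP.2.1 x h0
    · have hFi : ContDiffAt ℝ i F x := (hF.of_le (by exact_mod_cast hi)).contDiffAt
      have h1 : ContDiffAt ℝ i h x := (hP.1.of_le (by exact_mod_cast le_top)).contDiffAt
      have h2 : ContDiffAt ℝ i h' x := (hP'.1.of_le (by exact_mod_cast le_top)).contDiffAt
      rw [show h - h' = (h - F) - (h' - F) by abel,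
        iteratedFDeriv_sub_apply (f := h - F) (g := h' - F) (h1.sub hFi) (h2.sub hFi)]
      exact (norm_sub_le _ _).trans (add_le_add (hP.2.2 i hi x) (hP'.2.2 i hi x))
  obtain ⟨ψ₀, hψ₀⟩ := exists_isMollifier n
  have hseq : ∀ m : ℕ, ∃ h, P (1 / ((m : ℝ) + 1)) h := fun m => by
    obtain ⟨δ, hδ⟩ := (hA ψ₀ hψ₀ (1 / ((m : ℝ) + 1)) (by positivity)).exists
    exact ⟨_, hδ⟩
  choose hm hPm using hseq
  have hlim : ∀ m, ∃ L, Tendsto (fun ε => regSource z ε (hm m)) (𝓝[>] 0) (𝓝 L) := fun m =>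
    exists_tendsto_regSource hn z (hPm m).1 (hPc _ _ (hPm m))
  choose Lm hLm using hlim
  have hcau : CauchySeq Lm := by
    refine cauchySeq_of_le_tendsto_0 (fun m : ℕ => C * (1 / ((m : ℝ) + 1) + 1 / ((m : ℝ) + 1)))
      (fun p q m hp hq => ?_) ?_
    · rw [dist_eq_norm]
      refine (hB _ _ _ _ _ _ (hPm p) (hPm q) (hLm p) (hLm q)).trans ?_
      gcongr
    · have := (tendsto_one_div_add_atTop_nhds_zero_nat (𝕜 := ℝ))
      simpa using (this.add this).const_mul C
  obtain ⟨w, hw⟩ := cauchySeq_tendsto_of_complete hcau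
  have hCw : ∀ η h L, P η h → Tendsto (fun ε => regSource z ε h) (𝓝[>] 0) (𝓝 L) →
      ‖L - w‖ ≤ C * η := fun η h L hP hL => by
    have h1 : Tendsto (fun m : ℕ => C * (η + 1 / ((m : ℝ) + 1))) atTop (𝓝 (C * (η + 0))) :=
      ((tendsto_one_div_add_atTop_nhds_zero_nat (𝕜 := ℝ)).const_add η).const_mul C
    rw [add_zero] at h1
    exact le_of_tendsto_of_tendsto' (hw.const_sub L).norm h1 fun m =>
      hB _ _ _ _ _ _ hP (hPm m) hL (hLm m)
  refine ⟨w, fun ψ hψ => ?_⟩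
  have hex : ∀ δ : ℝ, ∃ L, 0 < δ → Tendsto (fun ε => regSource z ε (mollify ψ δ F)) (𝓝[>] 0) (𝓝 L) := by
    intro δ
    by_cases hδ : 0 < δ
    · obtain ⟨L, hL⟩ := exists_tendsto_regSource hn z (contDiff_mollify hψ hδ hF.continuous) (by
        rw [mollify_eq_average ψ hδ]; exact hasCompactSupport_average hψ hFc hδ.le)
      exact ⟨L, fun _ => hL⟩
    · exact ⟨0, fun h => absurd h hδ⟩
  choose W hW using hex
  refine ⟨W, hW, ?_⟩
  rw [Metric.tendsto_nhds]
  intro ε hε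
  filter_upwards [hA ψ hψ (ε / (C + 1)) (by positivity), self_mem_nhdsWithin] with δ hδ hδ0
  rw [dist_eq_norm]
  refine (hCw _ _ _ hδ (hW δ hδ0)).trans_lt ?_
  rw [mul_div_assoc', div_lt_iff₀ (by positivity)]
  nlinarith

/-- The action of the extended source depends only on a neighbourhood of the singular points. -/
theorem eq_of_hasAction_regSource (hn : 2 ≤ n) {F G : Rn n → Cl n} (hF : Continuous F)
    (hFc : HasCompactSupport F) (hG : Continuous G) (hGc : HasCompactSupport G)
    (hs : tsupport (F - G) ⊆ (singularPoints z)ᶜ) {v w : Cl n}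
    (hv : HasAction (regSource z) F v) (hw : HasAction (regSource z) G w) : v = w := by
  obtain ⟨ψ, hψ⟩ := exists_isMollifier n
  obtain ⟨V, hV, hVv⟩ := hv ψ hψ
  obtain ⟨W, hW, hWw⟩ := hw ψ hψ
  obtain ⟨K, -, hK, -, hev⟩ := tsupport_average_subset hψ (hFc.sub hGc)
    (isOpen_compl_singularPoints z) hs
  refine tendsto_nhds_unique hVv (hWw.congr' ?_)
  filter_upwards [hev, self_mem_nhdsWithin] with δ h1 hδ
  have hδ0 : 0 < δ := hδ
  have c1 : HasCompactSupport (mollify ψ δ F) := by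
    rw [mollify_eq_average ψ hδ]; exact hasCompactSupport_average hψ hFc hδ0.le
  have c2 : HasCompactSupport (mollify ψ δ G) := by
    rw [mollify_eq_average ψ hδ]; exact hasCompactSupport_average hψ hGc hδ0.le
  have s1 := contDiff_mollify hψ hδ hF
  have s2 := contDiff_mollify hψ hδ hG
  have h2 := tendsto_regSource_sub hn s1 c1 s2 c2 (hV δ hδ) (hW δ hδ)
  have h3 := tendsto_regSource_of_tsupport z (by omega) (h := mollify ψ δ F - mollify ψ δ G)
    ((s1.sub s2).of_le (by norm_cast)) (c1.sub c2) (by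
      rw [mollify_eq_average ψ hδ, mollify_eq_average ψ hδ, ← average_sub hψ δ hF hG]
      exact h1.trans hK)
  exact (sub_eq_zero.1 (tendsto_nhds_unique h2 h3)).symm

/-- The action of the Cauchy kernel on a Dirac derivative, up to a function that vanishes near the
singular points. -/
theorem hasAction_regCauchy (hn : 2 ≤ n) {F G : Rn n → Cl n} (hF : ContDiff ℝ 1 F)
    (hFc : HasCompactSupport F) (hG : Continuous G) (hGc : HasCompactSupport G)
    (hs : tsupport G ⊆ (singularPoints z)ᶜ) {v : Cl n} (hv : HasAction (regSource z) F v) :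
    HasAction (regCauchy z) (dirac F - G) (-v - ∫ x, cauchyKernel (shift x z) * G x) := by
  intro ψ hψ
  obtain ⟨V, hV, hVv⟩ := hv ψ hψ
  have hex : ∀ δ : ℝ, ∃ L, 0 < δ → Tendsto (fun ε => regCauchy z ε (mollify ψ δ G)) (𝓝[>] 0) (𝓝 L) := by
    intro δ
    by_cases hδ : 0 < δ
    · obtain ⟨L, hL⟩ := exists_tendsto_regCauchy hn z (contDiff_mollify hψ hδ hG) (by
        rw [mollify_eq_average ψ hδ]; exact hasCompactSupport_average hψ hGc hδ.le)
      exact ⟨L, fun _ => hL⟩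
    · exact ⟨0, fun h => absurd h hδ⟩
  choose W hW using hex
  have hdF := continuous_dirac hF
  have hdFc := hasCompactSupport_dirac hFc
  refine ⟨fun δ => -V δ - W δ, fun δ hδ => ?_, hVv.neg.sub ?_⟩
  · refine ((hV δ hδ).neg.sub (hW δ hδ)).congr' ?_
    filter_upwards [self_mem_nhdsWithin] with ε hε
    have c1 : HasCompactSupport (average ψ δ F) := hasCompactSupport_average hψ hFc hδ.le
    have c2 : HasCompactSupport (average ψ δ G) := hasCompactSupport_average hψ hGc hδ.le
    have s1 := contDiff_mollify hψ hδ hF.continuous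
    have s2 := contDiff_mollify hψ hδ hG
    rw [mollify_eq_average ψ hδ] at s1 s2
    have sd : ContDiff ℝ ∞ (dirac (average ψ δ F)) := contDiff_dirac (m := ⊤) (k := ⊤) s1 (by simp)
    rw [mollify_eq_average ψ hδ, mollify_eq_average ψ hδ, mollify_eq_average ψ hδ,
      average_sub hψ δ hdF hG, ← dirac_average hψ δ hF hFc,
      regCauchy_sub z hn hε (sd.of_le (by simp)) (hasCompactSupport_dirac c1) (s2.of_le (by simp)) c2,
      regSource_eq_neg_regCauchy z ε (s1.of_le (by norm_cast)), neg_neg]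
  · obtain ⟨K, hKc, hK, hGK, hev⟩ := tsupport_average_subset hψ hGc
      (isOpen_compl_singularPoints z) hs
    obtain ⟨D, hD⟩ := hKc.exists_bound_of_continuousOn
      ((contDiffOn_cauchyKernel z).continuousOn.mono hK)
    rw [Metric.tendsto_nhds]
    intro ε hε
    -- All mollifications of `G` with small `δ` are supported in a compact set off the singular
    -- points, where the kernel is bounded; uniform convergence there gives convergence of the
    -- integrals.
    set A := ‖mulC n‖ * |D| * volume.real K with hA
    have hA0 : 0 ≤ A := by positivity
    filter_upwards [hev, eventually_norm_average_sub_le hψ hG hGc (ε := ε / (A + 1)) (by positivity),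
      self_mem_nhdsWithin] with δ h1 h2 hδ
    have hδ0 : 0 < δ := hδ
    have c2 : HasCompactSupport (average ψ δ G) := hasCompactSupport_average hψ hGc hδ0.le
    have s2 := contDiff_mollify hψ hδ hG
    have h3 := hW δ hδ
    rw [mollify_eq_average ψ hδ] at s2 h3
    obtain ⟨-, i1, -⟩ := integral_potential_smul_dirac z (s2.of_le (by simp)) c2 (h1.trans hK)
    have h4 := tendsto_nhds_unique h3 (tendsto_regCauchy_of_tsupport z (by omega)
      (s2.of_le (by simp)) c2 (h1.trans hK))
    have i2 : Integrable fun x => cauchyKernel (shift x z) * G x :=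
      integrable_bilinear_of_tsupport volume (mulC n) (isOpen_compl_singularPoints z)
        (contDiffOn_cauchyKernel z).continuousOn hG hGc hs
    rw [dist_eq_norm, h4, ← integral_sub i1 i2]
    have h5 : ∀ x, x ∉ K → cauchyKernel (shift x z) * average ψ δ G x -
        cauchyKernel (shift x z) * G x = 0 := fun x hx => by
      rw [image_eq_zero_of_notMem_tsupport fun h => hx (h1 h),
        image_eq_zero_of_notMem_tsupport fun h => hx (hGK h), sub_self]
    rw [← setIntegral_eq_integral_of_forall_compl_eq_zero h5]
    refine (norm_setIntegral_le_of_norm_le_const (C := ‖mulC n‖ * |D| * (ε / (A + 1)))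
      hKc.measure_lt_top fun x hx => ?_).trans_lt ?_
    · rw [← mul_sub]
      refine (norm_mul_le_mulC _ _).trans ?_
      gcongr
      · exact (hD x hx).trans (le_abs_self D)
      · exact h2 x
    · have h6 : ‖mulC n‖ * |D| * (ε / (A + 1)) * volume.real K = A * ε / (A + 1) := by
        rw [hA]; ring
      rw [h6, div_lt_iff₀ (by positivity)]
      nlinarith

end


/-! ### The Borel–Pompeiu formula away from the singular points -/

section

variable {N : ℕ} {M : Set (Rn (N + 1))} (hM : IsPiecewiseC1Domain M) (z : Fin (N + 1) → ℂ)

include hM in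
theorem IsPiecewiseC1Domain.integrableOn {F : Type*} [NormedAddCommGroup F]
    {g : Rn (N + 1) → F} (hg : Continuous g) : IntegrableOn g M :=
  (hg.continuousOn.integrableOn_compact hM.isBounded.isCompact_closure).mono_set subset_closure

include hM in
theorem IsPiecewiseC1Domain.integrableOn_frontier {F : Type*} [NormedAddCommGroup F]
    [NormedSpace ℝ F] {g : Rn (N + 1) → F} (hg : Continuous g) (v : Rn (N + 1)) :
    IntegrableOn (fun x => (inner ℝ v (outwardNormal M x) : ℝ) • g x) (frontier M)
      (Measure.euclideanHausdorffMeasure N) := by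
  have hc : IsCompact (frontier M) :=
    hM.isBounded.isCompact_closure.of_isClosed_subset isClosed_frontier frontier_subset_closure
  have hfin : IsFiniteMeasure
      ((Measure.euclideanHausdorffMeasure N : Measure (Rn (N + 1))).restrict (frontier M)) :=
    ⟨by rw [Measure.restrict_apply_univ]; exact hM.area_lt_top⟩
  obtain ⟨C, hC⟩ := hc.exists_bound_of_continuousOn hg.continuousOn
  refine Integrable.of_bound (C := ‖v‖ * |C|) ?_ ?_
  · have h1 := aestronglyMeasurable_outwardNormal hM
    have hv : Continuous fun u : Rn (N + 1) => (inner ℝ v u : ℝ) := by fun_prop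
    refine (hv.comp_aestronglyMeasurable h1).smul ?_
    exact hg.continuousOn.aestronglyMeasurable_of_isCompact hc isClosed_frontier.measurableSet
  · filter_upwards [ae_restrict_mem isClosed_frontier.measurableSet] with x hx
    rw [norm_smul]
    have h1 := norm_inner_le_norm (𝕜 := ℝ) v (outwardNormal M x)
    have h2 : ‖v‖ * ‖outwardNormal M x‖ ≤ ‖v‖ * 1 := by gcongr; exact norm_outwardNormal_le M x
    have h3 := (hC x hx).trans (le_abs_self C)
    refine mul_le_mul (by linarith) h3 (norm_nonneg _) (norm_nonneg _)

/-- The Borel–Pompeiu formula for a function that vanishes near the singular points. -/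
theorem setIntegral_cauchyKernel_mul_dirac (hN : N ≠ 0) (hM : IsPiecewiseC1Domain M)
    {h : Rn (N + 1) → Cl (N + 1)} (hh : ContDiff ℝ 1 h) (hs : tsupport h ⊆ (singularPoints z)ᶜ) :
    IntegrableOn (boundaryIntegrand M h z) (frontier M) (Measure.euclideanHausdorffMeasure N) ∧
    ∫ x in M, cauchyKernel (shift x z) * dirac h x =
      ∫ x in frontier M, boundaryIntegrand M h z x ∂(Measure.euclideanHausdorffMeasure N) := by
  set φ : Fin (N + 1) → Rn (N + 1) → Cl (N + 1) := fun k x =>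
    cauchyKernel (shift x z) * (e k * h x) with hφ
  have heh : ∀ k : Fin (N + 1), ContDiff ℝ 1 fun x => (e k : Cl (N + 1)) * h x := fun k =>
    (mulC (N + 1) (e k)).contDiff.comp hh
  have hts : ∀ k : Fin (N + 1), tsupport (fun x => (e k : Cl (N + 1)) * h x) ⊆ (singularPoints z)ᶜ :=
    fun k => (tsupport_comp_subset (g := fun a => (e k : Cl (N + 1)) * a) (mul_zero _) h).trans hs
  have hO := isOpen_compl_singularPoints z
  have hC1 : ContDiffOn ℝ 1 (fun x => cauchyKernel (shift x z)) (singularPoints z)ᶜ :=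
    (contDiffOn_cauchyKernel z).of_le (by simp)
  have hφs : ∀ k, ContDiff ℝ 1 (φ k) := fun k =>
    contDiff_bilinear_of_tsupport (mulC (N + 1)) hO hC1 (heh k) (hts k)
  have hb : ∀ x, boundaryIntegrand M h z x = ∑ k,
      (inner ℝ (EuclideanSpace.single k 1) (outwardNormal M x) : ℝ) • φ k x := fun x => by
    rw [boundaryIntegrand, vec_eq_sum, Finset.mul_sum, Finset.sum_mul]
    refine Finset.sum_congr rfl fun k _ => ?_
    rw [EuclideanSpace.inner_single_left, mul_smul_comm, smul_mul_assoc, hφ, ← Complex.coe_smul]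
    simp [mul_assoc]
  have hi : ∀ k, IntegrableOn (fun x =>
      (inner ℝ (EuclideanSpace.single k 1) (outwardNormal M x) : ℝ) • φ k x) (frontier M)
      (Measure.euclideanHausdorffMeasure N) := fun k =>
    hM.integrableOn_frontier (hφs k).continuous _
  -- The divergence of the fields `C eₖ h`: the terms in which the kernel is differentiated sum to
  -- zero off the singular points, and `h` vanishes near these.
  have hd : ∀ x, cauchyKernel (shift x z) * dirac h x =
      ∑ k, fderiv ℝ (φ k) x (EuclideanSpace.single k 1) := fun x => by
    have h1 : ∀ k : Fin (N + 1), fderiv ℝ (fun x => (e k : Cl (N + 1)) * h x) x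
        (EuclideanSpace.single k 1) = e k * fderiv ℝ h x (EuclideanSpace.single k 1) := fun k => by
      have := ((mulC (N + 1) (e k)).hasFDerivAt.comp x
        (hh.differentiable one_ne_zero x).hasFDerivAt).fderiv
      change fderiv ℝ (fun x => (e k : Cl (N + 1)) * h x) x = _ at this
      rw [this]; rfl
    have h2 : ∀ k, fderiv ℝ (φ k) x (EuclideanSpace.single k 1) =
        cauchyKernel (shift x z) * (e k * fderiv ℝ h x (EuclideanSpace.single k 1)) +
          fderiv ℝ (fun x => cauchyKernel (shift x z)) x (EuclideanSpace.single k 1) *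
            (e k * h x) := fun k => by
      rw [← h1]
      exact fderiv_bilinear_of_tsupport (mulC (N + 1)) hO hC1 (heh k) (hts k) x _
    simp only [h2]
    rw [Finset.sum_add_distrib, ← Finset.mul_sum]
    simp only [← mul_assoc]
    rw [← Finset.sum_mul]
    by_cases hx : x ∈ singularPoints z
    · rw [image_eq_zero_of_notMem_tsupport fun h => hs h hx, mul_zero, add_zero, dirac]
    · rw [sum_fderiv_cauchyKernel z hx, zero_mul, add_zero, dirac]
  have hbs : IntegrableOn (fun x => ∑ k, (inner ℝ (EuclideanSpace.single k 1)
      (outwardNormal M x) : ℝ) • φ k x) (frontier M) (Measure.euclideanHausdorffMeasure N) :=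
    integrable_finsetSum _ fun k _ => hi k
  refine ⟨?_, ?_⟩
  · rw [show boundaryIntegrand M h z = _ from funext hb]
    exact hbs
  · simp only [hb, hd]
    rw [integral_finsetSum _ fun k _ => hi k, integral_finsetSum _ fun k _ => hM.integrableOn
      (((hφs k).continuous_fderiv one_ne_zero).clm_apply continuous_const)]
    exact Finset.sum_congr rfl fun k _ => divergence_theorem hN hM (hφs k) _

end

/-! ### Cutoff functions -/

section

variable {n : ℕ} {M : Set (Rn n)} {z : Fin n → ℂ}

/-- Regularity of `z` is stated for `z - b`, the singular points for `x - z`; the symmetry of the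
singular set reconciles the two. -/
theorem neg_mem_singularSet {w : Fin n → ℂ} (h : w ∈ singularSet n) : -w ∈ singularSet n := by
  unfold singularSet at h ⊢
  simp only [Set.mem_ofPred_eq, Pi.neg_apply, neg_sq, Complex.neg_re, Complex.neg_im,
    neg_mul_neg] at h ⊢
  exact h

theorem IsRegularFor.disjoint (hz : IsRegularFor M z) :
    Disjoint (singularPoints z) (frontier M) := by
  rw [Set.disjoint_left]
  intro x hx hxM
  refine hz ⟨x, hxM, _, neg_mem_singularSet hx, ?_⟩
  funext i
  simp [shift]

theorem exists_isCutoff {S B : Set (Rn n)} (hS : IsClosed S) (hB : IsClosed B)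
    (hd : Disjoint S B) : ∃ η : Rn n → ℝ, IsCutoff S B η := by
  obtain ⟨f, h0, h1, -⟩ := exists_contMDiffMap_zero_one_nhds_of_isClosed
    (modelWithCornersSelf ℝ (Rn n)) (n := ⊤) hB hS hd.symm
  exact ⟨f, f.contMDiff.contDiff, h1, h0⟩

theorem contDiff_indicator {F : Type*} [NormedAddCommGroup F] [NormedSpace ℝ F] (hM : IsOpen M)
    {g : Rn n → F} {m : WithTop ℕ∞} (hg : ContDiff ℝ m g) (h0 : ∀ᶠ x in 𝓝ˢ (frontier M), g x = 0) :
    ContDiff ℝ m (M.indicator g) := by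
  rw [contDiff_iff_contDiffAt]
  intro x
  by_cases hx : x ∈ M
  · refine hg.contDiffAt.congr_of_eventuallyEq ?_
    filter_upwards [hM.mem_nhds hx] with y hy
    exact Set.indicator_of_mem hy g
  refine (contDiffAt_const (c := (0 : F))).congr_of_eventuallyEq ?_
  by_cases hc : x ∈ closure M
  · have hf : x ∈ frontier M := by
      rw [hM.frontier_eq]; exact ⟨hc, hx⟩
    filter_upwards [eventually_nhdsSet_iff_forall.1 h0 x hf] with y hy
    rw [Set.indicator_apply_eq_zero]
    exact fun _ => hy
  · filter_upwards [isClosed_closure.isOpen_compl.mem_nhds hc] with y hy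
    exact Set.indicator_of_notMem (fun h => hy (subset_closure h)) g

theorem tsupport_subset_compl {F : Type*} [Zero F] {S : Set (Rn n)} {g : Rn n → F}
    (h : ∀ᶠ x in 𝓝ˢ S, g x = 0) : tsupport g ⊆ Sᶜ := fun x hx hxS =>
  notMem_tsupport_iff_eventuallyEq.2 (eventually_nhdsSet_iff_forall.1 h x hxS) hx

theorem hasCompactSupport_indicator {F : Type*} [Zero F] (hM : Bornology.IsBounded M)
    (g : Rn n → F) : HasCompactSupport (M.indicator g) :=
  HasCompactSupport.intro hM.isCompact_closure fun _ hx =>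
    Set.indicator_of_notMem (fun h => hx (subset_closure h)) g

theorem smul_indicator_eq {F : Type*} [NormedAddCommGroup F] [NormedSpace ℝ F] (η : Rn n → ℝ)
    (g : Rn n → F) :
    (fun x => η x • M.indicator g x) = M.indicator fun x => η x • g x := by
  funext x
  rw [Set.indicator_smul_apply]

theorem dirac_indicator (hM : IsOpen M) {g : Rn n → Cl n}
    (h0 : ∀ᶠ x in 𝓝ˢ (frontier M), g x = 0) : dirac (M.indicator g) = M.indicator (dirac g) := by
  funext x
  by_cases hx : x ∈ M
  · have h1 : M.indicator g =ᶠ[𝓝 x] g := by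
      filter_upwards [hM.mem_nhds hx] with y hy
      exact Set.indicator_of_mem hy g
    rw [Set.indicator_of_mem hx, dirac_eq, dirac_eq, h1.fderiv_eq]
  have h1 : M.indicator g =ᶠ[𝓝 x] fun _ => 0 := by
    by_cases hc : x ∈ closure M
    · have hf : x ∈ frontier M := by
        rw [hM.frontier_eq]; exact ⟨hc, hx⟩
      filter_upwards [eventually_nhdsSet_iff_forall.1 h0 x hf] with y hy
      rw [Set.indicator_apply_eq_zero]
      exact fun _ => hy
    · filter_upwards [isClosed_closure.isOpen_compl.mem_nhds hc] with y hy
      exact Set.indicator_of_notMem (fun h => hy (subset_closure h)) g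
  rw [Set.indicator_of_notMem hx, dirac_eq, h1.fderiv_eq]
  simp

theorem eventually_fderiv_eq_zero {S : Set (Rn n)} {η : Rn n → ℝ} {c : ℝ}
    (h : ∀ᶠ x in 𝓝ˢ S, η x = c) : ∀ᶠ x in 𝓝ˢ S, fderiv ℝ η x = 0 := by
  rw [eventually_nhdsSet_iff_forall] at h ⊢
  intro x hx
  filter_upwards [(h x hx).eventually_nhds] with y hy
  have h1 : η =ᶠ[𝓝 y] fun _ => c := hy
  rw [h1.fderiv_eq]; simp

end


/-! ### The extended Borel–Pompeiu formula -/

section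

variable {n : ℕ} {M : Set (Rn n)} {z : Fin n → ℂ} {f : Rn n → Cl n}

theorem IsCutoff.smul_eq_zero {S B : Set (Rn n)} {η : Rn n → ℝ} (hη : IsCutoff S B η)
    (g : Rn n → Cl n) : ∀ᶠ x in 𝓝ˢ B, η x • g x = 0 :=
  hη.eq_zero.mono fun x hx => by rw [hx, zero_smul]

/-- The action of the extended source on `η χ_M f` is the same for all cutoff functions `η`. -/
theorem exists_hasAction_cutoff (hn : 2 ≤ n) (hM : IsPiecewiseC1Domain M)
    (hf : ContDiff ℝ ((max 1 ((n - 1) / 2) : ℕ) : WithTop ℕ∞) f)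
    (he : ∃ η, IsCutoff (singularPoints z) (frontier M) η) :
    ∃ w, ∀ η, IsCutoff (singularPoints z) (frontier M) η →
      HasAction (regSource z) (fun x => η x • M.indicator f x) w := by
  have hF : ∀ η, IsCutoff (singularPoints z) (frontier M) η →
      ContDiff ℝ ((max 1 ((n - 1) / 2) : ℕ) : WithTop ℕ∞) (fun x => η x • M.indicator f x) ∧
      HasCompactSupport fun x => η x • M.indicator f x := fun η hη => by
    rw [smul_indicator_eq]
    exact ⟨contDiff_indicator hM.isOpen ((hη.smooth.of_le (by exact_mod_cast le_top)).smul hf)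
      (hη.smul_eq_zero f), hasCompactSupport_indicator hM.isBounded _⟩
  obtain ⟨η₀, h₀⟩ := he
  obtain ⟨w, hw⟩ := exists_hasAction_regSource z hn (hF η₀ h₀).1 (hF η₀ h₀).2
  refine ⟨w, fun η hη => ?_⟩
  obtain ⟨w', hw'⟩ := exists_hasAction_regSource z hn (hF η hη).1 (hF η hη).2
  -- Two cutoffs agree near the singular points, where the source is supported, so the actions
  -- coincide.
  rwa [← eq_of_hasAction_regSource z hn (hF η hη).1.continuous (hF η hη).2
    (hF η₀ h₀).1.continuous (hF η₀ h₀).2 ?_ hw' hw]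
  refine tsupport_subset_compl ?_
  filter_upwards [hη.eq_one, h₀.eq_one] with x h1 h2
  simp [h1, h2]

end

/-- For a fixed cutoff, the weak identity on `η χ_M f` and the classical formula on `(1 - η) f` are
added. The volume terms with `Dη` occur with opposite signs and are ordinary integrals, so they
cancel. -/
theorem extended_borel_pompeiu {N : ℕ} (hN : N ≠ 0) {M : Set (Rn (N + 1))}
    (hM : IsPiecewiseC1Domain M) {f : Rn (N + 1) → Cl (N + 1)}
    (hf : ContDiff ℝ ((max 1 ((N + 1 - 1) / 2) : ℕ) : WithTop ℕ∞) f)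
    {z : Fin (N + 1) → ℂ} (hz : IsRegularFor M z) :
    ∃ fM V : Cl (N + 1), HasExtension M f z fM ∧ HasVolumeIntegral M (dirac f) z V ∧
      IntegrableOn (boundaryIntegrand M f z) (frontier M) (Measure.euclideanHausdorffMeasure N) ∧
      fM = (∫ x in frontier M, boundaryIntegrand M f z x
        ∂(Measure.euclideanHausdorffMeasure N)) - V := by
  have hn : 2 ≤ N + 1 := by omega
  have hf1 : ContDiff ℝ 1 f := hf.of_le (by exact_mod_cast le_max_left _ _)
  have hdf := continuous_dirac hf1
  have hO := isOpen_compl_singularPoints z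
  have hCc : ContinuousOn (fun x => cauchyKernel (shift x z)) (singularPoints z)ᶜ :=
    (contDiffOn_cauchyKernel z).continuousOn
  have he := exists_isCutoff (isClosed_singularPoints z) (isClosed_frontier (s := M)) hz.disjoint
  obtain ⟨w, hw⟩ := exists_hasAction_cutoff hn hM hf he
  have key : ∀ η, IsCutoff (singularPoints z) (frontier M) η →
      IntegrableOn (boundaryIntegrand M f z) (frontier M) (Measure.euclideanHausdorffMeasure N) ∧
      Integrable (fun x => cauchyKernel (shift x z) * ((1 - η x) • M.indicator (dirac f) x)) ∧
      ∃ v, HasAction (regCauchy z) (fun x => η x • M.indicator (dirac f) x) v ∧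
        (∫ x in frontier M, boundaryIntegrand M f z x ∂(Measure.euclideanHausdorffMeasure N)) - w =
          v + ∫ x, cauchyKernel (shift x z) * ((1 - η x) • M.indicator (dirac f) x) := by
    intro η hη
    have hη1 : ContDiff ℝ 1 η := hη.smooth.of_le (by simp)
    have hζ : ContDiff ℝ 1 fun x => 1 - η x := contDiff_const.sub hη1
    have hζ0 : ∀ᶠ x in 𝓝ˢ (singularPoints z), 1 - η x = 0 :=
      hη.eq_one.mono fun x hx => by rw [hx, sub_self]
    have hζs : ∀ g : Rn (N + 1) → Cl (N + 1),
        tsupport (fun x => (1 - η x) • g x) ⊆ (singularPoints z)ᶜ := fun g =>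
      tsupport_subset_compl (hζ0.mono fun x hx => by rw [hx, zero_smul])
    -- The term `(Dη) f`. It vanishes near the singular points and near the boundary, since `η` is
    -- locally constant there; hence `M.indicator g` is continuous and pairs with the kernel as an
    -- ordinary integral.
    set g : Rn (N + 1) → Cl (N + 1) := fun x =>
      diracSymbol (N + 1) ((fderiv ℝ η x).smulRight (f x)) with hg
    have hgc : Continuous g := (diracSymbol (N + 1)).continuous.comp
      ((ContinuousLinearMap.smulRightL ℝ (Rn (N + 1)) (Cl (N + 1))).continuous₂.comp
        ((hη1.continuous_fderiv one_ne_zero).prodMk hf1.continuous))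
    have hg0 : ∀ (S : Set (Rn (N + 1))) (c : ℝ), (∀ᶠ x in 𝓝ˢ S, η x = c) → ∀ᶠ x in 𝓝ˢ S, g x = 0 :=
      fun S c h => (eventually_fderiv_eq_zero h).mono fun x hx => by simp [hg, hx]
    have hgs : tsupport g ⊆ (singularPoints z)ᶜ := tsupport_subset_compl (hg0 _ _ hη.eq_one)
    have hGc : Continuous (M.indicator g) :=
      (contDiff_indicator (m := 0) hM.isOpen (contDiff_zero.2 hgc) (hg0 _ _ hη.eq_zero)).continuous
    have hGk := hasCompactSupport_indicator hM.isBounded g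
    have hGs : tsupport (M.indicator g) ⊆ (singularPoints z)ᶜ :=
      tsupport_subset_compl ((hg0 _ _ hη.eq_one).mono fun x hx =>
        Set.indicator_apply_eq_zero.2 fun _ => hx)
    have hFs : ContDiff ℝ 1 (fun x => η x • M.indicator f x) := by
      rw [smul_indicator_eq]
      exact contDiff_indicator hM.isOpen (hη1.smul hf1) (hη.smul_eq_zero f)
    have hFk : HasCompactSupport (fun x => η x • M.indicator f x) := by
      rw [smul_indicator_eq]
      exact hasCompactSupport_indicator hM.isBounded _
    have hdec : (fun x => η x • M.indicator (dirac f) x) =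
        dirac (fun x => η x • M.indicator f x) - M.indicator g := by
      rw [smul_indicator_eq, smul_indicator_eq, dirac_indicator hM.isOpen (hη.smul_eq_zero f)]
      funext x
      by_cases hx : x ∈ M
      · rw [Pi.sub_apply, Set.indicator_of_mem hx, Set.indicator_of_mem hx, Set.indicator_of_mem hx]
        have := dirac_smul (hη1.differentiable one_ne_zero x) (hf1.differentiable one_ne_zero x)
        change dirac (fun x => η x • f x) x = _ at this
        rw [this, hg, add_sub_cancel_right]
      · rw [Pi.sub_apply, Set.indicator_of_notMem hx, Set.indicator_of_notMem hx,
          Set.indicator_of_notMem hx, sub_zero]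
    have hact := hasAction_regCauchy z hn hFs hFk hGc hGk hGs (hw η hη)
    rw [← hdec] at hact
    have hmul : ∀ h : Rn (N + 1) → Cl (N + 1),
        (fun x => cauchyKernel (shift x z) * M.indicator h x) =
          M.indicator fun x => cauchyKernel (shift x z) * h x := fun h => by
      funext x
      by_cases hx : x ∈ M
      · simp only [Set.indicator_of_mem hx]
      · simp only [Set.indicator_of_notMem hx, mul_zero]
    have hcont : ∀ h : Rn (N + 1) → Cl (N + 1), Continuous h → tsupport h ⊆ (singularPoints z)ᶜ →
        IntegrableOn (fun x => cauchyKernel (shift x z) * h x) M := fun h hh hs =>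
      hM.integrableOn (contDiff_bilinear_of_tsupport (mulC (N + 1)) hO (contDiffOn_zero.2 hCc)
        (contDiff_zero.2 hh) hs).continuous
    have i1 := hcont (fun x => (1 - η x) • dirac f x) (hζ.continuous.smul hdf) (hζs _)
    have i2 := hcont g hgc hgs
    have hvol : (fun x => cauchyKernel (shift x z) * ((1 - η x) • M.indicator (dirac f) x)) =
        M.indicator fun x => cauchyKernel (shift x z) * ((1 - η x) • dirac f x) := by
      have h1 := smul_indicator_eq (M := M) (fun x => 1 - η x) (dirac f)
      rw [← hmul, ← h1]
    have hms := hM.isOpen.measurableSet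
    obtain ⟨b1, b2⟩ := setIntegral_cauchyKernel_mul_dirac z hN hM
      (h := fun x => (1 - η x) • f x) (hζ.smul hf1) (hζs f)
    -- The cutoff vanishes on the boundary, so the boundary integral already contains all of `f`.
    have hbd : Set.EqOn (boundaryIntegrand M (fun x => (1 - η x) • f x) z) (boundaryIntegrand M f z)
        (frontier M) := fun x hx => by
      have h0 : η x = 0 := hη.eq_zero.self_of_nhdsSet x hx
      simp only [boundaryIntegrand, h0, sub_zero, one_smul]
    have hdz : ∀ x, dirac (fun x => (1 - η x) • f x) x = (1 - η x) • dirac f x - g x := fun x => by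
      have h1 := dirac_smul (hζ.differentiable one_ne_zero x) (hf1.differentiable one_ne_zero x)
      change dirac (fun x => (1 - η x) • f x) x = _ at h1
      have h2 : (-fderiv ℝ η x).smulRight (f x) = -(fderiv ℝ η x).smulRight (f x) := by
        ext v; simp
      rw [h1, fderiv_const_sub, h2, map_neg, ← sub_eq_add_neg]
    refine ⟨b1.congr_fun hbd isClosed_frontier.measurableSet, ?_, _, hact, ?_⟩
    · rw [hvol]
      exact (integrable_indicator_iff hms).2 i1
    · rw [← setIntegral_congr_fun isClosed_frontier.measurableSet hbd, ← b2]
      simp only [hdz, mul_sub]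
      rw [integral_sub i1 i2, hvol, integral_indicator hms, hmul, integral_indicator hms]
      abel
  obtain ⟨η₀, h₀⟩ := he
  -- `V` is taken to be the boundary integral minus `w`; the content is `key`, which shows that this
  -- value is the volume integral for every cutoff, as `w` is the same for all of them. In the
  -- extension the ordinary part is zero because the kernel of the source off the singular points is
  -- zero.
  refine ⟨w, _ - w, ⟨⟨η₀, h₀⟩, fun η hη => ⟨?_, w, hw η hη, ?_⟩⟩, ⟨⟨η₀, h₀⟩, fun η hη =>
    (key η hη).2⟩, (key η₀ h₀).1, (sub_sub_cancel _ _).symm⟩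
  · simp
  · simp

end ComplexDistance

end

open ComplexDistance in
theorem theorem6 (n : ℕ) (hn : 2 ≤ n)
    (M : Set (Rn n)) (hM : IsPiecewiseC1Domain M)
    (f : Rn n → Cl n) (hf : ContDiff ℝ ((max 1 ((n - 1) / 2) : ℕ) : WithTop ℕ∞) f)
    (z : Fin n → ℂ) (hz : IsRegularFor M z) :
    ∃ fM V : Cl n,
      HasExtension M f z fM ∧
      HasVolumeIntegral M (dirac f) z V ∧
      IntegrableOn (boundaryIntegrand M f z) (frontier M)
        (Measure.euclideanHausdorffMeasure (n - 1)) ∧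
      fM = (∫ x in frontier M, boundaryIntegrand M f z x
        ∂(Measure.euclideanHausdorffMeasure (n - 1))) - V := by
  obtain ⟨N, rfl⟩ : ∃ N, n = N + 1 := ⟨n - 1, by omega⟩
  exact extended_borel_pompeiu (by omega) hM hf hz
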